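/- Let $D\subset\mathbb C$ be a compact domain, i.e. a compact set whose interior is nonempty and connected and which is the closure of its interior, and let $W$ be a real-valued potential that is continuous on $D$. Let $\mathcal M(D)$ be the set of Borel probability measures on $D$ without point masses, and for $\sigma\in\mathcal M(D)$ put $$I_\sigma=\int_D W\,d\sigma+\int_D\int_D\log|z-w|^{-1}\,d\sigma(z)\,d\sigma(w)\in(-\infty,+\infty].$$ There is exactly one $\sigma\in\mathcal M(D)$ with $I_\sigma=\inf_{\mu\in\mathcal M(D)}I_\mu$ (the equilibrium measure of $W$ on $D$), and it has the following properties. (1) Let $m\ge1$ and let $\lambda_1,\dots,\lambda_m$ be real numbers with $\sum_i\lambda_i=0$. For $N\ge1$ let $\mathcal N_m(\lambda,D)$ be the set of $M\in\mathrm{Mat}_{mN}(\mathbb C)$ whose $N\times N$ blocks $M_{ij}$ vanish unless $j-i\equiv1$ mod $m$, for which, with $M_i=M_{i,i+1}$ (indices mod $m$), the spectrum of $M_1M_2\cdots M_m$ is contained in $D$, and for which $[M,M^\dagger]=\mathrm{diag}(\lambda_1I_N,\dots,\lambda_mI_N)$. Let $dM$ be the measure on $\mathcal N_m(\lambda,D)$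 induced by the Euclidean metric of $\mathrm{Mat}_{mN}(\mathbb C)$ (the Hausdorff measure of dimension $mN^2+N$). Then $$P_N(M)\,dM=Z_N^{-1}\exp\bigl(-N\,\mathrm{tr}\,W(M_1\cdots M_m)\bigr)\,dM$$ defines a probability measure on $\mathcal N_m(\lambda,D)$, where $\mathrm{tr}\,W(X)=\sum_jW(z_j)$ for $X$ with eigenvalues $z_1,\dots,z_N$ and $Z_N$ is the normalizing constant. For every $k\ge0$, the $k$-point eigenvalue correlation measure of this model (the joint distribution on $D^k$ of $k$ of the $N$ eigenvalues of $M_1\cdots M_m$, taken in uniformly random order, for $N\ge k$) converges weakly to $\sigma^{\otimes k}$ as $N\to\infty$. (2) The same holds, with the same $\sigma$, for the usual normal matrix model, i.e. for the normal matrices $M\in\mathrm{Mat}_N(\mathbb C)$ with spectrum in $D$, the measure $dM$ induced by the Euclidean metric (the Hausdorff measure of dimension $N^2+N$), the probability measure $Z_N^{-1}\exp(-N\,\mathrm{tr}\,W(M))\,dM$ and the eigenvalues of $M$. Thus the two models are equivalent in the limit $N\to\infty$. -/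

import Mathlib

open MeasureTheory Filter Topology
open scoped ENNReal Matrix

/-! ### Energy and equilibrium measures -/

/-- `𝓜(D)`: the Borel probability measures on `ℂ` carried by `D`, without point masses. -/
def admissibleMeasures (D : Set ℂ) : Set (Measure ℂ) :=
  {σ | IsProbabilityMeasure σ ∧ σ Dᶜ = 0 ∧ ∀ z : ℂ, σ {z} = 0}

/-- The logarithmic energy `∬ log |z - w|⁻¹ dσ(z) dσ(w)`, as positive part minus negative part.
For a measure carried by a bounded set the negative part is finite, so the value is a real number
or `+∞`.  For a measure without point masses the diagonal is a null set. -/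
noncomputable def logEnergy (σ : Measure ℂ) : EReal :=
  ((∫⁻ p : ℂ × ℂ, ENNReal.ofReal (Real.log (‖p.1 - p.2‖⁻¹)) ∂(σ.prod σ) : ℝ≥0∞) : EReal)
    - ((∫⁻ p : ℂ × ℂ, ENNReal.ofReal (Real.log ‖p.1 - p.2‖) ∂(σ.prod σ) : ℝ≥0∞) : EReal)

/-- `I_σ = ∫ W dσ + ∬ log |z - w|⁻¹ dσ(z) dσ(w)`. -/
noncomputable def energy (W : ℂ → ℝ) (σ : Measure ℂ) : EReal :=
  ((∫ z, W z ∂σ : ℝ) : EReal) + logEnergy σ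

/-- `σ` is an equilibrium measure on `D` for the potential `W`: it belongs to `𝓜(D)` and its
energy is the infimum of the energies of the elements of `𝓜(D)`. -/
def IsEquilibriumMeasure (D : Set ℂ) (W : ℂ → ℝ) (σ : Measure ℂ) : Prop :=
  σ ∈ admissibleMeasures D ∧ energy W σ = ⨅ μ ∈ admissibleMeasures D, energy W μ

/-! ### Eigenvalues -/

theorem exists_eigenvalueTuple {N : ℕ} (M : Matrix (Fin N) (Fin N) ℂ) :
    ∃ z : Fin N → ℂ, M.charpoly = ∏ i, (Polynomial.X - Polynomial.C (z i)) := by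
  have hs : M.charpoly.Splits := IsAlgClosed.splits _
  have hcard : Multiset.card M.charpoly.roots = N := by
    rw [← hs.natDegree_eq_card_roots, Matrix.charpoly_natDegree_eq_dim, Fintype.card_fin]
  have hprod := hs.eq_prod_roots_of_monic M.charpoly_monic
  have hlen : M.charpoly.roots.toList.length = N := by rw [Multiset.length_toList, hcard]
  refine ⟨fun i => M.charpoly.roots.toList.get (i.cast hlen.symm), ?_⟩
  conv_lhs => rw [hprod, ← Multiset.coe_toList M.charpoly.roots]
  rw [Multiset.map_coe, Multiset.prod_coe]
  generalize M.charpoly.roots.toList = l at hlen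
  subst hlen
  rw [← List.prod_ofFn]
  congr 1
  exact List.ext_getElem (by simp) (by simp)

/-- The eigenvalues `z₁, …, z_N` of an `N × N` matrix, with multiplicity, listed in some order.
It is only used through expressions that do not depend on the order. -/
noncomputable def eigenvalueTuple {N : ℕ} (M : Matrix (Fin N) (Fin N) ℂ) : Fin N → ℂ :=
  Classical.choose (exists_eigenvalueTuple M)

/-- `tr W(M) = ∑ᵢ W(zᵢ)`, where `z₁, …, z_N` are the eigenvalues of `M`. -/
noncomputable def tracePotential (W : ℂ → ℝ) {N : ℕ} (M : Matrix (Fin N) (Fin N) ℂ) : ℝ :=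
  ∑ i, W (eigenvalueTuple M i)

/-- The uniform distribution on the `k`-tuples `(z_{i₁}, …, z_{i_k})` of eigenvalues of `M` with
pairwise distinct indices `i₁, …, i_k` (meaningful for `k ≤ N`). -/
noncomputable def eigenvalueTupleMeasure (k : ℕ) {N : ℕ} (M : Matrix (Fin N) (Fin N) ℂ) :
    Measure (Fin k → ℂ) :=
  ((N.descFactorial k : ℕ) : ℝ≥0∞)⁻¹ •
    ∑ ι : Fin k ↪ Fin N, Measure.dirac (fun j => eigenvalueTuple M (ι j))

/-! ### Matrix models -/

/-- Square complex matrices with rows and columns indexed by `ι`, with the Euclidean (Frobenius)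
metric. -/
abbrev MatrixSpace (ι : Type) [Fintype ι] : Type := EuclideanSpace ℂ (ι × ι)

/-- The matrix with the given entries. -/
def MatrixSpace.toMatrix {ι : Type} [Fintype ι] (a : MatrixSpace ι) : Matrix ι ι ℂ :=
  Matrix.of fun i j => a (i, j)

/-- The measure `exp (-N tr W(T(M))) dM` on a `d`-dimensional subset `S` of a matrix space, where
`T` sends matrices in `S` to `N × N` matrices and `dM` is the measure on `S` induced by the
Euclidean metric, that is, the `d`-dimensional Hausdorff measure.  (The constant factor
by which it may differ from the Riemannian volume cancels in `modelLaw`.) -/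
noncomputable def modelWeight {ι : Type} [Fintype ι] {N : ℕ} (S : Set (MatrixSpace ι)) (d : ℕ)
    (T : MatrixSpace ι → Matrix (Fin N) (Fin N) ℂ) (W : ℂ → ℝ) : Measure (MatrixSpace ι) :=
  ((Measure.hausdorffMeasure (d : ℝ)).restrict S).withDensity
    fun a => ENNReal.ofReal (Real.exp (-(N : ℝ) * tracePotential W (T a)))

/-- `P_N(M) dM = Z_N⁻¹ exp (-N tr W(T(M))) dM`, where `Z_N` is the total mass of
`exp (-N tr W(T(M))) dM`. -/
noncomputable def modelLaw {ι : Type} [Fintype ι] {N : ℕ} (S : Set (MatrixSpace ι)) (d : ℕ)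
    (T : MatrixSpace ι → Matrix (Fin N) (Fin N) ℂ) (W : ℂ → ℝ) : Measure (MatrixSpace ι) :=
  (modelWeight S d T W Set.univ)⁻¹ • modelWeight S d T W

/-- The `k`-point correlation measure: the law of `k` of the `N` eigenvalues of `T(M)` (numbered
in uniformly random order), `M` being distributed by `P_N(M) dM`.  Equivalently, the marginal on
the first `k` variables of the symmetric joint distribution of the eigenvalues on `ℂ^N`. -/
noncomputable def modelCorrelation {ι : Type} [Fintype ι] {N : ℕ} (S : Set (MatrixSpace ι)) (d : ℕ)
    (T : MatrixSpace ι → Matrix (Fin N) (Fin N) ℂ) (W : ℂ → ℝ) (k : ℕ) : Measure (Fin k → ℂ) :=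
  (modelLaw S d T W).bind fun a => eigenvalueTupleMeasure k (T a)

/-! ### The normal matrix model -/

/-- `𝓝(D)`: the normal `N × N` matrices with spectrum in `D`. -/
def normalMatrices (N : ℕ) (D : Set ℂ) : Set (MatrixSpace (Fin N)) :=
  {a | a.toMatrix * a.toMatrixᴴ - a.toMatrixᴴ * a.toMatrix = 0 ∧ spectrum ℂ a.toMatrix ⊆ D}

/-- The probability measure `Z_N⁻¹ exp (-N tr W(M)) dM` on `𝓝(D)`, a set of real dimension
`N² + N`. -/
noncomputable def normalLaw (N : ℕ) (D : Set ℂ) (W : ℂ → ℝ) : Measure (MatrixSpace (Fin N)) :=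
  modelLaw (normalMatrices N D) (N ^ 2 + N) MatrixSpace.toMatrix W

/-- The `k`-point eigenvalue correlation measure of the normal matrix model. -/
noncomputable def normalCorrelation (N : ℕ) (D : Set ℂ) (W : ℂ → ℝ) (k : ℕ) :
    Measure (Fin k → ℂ) :=
  modelCorrelation (normalMatrices N D) (N ^ 2 + N) MatrixSpace.toMatrix W k

/-! ### The generalized normal matrix model

The `m` block indices are the elements of `Fin m`, whose addition is addition mod `m`. -/

/-- The block `A_{i,j}` of an `mN × mN` matrix. -/
def blockOf {m N : ℕ} (A : Matrix (Fin m × Fin N) (Fin m × Fin N) ℂ) (i j : Fin m) :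
    Matrix (Fin N) (Fin N) ℂ :=
  Matrix.of fun p q => A (i, p) (j, q)

/-- The product `M₁ M₂ ⋯ M_m` of the blocks `M_i = M_{i,i+1}`, in this order. -/
def blockProduct (m N : ℕ) [NeZero m] (a : MatrixSpace (Fin m × Fin N)) :
    Matrix (Fin N) (Fin N) ℂ :=
  (List.ofFn fun i : Fin m => blockOf a.toMatrix i (i + 1)).prod

/-- `𝓝_m(λ, D)`: the `mN × mN` matrices `A` whose `N × N` blocks `A_{i,j}` vanish unless
`j - i = 1` mod `m`, for which the spectrum of `A_{1,2} A_{2,3} ⋯ A_{m,1}` is contained in `D`, and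
`[A, A†]` is block diagonal with diagonal blocks `λ₁ I_N, …, λ_m I_N`. -/
def generalizedNormalMatrices (m N : ℕ) [NeZero m] (lam : Fin m → ℝ) (D : Set ℂ) :
    Set (MatrixSpace (Fin m × Fin N)) :=
  {a | (∀ i j : Fin m, j ≠ i + 1 → blockOf a.toMatrix i j = 0) ∧
    spectrum ℂ (blockProduct m N a) ⊆ D ∧
    a.toMatrix * a.toMatrixᴴ - a.toMatrixᴴ * a.toMatrix =
      Matrix.diagonal fun ip : Fin m × Fin N => (lam ip.1 : ℂ)}

/-- The probability measure `Z_N⁻¹ exp (-N tr W(M₁ ⋯ M_m)) dM` on `𝓝_m(λ, D)`, a set of real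
dimension `m N² + N`. -/
noncomputable def generalizedLaw (m N : ℕ) [NeZero m] (lam : Fin m → ℝ) (D : Set ℂ) (W : ℂ → ℝ) :
    Measure (MatrixSpace (Fin m × Fin N)) :=
  modelLaw (generalizedNormalMatrices m N lam D) (m * N ^ 2 + N) (blockProduct m N) W

/-- The `k`-point eigenvalue correlation measure of the generalized normal matrix model; the
eigenvalues are those of `M₁ ⋯ M_m`. -/
noncomputable def generalizedCorrelation (m N : ℕ) [NeZero m] (lam : Fin m → ℝ) (D : Set ℂ)
    (W : ℂ → ℝ) (k : ℕ) : Measure (Fin k → ℂ) :=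
  modelCorrelation (generalizedNormalMatrices m N lam D) (m * N ^ 2 + N) (blockProduct m N) W k

/-! ### Weak convergence -/

/-- Weak convergence of a sequence of measures on `ℂ^k`. -/
def ConvergesWeakly {k : ℕ} (ν : ℕ → Measure (Fin k → ℂ)) (ν' : Measure (Fin k → ℂ)) : Prop :=
  ∀ f : BoundedContinuousFunction (Fin k → ℂ) ℝ,
    Tendsto (fun N => ∫ z, f z ∂(ν N)) atTop (𝓝 (∫ z, f z ∂ν'))

/-! Both models are Coulomb gases in disguise. Their eigenvalues have joint law proportional to
∏_{i≠j} |z_i - z_j| · exp(-N ∑ W(z_i)) ∏ dη(z_i), where η is a finite measure on D that depends on m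
and λ but not on N. The interaction and the potential act on the scale exp(O(N²)), while η enters
only through an N-fold product. If η is finite and dominates Lebesgue measure on D, it cannot
influence the limit. Every such model therefore has the same limit, governed by the equilibrium
measure of W alone.

Reduction to eigenvalues. As ∑ λ_i = 0, there are c_i with c_i - c_{i+1} = λ_{i+1}, and the
commutator equation reads M_{i+1} M_{i+1}† + c_{i+1} = M_i† M_i + c_i. So all M_i M_i† + c_i have
one common spectrum x, and a simultaneous singular value decomposition (`exists_cyclic_normalForm`)
gives M_i = U_i D_i U_{i+1}† with D_i diagonal and |D_i|² = x - c_i. Put b = max c, s = √(x - b),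
γ_i = b - c_i. The eigenvalues of the product are z = ∏ d_i with |d_i| = √(s² + γ_i). In the moving
frame ω_i = U_i† dU_i, the pair (p,q) contributes the map v ↦ (v_i d_i(q) - d_i(p) v_{i+1})_i, whose
complex determinant is z_q - z_p (`det_cyclicDifference`). Over ℝ this is the factor |z_q - z_p|².
The diagonal contributes a product of one-particle densities. The area formula
`lintegral_hausdorffMeasure_image` turns this into a statement about dM, and the unitary coordinates
integrate to a constant (`exists_lintegral_cyclicPoints`). Normal matrices are the case m = 1, λ =
0.

Large deviations. After rescaling, the kernel log(1/(r|z - w|)) + U(z) + U(w) with U = W/2 + const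
on D is continuous with values in [0,∞] and infinite on the diagonal. The energy is lower
semicontinuous on the compact space of probability measures on D, so a minimizer σ exists, and it
has no atoms. It is unique because the logarithmic energy is positive definite: Frullani's integral
writes the logarithm as a mixture of Gaussians, which are characteristic functions
(`logInteraction_le`).

Concentration is `IsGibbsLimit.tendsto_gibbsWeight`. On a closed set C of measures that misses σ, a
truncated energy exceeds the minimum by a uniform margin, so configurations with empirical measure
in C weigh at most exp(-N² a₂ + O(N)). Jensen's inequality bounds the partition function below by
exp(-N² a₁ - O(N)) with a₁ < a₂, provided the minimal energy is approximated by measures of bounded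
density with respect to η. That approximation spreads each point over the part of small circles
about it that lies in the interior of D. Connectedness of the interior guarantees that small circles
about points of D meet it. -/

set_option linter.unusedSectionVars false
set_option linter.style.haveILetI false
/-! ### Empirical measures and Gibbs measures of a pair interaction -/

section Gibbs

variable {X : Type*} [MeasurableSpace X]

/-- The interaction energy of a measure for the pair interaction `κ`. -/
noncomputable def pairInteraction (κ : X × X → ℝ≥0∞) (μ : Measure X) : ℝ≥0∞ :=
  ∫⁻ p, κ p ∂(μ.prod μ)

/-- The interaction energy of a configuration of `N` particles. -/
noncomputable def configEnergy (κ : X × X → ℝ≥0∞) {N : ℕ} (z : Fin N → X) : ℝ≥0∞ :=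
  ∑ x ∈ (Finset.univ : Finset (Fin N)).offDiag, κ (z x.1, z x.2)

/-- The Boltzmann factor of a configuration. -/
noncomputable def boltzmann (κ : X × X → ℝ≥0∞) {N : ℕ} (z : Fin N → X) : ℝ≥0∞ :=
  EReal.exp (-((configEnergy κ z : ℝ≥0∞) : EReal))

theorem measurable_configEnergy {κ : X × X → ℝ≥0∞} (hκ : Measurable κ) (N : ℕ) :
    Measurable fun z : Fin N → X => configEnergy κ z := by
  unfold configEnergy
  refine Finset.measurable_sum _ fun x _ => hκ.comp ?_
  fun_prop

theorem measurable_boltzmann {κ : X × X → ℝ≥0∞} (hκ : Measurable κ) (N : ℕ) :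
    Measurable fun z : Fin N → X => boltzmann κ z := by
  have h := measurable_configEnergy hκ N
  unfold boltzmann
  exact EReal.measurable_exp.comp (measurable_coe_ennreal_ereal.comp h).neg

theorem boltzmann_le_one {κ : X × X → ℝ≥0∞} {N : ℕ} (z : Fin N → X) : boltzmann κ z ≤ 1 := by
  rw [boltzmann, EReal.exp_le_one_iff, EReal.neg_le_zero]
  exact EReal.coe_ennreal_nonneg _

/-- The unnormalized Gibbs measure. -/
noncomputable def gibbsWeight (κ : X × X → ℝ≥0∞) (η : Measure X) (N : ℕ) : Measure (Fin N → X) :=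
  (Measure.pi fun _ : Fin N => η).withDensity fun z => boltzmann κ z

/-- The uniform probability measure on `Fin N`. -/
noncomputable def uniformFin (N : ℕ) : Measure (Fin N) := (N : ℝ≥0∞)⁻¹ • Measure.count

theorem uniformFin_singleton {N : ℕ} (i : Fin N) : uniformFin N {i} = (N : ℝ≥0∞)⁻¹ := by
  simp [uniformFin]

instance isProbabilityMeasure_uniformFin (N : ℕ) [NeZero N] :
    IsProbabilityMeasure (uniformFin N) := by
  constructor
  simp only [uniformFin, Measure.smul_apply, Measure.count_univ, smul_eq_mul]
  simp [ENNReal.inv_mul_cancel, NeZero.ne N]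

/-- The empirical measure of a configuration. -/
noncomputable def empirical {N : ℕ} [NeZero N] (z : Fin N → X) : ProbabilityMeasure X :=
  ⟨(uniformFin N).map z, Measure.isProbabilityMeasure_map (measurable_of_finite z).aemeasurable⟩

theorem empirical_toMeasure {N : ℕ} [NeZero N] (z : Fin N → X) :
    (empirical z : Measure X) = (uniformFin N).map z := rfl

theorem pairInteraction_empirical {κ : X × X → ℝ≥0∞} (hκ : Measurable κ) {N : ℕ} [NeZero N]
    (z : Fin N → X) :
    (N : ℝ≥0∞) ^ 2 * pairInteraction κ (empirical z : Measure X)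
      = ∑ x : Fin N × Fin N, κ (z x.1, z x.2) := by
  have hz := measurable_of_finite z
  rw [pairInteraction, empirical_toMeasure, Measure.map_prod_map _ _ hz hz,
    lintegral_map hκ (hz.prodMap hz), lintegral_fintype]
  have h1 : ∀ x : Fin N × Fin N, ((uniformFin N).prod (uniformFin N)) {x}
      = ((N : ℝ≥0∞) ^ 2)⁻¹ := by
    rintro ⟨i, j⟩
    rw [← Set.singleton_prod_singleton, Measure.prod_prod, uniformFin_singleton,
      uniformFin_singleton, sq, ENNReal.mul_inv (Or.inr (by simp)) (Or.inl (by simp))]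
  simp_rw [h1]
  rw [← Finset.sum_mul, mul_comm, mul_assoc, ENNReal.inv_mul_cancel, mul_one]
  · rfl
  · simp [NeZero.ne N]
  · simp

/-- An empirical measure charges the diagonal, where the logarithmic kernel is infinite. After
truncation at L the N diagonal terms cost at most N L, which is negligible against N². -/
theorem sum_le_configEnergy_add {κ : X × X → ℝ≥0∞} {N : ℕ} (z : Fin N → X) (L : ℝ≥0∞) :
    ∑ x : Fin N × Fin N, min (κ (z x.1, z x.2)) L ≤ configEnergy κ z + N * L := by
  have h := Finset.diag_union_offDiag (s := (Finset.univ : Finset (Fin N)))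
  rw [Finset.univ_product_univ] at h
  rw [← h, Finset.sum_union (Finset.disjoint_diag_offDiag _), add_comm]
  refine add_le_add (Finset.sum_le_sum fun x _ => min_le_left _ _) ?_
  refine (Finset.sum_le_card_nsmul _ _ L fun x _ => min_le_right _ _).trans ?_
  simp

/-- Powers of the empirical measure run over all index tuples, repetitions included. The gap to
tuples of distinct particles is estimated separately in `abs_tupleAverage_sub_le`. -/
theorem integral_pi_empirical {N : ℕ} [NeZero N] {k : ℕ} (z : Fin N → X) (f : (Fin k → X) → ℝ)
    (hf : Measurable f) :
    ∫ y, f y ∂(Measure.pi fun _ : Fin k => (empirical z : Measure X))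
      = ((N : ℝ) ^ k)⁻¹ * ∑ ι : Fin k → Fin N, f (fun j => z (ι j)) := by
  have hz := measurable_of_finite z
  simp_rw [empirical_toMeasure]
  haveI : IsProbabilityMeasure ((uniformFin N).map z) :=
    Measure.isProbabilityMeasure_map hz.aemeasurable
  rw [← Measure.pi_map_pi (fun _ => hz.aemeasurable), integral_map
    (measurable_of_finite _).aemeasurable hf.aestronglyMeasurable, integral_fintype (.of_finite), Finset.mul_sum]
  refine Finset.sum_congr rfl fun ι _ => ?_
  simp [Measure.real, uniformFin_singleton]

end Gibbs

/-! ### Semicontinuity of the interaction energy and compactness -/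

section GibbsTopology

variable {X : Type*} [TopologicalSpace X] [CompactSpace X] [TopologicalSpace.MetrizableSpace X]
  [MeasurableSpace X] [BorelSpace X]

/-- Truncation turns the kernel into a bounded continuous function, and μ ↦ μ ⊗ μ is weakly
continuous. -/
theorem continuous_lintegral_min {κ : X × X → ℝ≥0∞} (hκ : Continuous κ) (L : ℕ) :
    Continuous fun μ : ProbabilityMeasure X =>
      pairInteraction (fun p => min (κ p) L) (μ : Measure X) := by
  haveI : SecondCountableTopology X := by
    letI := TopologicalSpace.metrizableSpaceMetric X
    infer_instance
  have h1 : Continuous fun p => (min (κ p) L).toNNReal :=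
    ENNReal.continuousOn_toNNReal.comp_continuous (hκ.min continuous_const)
      fun p => ((min_le_right _ _).trans_lt (ENNReal.natCast_lt_top L)).ne
  let g : BoundedContinuousFunction (X × X) NNReal :=
    BoundedContinuousFunction.mkOfCompact ⟨_, h1⟩
  have h2 : Continuous fun μ : ProbabilityMeasure X => μ.prod μ :=
    ProbabilityMeasure.continuous_prod.comp (continuous_id.prodMk continuous_id)
  have h3 := (ProbabilityMeasure.continuous_iff_forall_continuous_lintegral.1 h2) g
  refine h3.congr fun μ => ?_
  refine lintegral_congr fun p => ?_
  simp only [g, BoundedContinuousFunction.mkOfCompact_apply, ContinuousMap.coe_mk]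
  rw [ENNReal.coe_toNNReal]
  exact ((min_le_right _ _).trans_lt (ENNReal.natCast_lt_top L)).ne

theorem iSup_pairInteraction_min {κ : X × X → ℝ≥0∞} (hκ : Measurable κ) (μ : Measure X) :
    ⨆ L : ℕ, pairInteraction (fun p => min (κ p) L) μ = pairInteraction κ μ := by
  unfold pairInteraction
  rw [← lintegral_iSup (fun L => hκ.min measurable_const)]
  · refine lintegral_congr fun p => ?_
    rw [← inf_iSup_eq, ENNReal.iSup_natCast]
    simp
  · intro L L' h p
    exact min_le_min le_rfl (by exact_mod_cast h)

theorem lowerSemicontinuous_pairInteraction {κ : X × X → ℝ≥0∞} (hκ : Continuous κ) :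
    LowerSemicontinuous fun μ : ProbabilityMeasure X => pairInteraction κ (μ : Measure X) := by
  haveI : SecondCountableTopology X := by
    letI := TopologicalSpace.metrizableSpaceMetric X
    infer_instance
  have h : (fun μ : ProbabilityMeasure X => pairInteraction κ (μ : Measure X))
      = fun μ : ProbabilityMeasure X =>
        ⨆ L : ℕ, pairInteraction (fun p => min (κ p) L) (μ : Measure X) := by
    funext μ
    exact (iSup_pairInteraction_min hκ.measurable _).symm
  rw [h]
  exact lowerSemicontinuous_iSup fun L => (continuous_lintegral_min hκ L).lowerSemicontinuous

/-- A Dini argument: the sets where the truncated energy exceeds a are open, increase with L, and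
cover the compact set C. One truncation level then serves all of C. -/
theorem exists_lt_pairInteraction_min {κ : X × X → ℝ≥0∞} (hκ : Continuous κ)
    {C : Set (ProbabilityMeasure X)} (hC : IsClosed C) {a : ℝ≥0∞}
    (ha : ∀ μ ∈ C, a < pairInteraction κ (μ : Measure X)) :
    ∃ L : ℕ, ∀ μ ∈ C, a < pairInteraction (fun p => min (κ p) L) (μ : Measure X) := by
  haveI : SecondCountableTopology X := by
    letI := TopologicalSpace.metrizableSpaceMetric X
    infer_instance
  have hcomp : IsCompact C := hC.isCompact
  obtain ⟨L, hL⟩ := hcomp.elim_directed_cover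
    (fun L : ℕ => {μ : ProbabilityMeasure X |
      a < pairInteraction (fun p => min (κ p) L) (μ : Measure X)})
    (fun L => isOpen_lt continuous_const (continuous_lintegral_min hκ L))
    (fun μ hμ => by
      have := ha μ hμ
      rw [← iSup_pairInteraction_min hκ.measurable, lt_iSup_iff] at this
      exact Set.mem_iUnion.2 this)
    (directed_of_isDirected_le fun L L' h μ hμ => lt_of_lt_of_le hμ
      (lintegral_mono fun p => min_le_min le_rfl (by exact_mod_cast h)))
  exact ⟨L, hL⟩

end GibbsTopology

/-! ### Jensen's lower bound for the partition function -/

section GibbsBounds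

variable {X : Type*} [MeasurableSpace X]

theorem measure_pi_mono {N : ℕ} {μ ν : Measure X} [SigmaFinite μ] [SigmaFinite ν] (h : μ ≤ ν) :
    (Measure.pi fun _ : Fin N => μ) ≤ Measure.pi fun _ : Fin N => ν := by
  refine Measure.le_intro fun s hs _ => ?_
  rw [Measure.pi, Measure.pi, toMeasure_apply _ _ hs, toMeasure_apply _ _ hs]
  suffices OuterMeasure.pi (fun _ : Fin N => μ.toOuterMeasure)
      ≤ OuterMeasure.pi (fun _ : Fin N => ν.toOuterMeasure) from this s
  rw [OuterMeasure.le_pi]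
  intro s _
  refine (OuterMeasure.pi_pi_le _ _).trans ?_
  exact Finset.prod_le_prod' fun i _ => h _

theorem pi_smul_const {N : ℕ} (c : NNReal) (μ : Measure X) [IsFiniteMeasure μ] :
    (Measure.pi fun _ : Fin N => c • μ) = c ^ N • Measure.pi fun _ : Fin N => μ := by
  refine Measure.pi_eq fun s _ => ?_
  simp only [Measure.smul_apply, Measure.pi_pi, ENNReal.smul_def, smul_eq_mul,
    Finset.prod_mul_distrib, Finset.prod_const, Finset.card_univ, Fintype.card_fin]
  push_cast
  rfl

theorem lintegral_pi_pair {N : ℕ} (μ : Measure X) [IsProbabilityMeasure μ] {κ : X × X → ℝ≥0∞}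
    (hκ : Measurable κ) {i j : Fin N} (hij : i ≠ j) :
    ∫⁻ z, κ (z i, z j) ∂(Measure.pi fun _ : Fin N => μ) = pairInteraction κ μ := by
  have hind := ProbabilityTheory.iIndepFun_pi (μ := fun _ : Fin N => μ) (X := fun _ x => x)
    (fun _ => aemeasurable_id)
  have h2 := (ProbabilityTheory.indepFun_iff_map_prod_eq_prod_map_map
    (measurable_pi_apply i).aemeasurable (measurable_pi_apply j).aemeasurable).1
    (hind.indepFun hij)
  rw [show (Measure.pi fun _ : Fin N => μ).map (fun ω => ω i) = μ from
      (measurePreserving_eval (fun _ : Fin N => μ) i).map_eq,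
    show (Measure.pi fun _ : Fin N => μ).map (fun ω => ω j) = μ from
      (measurePreserving_eval (fun _ : Fin N => μ) j).map_eq] at h2
  rw [pairInteraction, ← h2, lintegral_map hκ (by fun_prop)]

theorem lintegral_configEnergy_le {N : ℕ} (μ : Measure X) [IsProbabilityMeasure μ]
    {κ : X × X → ℝ≥0∞} (hκ : Measurable κ) :
    ∫⁻ z, configEnergy κ z ∂(Measure.pi fun _ : Fin N => μ) ≤ N ^ 2 * pairInteraction κ μ := by
  unfold configEnergy
  rw [lintegral_finsetSum _ (fun x _ => show Measurable fun z : Fin N → X =>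
    κ (z x.1, z x.2) from hκ.comp (by fun_prop))]
  have : ∀ x ∈ (Finset.univ : Finset (Fin N)).offDiag,
      ∫⁻ z : Fin N → X, κ (z x.1, z x.2) ∂(Measure.pi fun _ : Fin N => μ)
        = pairInteraction κ μ := fun x hx =>
    lintegral_pi_pair μ hκ (Finset.mem_offDiag.1 hx).2.2
  rw [Finset.sum_congr rfl this, Finset.sum_const, Finset.offDiag_card, nsmul_eq_mul]
  gcongr
  simp only [Finset.card_univ, Fintype.card_fin]
  calc ((N * N - N : ℕ) : ℝ≥0∞) ≤ ((N * N : ℕ) : ℝ≥0∞) := by exact_mod_cast Nat.sub_le _ _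
    _ = (N : ℝ≥0∞) ^ 2 := by push_cast; ring

theorem boltzmann_eq_ofReal {κ : X × X → ℝ≥0∞} {N : ℕ} {z : Fin N → X}
    (h : configEnergy κ z ≠ ⊤) :
    boltzmann κ z = ENNReal.ofReal (Real.exp (-(configEnergy κ z).toReal)) := by
  rw [boltzmann, ← EReal.coe_ennreal_toReal h, ← EReal.coe_neg, EReal.exp_coe]

/-- Jensen's inequality for the Boltzmann factor. -/
theorem exp_le_lintegral_boltzmann {N : ℕ} (μ : Measure X) [IsProbabilityMeasure μ]
    {κ : X × X → ℝ≥0∞} (hκ : Measurable κ) {a : ℝ} (ha : 0 ≤ a)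
    (h : pairInteraction κ μ ≤ ENNReal.ofReal a) :
    ENNReal.ofReal (Real.exp (-(N : ℝ) ^ 2 * a))
      ≤ ∫⁻ z, boltzmann κ z ∂(Measure.pi fun _ : Fin N => μ) := by
  set b : ℝ := (N : ℝ) ^ 2 * a with hb
  have hb0 : 0 ≤ b := by positivity
  have hint : ∫⁻ z, configEnergy κ z ∂(Measure.pi fun _ : Fin N => μ) ≤ ENNReal.ofReal b := by
    refine (lintegral_configEnergy_le μ hκ).trans ?_
    rw [hb, ENNReal.ofReal_mul (by positivity), ENNReal.ofReal_pow (by positivity),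
      ENNReal.ofReal_natCast]
    gcongr
  set c := ENNReal.ofReal (Real.exp (-b)) with hc
  -- The tangent line of exp at -b: e^{-t} ≥ e^{-b}(1 + b - t), rearranged so that nothing is
  -- subtracted in `ℝ≥0∞`.
  have hpt : ∀ z : Fin N → X, c * (1 + ENNReal.ofReal b)
      ≤ boltzmann κ z + c * configEnergy κ z := by
    intro z
    by_cases hz : configEnergy κ z = ⊤
    · rw [hz, ENNReal.mul_top (by simp [hc, Real.exp_pos])]
      simp
    · rw [boltzmann_eq_ofReal hz, ← ENNReal.ofReal_toReal hz]
      set t := (configEnergy κ z).toReal with ht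
      have ht0 : 0 ≤ t := ENNReal.toReal_nonneg
      rw [ENNReal.toReal_ofReal ht0, hc, ← ENNReal.ofReal_one,
        ← ENNReal.ofReal_add zero_le_one hb0,
        ← ENNReal.ofReal_mul (Real.exp_nonneg _), ← ENNReal.ofReal_mul (Real.exp_nonneg _),
        ← ENNReal.ofReal_add (Real.exp_nonneg _) (by positivity)]
      refine ENNReal.ofReal_le_ofReal ?_
      have h1 : Real.exp (-t) = Real.exp (-b) * Real.exp (b - t) := by
        rw [← Real.exp_add]; congr 1; ring
      have h2 := Real.add_one_le_exp (b - t)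
      rw [h1]
      nlinarith [Real.exp_pos (-b)]
  have hI := lintegral_mono (μ := Measure.pi fun _ : Fin N => μ) hpt
  rw [lintegral_const, measure_univ, mul_one, lintegral_add_left (measurable_boltzmann hκ N),
    lintegral_const_mul _ (measurable_configEnergy hκ N)] at hI
  have hI2 := hI.trans (add_le_add le_rfl (mul_le_mul_right hint c))
  rw [mul_add, mul_one] at hI2
  have := (ENNReal.add_le_add_iff_right (by finiteness)).1 hI2
  rw [neg_mul, ← hb]
  exact this

end GibbsBounds

/-! ### Concentration of Gibbs measures at the energy minimizer -/

section GibbsConcentration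

variable {X : Type*} [TopologicalSpace X] [CompactSpace X] [TopologicalSpace.MetrizableSpace X]
  [MeasurableSpace X] [BorelSpace X]

theorem gibbsWeight_univ_le {κ : X × X → ℝ≥0∞} (η : Measure X) [IsFiniteMeasure η] (N : ℕ) :
    gibbsWeight κ η N Set.univ ≤ η Set.univ ^ N := by
  rw [gibbsWeight, withDensity_apply _ .univ, Measure.restrict_univ]
  refine (lintegral_mono boltzmann_le_one).trans ?_
  simp [Measure.pi_univ]

/-- The upper half of the large deviation estimate. The truncated energy of the empirical measure
controls the energy of the configuration up to the diagonal cost N L. -/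
theorem boltzmann_le_of_empirical {κ : X × X → ℝ≥0∞} (hκ : Measurable κ) {N : ℕ} [NeZero N]
    (z : Fin N → X) (L : ℕ) {a : ℝ} (ha : 0 ≤ a)
    (h : ENNReal.ofReal a ≤ pairInteraction (fun p => min (κ p) L) (empirical z : Measure X)) :
    boltzmann κ z ≤ ENNReal.ofReal (Real.exp (-((N : ℝ) ^ 2 * a) + N * L)) := by
  have h1 : (N : ℝ≥0∞) ^ 2 * ENNReal.ofReal a ≤ configEnergy κ z + N * L := by
    refine (mul_le_mul_right h _).trans ?_
    rw [pairInteraction_empirical (hκ.min measurable_const)]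
    exact sum_le_configEnergy_add z L
  by_cases hz : configEnergy κ z = ⊤
  · rw [boltzmann, hz]; simp
  · rw [boltzmann_eq_ofReal hz]
    refine ENNReal.ofReal_le_ofReal (Real.exp_le_exp.2 ?_)
    have h2 := ENNReal.toReal_mono (by finiteness) h1
    rw [ENNReal.toReal_add hz (by finiteness), ENNReal.toReal_mul, ENNReal.toReal_pow,
      ENNReal.toReal_mul, ENNReal.toReal_natCast, ENNReal.toReal_natCast,
      ENNReal.toReal_ofReal ha] at h2
    linarith

/-- The lower half. Jensen's inequality is applied under μ, and passing from μ to η loses only n^N,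
which is invisible on the scale exp(N²). -/
theorem exp_le_mul_gibbsWeight {κ : X × X → ℝ≥0∞} (hκ : Measurable κ) (η : Measure X)
    [IsFiniteMeasure η] (N : ℕ) (μ : Measure X) [IsProbabilityMeasure μ] {n : NNReal}
    (hμ : μ ≤ n • η) {a : ℝ} (ha : 0 ≤ a) (h : pairInteraction κ μ ≤ ENNReal.ofReal a) :
    ENNReal.ofReal (Real.exp (-(N : ℝ) ^ 2 * a)) ≤ n ^ N * gibbsWeight κ η N Set.univ := by
  refine (exp_le_lintegral_boltzmann μ hκ ha h).trans ?_
  refine (lintegral_mono' (measure_pi_mono hμ) le_rfl).trans ?_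
  rw [pi_smul_const, gibbsWeight, withDensity_apply _ .univ, Measure.restrict_univ]
  rw [ENNReal.smul_def, lintegral_smul_measure]
  simp

/-- The standing hypotheses for the large deviation argument: `σ` is the unique minimizer of the
interaction energy, which is approximated by measures of bounded density with respect to `η`. -/
structure IsGibbsLimit (κ : X × X → ℝ≥0∞) (η : Measure X) (σ : ProbabilityMeasure X) : Prop where
  continuous : Continuous κ
  finite : pairInteraction κ (σ : Measure X) ≠ ⊤
  unique : ∀ μ : ProbabilityMeasure X,
    pairInteraction κ (μ : Measure X) ≤ pairInteraction κ (σ : Measure X) → μ = σ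
  approx : ∀ a, pairInteraction κ (σ : Measure X) < a → ∃ μ : Measure X,
    IsProbabilityMeasure μ ∧ (∃ n : NNReal, μ ≤ n • η) ∧ pairInteraction κ μ < a

variable {κ : X × X → ℝ≥0∞} {η : Measure X} [IsFiniteMeasure η] {σ : ProbabilityMeasure X}

theorem IsGibbsLimit.gibbsWeight_univ_ne_zero (H : IsGibbsLimit κ η σ) (N : ℕ) :
    gibbsWeight κ η N Set.univ ≠ 0 := by
  obtain ⟨μ, hμ, ⟨n, hn⟩, h⟩ := H.approx _ H.finite.lt_top
  have := exp_le_mul_gibbsWeight H.continuous.measurable η N μ hn ENNReal.toReal_nonneg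
    (ENNReal.ofReal_toReal h.ne).ge
  intro h0
  rw [h0, mul_zero] at this
  simp only [nonpos_iff_eq_zero, ENNReal.ofReal_eq_zero, not_le.2 (Real.exp_pos _)] at this

theorem gibbsWeight_univ_ne_top (N : ℕ) :
    gibbsWeight κ η N Set.univ ≠ ⊤ :=
  ((gibbsWeight_univ_le η N).trans_lt (by finiteness)).ne

theorem tendsto_exp_neg_sq_add {δ : ℝ} (hδ : 0 < δ) (c : ℝ) :
    Tendsto (fun N : ℕ => Real.exp (-((N : ℝ) ^ 2 * δ) + N * c)) atTop (𝓝 0) := by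
  refine Real.tendsto_exp_atBot.comp ?_
  have h1 : Tendsto (fun N : ℕ => (N : ℝ) * ((N : ℝ) * δ - c)) atTop atTop := by
    refine tendsto_natCast_atTop_atTop.atTop_mul_atTop₀ ?_
    exact tendsto_atTop_add_const_right _ _ (tendsto_natCast_atTop_atTop.atTop_mul_const hδ)
  refine (tendsto_neg_atTop_atBot.comp h1).congr fun N => ?_
  simp only [Function.comp]
  ring

/-- The weight of C is at most exp(-N² a₂ + O(N)) and the total mass is at least exp(-N² a₁ - O(N)),
with levels a₁ < a₂ placed strictly between the minimal energy and the least truncated energy on C.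
-/
theorem IsGibbsLimit.tendsto_gibbsWeight (H : IsGibbsLimit κ η σ)
    {C : Set (ProbabilityMeasure X)} (hC : IsClosed C) (hσC : σ ∉ C) :
    Tendsto (fun N : ℕ => gibbsWeight κ η (N + 1) {z | empirical z ∈ C}
      / gibbsWeight κ η (N + 1) Set.univ) atTop (𝓝 0) := by
  haveI : SecondCountableTopology X := by
    letI := TopologicalSpace.metrizableSpaceMetric X
    infer_instance
  have hκ := H.continuous
  have hm := hκ.measurable
  rcases C.eq_empty_or_nonempty with rfl | hne
  · simp
  obtain ⟨L, hL⟩ := exists_lt_pairInteraction_min hκ hC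
    (a := pairInteraction κ (σ : Measure X)) fun μ hμ => by
      by_contra h
      exact hσC (H.unique μ (not_lt.1 h) ▸ hμ)
  obtain ⟨μ₀, hμ₀, hmin⟩ := hC.isCompact.exists_isMinOn hne
    (continuous_lintegral_min hκ L).continuousOn
  obtain ⟨a₂, ha₂, ha₂'⟩ := ENNReal.lt_iff_exists_nnreal_btwn.1 (hL μ₀ hμ₀)
  obtain ⟨a₁, ha₁, ha₁'⟩ := ENNReal.lt_iff_exists_nnreal_btwn.1 ha₂
  obtain ⟨μ, hμ, ⟨n, hn⟩, hμa⟩ := H.approx _ ha₁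
  -- M absorbs the two factors that are exponential in N only: the N-th power of the mass of η and
  -- the density bound n^N.
  obtain ⟨M, hM⟩ : ∃ M : ℝ, (η Set.univ).toReal * n ≤ Real.exp M :=
    ⟨_, (Real.add_one_le_exp _).trans' (le_add_of_nonneg_right zero_le_one)⟩
  have hδ : (0 : ℝ) < a₂ - a₁ := sub_pos.2 (by exact_mod_cast ha₁')
  have hlim : Tendsto (fun N : ℕ => ENNReal.ofReal
      (Real.exp (-(((N + 1 : ℕ) : ℝ) ^ 2 * (a₂ - a₁)) + (N + 1 : ℕ) * (L + M)))) atTop (𝓝 0) := by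
    have := (ENNReal.tendsto_ofReal (tendsto_exp_neg_sq_add hδ (L + M))).comp
      (tendsto_add_atTop_nat 1)
    rw [ENNReal.ofReal_zero] at this
    exact this
  refine tendsto_of_tendsto_of_tendsto_of_le_of_le tendsto_const_nhds hlim (fun _ => zero_le) ?_
  intro k
  set N := k + 1 with hN
  have hlow := exp_le_mul_gibbsWeight hm η N μ hn a₁.coe_nonneg (by simpa using hμa.le)
  have hup : gibbsWeight κ η N {z | empirical z ∈ C} ≤
      ENNReal.ofReal (Real.exp (-((N : ℝ) ^ 2 * a₂) + N * L)) * η Set.univ ^ N := by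
    rw [gibbsWeight, withDensity_apply']
    have : ∀ z ∈ {z : Fin N → X | empirical z ∈ C},
        boltzmann κ z ≤ ENNReal.ofReal (Real.exp (-((N : ℝ) ^ 2 * a₂) + N * L)) := by
      intro z hz
      refine boltzmann_le_of_empirical hm z L a₂.coe_nonneg ?_
      rw [ENNReal.ofReal_coe_nnreal]
      exact ha₂'.le.trans (hmin hz)
    calc _ ≤ ∫⁻ z in {z : Fin N → X | empirical z ∈ C},
            ENNReal.ofReal (Real.exp (-((N : ℝ) ^ 2 * a₂) + N * L))
            ∂(Measure.pi fun _ : Fin N => η) := setLIntegral_mono measurable_const this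
      _ ≤ _ := by
        rw [setLIntegral_const]
        refine mul_le_mul_right ((measure_mono (Set.subset_univ _)).trans ?_) _
        simp [Measure.pi_univ]
  refine ENNReal.div_le_of_le_mul ?_
  set Y := gibbsWeight κ η N Set.univ with hY
  have hη : η Set.univ = ENNReal.ofReal (η Set.univ).toReal :=
    (ENNReal.ofReal_toReal (by finiteness)).symm
  calc _ ≤ _ := hup
    _ = ENNReal.ofReal (Real.exp (-((N : ℝ) ^ 2 * (a₂ - a₁)) + N * L)) * η Set.univ ^ N
        * ENNReal.ofReal (Real.exp (-(N : ℝ) ^ 2 * a₁)) := by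
      rw [mul_right_comm, ← ENNReal.ofReal_mul (Real.exp_nonneg _), ← Real.exp_add]
      rw [show -((N : ℝ) ^ 2 * (a₂ - a₁)) + N * L + -(N : ℝ) ^ 2 * a₁
        = -((N : ℝ) ^ 2 * a₂) + N * L by ring]
    _ ≤ ENNReal.ofReal (Real.exp (-((N : ℝ) ^ 2 * (a₂ - a₁)) + N * L)) * η Set.univ ^ N
        * (n ^ N * Y) := mul_le_mul_right hlow _
    _ = (ENNReal.ofReal (Real.exp (-((N : ℝ) ^ 2 * (a₂ - a₁)) + N * L))
        * (η Set.univ * n) ^ N) * Y := by rw [mul_pow]; ring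
    _ ≤ _ := by
      refine mul_le_mul_left ?_ _
      have h1 : η Set.univ * n ≤ ENNReal.ofReal (Real.exp M) := by
        rw [hη, ← ENNReal.ofReal_coe_nnreal, ← ENNReal.ofReal_mul ENNReal.toReal_nonneg]
        exact ENNReal.ofReal_le_ofReal hM
      calc _ ≤ ENNReal.ofReal (Real.exp (-((N : ℝ) ^ 2 * (a₂ - a₁)) + N * L))
            * ENNReal.ofReal (Real.exp M) ^ N := by gcongr
        _ = _ := by
          rw [← ENNReal.ofReal_pow (Real.exp_nonneg _), ← ENNReal.ofReal_mul (Real.exp_nonneg _),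
            ← Real.exp_nat_mul, ← Real.exp_add]
          congr 2
          ring

/-- The average of `f` over the `k`-tuples of distinct particles. -/
noncomputable def tupleAverage {Y : Type*} {k N : ℕ} (f : (Fin k → Y) → ℝ) (z : Fin N → Y) : ℝ :=
  ((N.descFactorial k : ℕ) : ℝ)⁻¹ * ∑ ι : Fin k ↪ Fin N, f (fun j => z (ι j))

/-- Injective index tuples make up the fraction `N.descFactorial k / N ^ k` of all tuples. The
omitted tuples contribute one error term and the different normalization of the injective ones
another, whence the factor 2. -/
theorem abs_tupleAverage_sub_le {Y : Type*} {k N : ℕ} (f : (Fin k → Y) → ℝ) {B : ℝ}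
    (hB : ∀ y, |f y| ≤ B) (z : Fin N → Y) (hk : 0 < N.descFactorial k) :
    |tupleAverage f z - ((N : ℝ) ^ k)⁻¹ * ∑ ι : Fin k → Fin N, f (fun j => z (ι j))|
      ≤ 2 * B * (1 - (N.descFactorial k : ℝ) / (N : ℝ) ^ k) := by
  classical
  set d : ℝ := ((N.descFactorial k : ℕ) : ℝ) with hd
  have hd0 : 0 < d := by rw [hd]; exact_mod_cast hk
  have hdle : d ≤ (N : ℝ) ^ k := by rw [hd]; exact_mod_cast Nat.descFactorial_le_pow N k
  set P : ℝ := (N : ℝ) ^ k with hP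
  have hP0 : 0 < P := hd0.trans_le hdle
  set S : ℝ := ∑ ι : Fin k ↪ Fin N, f (fun j => z (ι j)) with hS
  have hinj : S = ∑ ι ∈ (Finset.univ.filter fun ι : Fin k → Fin N => Function.Injective ι),
      f (fun j => z (ι j)) := by
    rw [hS]
    refine Finset.sum_bij (fun ι _ => (ι : Fin k → Fin N)) (fun ι _ => ?_) (fun ι _ ι' _ h => ?_)
      (fun ι hι => ?_) (fun ι _ => rfl)
    · simpa using ι.injective
    · exact DFunLike.coe_injective h
    · exact ⟨⟨ι, (Finset.mem_filter.1 hι).2⟩, Finset.mem_univ _, rfl⟩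
  have hcardι : Fintype.card (Fin k ↪ Fin N) = N.descFactorial k := by
    simp [Fintype.card_embedding_eq]
  have hSB : |S| ≤ d * B := by
    refine (Finset.abs_sum_le_sum_abs _ _).trans ?_
    refine (Finset.sum_le_card_nsmul _ _ B fun ι _ => hB _).trans ?_
    rw [Finset.card_univ, hcardι, nsmul_eq_mul]
  set T : ℝ := ∑ ι ∈ (Finset.univ.filter fun ι : Fin k → Fin N => ¬ Function.Injective ι),
      f (fun j => z (ι j)) with hT
  have hsplit : ∑ ι : Fin k → Fin N, f (fun j => z (ι j)) = S + T := by
    rw [hinj, hT, Finset.sum_filter_add_sum_filter_not]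
  have hcardS : (Finset.univ.filter fun ι : Fin k → Fin N => Function.Injective ι).card
      = N.descFactorial k := by
    rw [← hcardι, ← Fintype.card_subtype]
    exact Fintype.card_congr (Equiv.subtypeInjectiveEquivEmbedding _ _)
  have hTB : |T| ≤ (P - d) * B := by
    refine (Finset.abs_sum_le_sum_abs _ _).trans ?_
    refine (Finset.sum_le_card_nsmul _ _ B fun ι _ => hB _).trans ?_
    rw [nsmul_eq_mul]
    have h1 := Finset.card_filter_add_card_filter_not
      (s := (Finset.univ : Finset (Fin k → Fin N))) Function.Injective
    rw [hcardS, Finset.card_univ, Fintype.card_fun, Fintype.card_fin, Fintype.card_fin] at h1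
    have h2 : d + ((Finset.univ.filter fun ι : Fin k → Fin N => ¬ Function.Injective ι).card : ℝ)
        = P := by rw [hd, hP]; exact_mod_cast h1
    rw [← h2, add_sub_cancel_left]
  rw [tupleAverage, hsplit, ← hS, ← hd]
  have e : d⁻¹ * S - P⁻¹ * (S + T) = (1 / d) * (1 - d / P) * S - P⁻¹ * T := by
    field_simp
    ring
  have h1dP : 0 ≤ 1 - d / P := by
    rw [sub_nonneg, div_le_one hP0]; exact hdle
  rw [e]
  refine (abs_sub _ _).trans ?_
  rw [abs_mul _ S, abs_mul _ T, abs_of_nonneg (by positivity : 0 ≤ (1 / d) * (1 - d / P)),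
    abs_of_pos (inv_pos.2 hP0)]
  have h2 : 1 / d * (1 - d / P) * |S| ≤ 1 / d * (1 - d / P) * (d * B) := by gcongr
  have h3 : P⁻¹ * |T| ≤ P⁻¹ * ((P - d) * B) := by gcongr
  refine (add_le_add h2 h3).trans (le_of_eq ?_)
  field_simp
  ring

theorem tendsto_descFactorial_div_pow (k : ℕ) :
    Tendsto (fun N : ℕ => (N.descFactorial k : ℝ) / (N : ℝ) ^ k) atTop (𝓝 1) := by
  refine (Asymptotics.isEquivalent_iff_tendsto_one ?_).1 (isEquivalent_descFactorial k)
  filter_upwards [eventually_gt_atTop 0] with N hN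
  positivity

theorem measurable_tupleAverage {Y : Type*} [MeasurableSpace Y] {k N : ℕ} {f : (Fin k → Y) → ℝ}
    (hf : Measurable f) : Measurable fun z : Fin N → Y => tupleAverage f z := by
  unfold tupleAverage
  refine Measurable.const_mul (Finset.measurable_sum _ fun ι _ => hf.comp ?_) _
  exact measurable_pi_lambda _ fun j => measurable_pi_apply _

theorem abs_tupleAverage_le {Y : Type*} {k N : ℕ} {f : (Fin k → Y) → ℝ} {B : ℝ}
    (hB : ∀ y, |f y| ≤ B) (hB0 : 0 ≤ B) (z : Fin N → Y) : |tupleAverage f z| ≤ B := by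
  rw [tupleAverage, abs_mul, abs_of_nonneg (by positivity)]
  have h : |∑ ι : Fin k ↪ Fin N, f (fun j => z (ι j))| ≤ (N.descFactorial k : ℕ) * B := by
    refine (Finset.abs_sum_le_sum_abs _ _).trans ?_
    refine (Finset.sum_le_card_nsmul _ _ B fun ι _ => hB _).trans ?_
    rw [Finset.card_univ, Fintype.card_embedding_eq, nsmul_eq_mul]
    simp
  rcases Nat.eq_zero_or_pos (N.descFactorial k) with h0 | h0
  · simp [h0, hB0]
  · have : (0 : ℝ) < (N.descFactorial k : ℕ) := by exact_mod_cast h0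
    rw [inv_mul_le_iff₀ this]
    exact h

/-- Law of large numbers for Gibbs measures: the averages over `k`-tuples of distinct particles
converge to the integral against the product of the minimizers. -/
theorem IsGibbsLimit.tendsto_integral_tupleAverage (H : IsGibbsLimit κ η σ) {k : ℕ}
    (f : BoundedContinuousFunction (Fin k → X) ℝ) :
    Tendsto (fun N : ℕ => ∫ z, tupleAverage f z
      ∂((gibbsWeight κ η N Set.univ)⁻¹ • gibbsWeight κ η N)) atTop
      (𝓝 (∫ y, f y ∂(Measure.pi fun _ : Fin k => (σ : Measure X)))) := by
  haveI : SecondCountableTopology X := by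
    letI := TopologicalSpace.metrizableSpaceMetric X
    infer_instance
  rw [← tendsto_add_atTop_iff_nat 1]
  set c := ∫ y, f y ∂(Measure.pi fun _ : Fin k => (σ : Measure X)) with hc
  set B := ‖f‖ with hBdef
  have hB : ∀ y, |f y| ≤ B := f.norm_coe_le_norm
  have hB0 : 0 ≤ B := norm_nonneg f
  have hf : Measurable f := f.continuous.measurable
  let Φ : ProbabilityMeasure X → ℝ := fun μ =>
    ∫ y, f y ∂(Measure.pi fun _ : Fin k => (μ : Measure X))
  have hΦ : Continuous Φ := by
    have h2 : Continuous fun μ : ProbabilityMeasure X =>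
        ProbabilityMeasure.pi (fun _ : Fin k => μ) :=
      ProbabilityMeasure.continuous_pi.comp (continuous_pi fun _ => continuous_id)
    exact (ProbabilityMeasure.continuous_iff_forall_continuous_integral.1 h2) f
  have hcB : |c| ≤ B := by
    rw [hc]
    refine (abs_integral_le_integral_abs).trans ?_
    refine (integral_mono_of_nonneg (ae_of_all _ fun _ => abs_nonneg _) (integrable_const B)
      (ae_of_all _ hB)).trans ?_
    simp
  rw [Metric.tendsto_atTop]
  intro ε hε
  -- The bad event: the empirical measure gives f a visibly wrong integral. It is closed by weak
  -- continuity of μ ↦ μ^{⊗k}, and it excludes σ.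
  set C : Set (ProbabilityMeasure X) := {μ | ε / 4 ≤ |Φ μ - c|} with hCdef
  have hC : IsClosed C := isClosed_le continuous_const (by fun_prop)
  have hσC : σ ∉ C := by
    simp only [hCdef, Set.mem_ofPred_eq, not_le]
    have : Φ σ = c := rfl
    rw [this, sub_self, abs_zero]
    positivity
  have hlim := H.tendsto_gibbsWeight hC hσC
  -- This threshold makes both the bad event, where the error is at most 2B, and the collision error
  -- of `abs_tupleAverage_sub_le` cost at most ε/4. Using B + 1 covers f = 0.
  have hδ : 0 < ε / (8 * (B + 1)) := by positivity
  have hev1 := hlim.eventually_lt_const (u := ENNReal.ofReal (ε / (8 * (B + 1))))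
    (by simpa using hδ)
  have hd := (tendsto_descFactorial_div_pow k).comp (tendsto_add_atTop_nat 1)
  have hev2 := hd.eventually_const_lt (u := 1 - ε / (8 * (B + 1))) (by linarith)
  obtain ⟨N₀, hN₀⟩ := eventually_atTop.1 (hev1.and (hev2.and (eventually_ge_atTop k)))
  refine ⟨N₀, fun n hn => ?_⟩
  obtain ⟨h1, h2, h3⟩ := hN₀ n hn
  set N := n + 1 with hN
  set Q : Measure (Fin N → X) := (gibbsWeight κ η N Set.univ)⁻¹ • gibbsWeight κ η N with hQ
  have hQprob : IsProbabilityMeasure Q := ⟨by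
    rw [hQ, Measure.smul_apply, smul_eq_mul]
    exact ENNReal.inv_mul_cancel (H.gibbsWeight_univ_ne_zero N) (gibbsWeight_univ_ne_top N)⟩
  set S : Set (Fin N → X) := {z | empirical z ∈ C} with hS
  have hSeq : S = {z | ε / 4 ≤
      |((N : ℝ) ^ k)⁻¹ * ∑ ι : Fin k → Fin N, f (fun j => z (ι j)) - c|} := by
    ext z
    simp only [hS, hCdef, Set.mem_ofPred_eq, Φ]
    rw [integral_pi_empirical z f hf]
  have hSm : MeasurableSet S := by
    rw [hSeq]
    refine measurableSet_le measurable_const (Measurable.abs (Measurable.sub_const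
      (Measurable.const_mul (Finset.measurable_sum _ fun ι _ => hf.comp ?_) _) _))
    exact measurable_pi_lambda _ fun j => measurable_pi_apply _
  have hQS : Q.real S ≤ ε / (8 * (B + 1)) := by
    refine ENNReal.toReal_le_of_le_ofReal hδ.le ?_
    rw [hQ, Measure.smul_apply, smul_eq_mul, mul_comm, ← div_eq_mul_inv]
    exact h1.le
  have hFm : Measurable fun z : Fin N → X => tupleAverage f z := measurable_tupleAverage hf
  have hFint : Integrable (fun z : Fin N → X => tupleAverage f z) Q :=
    Integrable.of_bound hFm.aestronglyMeasurable B
      (ae_of_all _ fun z => abs_tupleAverage_le hB hB0 z)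
  have hpt : ∀ z : Fin N → X, |tupleAverage f z - c|
      ≤ ε / 4 + ε / 4 + S.indicator (fun _ => 2 * B) z := by
    intro z
    by_cases hz : z ∈ S
    · rw [Set.indicator_of_mem hz]
      have := abs_tupleAverage_le hB hB0 z
      refine (abs_sub _ _).trans ?_
      linarith
    · rw [Set.indicator_of_notMem hz, add_zero]
      rw [hSeq, Set.mem_ofPred_eq, not_le] at hz
      have h4 := abs_tupleAverage_sub_le f hB z
        (Nat.descFactorial_pos.2 (by omega))
      have h5 : 2 * B * (1 - (N.descFactorial k : ℝ) / (N : ℝ) ^ k) ≤ ε / 4 := by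
        have h6 : 1 - (N.descFactorial k : ℝ) / (N : ℝ) ^ k ≤ ε / (8 * (B + 1)) := by
          simp only [Function.comp] at h2
          linarith
        calc _ ≤ 2 * B * (ε / (8 * (B + 1))) := by gcongr
          _ ≤ 2 * (B + 1) * (ε / (8 * (B + 1))) := by gcongr; linarith
          _ = ε / 4 := by field_simp; ring
      refine (abs_sub_le _ (((N : ℝ) ^ k)⁻¹ * ∑ ι : Fin k → Fin N, f (fun j => z (ι j))) _).trans ?_
      linarith
  rw [Real.dist_eq]
  have hsub : ∫ z, tupleAverage f z ∂Q - c = ∫ z, (tupleAverage f z - c) ∂Q := by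
    rw [integral_sub hFint (integrable_const c)]
    simp
  rw [hsub]
  refine (abs_integral_le_integral_abs).trans_lt ?_
  have hi : Integrable (fun z => ε / 4 + ε / 4 + S.indicator (fun _ => 2 * B) z) Q :=
    (integrable_const _).add ((integrable_const _).indicator hSm)
  refine (integral_mono (hFint.sub (integrable_const c)).abs hi hpt).trans_lt ?_
  rw [integral_add (integrable_const _) ((integrable_const _).indicator hSm),
    integral_indicator_const _ hSm]
  simp only [integral_const, probReal_univ, smul_eq_mul, one_mul]
  have h7 : Q.real S * (2 * B) ≤ ε / 4 := by
    calc _ ≤ ε / (8 * (B + 1)) * (2 * (B + 1)) := by gcongr; linarith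
      _ = ε / 4 := by field_simp; ring
  linarith

end GibbsConcentration

/-! ### Positive definiteness of the logarithmic energy -/

section LogEnergy

open ProbabilityTheory

/-- Frullani's integral for the exponential function. -/
theorem lintegral_exp_sub_exp_div {a : ℝ} (ha : 0 < a) (ha1 : a ≤ 1) :
    ∫⁻ t in Set.Ioi (0 : ℝ), ENNReal.ofReal (t⁻¹ * (Real.exp (-(t * a)) - Real.exp (-t)))
      = ENNReal.ofReal (-Real.log a) := by
  -- The integrand is the integral of e^{-tu} over u ∈ (a, 1]. After Tonelli the t-integral is 1/u,
  -- and integrating 1/u yields -log a.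
  have h1 : ∀ t ∈ Set.Ioi (0 : ℝ), ENNReal.ofReal (t⁻¹ * (Real.exp (-(t * a)) - Real.exp (-t)))
      = ∫⁻ u in Set.Ioc a 1, ENNReal.ofReal (Real.exp (-(t * u))) := by
    intro t ht
    have ht0 : t ≠ 0 := (Set.mem_Ioi.1 ht).ne'
    rw [← ofReal_integral_eq_lintegral_ofReal
      ((Continuous.integrableOn_Icc (by fun_prop)).mono_set Set.Ioc_subset_Icc_self)
      (ae_of_all _ fun u => (Real.exp_pos _).le), ← intervalIntegral.integral_of_le ha1]
    congr 1
    have hder : ∀ u ∈ Set.uIcc a 1, HasDerivAt (fun u => -(t⁻¹) * Real.exp (-(t * u)))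
        (Real.exp (-(t * u))) u := by
      intro u _
      have h0 : HasDerivAt (fun u => -(t * u)) (-(t * 1)) u := ((hasDerivAt_id u).const_mul t).neg
      refine (h0.exp.const_mul (-(t⁻¹))).congr_deriv ?_
      field_simp
    rw [intervalIntegral.integral_eq_sub_of_hasDerivAt hder
      (Continuous.intervalIntegrable (by fun_prop) _ _)]
    simp only [mul_one]
    ring
  rw [setLIntegral_congr_fun measurableSet_Ioi h1, lintegral_lintegral_swap]
  · have h2 : ∀ u ∈ Set.Ioc a 1, ∫⁻ t in Set.Ioi (0 : ℝ), ENNReal.ofReal (Real.exp (-(t * u)))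
        = ENNReal.ofReal u⁻¹ := by
      intro u hu
      have hu0 : 0 < u := ha.trans hu.1
      have h3 := integral_exp_mul_Ioi (a := -u) (by linarith) 0
      have h4 := integrableOn_exp_mul_Ioi (a := -u) (by linarith) 0
      have e : ∀ t : ℝ, Real.exp (-(t * u)) = Real.exp (-u * t) := by
        intro t; congr 1; ring
      simp_rw [e]
      rw [← ofReal_integral_eq_lintegral_ofReal h4 (ae_of_all _ fun u => (Real.exp_pos _).le),
        h3]
      congr 1
      simp [neg_div]
    rw [setLIntegral_congr_fun measurableSet_Ioc h2]
    have hint : IntegrableOn (fun u : ℝ => u⁻¹) (Set.Ioc a 1) := by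
      refine (ContinuousOn.integrableOn_Icc (continuousOn_inv₀.mono ?_)).mono_set
        Set.Ioc_subset_Icc_self
      intro u hu
      exact (ha.trans_le hu.1).ne'
    rw [← ofReal_integral_eq_lintegral_ofReal hint, ← intervalIntegral.integral_of_le ha1,
      integral_inv_of_pos ha one_pos]
    · simp
    · refine (ae_restrict_iff' measurableSet_Ioc).2 (ae_of_all _ fun u hu => ?_)
      exact (inv_pos.2 (ha.trans hu.1)).le
  · exact Measurable.aemeasurable (by fun_prop)

/-- The Gaussian interaction of two probability measures. -/
noncomputable def gaussInteraction (s : ℝ) (σ τ : Measure ℂ) : ℝ :=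
  ∫ p, Real.exp (-(s ^ 2 * ‖p.1 - p.2‖ ^ 2 / 2)) ∂(σ.prod τ)

/-- The Gaussian kernel is the characteristic function of `stdGaussian ℂ` evaluated at s(z - w).
Fubini then moves the Fourier transform onto σ and τ. -/
theorem gaussInteraction_eq (s : ℝ) (σ τ : Measure ℂ) [IsProbabilityMeasure σ]
    [IsProbabilityMeasure τ] :
    ((gaussInteraction s σ τ : ℝ) : ℂ)
      = ∫ ξ, charFun σ (s • ξ) * (starRingEnd ℂ) (charFun τ (s • ξ)) ∂(stdGaussian ℂ) := by
  have h1 : ∀ ξ : ℂ, charFun σ (s • ξ) * (starRingEnd ℂ) (charFun τ (s • ξ))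
      = ∫ p : ℂ × ℂ, Complex.exp ((inner ℝ ξ (s • (p.1 - p.2)) : ℝ) * Complex.I)
        ∂(σ.prod τ) := by
    intro ξ
    rw [← charFun_neg, charFun_apply, charFun_apply, ← integral_prod_mul]
    refine integral_congr_ae (ae_of_all _ fun p => ?_)
    simp only
    rw [← Complex.exp_add, ← add_mul]
    congr 2
    rw [inner_neg_right, inner_smul_right, inner_smul_right, inner_smul_right, inner_sub_right,
      real_inner_comm ξ p.1, real_inner_comm ξ p.2]
    push_cast
    ring
  simp_rw [h1]
  rw [integral_integral_swap]
  · have h2 : ∀ p : ℂ × ℂ, ∫ ξ : ℂ, Complex.exp ((inner ℝ ξ (s • (p.1 - p.2)) : ℝ) * Complex.I)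
        ∂(stdGaussian ℂ) = ((Real.exp (-(s ^ 2 * ‖p.1 - p.2‖ ^ 2 / 2)) : ℝ) : ℂ) := by
      intro p
      rw [← charFun_apply, charFun_stdGaussian, norm_smul]
      push_cast
      congr 1
      rw [mul_pow]
      norm_cast
      rw [Real.norm_eq_abs, sq_abs]
      push_cast
      ring
    simp_rw [h2]
    rw [gaussInteraction]
    exact integral_ofReal.symm
  · refine Integrable.of_bound (C := 1) ?_ (ae_of_all _ fun x => ?_)
    · refine Continuous.aestronglyMeasurable ?_
      simp only [Function.uncurry_def]
      fun_prop
    · simp only [Function.uncurry_def]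
      rw [Complex.norm_exp_ofReal_mul_I]

theorem continuous_charFun_of_isProbabilityMeasure (σ : Measure ℂ) [IsProbabilityMeasure σ] :
    Continuous (charFun σ) := by
  unfold charFun
  refine continuous_of_dominated (bound := fun _ => 1) (fun t => ?_)
    (fun t => ae_of_all _ fun x => ?_) (integrable_const _) (ae_of_all _ fun x => ?_)
  · exact Continuous.aestronglyMeasurable (by fun_prop)
  · rw [Complex.norm_exp_ofReal_mul_I]
  · fun_prop

theorem integrable_charFun_mul_charFun (s : ℝ) (σ τ : Measure ℂ) [IsProbabilityMeasure σ]
    [IsProbabilityMeasure τ] :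
    Integrable (fun ξ => charFun σ (s • ξ) * (starRingEnd ℂ) (charFun τ (s • ξ)))
      (stdGaussian ℂ) := by
  have h1 := continuous_charFun_of_isProbabilityMeasure σ
  have h2 := continuous_charFun_of_isProbabilityMeasure τ
  refine Integrable.of_bound (C := 1) (Continuous.aestronglyMeasurable (by fun_prop))
    (ae_of_all _ fun ξ => ?_)
  rw [norm_mul, RCLike.norm_conj]
  exact mul_le_one₀ (norm_charFun_le_one _) (norm_nonneg _) (norm_charFun_le_one _)

theorem integral_norm_sq_charFun_sub (s : ℝ) (σ τ : Measure ℂ) [IsProbabilityMeasure σ]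
    [IsProbabilityMeasure τ] :
    ∫ ξ, ‖charFun σ (s • ξ) - charFun τ (s • ξ)‖ ^ 2 ∂(stdGaussian ℂ)
      = gaussInteraction s σ σ + gaussInteraction s τ τ - 2 * gaussInteraction s σ τ := by
  have key : ∀ μ ν : Measure ℂ, [IsProbabilityMeasure μ] → [IsProbabilityMeasure ν] →
      gaussInteraction s μ ν
        = ∫ ξ, (charFun μ (s • ξ) * (starRingEnd ℂ) (charFun ν (s • ξ))).re ∂(stdGaussian ℂ) := by
    intro μ ν _ _
    have h := congrArg Complex.re (gaussInteraction_eq s μ ν)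
    rw [Complex.ofReal_re] at h
    rw [h]
    exact (integral_re (integrable_charFun_mul_charFun s μ ν)).symm
  have hi : ∀ μ ν : Measure ℂ, [IsProbabilityMeasure μ] → [IsProbabilityMeasure ν] →
      Integrable (fun ξ => (charFun μ (s • ξ) * (starRingEnd ℂ) (charFun ν (s • ξ))).re)
        (stdGaussian ℂ) := fun μ ν _ _ => (integrable_charFun_mul_charFun s μ ν).re
  rw [key σ σ, key τ τ, key σ τ, ← integral_const_mul,
    ← integral_add (hi σ σ) (hi τ τ),
    ← integral_sub (by exact (hi σ σ).add (hi τ τ)) ((hi σ τ).const_mul 2)]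
  refine integral_congr_ae (ae_of_all _ fun ξ => ?_)
  simp only [Complex.sq_norm, Complex.normSq_apply, Complex.sub_re, Complex.sub_im,
    Complex.mul_re, Complex.conj_re, Complex.conj_im]
  ring

theorem gaussInteraction_le (s : ℝ) (σ τ : Measure ℂ) [IsProbabilityMeasure σ]
    [IsProbabilityMeasure τ] :
    2 * gaussInteraction s σ τ ≤ gaussInteraction s σ σ + gaussInteraction s τ τ := by
  have h := integral_norm_sq_charFun_sub s σ τ
  have h0 : 0 ≤ ∫ ξ, ‖charFun σ (s • ξ) - charFun τ (s • ξ)‖ ^ 2 ∂(stdGaussian ℂ) :=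
    integral_nonneg fun _ => by positivity
  linarith

/-- Full support lets almost everywhere equality of continuous characteristic functions be upgraded
to equality everywhere. -/
instance isOpenPosMeasure_stdGaussian : (stdGaussian ℂ).IsOpenPosMeasure := by
  have h1 : (gaussianReal 0 1).IsOpenPosMeasure :=
    (gaussianReal_absolutelyContinuous' 0 one_ne_zero).isOpenPosMeasure
  unfold stdGaussian
  refine Continuous.isOpenPosMeasure_map (by fun_prop) ?_
  intro x
  exact ⟨fun i => (stdOrthonormalBasis ℝ ℂ).repr x i, (stdOrthonormalBasis ℝ ℂ).sum_repr x⟩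

/-- The defect is the Gaussian integral of the squared difference of the characteristic functions.
If it vanishes, these functions agree at all s ξ, hence everywhere, and they determine the measures.
-/
theorem eq_of_gaussInteraction_eq {s : ℝ} (hs : s ≠ 0) (σ τ : Measure ℂ) [IsProbabilityMeasure σ]
    [IsProbabilityMeasure τ]
    (h : gaussInteraction s σ σ + gaussInteraction s τ τ ≤ 2 * gaussInteraction s σ τ) :
    σ = τ := by
  have h1 := continuous_charFun_of_isProbabilityMeasure σ
  have h2 := continuous_charFun_of_isProbabilityMeasure τ
  have hI := integral_norm_sq_charFun_sub s σ τ
  have h0 : 0 ≤ ∫ ξ, ‖charFun σ (s • ξ) - charFun τ (s • ξ)‖ ^ 2 ∂(stdGaussian ℂ) :=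
    integral_nonneg fun _ => by positivity
  have hz : ∫ ξ, ‖charFun σ (s • ξ) - charFun τ (s • ξ)‖ ^ 2 ∂(stdGaussian ℂ) = 0 := by linarith
  rw [integral_eq_zero_iff_of_nonneg (fun _ => by positivity)] at hz
  · have hcont : (fun ξ => ‖charFun σ (s • ξ) - charFun τ (s • ξ)‖ ^ 2) = fun _ => (0 : ℝ) :=
      Continuous.ae_eq_iff_eq (stdGaussian ℂ) (by fun_prop) continuous_const |>.1 hz
    refine Measure.ext_of_charFun (funext fun t => ?_)
    have := congrFun hcont (s⁻¹ • t)
    rw [smul_smul, mul_inv_cancel₀ hs, one_smul] at this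
    simpa [sub_eq_zero] using this
  · refine Integrable.of_bound (C := 4) (Continuous.aestronglyMeasurable (by fun_prop))
      (ae_of_all _ fun ξ => ?_)
    have h3 : ‖charFun σ (s • ξ) - charFun τ (s • ξ)‖ ≤ 2 := by
      refine (norm_sub_le _ _).trans ?_
      linarith [norm_charFun_le_one (μ := σ) (s • ξ),
        norm_charFun_le_one (μ := τ) (s • ξ)]
    rw [Real.norm_of_nonneg (by positivity)]
    nlinarith [norm_nonneg (charFun σ (s • ξ) - charFun τ (s • ξ))]

/-- The logarithmic interaction `∬ log (1 / (r |z - w|))` of two measures, for `r |z - w| ≤ 1`. -/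
noncomputable def logInteraction (r : ℝ) (σ τ : Measure ℂ) : ℝ≥0∞ :=
  ∫⁻ p, ENNReal.ofReal (-Real.log (r * ‖p.1 - p.2‖)) ∂(σ.prod τ)

/-- Frullani's integral at a = (r|z - w|)² expresses the logarithm as a mixture of Gaussians; the
square explains the factor 2. The subtracted e^{-t} is the same for every pair of probability
measures and drops out of the differences that matter. -/
theorem logInteraction_eq {r : ℝ} (hr : 0 < r) (σ τ : Measure ℂ) [IsProbabilityMeasure σ]
    [IsProbabilityMeasure τ] (h1 : ∀ᵐ p ∂(σ.prod τ), r * ‖p.1 - p.2‖ ≤ 1)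
    (h2 : ∀ᵐ p ∂(σ.prod τ), p.1 ≠ p.2) :
    2 * logInteraction r σ τ = ∫⁻ t in Set.Ioi (0 : ℝ), ENNReal.ofReal
      (t⁻¹ * (gaussInteraction (Real.sqrt (2 * t) * r) σ τ - Real.exp (-t))) := by
  have e1 : 2 * logInteraction r σ τ = ∫⁻ p, (∫⁻ t in Set.Ioi (0 : ℝ), ENNReal.ofReal
      (t⁻¹ * (Real.exp (-(t * (r * ‖p.1 - p.2‖) ^ 2)) - Real.exp (-t)))) ∂(σ.prod τ) := by
    rw [logInteraction, ← lintegral_const_mul _ (by fun_prop)]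
    refine lintegral_congr_ae ?_
    filter_upwards [h1, h2] with p hp hp2
    have hpos : 0 < r * ‖p.1 - p.2‖ := mul_pos hr (norm_pos_iff.2 (sub_ne_zero.2 hp2))
    rw [lintegral_exp_sub_exp_div (by positivity) (pow_le_one₀ hpos.le hp), Real.log_pow]
    rw [show (2 : ℝ≥0∞) = ENNReal.ofReal 2 by simp, ← ENNReal.ofReal_mul (by norm_num)]
    congr 1
    push_cast
    ring
  rw [e1, lintegral_lintegral_swap (Measurable.aemeasurable (by fun_prop))]
  refine setLIntegral_congr_fun measurableSet_Ioi fun t ht => ?_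
  have ht0 : (0 : ℝ) < t := ht
  -- The width is chosen with s² = 2 t r².
  have hs : ∀ p : ℂ × ℂ, Real.exp (-(t * (r * ‖p.1 - p.2‖) ^ 2))
      = Real.exp (-((Real.sqrt (2 * t) * r) ^ 2 * ‖p.1 - p.2‖ ^ 2 / 2)) := by
    intro p
    congr 1
    rw [mul_pow, mul_pow, Real.sq_sqrt (by positivity)]
    ring
  simp only [hs]
  have hint : Integrable (fun p : ℂ × ℂ =>
      Real.exp (-((Real.sqrt (2 * t) * r) ^ 2 * ‖p.1 - p.2‖ ^ 2 / 2))) (σ.prod τ) := by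
    refine Integrable.of_bound (C := 1) (Continuous.aestronglyMeasurable (by fun_prop))
      (ae_of_all _ fun p => ?_)
    rw [Real.norm_of_nonneg (Real.exp_pos _).le, Real.exp_le_one_iff, neg_nonpos]
    positivity
  rw [← ofReal_integral_eq_lintegral_ofReal]
  · congr 1
    rw [integral_const_mul, integral_sub hint (integrable_const _), gaussInteraction]
    simp
  · exact (hint.sub (integrable_const _)).const_mul _
  · filter_upwards [h1, h2] with p hp hp2
    have hpos : 0 ≤ r * ‖p.1 - p.2‖ := by positivity
    simp only [Pi.zero_apply]
    rw [← hs]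
    refine mul_nonneg (by positivity) (sub_nonneg.2 (Real.exp_le_exp.2 (neg_le_neg ?_)))
    have := pow_le_one₀ (n := 2) hpos hp
    nlinarith

/-- Since r|z - w| ≤ 1, the Gaussian kernel is at least e^{-t}. The integrand of `logInteraction_eq`
is thus nonnegative, and `ENNReal.ofReal` cuts nothing off. -/
theorem exp_neg_le_gaussInteraction {r : ℝ} (hr : 0 < r) (σ τ : Measure ℂ)
    [IsProbabilityMeasure σ] [IsProbabilityMeasure τ]
    (h1 : ∀ᵐ p ∂(σ.prod τ), r * ‖p.1 - p.2‖ ≤ 1) {t : ℝ} (ht : 0 < t) :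
    Real.exp (-t) ≤ gaussInteraction (Real.sqrt (2 * t) * r) σ τ := by
  have hint : Integrable (fun p : ℂ × ℂ =>
      Real.exp (-((Real.sqrt (2 * t) * r) ^ 2 * ‖p.1 - p.2‖ ^ 2 / 2))) (σ.prod τ) := by
    refine Integrable.of_bound (C := 1) (Continuous.aestronglyMeasurable (by fun_prop))
      (ae_of_all _ fun p => ?_)
    rw [Real.norm_of_nonneg (Real.exp_pos _).le, Real.exp_le_one_iff, neg_nonpos]
    positivity
  have h2 : ∫ p : ℂ × ℂ, Real.exp (-t) ∂(σ.prod τ)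
      ≤ gaussInteraction (Real.sqrt (2 * t) * r) σ τ := by
    refine integral_mono_ae (integrable_const _) hint ?_
    filter_upwards [h1] with p hp
    refine Real.exp_le_exp.2 (neg_le_neg ?_)
    rw [mul_pow, Real.sq_sqrt (by positivity)]
    have := pow_le_one₀ (n := 2) (by positivity : 0 ≤ r * ‖p.1 - p.2‖) hp
    rw [mul_pow] at this
    nlinarith
  simpa using h2

theorem measurable_gaussInteraction (σ τ : Measure ℂ) [IsProbabilityMeasure σ]
    [IsProbabilityMeasure τ] : Measurable fun s => gaussInteraction s σ τ := by
  unfold gaussInteraction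
  refine (StronglyMeasurable.integral_prod_right (f := fun (s : ℝ) (p : ℂ × ℂ) =>
    Real.exp (-(s ^ 2 * ‖p.1 - p.2‖ ^ 2 / 2))) ?_).measurable
  refine Continuous.stronglyMeasurable ?_
  simp only [Function.uncurry_def]
  fun_prop

/-- The logarithmic energy is positive definite on measures of total mass zero. -/
theorem logInteraction_le {r : ℝ} (hr : 0 < r) (σ τ : Measure ℂ) [IsProbabilityMeasure σ]
    [IsProbabilityMeasure τ]
    (h : ∀ μ ν : Measure ℂ, μ = σ ∨ μ = τ → ν = σ ∨ ν = τ →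
      ∀ᵐ p ∂(μ.prod ν), r * ‖p.1 - p.2‖ ≤ 1 ∧ p.1 ≠ p.2) :
    2 * logInteraction r σ τ ≤ logInteraction r σ σ + logInteraction r τ τ ∧
      (logInteraction r σ σ + logInteraction r τ τ ≤ 2 * logInteraction r σ τ →
        logInteraction r σ σ ≠ ⊤ → logInteraction r τ τ ≠ ⊤ → σ = τ) := by
  have hστ := logInteraction_eq hr σ τ ((h σ τ (by simp) (by simp)).mono fun _ h => h.1)
    ((h σ τ (by simp) (by simp)).mono fun _ h => h.2)
  have hσσ := logInteraction_eq hr σ σ ((h σ σ (by simp) (by simp)).mono fun _ h => h.1)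
    ((h σ σ (by simp) (by simp)).mono fun _ h => h.2)
  have hττ := logInteraction_eq hr τ τ ((h τ τ (by simp) (by simp)).mono fun _ h => h.1)
    ((h τ τ (by simp) (by simp)).mono fun _ h => h.2)
  set A : Measure ℂ → Measure ℂ → ℝ → ℝ := fun μ ν t =>
    t⁻¹ * (gaussInteraction (Real.sqrt (2 * t) * r) μ ν - Real.exp (-t)) with hA
  have hle : ∀ t ∈ Set.Ioi (0 : ℝ), 2 * A σ τ t ≤ A σ σ t + A τ τ t := by
    intro t ht
    have ht0 : (0 : ℝ) < t := ht
    have h1 := gaussInteraction_le (Real.sqrt (2 * t) * r) σ τ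
    have h2 : 0 < t⁻¹ := inv_pos.2 ht0
    simp only [hA]
    nlinarith
  have hpt : ∀ t ∈ Set.Ioi (0 : ℝ), 2 * ENNReal.ofReal (A σ τ t)
      ≤ ENNReal.ofReal (A σ σ t) + ENNReal.ofReal (A τ τ t) := by
    intro t ht
    rw [show (2 : ℝ≥0∞) = ENNReal.ofReal 2 by simp, ← ENNReal.ofReal_mul (by norm_num)]
    exact (ENNReal.ofReal_le_ofReal (hle t ht)).trans ENNReal.ofReal_add_le
  have hmeas : ∀ μ ν : Measure ℂ, [IsProbabilityMeasure μ] → [IsProbabilityMeasure ν] →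
      Measurable fun t => ENNReal.ofReal (A μ ν t) := by
    intro μ ν _ _
    have h1 := measurable_gaussInteraction μ ν
    have h2 : Measurable fun t : ℝ => gaussInteraction (Real.sqrt (2 * t) * r) μ ν :=
      h1.comp (by fun_prop)
    simp only [hA]
    fun_prop
  have hL : 2 * (2 * logInteraction r σ τ)
      = ∫⁻ t in Set.Ioi (0 : ℝ), 2 * ENNReal.ofReal (A σ τ t) := by
    rw [hστ, lintegral_const_mul _ (hmeas σ τ)]
  have hR : 2 * (logInteraction r σ σ + logInteraction r τ τ)
      = ∫⁻ t in Set.Ioi (0 : ℝ), (ENNReal.ofReal (A σ σ t) + ENNReal.ofReal (A τ τ t)) := by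
    rw [mul_add, hσσ, hττ, lintegral_add_left (hmeas σ σ)]
  have h2 : (2 : ℝ≥0∞) ≠ 0 := by norm_num
  have h2' : (2 : ℝ≥0∞) ≠ ⊤ := by norm_num
  refine ⟨?_, fun hge hf1 hf2 => ?_⟩
  · rw [← ENNReal.mul_le_mul_iff_right h2 h2', hL, hR]
    exact setLIntegral_mono' measurableSet_Ioi hpt
  · rw [← ENNReal.mul_le_mul_iff_right h2 h2', hL, hR] at hge
    have hfin : ∫⁻ t in Set.Ioi (0 : ℝ), 2 * ENNReal.ofReal (A σ τ t) ≠ ⊤ := by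
      refine ((setLIntegral_mono' measurableSet_Ioi hpt).trans_lt ?_).ne
      rw [← hR]
      finiteness
    have hae := ae_eq_of_ae_le_of_lintegral_le
      ((ae_restrict_iff' measurableSet_Ioi).2 (ae_of_all _ hpt)) hfin
      ((hmeas σ σ).add (hmeas τ τ)).aemeasurable hge
    have hne : (ae (volume.restrict (Set.Ioi (0 : ℝ)))).NeBot := by
      rw [ae_neBot]
      simp
    -- Equality of the finite integrals forces equality of the integrands for almost every t. A
    -- single t > 0 already identifies the measures.
    obtain ⟨t, ht, ht0⟩ := (hae.and (self_mem_ae_restrict measurableSet_Ioi)).exists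
    beta_reduce at ht
    have ht0' : (0 : ℝ) < t := ht0
    have hs : Real.sqrt (2 * t) * r ≠ 0 := by positivity
    refine eq_of_gaussInteraction_eq hs σ τ ?_
    have hnn : ∀ μ ν : Measure ℂ, [IsProbabilityMeasure μ] → [IsProbabilityMeasure ν] →
        μ = σ ∨ μ = τ → ν = σ ∨ ν = τ → 0 ≤ A μ ν t := by
      intro μ ν _ _ hμ hν
      have := exp_neg_le_gaussInteraction hr μ ν ((h μ ν hμ hν).mono fun _ h => h.1) ht0'
      exact mul_nonneg (by positivity) (sub_nonneg.2 this)
    have e1 := hnn σ σ (by simp) (by simp)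
    have e2 := hnn τ τ (by simp) (by simp)
    have e3 := hnn σ τ (by simp) (by simp)
    rw [← ENNReal.ofReal_add e1 e2, show (2 : ℝ≥0∞) = ENNReal.ofReal 2 by simp,
      ← ENNReal.ofReal_mul (by norm_num),
      ENNReal.ofReal_eq_ofReal_iff (by positivity) (by positivity)] at ht
    simp only [hA] at ht
    have ht1 : t⁻¹ ≠ 0 := by positivity
    have : t⁻¹ * (gaussInteraction (Real.sqrt (2 * t) * r) σ σ
        + gaussInteraction (Real.sqrt (2 * t) * r) τ τ
        - 2 * gaussInteraction (Real.sqrt (2 * t) * r) σ τ) = 0 := by linarith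
    rcases mul_eq_zero.1 this with h | h
    · exact absurd h ht1
    · linarith

end LogEnergy

/-! ### Equilibrium measures -/

section Equilibrium

/-- The kernel `log (1 / (r |z - w|)) + U z + U w`, with the value `⊤` on the diagonal. -/
noncomputable def logKernel (r : ℝ) (U : ℂ → ℝ) (p : ℂ × ℂ) : ℝ≥0∞ :=
  (ENNReal.log (ENNReal.ofReal (r * ‖p.1 - p.2‖ * Real.exp (-(U p.1 + U p.2))))⁻¹).toENNReal

/-- With the potential as a factor under a single extended logarithm, the kernel is a composition of
continuous maps, across the diagonal as well. -/
theorem continuous_logKernel {r : ℝ} {U : ℂ → ℝ} (hU : Continuous U) :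
    Continuous (logKernel r U) := by
  unfold logKernel
  refine EReal.continuous_toENNReal.comp (ENNReal.continuous_log.comp (continuous_inv.comp ?_))
  exact ENNReal.continuous_ofReal.comp (by fun_prop)

theorem logKernel_self (r : ℝ) (U : ℂ → ℝ) (z : ℂ) : logKernel r U (z, z) = ⊤ := by
  simp [logKernel]

/-- Both r|z - w| ≤ 1 and U ≥ 0 are needed: each summand is nonnegative, so that truncation to
`ℝ≥0∞` is harmless. -/
theorem logKernel_of_ne {r : ℝ} (hr : 0 < r) {U : ℂ → ℝ} (hU : ∀ z, 0 ≤ U z) {p : ℂ × ℂ}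
    (h1 : r * ‖p.1 - p.2‖ ≤ 1) (h2 : p.1 ≠ p.2) :
    logKernel r U p = ENNReal.ofReal (-Real.log (r * ‖p.1 - p.2‖))
      + (ENNReal.ofReal (U p.1) + ENNReal.ofReal (U p.2)) := by
  have hpos : 0 < r * ‖p.1 - p.2‖ := mul_pos hr (norm_pos_iff.2 (sub_ne_zero.2 h2))
  have hlog : 0 ≤ -Real.log (r * ‖p.1 - p.2‖) := by
    have := Real.log_nonpos hpos.le h1
    linarith
  have hy : 0 < r * ‖p.1 - p.2‖ * Real.exp (-(U p.1 + U p.2)) := by positivity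
  rw [logKernel, ENNReal.log_inv, ENNReal.log_ofReal_of_pos hy, ← EReal.coe_neg,
    Real.log_mul hpos.ne' (Real.exp_ne_zero _), Real.log_exp, ← ENNReal.ofReal_add (hU _) (hU _),
    ← ENNReal.ofReal_add hlog (add_nonneg (hU _) (hU _)), EReal.toENNReal_of_ne_top (EReal.coe_ne_top _),
    EReal.toReal_coe]
  congr 1
  ring

theorem exp_neg_logKernel {r : ℝ} {U : ℂ → ℝ} (hU : ∀ z, 0 ≤ U z) {p : ℂ × ℂ}
    (h1 : r * ‖p.1 - p.2‖ ≤ 1) :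
    EReal.exp (-((logKernel r U p : ℝ≥0∞) : EReal))
      = ENNReal.ofReal (r * ‖p.1 - p.2‖ * Real.exp (-(U p.1 + U p.2))) := by
  have hle : r * ‖p.1 - p.2‖ * Real.exp (-(U p.1 + U p.2)) ≤ 1 := by
    refine mul_le_one₀ h1 (Real.exp_pos _).le ?_
    rw [Real.exp_le_one_iff, neg_nonpos]
    exact add_nonneg (hU _) (hU _)
  rw [logKernel, EReal.coe_toENNReal, ENNReal.log_inv, neg_neg, ENNReal.exp_log]
  rw [ENNReal.log_inv, EReal.neg_nonneg, ← ENNReal.log_one, ENNReal.log_le_log_iff]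
  exact ENNReal.ofReal_le_one.2 hle

theorem prod_diagonal_eq_zero {σ τ : Measure ℂ} [SFinite τ] (hτ : ∀ z, τ {z} = 0) :
    ∀ᵐ p ∂(σ.prod τ), p.1 ≠ p.2 := by
  rw [ae_iff]
  simp only [ne_eq, not_not]
  rw [Measure.measure_prod_null (measurableSet_eq_fun measurable_fst measurable_snd)]
  refine ae_of_all _ fun x => ?_
  have : Prod.mk x ⁻¹' {a : ℂ × ℂ | a.1 = a.2} = {x} := by
    ext y; simp [eq_comm]
  change τ (Prod.mk x ⁻¹' {a : ℂ × ℂ | a.1 = a.2}) = 0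
  rw [this, hτ]

theorem prod_ae_mem {D : Set ℂ} {σ τ : Measure ℂ} [SFinite τ] [SFinite σ] (hσ : σ Dᶜ = 0)
    (hτ : τ Dᶜ = 0) :
    ∀ᵐ p ∂(σ.prod τ), p.1 ∈ D ∧ p.2 ∈ D := by
  have h1 : ∀ᵐ p ∂(σ.prod τ), p.1 ∈ D :=
    Measure.quasiMeasurePreserving_fst.ae (p := fun z => z ∈ D) (by rw [ae_iff]; exact hσ)
  have h2 : ∀ᵐ p ∂(σ.prod τ), p.2 ∈ D :=
    Measure.quasiMeasurePreserving_snd.ae (p := fun z => z ∈ D) (by rw [ae_iff]; exact hτ)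
  exact h1.and h2

theorem lintegral_logKernel {D : Set ℂ} {r : ℝ} (hr : 0 < r)
    (hD : ∀ z ∈ D, ∀ w ∈ D, r * ‖z - w‖ ≤ 1) {U : ℂ → ℝ} (hUc : Continuous U) (hU : ∀ z, 0 ≤ U z)
    (σ τ : Measure ℂ) [IsProbabilityMeasure σ] [IsProbabilityMeasure τ] (hσ : σ Dᶜ = 0)
    (hτ : τ Dᶜ = 0) (hτa : ∀ z, τ {z} = 0) :
    ∫⁻ p, logKernel r U p ∂(σ.prod τ) = logInteraction r σ τ
      + (∫⁻ z, ENNReal.ofReal (U z) ∂σ + ∫⁻ z, ENNReal.ofReal (U z) ∂τ) := by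
  have h1 : ∀ᵐ p ∂(σ.prod τ), logKernel r U p = ENNReal.ofReal (-Real.log (r * ‖p.1 - p.2‖))
      + (ENNReal.ofReal (U p.1) + ENNReal.ofReal (U p.2)) := by
    filter_upwards [prod_ae_mem hσ hτ, prod_diagonal_eq_zero (σ := σ) hτa] with p hp hp2
    exact logKernel_of_ne hr hU (hD _ hp.1 _ hp.2) hp2
  rw [lintegral_congr_ae h1, lintegral_add_left (by fun_prop), lintegral_add_left (by fun_prop),
    logInteraction]
  congr 1
  have e1 := lintegral_prod_mul (μ := σ) (ν := τ) (f := fun z => ENNReal.ofReal (U z))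
    (g := fun _ => 1) (by fun_prop) (by fun_prop)
  have e2 := lintegral_prod_mul (μ := σ) (ν := τ) (f := fun _ => 1)
    (g := fun z => ENNReal.ofReal (U z)) (by fun_prop) (by fun_prop)
  simp only [mul_one, one_mul, lintegral_const, measure_univ] at e1 e2
  rw [e1, e2]

/-- An atom at z would charge the point (z, z), where the kernel is infinite. Minimizing over all
probability measures on D therefore excludes atoms automatically. -/
theorem measure_singleton_eq_zero_of_pairInteraction_ne_top {r : ℝ} {U : ℂ → ℝ}
    (hUc : Continuous U) {σ : Measure ℂ} [SFinite σ]
    (h : pairInteraction (logKernel r U) σ ≠ ⊤) (z : ℂ) : σ {z} = 0 := by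
  have h1 := ae_lt_top (continuous_logKernel (r := r) hUc).measurable h
  rw [ae_iff] at h1
  have h2 : (σ.prod σ) ({z} ×ˢ {z}) = 0 := by
    refine measure_mono_null ?_ h1
    rintro ⟨a, b⟩ ⟨ha, hb⟩
    obtain rfl : a = z := ha
    obtain rfl : b = a := hb
    simp [logKernel_self]
  rw [Measure.prod_prod] at h2
  simpa using h2

theorem lintegral_logKernel_comm {r : ℝ} {U : ℂ → ℝ} (σ τ : Measure ℂ) [SFinite σ]
    [SFinite τ] (hUc : Continuous U) :
    ∫⁻ p, logKernel r U p ∂(σ.prod τ) = ∫⁻ p, logKernel r U p ∂(τ.prod σ) := by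
  rw [← Measure.prod_swap, lintegral_map (continuous_logKernel hUc).measurable measurable_swap]
  refine lintegral_congr fun p => ?_
  simp only [logKernel, Prod.fst_swap, Prod.snd_swap]
  rw [norm_sub_rev, add_comm]

/-- The average of two measures. -/
noncomputable def midMeasure (σ τ : Measure ℂ) : Measure ℂ := (2 : ℝ≥0∞)⁻¹ • (σ + τ)

theorem pairInteraction_midMeasure {r : ℝ} {U : ℂ → ℝ} (hUc : Continuous U) (σ τ : Measure ℂ)
    [IsProbabilityMeasure σ] [IsProbabilityMeasure τ] :
    4 * pairInteraction (logKernel r U) (midMeasure σ τ) = pairInteraction (logKernel r U) σ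
      + pairInteraction (logKernel r U) τ + 2 * ∫⁻ p, logKernel r U p ∂(σ.prod τ) := by
  unfold pairInteraction
  have h4 : (4 : ℝ≥0∞) * ((2 : ℝ≥0∞)⁻¹ * (2 : ℝ≥0∞)⁻¹) = 1 := by
    rw [show (4 : ℝ≥0∞) = 2 * 2 by norm_num, mul_mul_mul_comm,
      ENNReal.mul_inv_cancel (by norm_num) (by norm_num), one_mul]
  have e : (midMeasure σ τ).prod (midMeasure σ τ) = ((2 : ℝ≥0∞)⁻¹ * (2 : ℝ≥0∞)⁻¹) •
      (σ.prod σ + τ.prod σ + (σ.prod τ + τ.prod τ)) := by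
    rw [midMeasure, Measure.prod_smul_left, Measure.prod_smul_right, smul_smul, Measure.prod_add,
      Measure.add_prod, Measure.add_prod]
  rw [e, lintegral_smul_measure, smul_eq_mul, ← mul_assoc, h4, one_mul, lintegral_add_measure,
    lintegral_add_measure, lintegral_add_measure, lintegral_logKernel_comm τ σ hUc]
  ring

/-- Two minimizers of the energy coincide. -/
theorem eq_of_pairInteraction_minimal {D : Set ℂ} {r : ℝ} (hr : 0 < r)
    (hD : ∀ z ∈ D, ∀ w ∈ D, r * ‖z - w‖ ≤ 1) {U : ℂ → ℝ} (hUc : Continuous U) (hU : ∀ z, 0 ≤ U z)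
    (σ τ : Measure ℂ) [IsProbabilityMeasure σ] [IsProbabilityMeasure τ] (hσ : σ Dᶜ = 0)
    (hτ : τ Dᶜ = 0) (hfin : pairInteraction (logKernel r U) σ ≠ ⊤)
    (heq : pairInteraction (logKernel r U) τ ≤ pairInteraction (logKernel r U) σ)
    (hmin : pairInteraction (logKernel r U) σ
      ≤ pairInteraction (logKernel r U) (midMeasure σ τ)) : σ = τ := by
  have hfin' : pairInteraction (logKernel r U) τ ≠ ⊤ := (heq.trans_lt hfin.lt_top).ne
  have hσa := measure_singleton_eq_zero_of_pairInteraction_ne_top hUc hfin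
  have hτa := measure_singleton_eq_zero_of_pairInteraction_ne_top hUc hfin'
  have e1 := lintegral_logKernel hr hD hUc hU σ σ hσ hσ hσa
  have e2 := lintegral_logKernel hr hD hUc hU τ τ hτ hτ hτa
  have e3 := lintegral_logKernel hr hD hUc hU σ τ hσ hτ hτa
  have hmid := pairInteraction_midMeasure (r := r) hUc σ τ
  set u := ∫⁻ z, ENNReal.ofReal (U z) ∂σ
  set v := ∫⁻ z, ENNReal.ofReal (U z) ∂τ
  set B := ∫⁻ p, logKernel r U p ∂(σ.prod τ) with hB
  set Jσ := pairInteraction (logKernel r U) σ with hJσ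
  set Jτ := pairInteraction (logKernel r U) τ with hJτ
  change Jσ = _ at e1
  change Jτ = _ at e2
  have hu : u ≠ ⊤ := by
    intro h; rw [e1, h] at hfin; simp at hfin
  have hv : v ≠ ⊤ := by
    intro h; rw [e2, h] at hfin'; simp at hfin'
  have hL1 : logInteraction r σ σ ≠ ⊤ := by
    intro h; rw [e1, h] at hfin; simp at hfin
  have hL2 : logInteraction r τ τ ≠ ⊤ := by
    intro h; rw [e2, h] at hfin'; simp at hfin'
  -- Minimality at the midpoint, expanded bilinearly with B the mutual energy. Together with Jτ ≤ Jσ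
  -- it gives Jσ + Jτ ≤ 2B, the reverse of positive definiteness.
  have h4 : 4 * Jσ ≤ Jσ + Jτ + 2 * B := by
    rw [← hmid]; gcongr
  have h5 : Jσ + Jτ ≤ 2 * B := by
    have h6 : 2 * Jσ + 2 * Jσ ≤ 2 * Jσ + 2 * B := by
      calc 2 * Jσ + 2 * Jσ = 4 * Jσ := by ring
        _ ≤ Jσ + Jτ + 2 * B := h4
        _ ≤ Jσ + Jσ + 2 * B := by gcongr
        _ = 2 * Jσ + 2 * B := by ring
    have h7 := (ENNReal.add_le_add_iff_left (by finiteness)).1 h6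
    calc Jσ + Jτ ≤ Jσ + Jσ := by gcongr
      _ = 2 * Jσ := by ring
      _ ≤ 2 * B := h7
  -- The potential terms are the same on both sides and cancel, leaving the equality case of
  -- `logInteraction_le`.
  have h8 : logInteraction r σ σ + logInteraction r τ τ + (2 * u + 2 * v)
      ≤ 2 * logInteraction r σ τ + (2 * u + 2 * v) := by
    calc _ = Jσ + Jτ := by rw [e1, e2]; ring
      _ ≤ 2 * B := h5
      _ = _ := by rw [e3]; ring
  have h9 := (ENNReal.add_le_add_iff_right (by finiteness)).1 h8
  refine (logInteraction_le hr σ τ ?_).2 h9 hL1 hL2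
  have hcase : ∀ μ : Measure ℂ, μ = σ ∨ μ = τ →
      IsProbabilityMeasure μ ∧ μ Dᶜ = 0 ∧ ∀ z, μ {z} = 0 := by
    rintro μ (rfl | rfl)
    · exact ⟨inferInstance, hσ, hσa⟩
    · exact ⟨inferInstance, hτ, hτa⟩
  intro μ ν hμ hν
  obtain ⟨_, hμ1, hμ2⟩ := hcase μ hμ
  obtain ⟨_, hν1, hν2⟩ := hcase ν hν
  filter_upwards [prod_ae_mem hμ1 hν1, prod_diagonal_eq_zero (σ := μ) hν2] with p hp hp2
  exact ⟨hD _ hp.1 _ hp.2, hp2⟩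

/-- The kernel carries W/2 + B in each of its two variables and a scale r in the logarithm. For
admissible measures this only adds the constant 2B - log r to the energy, so the minimization
problems agree. -/
theorem energy_eq_pairInteraction {D : Set ℂ} {r : ℝ} (hr : 0 < r) (hr1 : r ≤ 1)
    (hD : ∀ z ∈ D, ∀ w ∈ D, r * ‖z - w‖ ≤ 1) {U : ℂ → ℝ} (hUc : Continuous U) (hU : ∀ z, 0 ≤ U z)
    {W : ℂ → ℝ} {B : ℝ} (hUW : ∀ z ∈ D, U z = W z / 2 + B) {M : ℝ} (hM : ∀ z ∈ D, U z ≤ M)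
    {σ : Measure ℂ} (hσ : σ ∈ admissibleMeasures D) :
    energy W σ = ((pairInteraction (logKernel r U) σ : ℝ≥0∞) : EReal)
      - ((2 * B - Real.log r : ℝ) : EReal) := by
  obtain ⟨hσp, hσD, hσa⟩ := hσ
  have e1 : pairInteraction (logKernel r U) σ = _ :=
    lintegral_logKernel hr hD hUc hU σ σ hσD hσD hσa
  have hlr : 0 ≤ -Real.log r := by have := Real.log_nonpos hr.le hr1; linarith
  have hmem : ∀ᵐ z ∂σ, z ∈ D := by rw [ae_iff]; exact hσD
  have hUint : Integrable U σ := by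
    refine Integrable.of_bound (C := M) hUc.aestronglyMeasurable ?_
    filter_upwards [hmem] with z hz
    rw [Real.norm_of_nonneg (hU z)]
    exact hM z hz
  have hWae : W =ᵐ[σ] fun z => 2 * (U z - B) := by
    filter_upwards [hmem] with z hz
    rw [hUW z hz]; ring
  have hWint : ∫ z, W z ∂σ = 2 * (∫ z, U z ∂σ) - 2 * B := by
    rw [integral_congr_ae hWae, integral_const_mul, integral_sub hUint (integrable_const B)]
    simp
    ring
  rw [← ofReal_integral_eq_lintegral_ofReal hUint (ae_of_all _ hU)] at e1
  set P := ∫⁻ p : ℂ × ℂ, ENNReal.ofReal (Real.log (‖p.1 - p.2‖⁻¹)) ∂(σ.prod σ) with hP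
  set Q := ∫⁻ p : ℂ × ℂ, ENNReal.ofReal (Real.log ‖p.1 - p.2‖) ∂(σ.prod σ) with hQ
  set L := logInteraction r σ σ with hL
  have hae : ∀ᵐ p ∂(σ.prod σ), 0 < ‖p.1 - p.2‖ ∧ r * ‖p.1 - p.2‖ ≤ 1 := by
    filter_upwards [prod_ae_mem hσD hσD, prod_diagonal_eq_zero (σ := σ) hσa] with p hp hp2
    exact ⟨norm_pos_iff.2 (sub_ne_zero.2 hp2), hD _ hp.1 _ hp.2⟩
  have hQfin : Q ≠ ⊤ := by
    have : Q ≤ ∫⁻ _, ENNReal.ofReal (-Real.log r) ∂(σ.prod σ) := by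
      refine lintegral_mono_ae ?_
      filter_upwards [hae] with p hp
      refine ENNReal.ofReal_le_ofReal ?_
      have := Real.log_nonpos (by positivity) hp.2
      rw [Real.log_mul hr.ne' hp.1.ne'] at this
      linarith
    refine (this.trans_lt ?_).ne
    simp
  -- The identity -log(r t) = log(1/t) - log r, with positive and negative parts arranged so that
  -- every term is nonnegative.
  have hLQ : L + Q = P + ENNReal.ofReal (-Real.log r) := by
    have h1 : L + Q = ∫⁻ p : ℂ × ℂ, (ENNReal.ofReal (-Real.log (r * ‖p.1 - p.2‖))
        + ENNReal.ofReal (Real.log ‖p.1 - p.2‖)) ∂(σ.prod σ) := by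
      rw [lintegral_add_left (by fun_prop)]
      rfl
    have h2 : P + ENNReal.ofReal (-Real.log r) = ∫⁻ p : ℂ × ℂ,
        (ENNReal.ofReal (Real.log (‖p.1 - p.2‖⁻¹)) + ENNReal.ofReal (-Real.log r))
          ∂(σ.prod σ) := by
      rw [lintegral_add_left (by fun_prop)]
      simp [hP]
    rw [h1, h2]
    refine lintegral_congr_ae ?_
    filter_upwards [hae] with p hp
    have h3 := Real.log_nonpos (by positivity) hp.2
    rw [Real.log_mul hr.ne' hp.1.ne'] at h3 ⊢
    rw [Real.log_inv]
    rcases le_total 0 (Real.log ‖p.1 - p.2‖) with h | h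
    · rw [← ENNReal.ofReal_add (by linarith) h, ENNReal.ofReal_of_nonpos (p := -Real.log ‖p.1 - p.2‖)
        (by linarith), zero_add]
      congr 1; ring
    · rw [← ENNReal.ofReal_add (by linarith) hlr, ENNReal.ofReal_of_nonpos h, add_zero]
      congr 1; ring
  have hUnn : 0 ≤ ∫ z, U z ∂σ := integral_nonneg hU
  unfold energy logEnergy
  rw [← hP, ← hQ, hWint, e1]
  by_cases hPt : P = ⊤
  · have hLt : L = ⊤ := by
      by_contra h
      rw [hPt, top_add] at hLQ
      exact absurd hLQ (by finiteness)
    rw [hPt, hLt, top_add, ← ENNReal.ofReal_toReal hQfin]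
    rw [EReal.coe_ennreal_top, EReal.coe_ennreal_ofReal, EReal.top_sub_coe, EReal.coe_add_top,
      EReal.top_sub_coe]
  · have hLt : L ≠ ⊤ := by
      intro h
      rw [h, top_add] at hLQ
      exact absurd hLQ.symm (by finiteness)
    have hre := congrArg ENNReal.toReal hLQ
    rw [ENNReal.toReal_add hLt hQfin, ENNReal.toReal_add hPt (by finiteness),
      ENNReal.toReal_ofReal hlr] at hre
    rw [← ENNReal.ofReal_toReal hPt, ← ENNReal.ofReal_toReal hQfin, ← ENNReal.ofReal_toReal hLt,
      ← ENNReal.ofReal_add hUnn hUnn,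
      ← ENNReal.ofReal_add ENNReal.toReal_nonneg (by positivity)]
    rw [EReal.coe_ennreal_ofReal, EReal.coe_ennreal_ofReal, EReal.coe_ennreal_ofReal,
      max_eq_left ENNReal.toReal_nonneg, max_eq_left ENNReal.toReal_nonneg, max_eq_left (by positivity)]
    norm_cast
    linarith

theorem isEquilibriumMeasure_iff {D : Set ℂ} {r : ℝ} (hr : 0 < r) (hr1 : r ≤ 1)
    (hD : ∀ z ∈ D, ∀ w ∈ D, r * ‖z - w‖ ≤ 1) {U : ℂ → ℝ} (hUc : Continuous U) (hU : ∀ z, 0 ≤ U z)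
    {W : ℂ → ℝ} {B : ℝ} (hUW : ∀ z ∈ D, U z = W z / 2 + B) {M : ℝ} (hM : ∀ z ∈ D, U z ≤ M)
    {σ : Measure ℂ} : IsEquilibriumMeasure D W σ ↔ σ ∈ admissibleMeasures D ∧
      ∀ μ ∈ admissibleMeasures D,
        pairInteraction (logKernel r U) σ ≤ pairInteraction (logKernel r U) μ := by
  have key : ∀ σ ∈ admissibleMeasures D, ∀ μ ∈ admissibleMeasures D,
      (energy W σ ≤ energy W μ ↔
        pairInteraction (logKernel r U) σ ≤ pairInteraction (logKernel r U) μ) := by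
    intro σ hσ μ hμ
    rw [energy_eq_pairInteraction hr hr1 hD hUc hU hUW hM hσ,
      energy_eq_pairInteraction hr hr1 hD hUc hU hUW hM hμ, ← EReal.coe_ennreal_le_coe_ennreal_iff]
    constructor
    · intro h
      have := add_le_add_left h ((2 * B - Real.log r : ℝ) : EReal)
      rwa [EReal.sub_add_cancel, EReal.sub_add_cancel] at this
    · intro h
      exact EReal.sub_le_sub h le_rfl
  constructor
  · rintro ⟨h1, h2⟩
    refine ⟨h1, fun μ hμ => (key σ h1 μ hμ).1 ?_⟩
    rw [h2]
    exact iInf₂_le μ hμ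
  · rintro ⟨h1, h2⟩
    refine ⟨h1, le_antisymm (le_iInf₂ fun μ hμ => (key σ h1 μ hμ).2 (h2 μ hμ)) ?_⟩
    exact iInf₂_le σ h1

end Equilibrium

/-! ### Approximation by absolutely continuous measures -/

section Smearing

/-- The angular measure of the part of the circle of radius `s` about `x` lying in `G`. -/
noncomputable def arcMeasure (G : Set ℂ) (x : ℂ) (s : ℝ) : ℝ≥0∞ :=
  ∫⁻ θ in Set.Ioo (-Real.pi) Real.pi, G.indicator 1 (x + Complex.polarCoord.symm (s, θ))

/-- The density of the measure on `G ∩ {0 < |w - x| < e}` which is uniform on circles about `x` and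
whose radial law is uniform on `(0, e)`. -/
noncomputable def smearDensity (G : Set ℂ) (e : ℝ) (x w : ℂ) : ℝ≥0∞ :=
  G.indicator 1 w * (Set.Ioo 0 e).indicator
    (fun s => (ENNReal.ofReal e)⁻¹ * ((ENNReal.ofReal s)⁻¹ * (arcMeasure G x s)⁻¹)) ‖w - x‖

theorem measurable_arcMeasure {G : Set ℂ} (hG : MeasurableSet G) :
    Measurable fun p : ℂ × ℝ => arcMeasure G p.1 p.2 := by
  unfold arcMeasure
  refine Measurable.lintegral_prod_right' (f := fun q : (ℂ × ℝ) × ℝ =>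
    G.indicator (1 : ℂ → ℝ≥0∞) (q.1.1 + Complex.polarCoord.symm (q.1.2, q.2))) ?_
  refine (measurable_one.indicator hG).comp ?_
  simp only [Complex.polarCoord_symm_apply]
  fun_prop

theorem measurable_smearDensity {G : Set ℂ} (hG : MeasurableSet G) (e : ℝ) :
    Measurable fun p : ℂ × ℂ => smearDensity G e p.1 p.2 := by
  have h := measurable_arcMeasure hG
  have h1 : Measurable fun q : ℂ × ℝ => (Set.Ioo 0 e).indicator
      (fun s => (ENNReal.ofReal e)⁻¹ * ((ENNReal.ofReal s)⁻¹ * (arcMeasure G q.1 s)⁻¹)) q.2 := by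
    have : (fun q : ℂ × ℝ => (Set.Ioo 0 e).indicator
      (fun s => (ENNReal.ofReal e)⁻¹ * ((ENNReal.ofReal s)⁻¹ * (arcMeasure G q.1 s)⁻¹)) q.2)
      = (Prod.snd ⁻¹' (Set.Ioo 0 e)).indicator (fun q : ℂ × ℝ =>
        (ENNReal.ofReal e)⁻¹ * ((ENNReal.ofReal q.2)⁻¹ * (arcMeasure G q.1 q.2)⁻¹)) := by
      funext q
      by_cases hq : q.2 ∈ Set.Ioo 0 e
      · rw [Set.indicator_of_mem hq, Set.indicator_of_mem (show q ∈ Prod.snd ⁻¹' Set.Ioo 0 e from hq)]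
      · rw [Set.indicator_of_notMem hq,
          Set.indicator_of_notMem (show q ∉ Prod.snd ⁻¹' Set.Ioo 0 e from hq)]
    rw [this]
    exact Measurable.indicator (by fun_prop) (measurable_snd measurableSet_Ioo)
  unfold smearDensity
  refine Measurable.mul ((measurable_one.indicator hG).comp measurable_snd) ?_
  exact h1.comp (by fun_prop : Measurable fun p : ℂ × ℂ => (p.1, ‖p.2 - p.1‖))

/-- In polar coordinates about x the factor 1/s cancels the Jacobian and division by `arcMeasure`
normalizes the angular integral. A function of the distance to x thus sees only the uniform radial
law. -/
theorem lintegral_smearDensity {G : Set ℂ} (hG : MeasurableSet G) {e : ℝ} {x : ℂ}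
    (hx : ∀ s ∈ Set.Ioo 0 e, arcMeasure G x s ≠ 0) {h : ℝ → ℝ≥0∞} (hh : Measurable h) :
    ∫⁻ w, h ‖w - x‖ * smearDensity G e x w
      = (ENNReal.ofReal e)⁻¹ * ∫⁻ s in Set.Ioo 0 e, h s := by
  have hsm : Measurable fun w => smearDensity G e x w :=
    (measurable_smearDensity hG e).comp (measurable_const.prodMk measurable_id)
  rw [← lintegral_add_left_eq_self _ x, ← Complex.lintegral_comp_polarCoord_symm,
    polarCoord_target, Measure.volume_eq_prod, ← Measure.prod_restrict, lintegral_prod]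
  · have h1 : ∀ s ∈ Set.Ioi (0 : ℝ), (∫⁻ θ in Set.Ioo (-Real.pi) Real.pi, ENNReal.ofReal s •
        (h ‖x + Complex.polarCoord.symm (s, θ) - x‖
          * smearDensity G e x (x + Complex.polarCoord.symm (s, θ))))
        = (Set.Ioo 0 e).indicator (fun s => (ENNReal.ofReal e)⁻¹ * h s) s := by
      intro s hs
      have hs0 : (0 : ℝ) < s := hs
      have hn : ∀ θ, ‖x + Complex.polarCoord.symm (s, θ) - x‖ = s := by
        intro θ
        rw [add_sub_cancel_left, Complex.norm_polarCoord_symm, abs_of_pos hs0]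
      simp only [hn, smearDensity, smul_eq_mul]
      by_cases hse : s ∈ Set.Ioo 0 e
      · simp only [Set.indicator_of_mem hse]
        set c := (ENNReal.ofReal e)⁻¹ * ((ENNReal.ofReal s)⁻¹ * (arcMeasure G x s)⁻¹) with hc
        have : ∀ θ, ENNReal.ofReal s * (h s * (G.indicator 1 (x + Complex.polarCoord.symm (s, θ))
            * c)) = (ENNReal.ofReal s * h s * c)
              * G.indicator 1 (x + Complex.polarCoord.symm (s, θ)) := by
          intro θ; ring
        simp only [this]
        have hm : Measurable fun θ : ℝ =>
            G.indicator (1 : ℂ → ℝ≥0∞) (x + Complex.polarCoord.symm (s, θ)) := by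
          refine (measurable_one.indicator hG).comp ?_
          simp only [Complex.polarCoord_symm_apply]
          fun_prop
        rw [lintegral_const_mul _ hm]
        change ENNReal.ofReal s * h s * c * arcMeasure G x s = _
        have hfin : arcMeasure G x s ≠ ⊤ := by
          have : arcMeasure G x s ≤ ∫⁻ θ in Set.Ioo (-Real.pi) Real.pi, 1 := by
            refine lintegral_mono fun θ => ?_
            exact Set.indicator_le_self' (fun _ _ => zero_le) _
          refine (this.trans_lt ?_).ne
          simp
        calc ENNReal.ofReal s * h s * c * arcMeasure G x s
            = (ENNReal.ofReal e)⁻¹ * h s * (ENNReal.ofReal s * (ENNReal.ofReal s)⁻¹)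
              * ((arcMeasure G x s) * (arcMeasure G x s)⁻¹) := by rw [hc]; ring
          _ = (ENNReal.ofReal e)⁻¹ * h s := by
            rw [ENNReal.mul_inv_cancel (by simpa using hs0) (by simp),
              ENNReal.mul_inv_cancel (hx s hse) hfin, mul_one, mul_one]
      · simp [Set.indicator_of_notMem hse]
    rw [setLIntegral_congr_fun measurableSet_Ioi h1, lintegral_indicator measurableSet_Ioo,
      Measure.restrict_restrict measurableSet_Ioo, lintegral_const_mul _ hh,
      Set.inter_eq_left.2 (fun s hs => hs.1)]
  · refine Measurable.aemeasurable ?_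
    have hpc : Measurable fun p : ℝ × ℝ => x + Complex.polarCoord.symm p := by
      simp only [Complex.polarCoord_symm_apply]
      fun_prop
    simp only [smul_eq_mul]
    refine Measurable.mul (by fun_prop) (Measurable.mul ?_ (hsm.comp hpc))
    exact hh.comp (hpc.sub_const x).norm

/-- A connected open set meets all small circles about the points of its closure. -/
theorem exists_arcMeasure_ne_zero {G : Set ℂ} (hG : IsOpen G) (hconn : IsConnected G) :
    ∃ e₀ > 0, ∀ x ∈ closure G, ∀ s ∈ Set.Ioo 0 e₀, arcMeasure G x s ≠ 0 := by
  obtain ⟨a, ha⟩ := hconn.nonempty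
  obtain ⟨d, hd, hball⟩ := Metric.isOpen_iff.1 hG a ha
  set b : ℂ := a + (d / 2 : ℝ) with hb
  have hbG : b ∈ G := by
    refine hball ?_
    rw [Metric.mem_ball, dist_eq_norm, hb, add_sub_cancel_left, Complex.norm_real,
      Real.norm_of_nonneg (by positivity)]
    linarith
  have hab : ‖a - b‖ = d / 2 := by
    rw [hb, norm_sub_rev, add_sub_cancel_left, Complex.norm_real,
      Real.norm_of_nonneg (by positivity)]
  refine ⟨d / 4, by positivity, fun x hx s hs => ?_⟩
  obtain ⟨y, hyG, hy⟩ := Metric.mem_closure_iff.1 hx s hs.1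
  -- The points a and b of G are d/2 apart and s < d/4, so G does not fit inside the disc of radius
  -- s. A connected set with points on both sides of the circle meets it.
  have hfar : ∃ c ∈ G, s ≤ ‖c - x‖ := by
    by_contra! h
    have h1 := h a ha
    have h2 := h b hbG
    have h3 : ‖a - b‖ ≤ ‖a - x‖ + ‖b - x‖ := by
      rw [← norm_sub_rev x b]
      simpa using norm_add_le (a - x) (x - b)
    have := hs.2
    linarith
  obtain ⟨c, hcG, hc⟩ := hfar
  obtain ⟨w, hwG, hw⟩ := hconn.isPreconnected.intermediate_value hyG hcG
    (f := fun w => ‖w - x‖) (by fun_prop) (show s ∈ Set.Icc _ _ from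
      ⟨by rw [← dist_eq_norm, dist_comm]; exact hy.le, hc⟩)
  have hs0 : 0 < s := hs.1
  have hcont : Continuous fun θ : ℝ => x + Complex.polarCoord.symm (s, θ) := by
    simp only [Complex.polarCoord_symm_apply]
    fun_prop
  set O : Set ℝ := (fun θ : ℝ => x + Complex.polarCoord.symm (s, θ)) ⁻¹' G with hO
  have hOopen : IsOpen O := hG.preimage hcont
  set θ₀ := Complex.arg (w - x) with hθ₀
  have hθO : θ₀ ∈ O := by
    change x + Complex.polarCoord.symm (s, θ₀) ∈ G
    rw [Complex.polarCoord_symm_apply, hθ₀]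
    have := Complex.norm_mul_cos_add_sin_mul_I (w - x)
    have hw' : ‖w - x‖ = s := hw
    rw [hw'] at this
    rw [Complex.ofReal_cos, Complex.ofReal_sin, this]
    simpa using hwG
  -- The argument may equal π, the excluded endpoint of the angular interval. Openness of O moves it
  -- inside.
  have hmeet : (O ∩ Set.Ioo (-Real.pi) Real.pi).Nonempty := by
    have hcl : θ₀ ∈ closure (Set.Ioo (-Real.pi) Real.pi) := by
      rw [closure_Ioo (by linarith [Real.pi_pos])]
      exact ⟨(Complex.neg_pi_lt_arg _).le, Complex.arg_le_pi _⟩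
    exact mem_closure_iff.1 hcl O hOopen hθO
  have hpos := (hOopen.inter isOpen_Ioo).measure_pos volume hmeet
  have heq : arcMeasure G x s = volume (O ∩ Set.Ioo (-Real.pi) Real.pi) := by
    have : ∀ θ : ℝ, G.indicator (1 : ℂ → ℝ≥0∞) (x + Complex.polarCoord.symm (s, θ))
        = O.indicator 1 θ := fun θ => rfl
    rw [arcMeasure]
    simp only [this]
    rw [lintegral_indicator_one hOopen.measurableSet,
      Measure.restrict_apply hOopen.measurableSet]
  rw [heq]
  exact hpos.ne'

/-- The function `log (1 / (r a))`, as an extended nonnegative number. -/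
noncomputable def radialLog (r a : ℝ) : ℝ≥0∞ :=
  (ENNReal.log (ENNReal.ofReal (r * a))⁻¹).toENNReal

theorem continuous_radialLog (r : ℝ) : Continuous (radialLog r) := by
  unfold radialLog
  refine EReal.continuous_toENNReal.comp (ENNReal.continuous_log.comp (continuous_inv.comp ?_))
  exact ENNReal.continuous_ofReal.comp (by fun_prop)

theorem antitone_radialLog {r : ℝ} (hr : 0 ≤ r) : Antitone (radialLog r) := by
  intro a b hab
  unfold radialLog
  refine EReal.toENNReal_le_toENNReal (ENNReal.log_monotone (ENNReal.inv_le_inv.2 ?_))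
  exact ENNReal.ofReal_le_ofReal (by gcongr)

theorem radialLog_of_pos {r a : ℝ} (h : 0 < r * a) :
    radialLog r a = ENNReal.ofReal (-Real.log (r * a)) := by
  rw [radialLog, ENNReal.log_inv, ENNReal.log_ofReal_of_pos h, ← EReal.coe_neg,
    EReal.toENNReal_of_ne_top (EReal.coe_ne_top _), EReal.toReal_coe]

theorem radialLog_zero (r : ℝ) : radialLog r 0 = ⊤ := by simp [radialLog]

theorem logKernel_eq_radialLog_add {r : ℝ} (hr : 0 < r) {U : ℂ → ℝ} (hU : ∀ z, 0 ≤ U z) {p : ℂ × ℂ}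
    (h1 : r * ‖p.1 - p.2‖ ≤ 1) :
    logKernel r U p = radialLog r ‖p.1 - p.2‖
      + (ENNReal.ofReal (U p.1) + ENNReal.ofReal (U p.2)) := by
  by_cases h : p.1 = p.2
  · obtain ⟨a, b⟩ := p
    obtain rfl : a = b := h
    rw [logKernel_self]
    simp [radialLog_zero]
  · rw [logKernel_of_ne hr hU h1 h, radialLog_of_pos
      (mul_pos hr (norm_pos_iff.2 (sub_ne_zero.2 h)))]

theorem lintegral_neg_log_abs_ne_top :
    ∫⁻ a : ℝ, ENNReal.ofReal (-Real.log |a|) ≠ ⊤ := by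
  have h1 : ∀ a : ℝ, ENNReal.ofReal (-Real.log |a|)
      = (Set.Ioc (-1 : ℝ) 1).indicator (fun a => ENNReal.ofReal (-Real.log a)) a := by
    intro a
    rw [Real.log_abs]
    by_cases ha : a ∈ Set.Ioc (-1 : ℝ) 1
    · rw [Set.indicator_of_mem ha]
    · rw [Set.indicator_of_notMem ha, ENNReal.ofReal_eq_zero, neg_nonpos, ← Real.log_abs]
      refine Real.log_nonneg ?_
      rw [Set.mem_Ioc, not_and_or, not_lt, not_le] at ha
      rcases ha with h | h
      · rw [abs_of_nonpos (by linarith)]; linarith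
      · exact h.le.trans (le_abs_self a)
  simp_rw [h1]
  rw [lintegral_indicator measurableSet_Ioc]
  have hint : IntegrableOn (fun a : ℝ => -Real.log a) (Set.Ioc (-1) 1) :=
    (intervalIntegrable_iff_integrableOn_Ioc_of_le (by norm_num)).1
      intervalIntegral.intervalIntegrable_log'.neg
  exact hint.lintegral_lt_top.ne

/-- A bound for the average of `radialLog r |s - t|` over `s ∈ (0, e)`. -/
theorem average_radialLog_le {r e : ℝ} (hr : 0 < r) (he : 0 < e) (t : ℝ) :
    (ENNReal.ofReal e)⁻¹ * ∫⁻ s in Set.Ioo 0 e, radialLog r |s - t|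
      ≤ ENNReal.ofReal (-Real.log (r * e)) + ∫⁻ a : ℝ, ENNReal.ofReal (-Real.log |a|) := by
  set C := ∫⁻ a : ℝ, ENNReal.ofReal (-Real.log |a|) with hC
  have he0 : ENNReal.ofReal e ≠ 0 := by simpa using he
  -- Split -log(r|s - t|) as -log(re) - log(|s - t|/e). Rescaling by e then reduces the second term
  -- to a fixed integrable function on the line.
  have h1 : ∫⁻ s in Set.Ioo 0 e, radialLog r |s - t|
      ≤ ∫⁻ s in Set.Ioo 0 e, (ENNReal.ofReal (-Real.log (r * e))
        + ENNReal.ofReal (-Real.log |e⁻¹ * (s - t)|)) := by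
    refine lintegral_mono_ae (ae_restrict_of_ae ?_)
    have : ∀ᵐ s : ℝ, s ≠ t := by
      rw [ae_iff]; simp
    filter_upwards [this] with s hs
    have hst : 0 < |s - t| := abs_pos.2 (sub_ne_zero.2 hs)
    rw [radialLog_of_pos (by positivity)]
    refine (ENNReal.ofReal_le_ofReal ?_).trans ENNReal.ofReal_add_le
    rw [abs_mul, abs_of_pos (inv_pos.2 he), Real.log_mul hr.ne' hst.ne',
      Real.log_mul hr.ne' he.ne', Real.log_mul (inv_pos.2 he).ne' hst.ne', Real.log_inv]
    linarith
  have h2 : ∫⁻ s : ℝ, ENNReal.ofReal (-Real.log |e⁻¹ * (s - t)|) = ENNReal.ofReal e * C := by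
    rw [lintegral_sub_right_eq_self (fun s => ENNReal.ofReal (-Real.log |e⁻¹ * s|)) t, hC]
    have hmap := Real.map_volume_mul_left (inv_pos.2 he).ne'
    rw [inv_inv, abs_of_pos he] at hmap
    have h3 : ∫⁻ a, ENNReal.ofReal (-Real.log |a|) ∂(Measure.map (fun x => e⁻¹ * x) volume)
        = ∫⁻ s : ℝ, ENNReal.ofReal (-Real.log |e⁻¹ * s|) :=
      lintegral_map (by fun_prop) (by fun_prop)
    rw [← h3, hmap, lintegral_smul_measure, smul_eq_mul]
  calc _ ≤ (ENNReal.ofReal e)⁻¹ * ∫⁻ s in Set.Ioo 0 e, (ENNReal.ofReal (-Real.log (r * e))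
        + ENNReal.ofReal (-Real.log |e⁻¹ * (s - t)|)) := by gcongr
    _ ≤ (ENNReal.ofReal e)⁻¹ * (ENNReal.ofReal (-Real.log (r * e)) * ENNReal.ofReal e
        + ENNReal.ofReal e * C) := by
      rw [lintegral_add_left measurable_const]
      gcongr
      · simp
      · rw [← h2]
        exact setLIntegral_le_lintegral _ _
    _ = (ENNReal.ofReal e)⁻¹ * ENNReal.ofReal e * (ENNReal.ofReal (-Real.log (r * e)) + C) := by
      ring
    _ = _ := by rw [ENNReal.inv_mul_cancel he0 (by simp), one_mul]

end Smearing

/-! ### Energy of smeared measures -/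

section SmearingEnergy

theorem pairInteraction_logKernel_eq {D : Set ℂ} {r : ℝ} (hr : 0 < r)
    (hD : ∀ z ∈ D, ∀ w ∈ D, r * ‖z - w‖ ≤ 1) {U : ℂ → ℝ} (hUc : Continuous U) (hU : ∀ z, 0 ≤ U z)
    (σ : Measure ℂ) [IsProbabilityMeasure σ] (hσ : σ Dᶜ = 0) :
    pairInteraction (logKernel r U) σ = pairInteraction (fun p => radialLog r ‖p.1 - p.2‖) σ
      + 2 * ∫⁻ z, ENNReal.ofReal (U z) ∂σ := by
  have h1 : ∀ᵐ p ∂(σ.prod σ), logKernel r U p = radialLog r ‖p.1 - p.2‖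
      + (ENNReal.ofReal (U p.1) + ENNReal.ofReal (U p.2)) := by
    filter_upwards [prod_ae_mem hσ hσ] with p hp
    exact logKernel_eq_radialLog_add hr hU (hD _ hp.1 _ hp.2)
  have hm : Measurable fun p : ℂ × ℂ => radialLog r ‖p.1 - p.2‖ :=
    (continuous_radialLog r).measurable.comp (by fun_prop)
  unfold pairInteraction
  rw [lintegral_congr_ae h1, lintegral_add_left hm, lintegral_add_left (by fun_prop), two_mul]
  congr 1
  have e1 := lintegral_prod_mul (μ := σ) (ν := σ) (f := fun z => ENNReal.ofReal (U z))
    (g := fun _ => 1) (by fun_prop) (by fun_prop)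
  have e2 := lintegral_prod_mul (μ := σ) (ν := σ) (f := fun _ => 1)
    (g := fun z => ENNReal.ofReal (U z)) (by fun_prop) (by fun_prop)
  simp only [mul_one, one_mul, lintegral_const, measure_univ] at e1 e2
  rw [e1, e2]

/-- The smearing of a measure over small circles. -/
noncomputable def smearMeasure (G : Set ℂ) (e : ℝ) (σ : Measure ℂ) : Measure ℂ :=
  volume.withDensity fun w => ∫⁻ x, smearDensity G e x w ∂σ

variable {G : Set ℂ} {e : ℝ} {σ : Measure ℂ} [IsProbabilityMeasure σ]

theorem lintegral_smearMeasure (hG : MeasurableSet G) {F : ℂ → ℝ≥0∞} (hF : Measurable F) :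
    ∫⁻ w, F w ∂(smearMeasure G e σ) = ∫⁻ x, (∫⁻ w, F w * smearDensity G e x w) ∂σ := by
  have hm := measurable_smearDensity hG e
  have hm' : Measurable fun w => ∫⁻ x, smearDensity G e x w ∂σ := hm.lintegral_prod_left'
  rw [smearMeasure, lintegral_withDensity_eq_lintegral_mul _ hm' hF]
  simp only [Pi.mul_apply]
  have h1 : ∀ w, (∫⁻ x, smearDensity G e x w ∂σ) * F w
      = ∫⁻ x, F w * smearDensity G e x w ∂σ := by
    intro w
    rw [lintegral_const_mul _ (show Measurable fun x => smearDensity G e x w from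
      hm.comp (measurable_id.prodMk measurable_const)), mul_comm]
  simp_rw [h1]
  rw [lintegral_lintegral_swap]
  exact ((hF.comp measurable_fst).mul (hm.comp measurable_swap)).aemeasurable

theorem smearDensity_eq_zero_of_notMem {x w : ℂ} (h : w ∉ G) : smearDensity G e x w = 0 := by
  simp [smearDensity, h]

theorem smearDensity_eq_zero_of_le {x w : ℂ} (h : e ≤ ‖w - x‖) : smearDensity G e x w = 0 := by
  rw [smearDensity, Set.indicator_of_notMem (s := Set.Ioo 0 e), mul_zero]
  exact fun hw => absurd hw.2 (not_lt.2 h)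

theorem lintegral_smearDensity_eq_one (hG : MeasurableSet G) (he : 0 < e) {x : ℂ}
    (hx : ∀ s ∈ Set.Ioo 0 e, arcMeasure G x s ≠ 0) : ∫⁻ w, smearDensity G e x w = 1 := by
  have h := lintegral_smearDensity hG hx (h := fun _ => 1) measurable_const
  simp only [one_mul, lintegral_const, Measure.restrict_apply, MeasurableSet.univ, Set.univ_inter,
    Real.volume_Ioo, sub_zero] at h
  rw [h, ENNReal.inv_mul_cancel (by simpa using he) (by simp)]

theorem isProbabilityMeasure_smearMeasure (hG : MeasurableSet G) (he : 0 < e) {D : Set ℂ}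
    (hσ : σ Dᶜ = 0) (hx : ∀ x ∈ D, ∀ s ∈ Set.Ioo 0 e, arcMeasure G x s ≠ 0) :
    IsProbabilityMeasure (smearMeasure G e σ) := by
  constructor
  have h := lintegral_smearMeasure (e := e) (σ := σ) hG (F := fun _ => 1) measurable_const
  simp only [lintegral_const, one_mul] at h
  rw [h]
  have h2 : ∀ᵐ x ∂σ, (∫⁻ w, smearDensity G e x w) = 1 := by
    have : ∀ᵐ x ∂σ, x ∈ D := by rw [ae_iff]; exact hσ
    filter_upwards [this] with x hxD
    exact lintegral_smearDensity_eq_one hG he (hx x hxD)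
  rw [lintegral_congr_ae h2]
  simp

theorem smearMeasure_compl (hG : MeasurableSet G) : smearMeasure G e σ Gᶜ = 0 := by
  rw [← lintegral_indicator_one hG.compl,
    lintegral_smearMeasure hG (measurable_one.indicator hG.compl)]
  have : ∀ x w, (Gᶜ).indicator 1 w * smearDensity G e x w = 0 := by
    intro x w
    by_cases h : w ∈ G
    · simp [h]
    · rw [smearDensity_eq_zero_of_notMem h, mul_zero]
  simp [this]

theorem smearMeasure_absolutelyContinuous : smearMeasure G e σ ≪ volume :=
  withDensity_absolutelyContinuous _ _

/-- The constant in the bound for the potential of a smeared point mass. -/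
noncomputable def smearConst : ℝ≥0∞ :=
  ENNReal.ofReal (Real.log 4) + ∫⁻ a : ℝ, ENNReal.ofReal (-Real.log |a|)

theorem smearConst_ne_top : smearConst ≠ ⊤ :=
  ENNReal.add_ne_top.2 ⟨by simp, lintegral_neg_log_abs_ne_top⟩

/-- A bound for the mutual energy of two smeared point masses at distance `t`. -/
noncomputable def smearBound (r e t : ℝ) : ℝ≥0∞ :=
  if 4 * e ≤ t then radialLog r (t - 2 * e) else radialLog r t + smearConst

/-- For t ≥ 4e one has t - 2e ≥ t/2, so the logarithm changes by at most log 2. The right side does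
not depend on e and serves as a dominating function. -/
theorem smearBound_le {r e t : ℝ} (hr : 0 < r) (he : 0 < e) :
    smearBound r e t ≤ radialLog r t + smearConst := by
  unfold smearBound
  split_ifs with h
  · have ht : 0 < t := by linarith
    calc radialLog r (t - 2 * e) ≤ radialLog r (t / 2) := antitone_radialLog hr.le (by linarith)
      _ ≤ radialLog r t + ENNReal.ofReal (Real.log 4) := by
        rw [radialLog_of_pos (by positivity), radialLog_of_pos (by positivity)]
        refine (ENNReal.ofReal_le_ofReal ?_).trans ENNReal.ofReal_add_le
        rw [← mul_div_assoc, Real.log_div (by positivity) (by norm_num)]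
        have := Real.log_le_log (by norm_num : (0 : ℝ) < 2) (by norm_num : (2 : ℝ) ≤ 4)
        linarith
      _ ≤ _ := by
        unfold smearConst
        gcongr
        exact le_self_add
  · exact le_rfl

/-- By the reverse triangle inequality |u - v| is at least the difference of the distances of u and
v to x. The bound therefore depends only on the radial law, however small or oddly shaped the arcs
inside G are. -/
theorem lintegral_radialLog_smearDensity_le (hG : MeasurableSet G) {r : ℝ} (hr : 0 < r)
    {x : ℂ} (hx : ∀ s ∈ Set.Ioo 0 e, arcMeasure G x s ≠ 0) (v : ℂ) :
    ∫⁻ u, radialLog r ‖u - v‖ * smearDensity G e x u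
      ≤ (ENNReal.ofReal e)⁻¹ * ∫⁻ s in Set.Ioo 0 e, radialLog r |s - ‖v - x‖| := by
  have hm : Measurable fun s : ℝ => radialLog r |s - ‖v - x‖| :=
    (continuous_radialLog r).measurable.comp (by fun_prop)
  rw [← lintegral_smearDensity hG hx hm]
  refine lintegral_mono fun u => ?_
  refine mul_le_mul_left (antitone_radialLog hr.le ?_) _
  have := abs_norm_sub_norm_le (u - x) (v - x)
  simpa using this

/-- Two cases. Far apart, smearing moves each point by less than e, so distances drop by at most 2e.
For |x - y| < 4e the averaged logarithm is at most -log(re) plus a constant, and re exceeds r|x -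
y|/4. -/
theorem lintegral_radialLog_smearDensity_smearDensity_le (hG : MeasurableSet G) {r : ℝ}
    (hr : 0 < r) (he : 0 < e) {x y : ℂ} (hx : ∀ s ∈ Set.Ioo 0 e, arcMeasure G x s ≠ 0)
    (hy : ∀ s ∈ Set.Ioo 0 e, arcMeasure G y s ≠ 0) :
    ∫⁻ v, (∫⁻ u, radialLog r ‖u - v‖ * smearDensity G e x u) * smearDensity G e y v
      ≤ smearBound r e ‖x - y‖ := by
  have he0 : ENNReal.ofReal e ≠ 0 := by simpa using he
  suffices h : ∀ v, ‖v - y‖ < e →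
      ∫⁻ u, radialLog r ‖u - v‖ * smearDensity G e x u ≤ smearBound r e ‖x - y‖ by
    calc _ ≤ ∫⁻ v, smearBound r e ‖x - y‖ * smearDensity G e y v := by
          refine lintegral_mono fun v => ?_
          by_cases hv : ‖v - y‖ < e
          · exact mul_le_mul_left (h v hv) _
          · rw [smearDensity_eq_zero_of_le (not_lt.1 hv), mul_zero, mul_zero]
      _ = _ := by
        rw [lintegral_const_mul, lintegral_smearDensity_eq_one hG he hy, mul_one]
        exact (measurable_smearDensity hG e).comp (measurable_const.prodMk measurable_id)
  intro v hv
  refine (lintegral_radialLog_smearDensity_le hG hr hx v).trans ?_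
  unfold smearBound
  split_ifs with h
  · have h1 : ‖x - y‖ ≤ ‖v - x‖ + ‖v - y‖ := by
      rw [← norm_sub_rev x v]
      simpa using norm_add_le (x - v) (v - y)
    have h2 : ∫⁻ s in Set.Ioo 0 e, radialLog r |s - ‖v - x‖|
        ≤ ∫⁻ s in Set.Ioo 0 e, radialLog r (‖x - y‖ - 2 * e) := by
      refine setLIntegral_mono measurable_const fun s hs => antitone_radialLog hr.le ?_
      rw [abs_sub_comm]
      exact le_trans (by linarith [hs.2]) (le_abs_self _)
    refine (mul_le_mul_right h2 _).trans ?_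
    rw [setLIntegral_const, Real.volume_Ioo, sub_zero, mul_comm, mul_assoc,
      ENNReal.mul_inv_cancel he0 (by simp), mul_one]
  · refine (average_radialLog_le hr he _).trans ?_
    unfold smearConst
    rw [← add_assoc]
    refine add_le_add ?_ le_rfl
    rcases (norm_nonneg (x - y)).eq_or_lt with h0 | h0
    · rw [← h0, radialLog_zero]; simp
    · rw [radialLog_of_pos (by positivity)]
      refine (ENNReal.ofReal_le_ofReal ?_).trans ENNReal.ofReal_add_le
      have h1 : Real.log (r * ‖x - y‖) ≤ Real.log (4 * (r * e)) :=
        Real.log_le_log (by positivity) (by nlinarith)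
      rw [Real.log_mul (x := 4) (y := r * e) (by norm_num) (by positivity)] at h1
      linarith

theorem measurable_lintegral_radialLog_smearDensity (hG : MeasurableSet G) (r : ℝ) :
    Measurable fun q : ℂ × ℂ => ∫⁻ u, radialLog r ‖u - q.1‖ * smearDensity G e q.2 u := by
  have hn := measurable_smearDensity hG e
  have h1 : Measurable fun t : (ℂ × ℂ) × ℂ => radialLog r ‖t.2 - t.1.1‖ :=
    (continuous_radialLog r).measurable.comp (by fun_prop)
  have h2 : Measurable fun t : (ℂ × ℂ) × ℂ => smearDensity G e t.1.2 t.2 :=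
    hn.comp (by fun_prop : Measurable fun t : (ℂ × ℂ) × ℂ => (t.1.2, t.2))
  exact (h1.mul h2).lintegral_prod_right'

theorem measurable_smearBound (r e : ℝ) :
    Measurable fun p : ℂ × ℂ => smearBound r e ‖p.1 - p.2‖ := by
  have hR : Measurable (radialLog r) := (continuous_radialLog r).measurable
  have h : Measurable (smearBound r e) := by
    unfold smearBound
    exact Measurable.ite (measurableSet_le measurable_const measurable_id)
      (hR.comp (measurable_id.sub_const _)) (hR.add_const _)
  exact h.comp (by fun_prop)

@[fun_prop]
theorem measurable_radialLog (r : ℝ) : Measurable (radialLog r) :=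
  (continuous_radialLog r).measurable

theorem measurable_radialLog_norm_sub (r : ℝ) :
    Measurable fun p : ℂ × ℂ => radialLog r ‖p.1 - p.2‖ :=
  (measurable_radialLog r).comp (by fun_prop)

theorem lintegral_radialLog_smearMeasure (hG : MeasurableSet G) (r : ℝ) (v : ℂ) :
    ∫⁻ u, radialLog r ‖u - v‖ ∂(smearMeasure G e σ)
      = ∫⁻ x, (∫⁻ u, radialLog r ‖u - v‖ * smearDensity G e x u) ∂σ :=
  lintegral_smearMeasure hG (F := fun u => radialLog r ‖u - v‖)
    (by fun_prop)

theorem pairInteraction_radialLog_smearMeasure (hG : MeasurableSet G) (r : ℝ)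
    [SFinite (smearMeasure G e σ)] :
    pairInteraction (fun p => radialLog r ‖p.1 - p.2‖) (smearMeasure G e σ)
      = ∫⁻ y, (∫⁻ x, (∫⁻ v, (∫⁻ u, radialLog r ‖u - v‖ * smearDensity G e x u)
        * smearDensity G e y v) ∂σ) ∂σ := by
  have hA := measurable_lintegral_radialLog_smearDensity (e := e) hG r
  have hn := measurable_smearDensity hG e
  unfold pairInteraction
  rw [lintegral_prod_symm _ (measurable_radialLog_norm_sub r).aemeasurable]
  simp only [lintegral_radialLog_smearMeasure hG r]
  rw [lintegral_smearMeasure hG hA.lintegral_prod_right']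
  refine lintegral_congr fun y => ?_
  rw [← lintegral_lintegral_swap]
  · refine lintegral_congr fun v => ?_
    have hA' := hA.comp (measurable_prodMk_left (x := v))
    exact (lintegral_mul_const _ hA').symm
  · exact (hA.mul (hn.comp (measurable_const.prodMk measurable_fst))).aemeasurable

theorem pairInteraction_radialLog_smearMeasure_le (hG : MeasurableSet G) {r : ℝ} (hr : 0 < r)
    (he : 0 < e) {D : Set ℂ} (hσ : σ Dᶜ = 0)
    (hx : ∀ x ∈ D, ∀ s ∈ Set.Ioo 0 e, arcMeasure G x s ≠ 0) :
    pairInteraction (fun p => radialLog r ‖p.1 - p.2‖) (smearMeasure G e σ)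
      ≤ ∫⁻ p, smearBound r e ‖p.1 - p.2‖ ∂(σ.prod σ) := by
  have hprob := isProbabilityMeasure_smearMeasure hG he hσ hx
  rw [pairInteraction_radialLog_smearMeasure hG,
    lintegral_prod_symm _ (measurable_smearBound r e).aemeasurable]
  have hD : ∀ᵐ x ∂σ, x ∈ D := by rw [ae_iff]; exact hσ
  refine lintegral_mono_ae ?_
  filter_upwards [hD] with y hy
  refine lintegral_mono_ae ?_
  filter_upwards [hD] with x hxD
  exact lintegral_radialLog_smearDensity_smearDensity_le hG hr he (hx x hxD) (hx y hy)

theorem lintegral_ofReal_smearMeasure_le (hG : MeasurableSet G) (he : 0 < e) {D : Set ℂ}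
    (hσ : σ Dᶜ = 0) (hx : ∀ x ∈ D, ∀ s ∈ Set.Ioo 0 e, arcMeasure G x s ≠ 0) {U : ℂ → ℝ}
    (hUc : Continuous U) {δ : ℝ} (hδ : ∀ x ∈ D, ∀ u ∈ G, ‖u - x‖ < e → U u ≤ U x + δ) :
    ∫⁻ z, ENNReal.ofReal (U z) ∂(smearMeasure G e σ)
      ≤ ∫⁻ z, ENNReal.ofReal (U z) ∂σ + ENNReal.ofReal δ := by
  rw [lintegral_smearMeasure hG (by fun_prop)]
  have hD : ∀ᵐ x ∂σ, x ∈ D := by rw [ae_iff]; exact hσ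
  have h2 : ∫⁻ z, ENNReal.ofReal (U z) ∂σ + ENNReal.ofReal δ
      = ∫⁻ z, (ENNReal.ofReal (U z) + ENNReal.ofReal δ) ∂σ := by
    rw [lintegral_add_right _ measurable_const]; simp
  rw [h2]
  refine lintegral_mono_ae ?_
  filter_upwards [hD] with x hxD
  calc _ ≤ ∫⁻ w, (ENNReal.ofReal (U x) + ENNReal.ofReal δ) * smearDensity G e x w := by
        refine lintegral_mono fun w => ?_
        by_cases hw : w ∈ G ∧ ‖w - x‖ < e
        · refine mul_le_mul_left ?_ _
          exact (ENNReal.ofReal_le_ofReal (hδ x hxD w hw.1 hw.2)).trans ENNReal.ofReal_add_le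
        · have : smearDensity G e x w = 0 := by
            rcases not_and_or.1 hw with h | h
            · exact smearDensity_eq_zero_of_notMem h
            · exact smearDensity_eq_zero_of_le (not_lt.1 h)
          rw [this, mul_zero, mul_zero]
    _ = _ := by
      rw [lintegral_const_mul, lintegral_smearDensity_eq_one hG he (hx x hxD), mul_one]
      exact (measurable_smearDensity hG e).comp (measurable_const.prodMk measurable_id)

/-- Dominated convergence: finite energy makes the diagonal null, and off the diagonal only the far
case of `smearBound` remains once e is small. -/
theorem tendsto_lintegral_smearBound {r : ℝ} (hr : 0 < r)
    (hfin : pairInteraction (fun p => radialLog r ‖p.1 - p.2‖) σ ≠ ⊤) :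
    Tendsto (fun e => ∫⁻ p, smearBound r e ‖p.1 - p.2‖ ∂(σ.prod σ)) (𝓝[>] 0)
      (𝓝 (pairInteraction (fun p => radialLog r ‖p.1 - p.2‖) σ)) := by
  have hR : Measurable fun p : ℂ × ℂ => radialLog r ‖p.1 - p.2‖ :=
    (continuous_radialLog r).measurable.comp (by fun_prop)
  refine tendsto_lintegral_filter_of_dominated_convergence
    (fun p => radialLog r ‖p.1 - p.2‖ + smearConst) ?_ ?_ ?_ ?_
  · exact Eventually.of_forall fun e => measurable_smearBound r e
  · filter_upwards [self_mem_nhdsWithin] with e he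
    exact ae_of_all _ fun p => smearBound_le hr he
  · rw [lintegral_add_left hR]
    refine ENNReal.add_ne_top.2 ⟨hfin, ?_⟩
    simpa using smearConst_ne_top
  · have h := ae_lt_top hR hfin
    filter_upwards [h] with p hp
    have hpos : 0 < ‖p.1 - p.2‖ := by
      rcases (norm_nonneg (p.1 - p.2)).eq_or_lt with h0 | h0
      · rw [← h0, radialLog_zero] at hp
        exact absurd hp (lt_irrefl _)
      · exact h0
    have h1 : Tendsto (fun e : ℝ => radialLog r (‖p.1 - p.2‖ - 2 * e)) (𝓝[>] 0)
        (𝓝 (radialLog r ‖p.1 - p.2‖)) := by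
      have : Continuous fun e : ℝ => radialLog r (‖p.1 - p.2‖ - 2 * e) :=
        (continuous_radialLog r).comp (by fun_prop)
      have h2 := this.tendsto 0
      simp only [mul_zero, sub_zero] at h2
      exact h2.mono_left nhdsWithin_le_nhds
    refine h1.congr' ?_
    have h3 : ∀ᶠ e : ℝ in 𝓝[>] 0, e < ‖p.1 - p.2‖ / 4 :=
      nhdsWithin_le_nhds (Iio_mem_nhds (by positivity))
    filter_upwards [h3] with e he
    rw [smearBound, if_pos (by linarith)]

/-- The energies of absolutely continuous measures approximate those of all measures. -/
theorem exists_absolutelyContinuous_pairInteraction_lt {D : Set ℂ} (hDc : IsCompact D)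
    (hconn : IsConnected (interior D)) (hcl : closure (interior D) = D) {r : ℝ} (hr : 0 < r)
    (hD : ∀ z ∈ D, ∀ w ∈ D, r * ‖z - w‖ ≤ 1) {U : ℂ → ℝ} (hUc : Continuous U) (hU : ∀ z, 0 ≤ U z)
    (hσ : σ Dᶜ = 0) {a : ℝ≥0∞} (ha : pairInteraction (logKernel r U) σ < a) :
    ∃ μ : Measure ℂ, IsProbabilityMeasure μ ∧ μ Dᶜ = 0 ∧ μ ≪ volume ∧
      pairInteraction (logKernel r U) μ < a := by
  set G := interior D with hGdef
  have hGm : MeasurableSet G := isOpen_interior.measurableSet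
  obtain ⟨e₀, he₀, harc⟩ := exists_arcMeasure_ne_zero isOpen_interior hconn
  rw [hcl] at harc
  have hJ := pairInteraction_logKernel_eq hr hD hUc hU σ hσ
  set R := pairInteraction (fun p => radialLog r ‖p.1 - p.2‖) σ with hRdef
  set u := ∫⁻ z, ENNReal.ofReal (U z) ∂σ with hu
  rw [hJ] at ha
  have hRfin : R ≠ ⊤ := by
    intro h; rw [h] at ha; simp at ha
  have hufin : 2 * u ≠ ⊤ := by
    intro h; rw [h] at ha; simp at ha
  have hlim : Tendsto (fun e => ∫⁻ p, smearBound r e ‖p.1 - p.2‖ ∂(σ.prod σ) + 2 * (u + 0))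
      (𝓝[>] 0) (𝓝 (R + 2 * (u + 0))) := (tendsto_lintegral_smearBound hr hRfin).add_const _
  -- Part of the margin below a is reserved for the oscillation of U on the scale e, the rest for
  -- the logarithmic energy.
  obtain ⟨δ, hδ, hδa⟩ : ∃ δ : ℝ, 0 < δ ∧ R + 2 * (u + ENNReal.ofReal δ) < a := by
    have h1 : Tendsto (fun δ : ℝ => R + 2 * (u + ENNReal.ofReal δ)) (𝓝[>] 0)
        (𝓝 (R + 2 * (u + ENNReal.ofReal 0))) := by
      refine Tendsto.mono_left (Continuous.tendsto ?_ 0) nhdsWithin_le_nhds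
      refine continuous_const.add (ENNReal.continuous_const_mul (by norm_num) |>.comp ?_)
      exact continuous_const.add ENNReal.continuous_ofReal
    have h2 := h1.eventually_lt_const (u := a) (by simpa using ha)
    obtain ⟨δ, h3, h4⟩ := (h2.and self_mem_nhdsWithin).exists
    exact ⟨δ, h4, h3⟩
  have hlim2 : Tendsto (fun e => ∫⁻ p, smearBound r e ‖p.1 - p.2‖ ∂(σ.prod σ)
      + 2 * (u + ENNReal.ofReal δ)) (𝓝[>] 0) (𝓝 (R + 2 * (u + ENNReal.ofReal δ))) :=
    (tendsto_lintegral_smearBound hr hRfin).add_const _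
  have huc : UniformContinuousOn U D := hDc.uniformContinuousOn_of_continuous hUc.continuousOn
  obtain ⟨e₁, he₁, hUC⟩ := Metric.uniformContinuousOn_iff.1 huc δ hδ
  have hev : ∀ᶠ e : ℝ in 𝓝[>] 0, e < e₀ ∧ e < e₁ :=
    ((eventually_lt_nhds he₀).and (eventually_lt_nhds he₁)).filter_mono nhdsWithin_le_nhds
  have hpos : ∀ᶠ e : ℝ in 𝓝[>] 0, e ∈ Set.Ioi 0 := self_mem_nhdsWithin
  obtain ⟨e, ⟨hlt, he, hee₀, hee₁⟩⟩ := ((hlim2.eventually_lt_const hδa).and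
    (hpos.and hev)).exists
  have he' : (0 : ℝ) < e := he
  have hx : ∀ x ∈ D, ∀ s ∈ Set.Ioo 0 e, arcMeasure G x s ≠ 0 := fun x hx s hs =>
    harc x hx s ⟨hs.1, hs.2.trans hee₀⟩
  have hprob := isProbabilityMeasure_smearMeasure hGm he' hσ hx
  have hsupp : smearMeasure G e σ Dᶜ = 0 :=
    measure_mono_null (Set.compl_subset_compl.2 interior_subset) (smearMeasure_compl hGm)
  refine ⟨smearMeasure G e σ, hprob, hsupp, smearMeasure_absolutelyContinuous, ?_⟩
  rw [pairInteraction_logKernel_eq hr hD hUc hU _ hsupp]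
  refine lt_of_le_of_lt (add_le_add (pairInteraction_radialLog_smearMeasure_le hGm hr he' hσ hx)
    (mul_le_mul_right (lintegral_ofReal_smearMeasure_le hGm he' hσ hx hUc (δ := δ) ?_) _)) hlt
  intro x hxD w hw hwx
  have h5 := hUC w (interior_subset hw) x hxD (by rw [dist_eq_norm]; linarith)
  rw [Real.dist_eq] at h5
  linarith [le_abs_self (U w - U x)]

/-- There is a measure of finite energy. -/
theorem exists_pairInteraction_lt_top {D : Set ℂ} (hDc : IsCompact D)
    (hconn : IsConnected (interior D)) (hcl : closure (interior D) = D) {r : ℝ} (hr : 0 < r)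
    (hD : ∀ z ∈ D, ∀ w ∈ D, r * ‖z - w‖ ≤ 1) {U : ℂ → ℝ} (hUc : Continuous U) (hU : ∀ z, 0 ≤ U z) :
    ∃ μ : Measure ℂ, IsProbabilityMeasure μ ∧ μ Dᶜ = 0 ∧
      pairInteraction (logKernel r U) μ ≠ ⊤ := by
  set G := interior D with hGdef
  have hGm : MeasurableSet G := isOpen_interior.measurableSet
  obtain ⟨e, he, harc⟩ := exists_arcMeasure_ne_zero isOpen_interior hconn
  rw [hcl] at harc
  obtain ⟨x, hxG⟩ := hconn.nonempty
  have hxD : x ∈ D := interior_subset hxG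
  have hσ : (Measure.dirac x) Dᶜ = 0 := by
    rw [Measure.dirac_apply' _ hDc.measurableSet.compl]
    simp [hxD]
  have hprob := isProbabilityMeasure_smearMeasure hGm he hσ harc
  have hsupp : smearMeasure G e (Measure.dirac x) Dᶜ = 0 :=
    measure_mono_null (Set.compl_subset_compl.2 interior_subset) (smearMeasure_compl hGm)
  refine ⟨_, hprob, hsupp, ?_⟩
  obtain ⟨M, hM⟩ := hDc.exists_bound_of_continuousOn hUc.continuousOn
  have hR : Measurable fun p : ℂ × ℂ => radialLog r ‖p.1 - p.2‖ :=
    (continuous_radialLog r).measurable.comp (by fun_prop)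
  rw [pairInteraction_logKernel_eq hr hD hUc hU _ hsupp]
  refine ENNReal.add_ne_top.2 ⟨?_, ENNReal.mul_ne_top (by norm_num) ?_⟩
  · unfold pairInteraction
    rw [lintegral_prod_symm _ hR.aemeasurable]
    -- A smeared point mass has a bounded logarithmic potential, hence finite energy.
    have hb : ∀ v, ∫⁻ u, radialLog r ‖u - v‖ ∂(smearMeasure G e (Measure.dirac x))
        ≤ ENNReal.ofReal (-Real.log (r * e)) + ∫⁻ a : ℝ, ENNReal.ofReal (-Real.log |a|) := by
      intro v
      have hA := measurable_lintegral_radialLog_smearDensity (e := e) hGm r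
      have hA' := hA.comp (measurable_prodMk_left (x := v))
      rw [lintegral_radialLog_smearMeasure hGm]
      refine (lintegral_dirac' x hA').trans_le ?_
      exact (lintegral_radialLog_smearDensity_le hGm hr (harc x hxD) v).trans
        (average_radialLog_le hr he _)
    refine ((lintegral_mono hb).trans_lt ?_).ne
    rw [lintegral_const, measure_univ, mul_one]
    exact ENNReal.add_lt_top.2 ⟨by simp, lintegral_neg_log_abs_ne_top.lt_top⟩
  · have hae : ∀ᵐ z ∂(smearMeasure G e (Measure.dirac x)),
        ENNReal.ofReal (U z) ≤ ENNReal.ofReal M := by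
      have : ∀ᵐ z ∂(smearMeasure G e (Measure.dirac x)), z ∈ D := by rw [ae_iff]; exact hsupp
      filter_upwards [this] with z hz
      exact ENNReal.ofReal_le_ofReal ((le_abs_self _).trans (hM z hz))
    refine ((lintegral_mono_ae hae).trans_lt ?_).ne
    simp

end SmearingEnergy

/-! ### Products and images of measures with density -/

section ProductDensity

theorem lintegral_pi_prod {X : Type*} [MeasurableSpace X] {N : ℕ} (μ : Fin N → Measure X)
    [∀ i, SigmaFinite (μ i)] {g : Fin N → X → ℝ≥0∞} (hg : ∀ i, Measurable (g i)) :
    ∫⁻ z, ∏ i, g i (z i) ∂(Measure.pi μ) = ∏ i, ∫⁻ x, g i x ∂(μ i) := by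
  induction N with
  | zero => simp
  | succ n ih =>
    have h := (measurePreserving_piFinSuccAbove μ 0).symm
    have hm : Measurable fun z : Fin (n + 1) → X => ∏ i, g i (z i) :=
      Finset.measurable_prod _ fun i _ => (hg i).comp (measurable_pi_apply i)
    rw [← h.lintegral_comp hm]
    simp only [Fin.prod_univ_succ]
    have e : ∀ p : X × (Fin n → X), g 0 (((MeasurableEquiv.piFinSuccAbove (fun _ => X) 0).symm p) 0)
        * ∏ i : Fin n, g i.succ (((MeasurableEquiv.piFinSuccAbove (fun _ => X) 0).symm p) i.succ)
        = g 0 p.1 * ∏ i : Fin n, g i.succ (p.2 i) := by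
      intro p
      simp [MeasurableEquiv.piFinSuccAbove, Fin.insertNthEquiv]
    simp_rw [e]
    have h2 := lintegral_prod_mul (μ := μ 0) (ν := Measure.pi fun i : Fin n => μ i.succ)
      (f := g 0) (g := fun z => ∏ i : Fin n, g i.succ (z i)) (hg 0).aemeasurable
      (Finset.measurable_prod _ fun i _ => (hg i.succ).comp (measurable_pi_apply i)).aemeasurable
    rw [ih (fun i => μ i.succ) (fun i => hg i.succ)] at h2
    exact h2

theorem pi_withDensity {X : Type*} [MeasurableSpace X] {N : ℕ} (μ : Measure X) [SigmaFinite μ]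
    {f : X → ℝ≥0∞} (hf : Measurable f) [SigmaFinite (μ.withDensity f)] :
    (Measure.pi fun _ : Fin N => μ.withDensity f)
      = (Measure.pi fun _ : Fin N => μ).withDensity fun z => ∏ i, f (z i) := by
  refine Measure.pi_eq fun s hs => ?_
  rw [withDensity_apply _ (.univ_pi hs), ← lintegral_indicator (.univ_pi hs)]
  have h : ∀ z : Fin N → X, (Set.univ.pi s).indicator (fun z => ∏ i, f (z i)) z
      = ∏ i, (s i).indicator f (z i) := by
    intro z
    by_cases hz : z ∈ Set.univ.pi s
    · rw [Set.indicator_of_mem hz]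
      exact Finset.prod_congr rfl fun i _ => (Set.indicator_of_mem (hz i trivial) f).symm
    · rw [Set.indicator_of_notMem hz]
      simp only [Set.mem_univ_pi, not_forall] at hz
      obtain ⟨i, hi⟩ := hz
      exact (Finset.prod_eq_zero (Finset.mem_univ i) (Set.indicator_of_notMem hi f)).symm
  simp_rw [h]
  rw [lintegral_pi_prod (fun _ => μ) fun i => hf.indicator (hs i)]
  exact Finset.prod_congr rfl fun i _ => by
    rw [lintegral_indicator (hs i), withDensity_apply _ (hs i)]

theorem map_withDensity_comp {X Y : Type*} [MeasurableSpace X] [MeasurableSpace Y] (μ : Measure X)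
    {g : X → Y} (hg : Measurable g) {f : Y → ℝ≥0∞} (hf : Measurable f) :
    (μ.withDensity fun x => f (g x)).map g = (μ.map g).withDensity f := by
  ext s hs
  rw [Measure.map_apply hg hs, withDensity_apply _ (hg hs), withDensity_apply _ hs,
    setLIntegral_map hs hf hg]

end ProductDensity

/-! ### Truncation to bounded density -/

section BoundedDensity

variable {X : Type*} [MeasurableSpace X]

theorem pairInteraction_smul (κ : X × X → ℝ≥0∞) (μ : Measure X) [SFinite μ] (c : ℝ≥0∞) :
    pairInteraction κ (c • μ) = c ^ 2 * pairInteraction κ μ := by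
  unfold pairInteraction
  rw [Measure.prod_smul_left, Measure.prod_smul_right, smul_smul, lintegral_smul_measure, sq,
    smul_eq_mul]

theorem pairInteraction_mono (κ : X × X → ℝ≥0∞) {μ ν : Measure X} [SFinite μ] [SFinite ν]
    (h : μ ≤ ν) : pairInteraction κ μ ≤ pairInteraction κ ν :=
  lintegral_mono' (Measure.prod_mono h h) le_rfl

/-- A measure of given energy can be replaced by one of bounded density. -/
theorem exists_le_smul_pairInteraction_lt {κ : X × X → ℝ≥0∞} {μ η : Measure X}
    [IsProbabilityMeasure μ] [IsFiniteMeasure η] (h : μ ≪ η) {a : ℝ≥0∞}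
    (ha : pairInteraction κ μ < a) :
    ∃ ν : Measure X, IsProbabilityMeasure ν ∧ (∃ n : NNReal, ν ≤ n • η) ∧
      pairInteraction κ ν < a := by
  have hm := Measure.measurable_rnDeriv μ η
  set A : ℕ → Set X := fun n => {x | μ.rnDeriv η x ≤ n} with hA
  have hAm : ∀ n, MeasurableSet (A n) := fun n => measurableSet_le hm measurable_const
  have hmono : Monotone A := fun m n hmn x hx =>
    (show μ.rnDeriv η x ≤ (m : ℝ≥0∞) from hx).trans (Nat.cast_le.2 hmn)
  have hlim : Tendsto (fun n => μ (A n)) atTop (𝓝 1) := by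
    have h1 := tendsto_measure_iUnion_atTop (μ := μ) hmono
    have h2 : μ (⋃ n, A n) = 1 := by
      rw [prob_compl_eq_zero_iff (MeasurableSet.iUnion hAm) |>.symm]
      have h3 := h.ae_le (Measure.rnDeriv_lt_top μ η)
      refine measure_mono_null ?_ h3
      intro x hx hx'
      apply hx
      obtain ⟨n, hn⟩ := ENNReal.exists_nat_gt (hx' : μ.rnDeriv η x < ⊤).ne
      exact Set.mem_iUnion.2 ⟨n, hn.le⟩
    rwa [h2] at h1
  -- Restricting to {density ≤ n} lowers the energy, and renormalizing multiplies it by μ(A n)⁻²,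
  -- which tends to 1.
  have hlim2 : Tendsto (fun n => (μ (A n))⁻¹ ^ 2 * pairInteraction κ μ) atTop
      (𝓝 (pairInteraction κ μ)) := by
    have h1 : Tendsto (fun n => (μ (A n))⁻¹ ^ 2) atTop (𝓝 1) := by
      have := ENNReal.Tendsto.pow (n := 2) (tendsto_inv_iff.2 hlim)
      simpa using this
    simpa using ENNReal.Tendsto.mul_const (b := pairInteraction κ μ) h1 (Or.inl one_ne_zero)
  obtain ⟨n, hn1, hn2⟩ := ((hlim2.eventually_lt_const ha).and
    (hlim.eventually_const_lt (u := 0) zero_lt_one)).exists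
  have hfin : μ (A n) ≠ ⊤ := measure_ne_top _ _
  refine ⟨(μ (A n))⁻¹ • μ.restrict (A n), ⟨?_⟩, ⟨((μ (A n))⁻¹ * n).toNNReal, ?_⟩, ?_⟩
  · simp [ENNReal.inv_mul_cancel hn2.ne' hfin]
  · have h1 : μ.restrict (A n) ≤ (n : ℝ≥0∞) • η := by
      refine Measure.le_intro fun s hs _ => ?_
      rw [Measure.restrict_apply hs]
      conv_lhs => rw [← Measure.withDensity_rnDeriv_eq μ η h]
      rw [withDensity_apply _ (hs.inter (hAm n))]
      calc _ ≤ ∫⁻ x in s ∩ A n, (n : ℝ≥0∞) ∂η := by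
            refine setLIntegral_mono measurable_const fun x hx => hx.2
        _ ≤ _ := by
          rw [setLIntegral_const, Measure.smul_apply, smul_eq_mul]
          gcongr
          exact Set.inter_subset_left
    rw [ENNReal.smul_def, ENNReal.coe_toNNReal
      (ENNReal.mul_ne_top (ENNReal.inv_ne_top.2 hn2.ne') (by simp)), mul_smul]
    exact Measure.le_iff.2 fun s _ => by
      simp only [Measure.smul_apply, smul_eq_mul]
      gcongr
      exact h1 s
  · rw [pairInteraction_smul]
    refine lt_of_le_of_lt ?_ hn1
    gcongr
    exact pairInteraction_mono κ Measure.restrict_le_self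

end BoundedDensity

/-! ### Passage between measures on D and measures on ℂ carried by D -/

section Subtype

variable {D : Set ℂ}

theorem map_val_comap (hD : MeasurableSet D) {μ : Measure ℂ} (h : μ Dᶜ = 0) :
    (μ.comap ((↑) : D → ℂ)).map (↑) = μ := by
  rw [map_comap_subtype_coe hD, Measure.restrict_eq_self_of_ae_mem]
  rw [ae_iff]; exact h

theorem isProbabilityMeasure_comap_val (hD : MeasurableSet D) {μ : Measure ℂ}
    [IsProbabilityMeasure μ] (h : μ Dᶜ = 0) :
    IsProbabilityMeasure (μ.comap ((↑) : D → ℂ)) := by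
  constructor
  have h1 := map_val_comap hD h
  have h2 : (μ.comap ((↑) : D → ℂ)).map ((↑) : D → ℂ) Set.univ = 1 := by
    rw [h1]; exact measure_univ
  rwa [Measure.map_apply measurable_subtype_coe .univ, Set.preimage_univ] at h2

theorem map_val_compl (hD : MeasurableSet D) (ν : Measure D) :
    ν.map ((↑) : D → ℂ) Dᶜ = 0 := by
  rw [Measure.map_apply measurable_subtype_coe hD.compl]
  simp

theorem pairInteraction_map_val {κ : ℂ × ℂ → ℝ≥0∞} (hκ : Measurable κ) (ν : Measure D)
    [SFinite ν] :
    pairInteraction κ (ν.map ((↑) : D → ℂ))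
      = pairInteraction (fun p : D × D => κ (p.1, p.2)) ν := by
  unfold pairInteraction
  rw [Measure.map_prod_map _ _ measurable_subtype_coe measurable_subtype_coe,
    lintegral_map hκ (by fun_prop)]
  rfl

end Subtype

/-! ### Limit of the Coulomb gas -/

section CoulombGas

/-- The unnormalized law of `N` eigenvalues with reference measure `η` and potential `W`. -/
noncomputable def coulombWeight (η : Measure ℂ) (W : ℂ → ℝ) (N : ℕ) : Measure (Fin N → ℂ) :=
  (Measure.pi fun _ : Fin N => η).withDensity fun z =>
    ENNReal.ofReal ((∏ x ∈ (Finset.univ : Finset (Fin N)).offDiag, ‖z x.1 - z x.2‖)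
      * Real.exp (-(N : ℝ) * ∑ i, W (z i)))

/-- Each index occurs in 2(N - 1) ordered pairs. This N - 1, rather than N, is the source of the
correction e^{-W} in the reference measure below. -/
theorem sum_offDiag_add {N : ℕ} (u : Fin N → ℝ) :
    ∑ x ∈ (Finset.univ : Finset (Fin N)).offDiag, (u x.1 + u x.2) = 2 * ((N : ℝ) - 1) * ∑ i, u i := by
  have h := Finset.diag_union_offDiag (s := (Finset.univ : Finset (Fin N)))
  have h2 : ∑ x : Fin N × Fin N, (u x.1 + u x.2) = 2 * N * ∑ i, u i := by
    rw [Fintype.sum_prod_type]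
    simp only [Finset.sum_add_distrib, Finset.sum_const, Finset.card_univ, Fintype.card_fin,
      nsmul_eq_mul, ← Finset.mul_sum]
    ring
  rw [← Finset.univ_product_univ, ← h, Finset.sum_union (Finset.disjoint_diag_offDiag _),
    Finset.sum_diag] at h2
  have h3 : ∑ i, (u i + u i) = 2 * ∑ i, u i := by
    rw [Finset.mul_sum]; exact Finset.sum_congr rfl fun i _ => by ring
  linarith

theorem boltzmann_logKernel {D : Set ℂ} {r : ℝ} (hr : 0 < r)
    (hD : ∀ z ∈ D, ∀ w ∈ D, r * ‖z - w‖ ≤ 1) {U : ℂ → ℝ} (hU : ∀ z, 0 ≤ U z) {N : ℕ}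
    {z : Fin N → ℂ} (hz : ∀ i, z i ∈ D) :
    boltzmann (logKernel r U) z = ENNReal.ofReal (r ^ (N * N - N)
      * (∏ x ∈ (Finset.univ : Finset (Fin N)).offDiag, ‖z x.1 - z x.2‖)
      * Real.exp (-(2 * ((N : ℝ) - 1) * ∑ i, U (z i)))) := by
  have h1 : ∀ s : Finset (Fin N × Fin N),
      EReal.exp (-((∑ x ∈ s, logKernel r U (z x.1, z x.2) : ℝ≥0∞) : EReal))
      = ∏ x ∈ s, ENNReal.ofReal (r * ‖z x.1 - z x.2‖ * Real.exp (-(U (z x.1) + U (z x.2)))) := by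
    intro s
    induction s using Finset.induction_on with
    | empty => simp
    | insert x s hx ih =>
      rw [Finset.sum_insert hx, Finset.prod_insert hx, ← ih, EReal.coe_ennreal_add,
        EReal.neg_add (Or.inl (EReal.coe_ennreal_ne_bot _)) (Or.inr (EReal.coe_ennreal_ne_bot _)),
        sub_eq_add_neg, EReal.exp_add,
        exp_neg_logKernel hU (p := (z x.1, z x.2)) (hD _ (hz _) _ (hz _))]
  rw [boltzmann, configEnergy, h1, ← ENNReal.ofReal_prod_of_nonneg (fun x _ => by positivity)]
  congr 1
  rw [Finset.prod_mul_distrib, Finset.prod_mul_distrib, Finset.prod_const, Finset.offDiag_card,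
    Finset.card_univ, Fintype.card_fin, ← Real.exp_sum, Finset.sum_neg_distrib,
    sum_offDiag_add fun i => U (z i)]

/-- The pair kernel produces (N - 1) ∑ W where the model has N ∑ W. The missing factor exp(-∑ W) is
moved into the reference measure. The scale r and the shift B only contribute a constant. -/
theorem coulombWeight_eq {D : Set ℂ} (hDm : MeasurableSet D) {r : ℝ} (hr : 0 < r)
    (hD : ∀ z ∈ D, ∀ w ∈ D, r * ‖z - w‖ ≤ 1) {U : ℂ → ℝ} (hUc : Continuous U) (hU : ∀ z, 0 ≤ U z)
    {W : ℂ → ℝ} (hW : Continuous W) {B : ℝ} (hUW : ∀ z ∈ D, U z = W z / 2 + B)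
    (η : Measure ℂ) [IsFiniteMeasure η] (hη : η Dᶜ = 0)
    [IsFiniteMeasure (η.withDensity fun z => ENNReal.ofReal (Real.exp (-W z)))] (N : ℕ) :
    ∃ c : ℝ≥0∞, c ≠ 0 ∧ c ≠ ⊤ ∧ (gibbsWeight (fun p : D × D => logKernel r U (p.1, p.2))
      ((η.withDensity fun z => ENNReal.ofReal (Real.exp (-W z))).comap ((↑) : D → ℂ)) N).map
        (fun z i => (z i : ℂ)) = c • coulombWeight η W N := by
  set η' := η.withDensity fun z => ENNReal.ofReal (Real.exp (-W z)) with hη'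
  have hη'0 : η' Dᶜ = 0 := withDensity_absolutelyContinuous _ _ hη
  have hWm := hW.measurable
  have hκ : Measurable (logKernel r U) := (continuous_logKernel hUc).measurable
  have hfin : IsFiniteMeasure (η'.comap ((↑) : D → ℂ)) := by
    constructor
    have := (MeasurableEmbedding.subtype_coe hDm).comap_apply η' Set.univ
    rw [this]; exact measure_lt_top _ _
  set c : ℝ := r ^ (N * N - N) * Real.exp (-(2 * ((N : ℝ) - 1) * N * B)) with hc
  refine ⟨ENNReal.ofReal c, by simp only [ne_eq, ENNReal.ofReal_eq_zero, not_le]; positivity,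
    by simp, ?_⟩
  have hb : ∀ z : Fin N → D, boltzmann (fun p : D × D => logKernel r U (p.1, p.2)) z
      = boltzmann (logKernel r U) (fun i => (z i : ℂ)) := fun z => rfl
  have hg : Measurable fun (z : Fin N → D) i => (z i : ℂ) := by fun_prop
  rw [gibbsWeight]
  simp_rw [hb]
  rw [map_withDensity_comp _ hg (measurable_boltzmann hκ N),
    Measure.pi_map_pi (fun i => measurable_subtype_coe.aemeasurable), map_val_comap hDm hη'0,
    hη', pi_withDensity _ (by fun_prop), ← withDensity_mul _ (by fun_prop) (measurable_boltzmann hκ N),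
    coulombWeight, ← withDensity_smul _ (by fun_prop)]
  refine withDensity_congr_ae ?_
  have hmem : ∀ᵐ z ∂(Measure.pi fun _ : Fin N => η), ∀ i, z i ∈ D := by
    rw [ae_all_iff]
    intro i
    have : ∀ᵐ x ∂η, x ∈ D := by rw [ae_iff]; exact hη
    exact (Measure.quasiMeasurePreserving_eval (μ := fun _ : Fin N => η) i).ae this
  filter_upwards [hmem] with z hz
  simp only [Pi.mul_apply, Pi.smul_apply, smul_eq_mul]
  rw [boltzmann_logKernel hr hD hU hz, ← ENNReal.ofReal_prod_of_nonneg (fun x _ => by positivity),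
    ← ENNReal.ofReal_mul (by positivity), ← ENNReal.ofReal_mul (by positivity), hc, ← Real.exp_sum]
  congr 1
  have e1 : ∑ i, U (z i) = (∑ i, W (z i)) / 2 + N * B := by
    rw [Finset.sum_congr rfl fun i _ => hUW _ (hz i), Finset.sum_add_distrib, Finset.sum_div]
    simp
  rw [e1, Finset.sum_neg_distrib]
  have e2 : Real.exp (-∑ i, W (z i))
      * Real.exp (-(2 * ((N : ℝ) - 1) * ((∑ i, W (z i)) / 2 + N * B)))
      = Real.exp (-(2 * ((N : ℝ) - 1) * N * B)) * Real.exp (-(N : ℝ) * ∑ i, W (z i)) := by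
    rw [← Real.exp_add, ← Real.exp_add]; congr 1; ring
  linear_combination (r ^ (N * N - N)
    * (∏ x ∈ (Finset.univ : Finset (Fin N)).offDiag, ‖z x.1 - z x.2‖)) * e2

theorem map_val_comap_map_val {D : Set ℂ} (hDm : MeasurableSet D) (ν : Measure D) :
    (ν.map ((↑) : D → ℂ)).comap ((↑) : D → ℂ) = ν :=
  (MeasurableEmbedding.subtype_coe hDm).comap_map ν

/-- Existence and uniqueness of the equilibrium measure, and convergence of the correlations of
the Coulomb gas to its powers. -/
theorem exists_equilibriumMeasure {D : Set ℂ} (hDc : IsCompact D)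
    (hconn : IsConnected (interior D)) (hcl : closure (interior D) = D) {W : ℂ → ℝ}
    (hW : Continuous W) :
    ∃ σ : Measure ℂ, IsEquilibriumMeasure D W σ ∧
      (∀ τ : Measure ℂ, IsEquilibriumMeasure D W τ → τ = σ) ∧
      ∀ (η : Measure ℂ) [IsFiniteMeasure η], η Dᶜ = 0 → volume.restrict D ≪ η →
        (∀ N, coulombWeight η W N Set.univ ≠ 0 ∧ coulombWeight η W N Set.univ ≠ ⊤) ∧
        ∀ (k : ℕ) (f : BoundedContinuousFunction (Fin k → ℂ) ℝ),
          Tendsto (fun N => ∫ z, tupleAverage f z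
            ∂((coulombWeight η W N Set.univ)⁻¹ • coulombWeight η W N)) atTop
            (𝓝 (∫ y, f y ∂(Measure.pi fun _ : Fin k => σ))) := by
  have hDm : MeasurableSet D := hDc.measurableSet
  obtain ⟨M, hM⟩ := hDc.exists_bound_of_continuousOn hW.continuousOn
  obtain ⟨C, hC⟩ := hDc.isBounded.exists_norm_le
  have hC0 : 0 ≤ C := by
    obtain ⟨x, hx⟩ := hconn.nonempty
    exact (norm_nonneg x).trans (hC x (interior_subset hx))
  -- 2C bounds the diameter of D. Adding 1 gives r ≤ 1 and keeps r defined when C = 0.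
  set r : ℝ := (2 * C + 1)⁻¹ with hrdef
  have hr : 0 < r := by positivity
  have hr1 : r ≤ 1 := inv_le_one_of_one_le₀ (by linarith)
  have hD : ∀ z ∈ D, ∀ w ∈ D, r * ‖z - w‖ ≤ 1 := by
    intro z hz w hw
    rw [hrdef, inv_mul_le_one₀ (by positivity)]
    linarith [norm_sub_le z w, hC z hz, hC w hw]
  -- On D the maximum is inactive because |W| ≤ M there. Off D it only provides a global nonnegative
  -- continuous function.
  set U : ℂ → ℝ := fun z => max (W z / 2 + M) 0 with hUdef
  have hUc : Continuous U := by fun_prop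
  have hU : ∀ z, 0 ≤ U z := fun z => le_max_right _ _
  have hM0 : 0 ≤ M := by
    obtain ⟨x, hx⟩ := hconn.nonempty
    exact (norm_nonneg _).trans (hM x (interior_subset hx))
  have hUW : ∀ z ∈ D, U z = W z / 2 + M := by
    intro z hz
    refine max_eq_left ?_
    have := (abs_le.1 (hM z hz)).1
    linarith
  have hUM : ∀ z ∈ D, U z ≤ 2 * M := by
    intro z hz
    rw [hUW z hz]
    have := (abs_le.1 (hM z hz)).2
    linarith
  have hκc := continuous_logKernel (r := r) hUc
  have hκm := hκc.measurable
  haveI : CompactSpace D := isCompact_iff_compactSpace.1 hDc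
  set κ : D × D → ℝ≥0∞ := fun p => logKernel r U (p.1, p.2) with hκ
  have hκDc : Continuous κ := hκc.comp (by fun_prop)
  obtain ⟨μ₀, hμ₀, hμ₀D, hμ₀f⟩ := exists_pairInteraction_lt_top hDc hconn hcl hr hD hUc hU
  have hne : Nonempty (ProbabilityMeasure D) :=
    ⟨⟨_, isProbabilityMeasure_comap_val hDm hμ₀D⟩⟩
  obtain ⟨σD, -, hmin⟩ := LowerSemicontinuousOn.exists_isMinOn (s := Set.univ)
    (Set.univ_nonempty (α := ProbabilityMeasure D)) isCompact_univ
    ((lowerSemicontinuous_pairInteraction hκDc).lowerSemicontinuousOn _)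
  -- The comparison includes measures with atoms, since absence of atoms is not a closed condition.
  -- The minimizer turns out to have none.
  have hmin' : ∀ μ : Measure ℂ, IsProbabilityMeasure μ → μ Dᶜ = 0 →
      pairInteraction κ (σD : Measure D) ≤ pairInteraction (logKernel r U) μ := by
    intro μ hμ hμD
    haveI := isProbabilityMeasure_comap_val hDm hμD
    have h1 := hmin (Set.mem_univ (⟨_, isProbabilityMeasure_comap_val hDm hμD⟩ :
      ProbabilityMeasure D))
    refine (show pairInteraction κ (σD : Measure D) ≤ pairInteraction κ
      (μ.comap ((↑) : D → ℂ)) from h1).trans_eq ?_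
    rw [← pairInteraction_map_val hκm, map_val_comap hDm hμD]
  set σ : Measure ℂ := (σD : Measure D).map ((↑) : D → ℂ) with hσ
  haveI hσp : IsProbabilityMeasure σ :=
    Measure.isProbabilityMeasure_map measurable_subtype_coe.aemeasurable
  have hσD : σ Dᶜ = 0 := map_val_compl hDm _
  have hJσ : pairInteraction (logKernel r U) σ = pairInteraction κ (σD : Measure D) :=
    pairInteraction_map_val hκm _
  have hfin : pairInteraction (logKernel r U) σ ≠ ⊤ := by
    rw [hJσ]; exact ((hmin' μ₀ hμ₀ hμ₀D).trans_lt hμ₀f.lt_top).ne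
  have huniq : ∀ τ : Measure ℂ, IsProbabilityMeasure τ → τ Dᶜ = 0 →
      pairInteraction (logKernel r U) τ ≤ pairInteraction (logKernel r U) σ → τ = σ := by
    intro τ hτ hτD hle
    refine (eq_of_pairInteraction_minimal hr hD hUc hU σ τ hσD hτD hfin hle ?_).symm
    rw [hJσ]
    refine hmin' _ ?_ ?_
    · constructor
      simp [midMeasure, ENNReal.inv_two_add_inv_two]
    · simp [midMeasure, hσD, hτD]
  have hiff := @isEquilibriumMeasure_iff D r hr hr1 hD U hUc hU W M hUW (2 * M) hUM
  have hadm : σ ∈ admissibleMeasures D :=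
    ⟨hσp, hσD, measure_singleton_eq_zero_of_pairInteraction_ne_top hUc hfin⟩
  refine ⟨σ, hiff.2 ⟨hadm, fun μ hμ => hJσ.trans_le (hmin' μ hμ.1 hμ.2.1)⟩, ?_, ?_⟩
  · intro τ hτ
    obtain ⟨h1, h2⟩ := hiff.1 hτ
    exact huniq τ h1.1 h1.2.1 (h2 σ hadm)
  intro η _ hη hvol
  set η' := η.withDensity fun z => ENNReal.ofReal (Real.exp (-W z)) with hη'
  have hWm := hW.measurable
  haveI : IsFiniteMeasure η' := by
    refine isFiniteMeasure_withDensity (ne_of_lt ?_)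
    have hb : ∀ᵐ z ∂η, ENNReal.ofReal (Real.exp (-W z)) ≤ ENNReal.ofReal (Real.exp M) := by
      have : ∀ᵐ x ∂η, x ∈ D := by rw [ae_iff]; exact hη
      filter_upwards [this] with z hz
      refine ENNReal.ofReal_le_ofReal (Real.exp_le_exp.2 ?_)
      have := (abs_le.1 (hM z hz)).1
      linarith
    refine (lintegral_mono_ae hb).trans_lt ?_
    rw [lintegral_const]
    exact ENNReal.mul_lt_top (by simp) (measure_lt_top _ _)
  -- The density e^{-W} is positive everywhere, so the modified reference measure still dominates
  -- Lebesgue measure on D.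
  have hvol' : volume.restrict D ≪ η' := hvol.trans <|
    withDensity_absolutelyContinuous' (by fun_prop) (ae_of_all _ fun z => by
      simp only [ne_eq, ENNReal.ofReal_eq_zero, not_le]; positivity)
  set ηD := η'.comap ((↑) : D → ℂ) with hηD
  have hemb := MeasurableEmbedding.subtype_coe hDm
  haveI : IsFiniteMeasure ηD := by
    constructor
    rw [hηD, hemb.comap_apply]; exact measure_lt_top _ _
  have H : IsGibbsLimit κ ηD σD := by
    refine ⟨hκDc, by rwa [← hJσ], ?_, ?_⟩
    · intro μ hμ
      have h1 := huniq ((μ : Measure D).map (↑))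
        (Measure.isProbabilityMeasure_map measurable_subtype_coe.aemeasurable)
        (map_val_compl hDm _) (by rw [pairInteraction_map_val hκm, hJσ]; exact hμ)
      have h2 : (μ : Measure D) = (σD : Measure D) := by
        rw [← map_val_comap_map_val hDm (μ : Measure D), h1, hσ, map_val_comap_map_val hDm]
      exact Subtype.ext h2
    · intro a ha
      rw [← hJσ] at ha
      obtain ⟨μ, hμ, hμD, hμv, hμa⟩ :=
        exists_absolutelyContinuous_pairInteraction_lt hDc hconn hcl hr hD hUc hU hσD ha
      haveI := isProbabilityMeasure_comap_val hDm hμD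
      refine exists_le_smul_pairInteraction_lt (μ := μ.comap ((↑) : D → ℂ)) ?_ ?_
      · intro s hs
        rw [hemb.comap_apply]
        rw [hηD, hemb.comap_apply] at hs
        have h2 := hvol' hs
        rw [Measure.restrict_apply₀'  hDm.nullMeasurableSet,
          Set.inter_eq_left.2 (Subtype.coe_image_subset D s)] at h2
        exact hμv h2
      · rwa [← pairInteraction_map_val hκm, map_val_comap hDm hμD]
  have hg : ∀ N : ℕ, Measurable fun (z : Fin N → D) i => (z i : ℂ) := fun N => by fun_prop
  have hkey : ∀ N, ∃ c : ℝ≥0∞, c ≠ 0 ∧ c ≠ ⊤ ∧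
      (gibbsWeight κ ηD N).map (fun z i => (z i : ℂ)) = c • coulombWeight η W N :=
    coulombWeight_eq hDm hr hD hUc hU hW hUW η hη
  have huniv : ∀ N, ∀ c : ℝ≥0∞,
      (gibbsWeight κ ηD N).map (fun z i => (z i : ℂ)) = c • coulombWeight η W N →
      gibbsWeight κ ηD N Set.univ = c * coulombWeight η W N Set.univ := by
    intro N c h
    have h1 := congrArg (fun μ : Measure (Fin N → ℂ) => μ Set.univ) h
    simpa [Measure.map_apply (hg N) .univ] using h1
  refine ⟨fun N => ?_, fun k f => ?_⟩
  · obtain ⟨c, hc0, hct, h⟩ := hkey N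
    have h1 := huniv N c h
    have h2 := H.gibbsWeight_univ_ne_zero N
    have h3 := gibbsWeight_univ_ne_top (κ := κ) (η := ηD) N
    rw [h1] at h2 h3
    refine ⟨right_ne_zero_of_mul h2, fun h4 => h3 ?_⟩
    rw [h4, ENNReal.mul_top hc0]
  · let g : C(Fin k → D, Fin k → ℂ) := ⟨fun z i => (z i : ℂ), by fun_prop⟩
    have hlim := H.tendsto_integral_tupleAverage (f.compContinuous g)
    have e1 : ∫ y, (f.compContinuous g) y ∂(Measure.pi fun _ : Fin k => (σD : Measure D))
        = ∫ y, f y ∂(Measure.pi fun _ : Fin k => σ) := by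
      rw [hσ, ← Measure.pi_map_pi (fun i => measurable_subtype_coe.aemeasurable),
        integral_map (hg k).aemeasurable f.continuous.aestronglyMeasurable]
      rfl
    rw [e1] at hlim
    refine hlim.congr fun N => ?_
    obtain ⟨c, hc0, hct, h⟩ := hkey N
    have h1 := huniv N c h
    have hf : Measurable f := f.continuous.measurable
    have e2 : ∫ z, tupleAverage (f.compContinuous g) z
        ∂((gibbsWeight κ ηD N Set.univ)⁻¹ • gibbsWeight κ ηD N)
        = ∫ z, tupleAverage f z ∂(((gibbsWeight κ ηD N Set.univ)⁻¹ • gibbsWeight κ ηD N).map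
          (fun z i => (z i : ℂ))) := by
      rw [integral_map (hg N).aemeasurable (measurable_tupleAverage hf).aestronglyMeasurable]
      rfl
    rw [e2, Measure.map_smul, h, h1, smul_smul, ENNReal.mul_inv (Or.inl hc0) (Or.inl hct), mul_comm,
      ← mul_assoc, ENNReal.mul_inv_cancel hc0 hct, one_mul]

end CoulombGas

/-! ### The area formula for Hausdorff measure -/

section AreaFormula

/-- On s the map f factors through g by a K-Lipschitz map; the estimate itself makes this factor
well defined. -/
theorem hausdorffMeasure_image_le_of_dist_le {X Y Z : Type*} [MetricSpace Y]
    [MeasurableSpace Y] [BorelSpace Y] [MetricSpace Z] [MeasurableSpace Z] [BorelSpace Z]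
    {f : X → Y} {g : X → Z} {s : Set X} {K : NNReal}
    (h : ∀ a ∈ s, ∀ b ∈ s, dist (f a) (f b) ≤ K * dist (g a) (g b)) {d : ℝ} (hd : 0 ≤ d) :
    Measure.hausdorffMeasure d (f '' s) ≤ (K : ℝ≥0∞) ^ d * Measure.hausdorffMeasure d (g '' s) := by
  rcases s.eq_empty_or_nonempty with rfl | ⟨x₀, hx₀⟩
  · simp
  haveI : Nonempty X := ⟨x₀⟩
  set k : Z → Y := fun u => f (Function.invFunOn g s u) with hk
  have hmem : ∀ u ∈ g '' s, Function.invFunOn g s u ∈ s := fun u hu => Function.invFunOn_mem hu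
  have heq : ∀ u ∈ g '' s, g (Function.invFunOn g s u) = u := fun u hu => Function.invFunOn_eq hu
  have hL : LipschitzOnWith K k (g '' s) := by
    refine LipschitzOnWith.of_dist_le_mul fun u hu v hv => ?_
    have := h _ (hmem u hu) _ (hmem v hv)
    rwa [heq u hu, heq v hv] at this
  have himg : k '' (g '' s) = f '' s := by
    rw [Set.image_image]
    refine Set.image_congr fun a ha => ?_
    have h1 := h _ (hmem (g a) ⟨a, ha, rfl⟩) a ha
    rw [heq (g a) ⟨a, ha, rfl⟩, dist_self, mul_zero] at h1
    exact dist_le_zero.1 h1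
  rw [← himg]
  exact hL.hausdorffMeasure_image_le hd

theorem ENNReal.le_of_forall_one_lt_le_pow_mul {a b : ℝ≥0∞} (n : ℕ)
    (h : ∀ K : NNReal, 1 < K → a ≤ (K : ℝ≥0∞) ^ n * b) : a ≤ b := by
  have h1 : Tendsto (fun K : NNReal => (K : ℝ≥0∞) ^ n * b) (𝓝[>] 1) (𝓝 (1 * b)) := by
    refine ENNReal.Tendsto.mul_const ?_ (Or.inl one_ne_zero)
    have : Tendsto (fun K : NNReal => (K : ℝ≥0∞) ^ n) (𝓝 1) (𝓝 (((1 : NNReal) : ℝ≥0∞) ^ n)) :=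
      ((ENNReal.continuous_pow n).comp ENNReal.continuous_coe).tendsto 1
    simp only [ENNReal.coe_one, one_pow] at this
    exact this.mono_left nhdsWithin_le_nhds
  rw [one_mul] at h1
  refine ge_of_tendsto h1 ?_
  filter_upwards [self_mem_nhdsWithin] with K hK using h K hK

variable {E V V' : Type*} [NormedAddCommGroup E] [NormedSpace ℝ E] [FiniteDimensional ℝ E]
  [MeasurableSpace E] [BorelSpace E] [NormedAddCommGroup V] [NormedSpace ℝ V] [MeasurableSpace V]
  [BorelSpace V] [NormedAddCommGroup V'] [NormedSpace ℝ V'] [MeasurableSpace V'] [BorelSpace V']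

/-- Hausdorff measure of full dimension on the range of e is a Haar measure; pulled back to E, it is
proportional to μ. The constant is never computed, as it cancels on normalization. -/
theorem exists_hausdorffMeasure_image_linearMap (μ : Measure E) [μ.IsAddHaarMeasure]
    (e : E →ₗ[ℝ] V') (he : Function.Injective e) :
    ∃ c : ℝ≥0∞, c ≠ 0 ∧ c ≠ ⊤ ∧ ∀ s : Set E,
      Measure.hausdorffMeasure (Module.finrank ℝ E : ℝ) (e '' s) = c * μ s := by
  let e₁ : E ≃ₗ[ℝ] LinearMap.range e := LinearEquiv.ofInjective e he
  let e₂ : E ≃L[ℝ] LinearMap.range e := e₁.toContinuousLinearEquiv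
  set H : Measure (LinearMap.range e) :=
    Measure.hausdorffMeasure (Module.finrank ℝ (LinearMap.range e) : ℝ) with hH
  haveI h1 : (H.map e₂.symm).IsAddHaarMeasure := e₂.symm.isAddHaarMeasure_map H
  set c := Measure.addHaarScalarFactor (H.map e₂.symm) μ
  refine ⟨c, ?_, by simp, fun s => ?_⟩
  · simpa using (Measure.addHaarScalarFactor_pos_of_isAddHaarMeasure (H.map e₂.symm) μ).ne'
  · have h2 := congrArg (fun ν : Measure E => ν s)
      (Measure.isAddLeftInvariant_eq_smul (H.map e₂.symm) μ)
    simp only [Measure.smul_apply] at h2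
    have h3 : (H.map e₂.symm) s = H (e₂ '' s) := by
      have := (e₂.symm.toHomeomorph.toMeasurableEquiv).map_apply (μ := H) s
      refine (show (H.map e₂.symm) s = H (e₂.symm ⁻¹' s) from this).trans ?_
      rw [ContinuousLinearEquiv.image_eq_preimage_symm]
    have h4 : e '' s = ((↑) : LinearMap.range e → V') '' (e₂ '' s) := by
      rw [Set.image_image]; rfl
    have h5 : Module.finrank ℝ (LinearMap.range e) = Module.finrank ℝ E := e₁.finrank_eq.symm
    rw [h4, isometry_subtype_coe.hausdorffMeasure_image (Or.inl (by positivity)), ← h5]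
    rw [h3] at h2
    exact h2

/-- Strict differentiability makes the linearization error small against |a - b|, and injectivity of
L makes |a - b| comparable to |L(a - b)|. Only the norms of f' v and L v are compared, so f and L
may take values in different spaces. -/
theorem exists_nhds_dist_le {f : E → V} {f' : E →L[ℝ] V} {x : E} (hf : HasStrictFDerivAt f f' x)
    {L : E →ₗ[ℝ] V'} (hL : Function.Injective L) (h : ∀ v, ‖f' v‖ = ‖L v‖) {K : NNReal}
    (hK : 1 < K) : ∃ U ∈ 𝓝 x, ∀ a ∈ U, ∀ b ∈ U, dist (f a) (f b) ≤ K * dist (L a) (L b) ∧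
      dist (L a) (L b) ≤ K * dist (f a) (f b) := by
  obtain ⟨C, hC, hCL⟩ := (LinearMap.toContinuousLinearMap L).exists_antilipschitzWith
    (LinearMap.ker_eq_bot.2 hL)
  have hanti : ∀ v, ‖v‖ ≤ C * ‖L v‖ := fun v => by
    have := hCL.le_mul_dist v 0
    simpa using this
  have hK' : (1 : ℝ) < K := by exact_mod_cast hK
  have hC' : (0 : ℝ) < C := by exact_mod_cast hC
  -- Chosen so that 1 + η ≤ K and 1 - η = 1/K, which are the two sides of the comparison.
  set η : ℝ := (K - 1) / K with hη
  have hη0 : 0 < η := div_pos (by linarith) (by linarith)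
  have h1 := hf.isLittleO.def (c := η / C) (by positivity)
  rw [nhds_prod_eq] at h1
  obtain ⟨U, hU, hUU⟩ := Filter.eventually_prod_self_iff (r := fun a b =>
    ‖f a - f b - f' (a - b)‖ ≤ η / C * ‖a - b‖) |>.1 h1
  refine ⟨U, hU, fun a ha b hb => ?_⟩
  have h2 := hUU a ha b hb
  have h3 : ‖f a - f b - f' (a - b)‖ ≤ η * ‖L (a - b)‖ := by
    refine h2.trans ?_
    have := mul_le_mul_of_nonneg_left (hanti (a - b)) (by positivity : 0 ≤ η / C)
    refine this.trans_eq ?_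
    field_simp
  rw [dist_eq_norm, dist_eq_norm, ← map_sub]
  have h4 := norm_sub_norm_le (f a - f b) (f' (a - b))
  have h5 := norm_sub_norm_le (f' (a - b)) (f a - f b)
  rw [norm_sub_rev (f' (a - b))] at h5
  rw [h] at h4 h5
  have e1 : (K : ℝ) * η = K - 1 := by rw [hη]; field_simp
  have h6 := norm_nonneg (L (a - b))
  constructor
  · have : η ≤ K - 1 := by
      rw [← e1]; nlinarith
    nlinarith
  · have : ‖L (a - b)‖ - η * ‖L (a - b)‖ ≤ ‖f a - f b‖ := by linarith
    have h7 := mul_le_mul_of_nonneg_left this (by linarith : (0 : ℝ) ≤ K)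
    nlinarith

variable (μ : Measure E) [μ.IsAddHaarMeasure] {f : E → V} {f' : E → E →L[ℝ] V}
  {T : E → E →ₗ[ℝ] E} {e : E →ₗ[ℝ] V'} {s : Set E} {c : ℝ≥0∞}

/-- Near x, f distorts distances like the linear map e ∘ T x up to the factor K, which costs K^n in
Hausdorff measure. One more K pays for the variation of the determinant. -/
theorem exists_open_hausdorffMeasure_image_le (he : Function.Injective e)
    (hc : ∀ s : Set E, Measure.hausdorffMeasure (Module.finrank ℝ E : ℝ) (e '' s) = c * μ s)
    (hf' : ∀ x ∈ s, HasStrictFDerivAt f (f' x) x) (hT : ∀ x ∈ s, ∀ v, ‖f' x v‖ = ‖e (T x v)‖)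
    (hdet : ContinuousOn (fun x => LinearMap.det (T x)) s)
    (hne : ∀ x ∈ s, LinearMap.det (T x) ≠ 0) {K : NNReal} (hK : 1 < K) {x : E} (hx : x ∈ s) :
    ∃ U, IsOpen U ∧ x ∈ U ∧ ∀ B ⊆ U ∩ s, MeasurableSet B →
      Measure.hausdorffMeasure (Module.finrank ℝ E : ℝ) (f '' B)
        ≤ (K : ℝ≥0∞) ^ (Module.finrank ℝ E + 1)
          * ∫⁻ y in B, c * ENNReal.ofReal |LinearMap.det (T y)| ∂μ ∧
      ∫⁻ y in B, c * ENNReal.ofReal |LinearMap.det (T y)| ∂μ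
        ≤ (K : ℝ≥0∞) ^ (Module.finrank ℝ E + 1)
          * Measure.hausdorffMeasure (Module.finrank ℝ E : ℝ) (f '' B) := by
  set n := Module.finrank ℝ E with hn
  have hK' : (1 : ℝ) < K := by exact_mod_cast hK
  have hTi : Function.Injective (T x) := by
    rw [← LinearMap.ker_eq_bot]
    exact ((LinearEquiv.ofIsUnitDet (f := T x) (v := Module.finBasis ℝ E) (v' := Module.finBasis ℝ E)
      (by rw [LinearMap.det_toMatrix]; exact (hne x hx).isUnit)).ker)
  obtain ⟨U₁, hU₁, h1⟩ := exists_nhds_dist_le (hf' x hx) (L := e ∘ₗ T x) (he.comp hTi)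
    (hT x hx) hK
  have hpos : 0 < |LinearMap.det (T x)| := abs_pos.2 (hne x hx)
  have hcont : ContinuousWithinAt (fun x => |LinearMap.det (T x)|) s x := (hdet x hx).abs
  have h2 : ∀ᶠ y in 𝓝[s] x, |LinearMap.det (T x)| < K * |LinearMap.det (T y)| :=
    (hcont.const_mul (K : ℝ)).eventually_const_lt (by simp only; nlinarith)
  have h3 : ∀ᶠ y in 𝓝[s] x, |LinearMap.det (T y)| < K * |LinearMap.det (T x)| :=
    hcont.eventually_lt_const (by nlinarith)
  obtain ⟨U₂, hU₂, hxU₂, h23⟩ := mem_nhdsWithin.1 (h2.and h3)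
  refine ⟨interior U₁ ∩ U₂, isOpen_interior.inter hU₂, ⟨mem_interior_iff_mem_nhds.2 hU₁, hxU₂⟩,
    fun B hB hBm => ?_⟩
  set t : ℝ≥0∞ := ENNReal.ofReal |LinearMap.det (T x)| with ht
  have hL : Measure.hausdorffMeasure (n : ℝ) ((e ∘ₗ T x) '' B) = c * t * μ B := by
    rw [LinearMap.coe_comp, Set.image_comp, hc, Measure.addHaar_image_linearMap, mul_assoc]
  have hd : (0 : ℝ) ≤ n := by positivity
  have hB1 : ∀ a ∈ B, a ∈ U₁ := fun a ha => interior_subset (hB ha).1.1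
  have hA := hausdorffMeasure_image_le_of_dist_le (f := f) (g := e ∘ₗ T x) (s := B) (K := K)
    (fun a ha b hb => (h1 a (hB1 a ha) b (hB1 b hb)).1) hd
  have hA' := hausdorffMeasure_image_le_of_dist_le (f := e ∘ₗ T x) (g := f) (s := B) (K := K)
    (fun a ha b hb => (h1 a (hB1 a ha) b (hB1 b hb)).2) hd
  rw [hL, ENNReal.rpow_natCast] at hA hA'
  have hkt : ∀ y ∈ B, t ≤ K * ENNReal.ofReal |LinearMap.det (T y)| := fun y hy => by
    rw [← ENNReal.ofReal_coe_nnreal, ← ENNReal.ofReal_mul (by positivity)]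
    exact ENNReal.ofReal_le_ofReal (h23 ⟨(hB hy).1.2, (hB hy).2⟩).1.le
  have hkt' : ∀ y ∈ B, ENNReal.ofReal |LinearMap.det (T y)| ≤ K * t := fun y hy => by
    rw [← ENNReal.ofReal_coe_nnreal, ht, ← ENNReal.ofReal_mul (by positivity)]
    exact ENNReal.ofReal_le_ofReal (h23 ⟨(hB hy).1.2, (hB hy).2⟩).2.le
  constructor
  · refine hA.trans ?_
    rw [pow_succ, mul_assoc (_ ^ n)]
    refine mul_le_mul_right (α := ℝ≥0∞) ?_ _
    rw [← lintegral_const_mul' _ _ ENNReal.coe_ne_top, ← setLIntegral_const]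
    refine setLIntegral_mono' hBm fun y hy => ?_
    rw [mul_left_comm]
    gcongr
    exact hkt y hy
  · calc ∫⁻ y in B, c * ENNReal.ofReal |LinearMap.det (T y)| ∂μ
        ≤ ∫⁻ y in B, c * (K * t) ∂μ := by
          refine setLIntegral_mono' hBm fun y hy => ?_
          gcongr
          exact hkt' y hy
      _ = K * (c * t * μ B) := by rw [setLIntegral_const]; ring
      _ ≤ K * (K ^ n * _) := by gcongr
      _ = _ := by rw [pow_succ]; ring

/-- Countably many neighbourhoods with the local comparison are made disjoint. By injectivity both
sides add up over the pieces, and K → 1. -/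
theorem hausdorffMeasure_image_eq_lintegral (he : Function.Injective e)
    (hc : ∀ s : Set E, Measure.hausdorffMeasure (Module.finrank ℝ E : ℝ) (e '' s) = c * μ s)
    (hf' : ∀ x ∈ s, HasStrictFDerivAt f (f' x) x) (hT : ∀ x ∈ s, ∀ v, ‖f' x v‖ = ‖e (T x v)‖)
    (hdet : ContinuousOn (fun x => LinearMap.det (T x)) s)
    (hne : ∀ x ∈ s, LinearMap.det (T x) ≠ 0) (hs : MeasurableSet s) (hinj : Set.InjOn f s) :
    Measure.hausdorffMeasure (Module.finrank ℝ E : ℝ) (f '' s)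
      = ∫⁻ y in s, c * ENNReal.ofReal |LinearMap.det (T y)| ∂μ := by
  rcases s.eq_empty_or_nonempty with rfl | hne0
  · simp
  suffices h : ∀ K : NNReal, 1 < K →
      Measure.hausdorffMeasure (Module.finrank ℝ E : ℝ) (f '' s)
        ≤ (K : ℝ≥0∞) ^ (Module.finrank ℝ E + 1)
          * ∫⁻ y in s, c * ENNReal.ofReal |LinearMap.det (T y)| ∂μ ∧
      ∫⁻ y in s, c * ENNReal.ofReal |LinearMap.det (T y)| ∂μ
        ≤ (K : ℝ≥0∞) ^ (Module.finrank ℝ E + 1)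
          * Measure.hausdorffMeasure (Module.finrank ℝ E : ℝ) (f '' s) from
    le_antisymm (ENNReal.le_of_forall_one_lt_le_pow_mul _ fun K hK => (h K hK).1)
      (ENNReal.le_of_forall_one_lt_le_pow_mul _ fun K hK => (h K hK).2)
  intro K hK
  have hcont : ContinuousOn f s := fun x hx => (hf' x hx).continuousAt.continuousWithinAt
  choose! U hUo hxU hU using fun x hx =>
    exists_open_hausdorffMeasure_image_le μ he hc hf' hT hdet hne hK (x := x) hx
  obtain ⟨t, hts, htc, htU⟩ := TopologicalSpace.countable_cover_nhdsWithin (s := s) (f := U)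
    fun x hx => mem_nhdsWithin_of_mem_nhds ((hUo x hx).mem_nhds (hxU x hx))
  have htne : t.Nonempty := by
    obtain ⟨x, hx⟩ := hne0
    obtain ⟨y, hy, -⟩ := Set.mem_iUnion₂.1 (htU hx)
    exact ⟨y, hy⟩
  obtain ⟨g, rfl⟩ := htc.exists_eq_range htne
  have hgs : ∀ n, g n ∈ s := fun n => hts ⟨n, rfl⟩
  set A : ℕ → Set E := fun n => s ∩ disjointed (fun n => U (g n)) n with hA
  have hAm : ∀ n, MeasurableSet (A n) := fun n =>
    hs.inter (MeasurableSet.disjointed (fun n => (hUo _ (hgs n)).measurableSet) n)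
  have hAs : ∀ n, A n ⊆ s := fun n => Set.inter_subset_left
  have hAd : Pairwise (Function.onFun Disjoint A) := fun i j hij =>
    ((disjoint_disjointed _ hij).mono Set.inter_subset_right Set.inter_subset_right)
  have hAU : ⋃ n, A n = s := by
    rw [← Set.inter_iUnion, iUnion_disjointed, Set.inter_eq_left]
    intro x hx
    obtain ⟨_, ⟨n, rfl⟩, hy⟩ := Set.mem_iUnion₂.1 (htU hx)
    exact Set.mem_iUnion.2 ⟨n, hy⟩
  have e1 : Measure.hausdorffMeasure (Module.finrank ℝ E : ℝ) (f '' s)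
      = ∑' n, Measure.hausdorffMeasure (Module.finrank ℝ E : ℝ) (f '' A n) := by
    conv_lhs => rw [← hAU]
    rw [Set.image_iUnion]
    refine measure_iUnion (fun i j hij => ?_) fun n => ?_
    · exact Set.disjoint_image_image fun x hx y hy hxy =>
        Set.disjoint_left.1 (hAd hij) hx (hinj (hAs i hx) (hAs j hy) hxy ▸ hy)
    · exact (hAm n).image_of_continuousOn_injOn (hcont.mono (hAs n)) (hinj.mono (hAs n))
  have e2 : ∫⁻ y in s, c * ENNReal.ofReal |LinearMap.det (T y)| ∂μ
      = ∑' n, ∫⁻ y in A n, c * ENNReal.ofReal |LinearMap.det (T y)| ∂μ := by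
    conv_lhs => rw [← hAU]
    exact lintegral_iUnion hAm hAd _
  have hAB : ∀ n, A n ⊆ U (g n) ∩ s := fun n x hx => ⟨disjointed_subset (fun n => U (g n)) n hx.2, hx.1⟩
  rw [e1, e2, ← ENNReal.tsum_mul_left, ← ENNReal.tsum_mul_left]
  exact ⟨ENNReal.tsum_le_tsum fun n => (hU _ (hgs n) _ (hAB n) (hAm n)).1,
    ENNReal.tsum_le_tsum fun n => (hU _ (hgs n) _ (hAB n) (hAm n)).2⟩

/-- The area formula for an injective parametrization whose derivative has, up to the fixed linear
map `e`, the metric of the linear map `T`. -/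
theorem lintegral_hausdorffMeasure_image (he : Function.Injective e)
    (hc : ∀ s : Set E, Measure.hausdorffMeasure (Module.finrank ℝ E : ℝ) (e '' s) = c * μ s)
    (hfm : Measurable f)
    (hf' : ∀ x ∈ s, HasStrictFDerivAt f (f' x) x) (hT : ∀ x ∈ s, ∀ v, ‖f' x v‖ = ‖e (T x v)‖)
    (hdet : ContinuousOn (fun x => LinearMap.det (T x)) s)
    (hne : ∀ x ∈ s, LinearMap.det (T x) ≠ 0) (hs : MeasurableSet s) (hinj : Set.InjOn f s)
    {F : V → ℝ≥0∞} (hF : Measurable F) :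
    ∫⁻ y in f '' s, F y ∂(Measure.hausdorffMeasure (Module.finrank ℝ E : ℝ))
      = ∫⁻ x in s, c * ENNReal.ofReal |LinearMap.det (T x)| * F (f x) ∂μ := by
  have hg : AEMeasurable (fun x => c * ENNReal.ofReal |LinearMap.det (T x)|) (μ.restrict s) :=
    ((hdet.abs.aemeasurable hs).ennreal_ofReal).const_mul c
  have key : (Measure.hausdorffMeasure (Module.finrank ℝ E : ℝ)).restrict (f '' s)
      = ((μ.restrict s).withDensity fun x => c * ENNReal.ofReal |LinearMap.det (T x)|).map f := by
    ext B hB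
    rw [Measure.restrict_apply hB, Measure.map_apply hfm hB, withDensity_apply _ (hfm hB),
      Measure.restrict_restrict (hfm hB), Set.inter_comm, ← Set.image_inter_preimage,
      Set.inter_comm s]
    have hsub : f ⁻¹' B ∩ s ⊆ s := Set.inter_subset_right
    exact hausdorffMeasure_image_eq_lintegral μ he hc (fun x hx => hf' x (hsub hx))
      (fun x hx => hT x (hsub hx)) (hdet.mono hsub) (fun x hx => hne x (hsub hx))
      ((hfm hB).inter hs) (hinj.mono hsub)
  rw [key, lintegral_map hF hfm,
    lintegral_withDensity_eq_lintegral_mul₀ hg (g := fun x => F (f x)) (hF.comp hfm).aemeasurable]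
  rfl

/-- A C¹ map is locally Lipschitz, and countably many such neighbourhoods cover E. No injectivity is
needed, which is what makes degenerate coordinates negligible. -/
theorem hausdorffMeasure_image_eq_zero (hf : ContDiff ℝ 1 f) (hs : μ s = 0) :
    Measure.hausdorffMeasure (Module.finrank ℝ E : ℝ) (f '' s) = 0 := by
  have h0 : Measure.hausdorffMeasure (Module.finrank ℝ E : ℝ) s = 0 :=
    (Measure.isAddLeftInvariant_eq_smul (Measure.hausdorffMeasure (Module.finrank ℝ E : ℝ)) μ ▸
      by simp [hs] : (Measure.hausdorffMeasure (Module.finrank ℝ E : ℝ) : Measure E) s = 0)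
  have h1 : ∀ x : E, ∃ U ∈ 𝓝 x, ∃ K, LipschitzOnWith K f U := fun x => by
    obtain ⟨K, U, hU, h⟩ := hf.contDiffAt.exists_lipschitzOnWith (x := x)
    exact ⟨U, hU, K, h⟩
  choose U hU K hK using h1
  obtain ⟨t, htc, ht⟩ := TopologicalSpace.countable_cover_nhds hU
  have h2 : f '' s ⊆ ⋃ x ∈ t, f '' (s ∩ U x) := by
    rintro _ ⟨y, hy, rfl⟩
    have : y ∈ ⋃ x ∈ t, U x := ht ▸ Set.mem_univ y
    obtain ⟨x, hx, hyx⟩ := Set.mem_iUnion₂.1 this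
    exact Set.mem_iUnion₂.2 ⟨x, hx, y, ⟨hy, hyx⟩, rfl⟩
  refine measure_mono_null h2 ((measure_biUnion_null_iff htc).2 fun x _ => ?_)
  refine le_antisymm ?_ zero_le
  refine (((hK x).mono Set.inter_subset_right).hausdorffMeasure_image_le (by positivity)).trans ?_
  rw [measure_mono_null Set.inter_subset_left h0, mul_zero]

end AreaFormula

/-! ### Simultaneous singular value decomposition around a cycle -/

section NormalForm

theorem exists_orthonormalBasis_jointEigenvectors {E : Type*} [NormedAddCommGroup E]
    [InnerProductSpace ℂ E] [FiniteDimensional ℂ E] {n : ℕ} (hn : Module.finrank ℂ E = n)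
    {ι : Type*} [Finite ι] {T : ι → E →ₗ[ℂ] E} (hT : ∀ i, (T i).IsSymmetric)
    (hC : Pairwise (Function.onFun Commute T)) :
    ∃ (b : OrthonormalBasis (Fin n) ℂ E) (χ : Fin n → ι → ℂ), ∀ j i, T i (b j) = χ j i • b j := by
  classical
  have h1 := LinearMap.IsSymmetric.directSum_isInternal_of_pairwise_commute hT hC
  have h2 := LinearMap.IsSymmetric.orthogonalFamily_iInf_eigenspaces hT
  haveI := h1.submodule_iSupIndep.fintypeNeBotOfFiniteDimensional
  have h3 := DirectSum.isInternal_ne_bot_iff.2 h1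
  have h4 := h2.comp (γ := {i : ι → ℂ // (⨅ j, Module.End.eigenspace (T j) (i j)) ≠ ⊥})
    (f := (↑)) Subtype.val_injective
  refine ⟨h3.subordinateOrthonormalBasis hn h4,
    fun j => (h3.subordinateOrthonormalBasisIndex hn j h4).1, fun j i => ?_⟩
  have h5 := h3.subordinateOrthonormalBasis_subordinate hn j h4
  exact Module.End.mem_eigenspace_iff.1 ((Submodule.mem_iInf _).1 h5 i)

variable {N : ℕ}

theorem mem_unitaryGroup_of_conjTranspose_mul {U : Matrix (Fin N) (Fin N) ℂ} (h : Uᴴ * U = 1) :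
    U ∈ Matrix.unitaryGroup (Fin N) ℂ :=
  Matrix.mem_unitaryGroup_iff'.2 h

theorem conjTranspose_mul_of_mem_unitaryGroup {U : Matrix (Fin N) (Fin N) ℂ}
    (h : U ∈ Matrix.unitaryGroup (Fin N) ℂ) : Uᴴ * U = 1 :=
  Matrix.mem_unitaryGroup_iff'.1 h

theorem mul_conjTranspose_of_mem_unitaryGroup {U : Matrix (Fin N) (Fin N) ℂ}
    (h : U ∈ Matrix.unitaryGroup (Fin N) ℂ) : U * Uᴴ = 1 :=
  Matrix.mem_unitaryGroup_iff.1 h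

/-- A unitary matrix and a real diagonal matrix that commute can be diagonalized together. -/
theorem exists_joint_diagonalization {x : Fin N → ℝ} {Q : Matrix (Fin N) (Fin N) ℂ}
    (hQ : Q ∈ Matrix.unitaryGroup (Fin N) ℂ)
    (hc : Commute (Matrix.diagonal fun p => (x p : ℂ)) Q) :
    ∃ P ∈ Matrix.unitaryGroup (Fin N) ℂ, ∃ (τ : Fin N → Fin N) (w : Fin N → ℂ),
      (∀ p, ‖w p‖ = 1) ∧ Q * P = P * Matrix.diagonal w ∧
      ∀ p j, P p j ≠ 0 → x p = x (τ j) := by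
  have h1 := conjTranspose_mul_of_mem_unitaryGroup hQ
  have h2 := mul_conjTranspose_of_mem_unitaryGroup hQ
  set L : Matrix (Fin N) (Fin N) ℂ := Matrix.diagonal fun p => (x p : ℂ) with hL
  have hLh : Lᴴ = L := by
    rw [hL, Matrix.diagonal_conjTranspose]
    congr 1; funext p; simp
  have hc' : Commute L Qᴴ := by
    have := congrArg Matrix.conjTranspose hc.eq
    rw [Matrix.conjTranspose_mul, Matrix.conjTranspose_mul, hLh] at this
    exact this.symm
  have hQQ : Commute Q Qᴴ := by rw [Commute, SemiconjBy, h1, h2]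
  -- A normal matrix is diagonalized through its commuting Hermitian parts: Q is half of A 1 - i A
  -- 2.
  let A : Fin 3 → Matrix (Fin N) (Fin N) ℂ :=
    ![L, Q + Qᴴ, Complex.I • (Q - Qᴴ)]
  have hA : ∀ i, (A i).IsHermitian := by
    intro i
    fin_cases i
    · exact hLh
    · change (Q + Qᴴ)ᴴ = Q + Qᴴ
      rw [Matrix.conjTranspose_add, Matrix.conjTranspose_conjTranspose, add_comm]
    · change (Complex.I • (Q - Qᴴ))ᴴ = Complex.I • (Q - Qᴴ)
      rw [Matrix.conjTranspose_smul, Matrix.conjTranspose_sub, Matrix.conjTranspose_conjTranspose]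
      simp [smul_sub, neg_add_eq_sub]
  have hcomm : ∀ i j, Commute (A i) (A j) := by
    have c1 : Commute L (Q + Qᴴ) := hc.add_right hc'
    have c2 : Commute L (Complex.I • (Q - Qᴴ)) := (hc.sub_right hc').smul_right _
    have c3 : Commute (Q + Qᴴ) (Complex.I • (Q - Qᴴ)) :=
      (((Commute.refl Q).add_left hQQ.symm).sub_right (hQQ.add_left (Commute.refl _))).smul_right _
    intro i j
    fin_cases i <;> fin_cases j
    exacts [Commute.refl _, c1, c2, c1.symm, Commute.refl _, c3, c2.symm, c3.symm, Commute.refl _]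
  obtain ⟨b, χ, hb⟩ := exists_orthonormalBasis_jointEigenvectors
    (E := EuclideanSpace ℂ (Fin N)) (n := N) (by simp) (T := fun i => (A i).toEuclideanLin)
    (fun i => Matrix.isSymmetric_toEuclideanLin_iff.2 (hA i)) (fun i j _ => by
      have := congrArg Matrix.toEuclideanLin (hcomm i j).eq
      refine LinearMap.ext fun v => ?_
      have h := congrArg (fun B : Matrix (Fin N) (Fin N) ℂ => WithLp.toLp 2 (B *ᵥ v.ofLp))
        (hcomm i j).eq
      simpa [Matrix.toLpLin_apply, Matrix.mulVec_mulVec] using h)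
  set P : Matrix (Fin N) (Fin N) ℂ := Matrix.of fun p j => b j p with hP
  have hPu : Pᴴ * P = 1 := by
    ext j k
    have := orthonormal_iff_ite.1 b.orthonormal j k
    rw [EuclideanSpace.inner_eq_star_dotProduct] at this
    rw [Matrix.one_apply, ← this, Matrix.mul_apply, dotProduct]
    exact Finset.sum_congr rfl fun p _ => by simp [hP, mul_comm]
  have hvec : ∀ i j p, (A i * P) p j = χ j i * P p j := by
    intro i j p
    have := congrArg (fun v : EuclideanSpace ℂ (Fin N) => v p) (hb j i)
    simpa [Matrix.toLpLin_apply, Matrix.mulVec, dotProduct, Matrix.mul_apply, hP] using this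
  set w : Fin N → ℂ := fun j => (χ j 1 - Complex.I * χ j 2) / 2 with hw
  have hQP : Q * P = P * Matrix.diagonal w := by
    have e : Q = (2 : ℂ)⁻¹ • (A 1 - Complex.I • A 2) := by
      change Q = (2 : ℂ)⁻¹ • ((Q + Qᴴ) - Complex.I • (Complex.I • (Q - Qᴴ)))
      rw [smul_smul, Complex.I_mul_I]
      ext p q
      simp
      ring
    ext p j
    rw [e, Matrix.mul_diagonal, Matrix.smul_mul, Matrix.sub_mul, Matrix.smul_mul, Matrix.smul_apply,
      Matrix.sub_apply, Matrix.smul_apply, hvec, hvec, hw]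
    simp only [smul_eq_mul]
    ring
  have hnz : ∀ j, ∃ p, P p j ≠ 0 := by
    intro j
    by_contra! hcon
    have := congrFun (congrFun hPu j) j
    rw [Matrix.mul_apply, Finset.sum_eq_zero (fun p _ => by rw [hcon p, mul_zero])] at this
    simp at this
  -- τ j is a row in which column j is nonzero. Column j is an eigenvector of the diagonal matrix,
  -- so x is constant on its support and x (τ j) is its eigenvalue.
  choose τ hτ using hnz
  have hx : ∀ p j, P p j ≠ 0 → (x p : ℂ) = χ j 0 := by
    intro p j h
    have := hvec 0 j p
    change (L * P) p j = _ at this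
    rw [hL, Matrix.diagonal_mul] at this
    exact mul_right_cancel₀ h this
  refine ⟨P, mem_unitaryGroup_of_conjTranspose_mul hPu, τ, w, ?_, hQP, fun p j h => ?_⟩
  · intro j
    have e : (Matrix.diagonal w)ᴴ * Matrix.diagonal w = 1 := by
      have e1 : Matrix.diagonal w = Pᴴ * (Q * P) := by
        rw [hQP, ← Matrix.mul_assoc, hPu, Matrix.one_mul]
      have e2 := Matrix.mem_unitaryGroup_iff.1 (mem_unitaryGroup_of_conjTranspose_mul hPu)
      rw [Matrix.star_eq_conjTranspose] at e2
      rw [e1]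
      simp only [Matrix.conjTranspose_mul, Matrix.conjTranspose_conjTranspose]
      calc Pᴴ * Qᴴ * P * (Pᴴ * (Q * P)) = Pᴴ * (Qᴴ * ((P * Pᴴ) * (Q * P))) := by
            simp only [Matrix.mul_assoc]
        _ = Pᴴ * ((Qᴴ * Q) * P) := by rw [e2, Matrix.one_mul, Matrix.mul_assoc]
        _ = 1 := by rw [h1, Matrix.one_mul, hPu]
    have e3 := congrFun (congrFun e j) j
    rw [Matrix.diagonal_conjTranspose, Matrix.diagonal_mul_diagonal, Matrix.diagonal_apply_eq,
      Matrix.one_apply_eq] at e3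
    have e4 : Complex.normSq (w j) = 1 := by
      have : ((Complex.normSq (w j) : ℝ) : ℂ) = 1 := by
        rw [Complex.normSq_eq_conj_mul_self]; simpa using e3
      exact_mod_cast this
    rw [Complex.norm_def, e4, Real.sqrt_one]
  · have e1 := hx p j h
    have e2 := hx (τ j) j (hτ j)
    exact_mod_cast e1.trans e2.symm

/-- The polar decomposition of a normal matrix with diagonal modulus. -/
theorem exists_unitary_mul_diagonal_sqrt {B : Matrix (Fin N) (Fin N) ℂ} {d : Fin N → ℝ}
    (h1 : Bᴴ * B = Matrix.diagonal fun p => (d p : ℂ))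
    (h2 : B * Bᴴ = Matrix.diagonal fun p => (d p : ℂ)) :
    (∀ p, 0 ≤ d p) ∧ ∃ Q ∈ Matrix.unitaryGroup (Fin N) ℂ,
      B = Q * Matrix.diagonal (fun p => (Real.sqrt (d p) : ℂ)) ∧
      ∀ p q, Q p q ≠ 0 → d p = d q := by
  have hcol : ∀ q, ∑ p, Complex.normSq (B p q) = d q := by
    intro q
    have := congrFun (congrFun h1 q) q
    rw [Matrix.mul_apply, Matrix.diagonal_apply_eq] at this
    have h3 : ((∑ p, Complex.normSq (B p q) : ℝ) : ℂ) = d q := by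
      rw [← this, Complex.ofReal_sum]
      exact Finset.sum_congr rfl fun p _ => by
        rw [Complex.normSq_eq_conj_mul_self]; rfl
    exact_mod_cast h3
  have hd : ∀ q, 0 ≤ d q := fun q => by
    rw [← hcol q]; exact Finset.sum_nonneg fun p _ => Complex.normSq_nonneg _
  have hzero : ∀ q, d q = 0 → ∀ p, B p q = 0 := by
    intro q hq p
    have := hcol q
    rw [hq, Finset.sum_eq_zero_iff_of_nonneg fun p _ => Complex.normSq_nonneg _] at this
    exact Complex.normSq_eq_zero.1 (this p (Finset.mem_univ _))
  have hBd : ∀ p q, B p q ≠ 0 → d p = d q := by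
    intro p q hpq
    have e : (Matrix.diagonal fun p => (d p : ℂ)) * B = B * Matrix.diagonal fun p => (d p : ℂ) := by
      rw [← h2, Matrix.mul_assoc, h1, h2]
    have := congrFun (congrFun e p) q
    rw [Matrix.diagonal_mul, Matrix.mul_diagonal, mul_comm] at this
    exact_mod_cast mul_left_cancel₀ hpq this
  -- Columns of B with d q = 0 vanish and are replaced by standard basis vectors. The others are
  -- normalized. The two kinds are orthogonal because B preserves the eigenspaces of d.
  refine ⟨hd, Matrix.of fun p q => if d q = 0 then (if p = q then 1 else 0)
    else B p q / (Real.sqrt (d q) : ℂ), ?_, ?_, ?_⟩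
  · refine mem_unitaryGroup_of_conjTranspose_mul ?_
    ext q q'
    rw [Matrix.mul_apply]
    simp only [Matrix.conjTranspose_apply, Matrix.of_apply]
    by_cases hq : d q = 0 <;> by_cases hq' : d q' = 0
    · simp only [hq, hq', if_true, Matrix.one_apply]
      rw [Finset.sum_eq_single q (fun p _ hp => by simp [hp]) (by simp)]
      simp
    · have hne : q ≠ q' := fun h => hq' (h ▸ hq)
      have hB : B q q' = 0 := by
        by_contra h
        exact hq' ((hBd _ _ h).symm.trans hq)
      simp only [hq, hq', if_true, if_false, Matrix.one_apply_ne hne]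
      refine Finset.sum_eq_zero fun p _ => ?_
      by_cases hp : p = q
      · rw [hp, hB, zero_div, mul_zero]
      · simp [hp]
    · have hne : q ≠ q' := fun h => hq (h ▸ hq')
      have hB : B q' q = 0 := by
        by_contra h
        exact hq ((hBd _ _ h).symm.trans hq')
      simp only [hq, hq', if_true, if_false, Matrix.one_apply_ne hne]
      refine Finset.sum_eq_zero fun p _ => ?_
      by_cases hp : p = q'
      · rw [hp, hB, zero_div, star_zero, zero_mul]
      · simp [hp]
    · simp only [hq, hq', if_false]
      have e := congrFun (congrFun h1 q) q'
      rw [Matrix.mul_apply] at e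
      simp only [Matrix.conjTranspose_apply] at e
      have e2 : ∀ p, star (B p q / (Real.sqrt (d q) : ℂ)) * (B p q' / (Real.sqrt (d q') : ℂ))
          = (star (B p q) * B p q') / ((Real.sqrt (d q) : ℂ) * (Real.sqrt (d q') : ℂ)) := by
        intro p
        rw [star_div₀]
        simp only [RCLike.star_def, Complex.conj_ofReal]
        rw [div_mul_div_comm]
      rw [Finset.sum_congr rfl fun p _ => e2 p, ← Finset.sum_div, e]
      by_cases hqq : q = q'
      · subst hqq
        rw [Matrix.diagonal_apply_eq, Matrix.one_apply_eq, ← Complex.ofReal_mul,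
          Real.mul_self_sqrt (hd q), div_self (by exact_mod_cast hq)]
      · rw [Matrix.diagonal_apply_ne _ hqq, Matrix.one_apply_ne hqq, zero_div]
  · ext p q
    rw [Matrix.mul_diagonal, Matrix.of_apply]
    by_cases hq : d q = 0
    · simp [hq, hzero q hq p]
    · rw [if_neg hq, div_mul_cancel₀]
      exact_mod_cast (Real.sqrt_pos.2 ((hd q).lt_of_ne' hq)).ne'
  · intro p q
    rw [Matrix.of_apply]
    by_cases hq : d q = 0
    · rw [if_pos hq]
      intro h
      by_cases hpq : p = q
      · rw [hpq]
      · simp [hpq] at h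
    · rw [if_neg hq]
      intro h
      exact hBd _ _ fun h0 => h (by rw [h0, zero_div])

theorem charpoly_mul_add_scalar (A B : Matrix (Fin N) (Fin N) ℂ) (c : ℂ) :
    (A * B + Matrix.scalar (Fin N) c).charpoly = (B * A + Matrix.scalar (Fin N) c).charpoly := by
  have h : ∀ M : Matrix (Fin N) (Fin N) ℂ, M + Matrix.scalar (Fin N) c
      = M - Matrix.scalar (Fin N) (-c) := fun M => by rw [map_neg, sub_neg_eq_add]
  rw [h, h, Matrix.charpoly_sub_scalar, Matrix.charpoly_sub_scalar, Matrix.charpoly_mul_comm]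

theorem Fin.forall_of_add_one {m : ℕ} [NeZero m] {P : Fin m → Prop} (h0 : P 0)
    (h : ∀ i, P i → P (i + 1)) (i : Fin m) : P i := by
  have key : ∀ (j : ℕ) (hj : j < m), P ⟨j, hj⟩ := by
    intro j
    induction j with
    | zero => intro hj; exact h0
    | succ j ih =>
      intro hj
      have h1 := h _ (ih (by omega))
      have h2 : (⟨j, by omega⟩ : Fin m) + 1 = ⟨j + 1, hj⟩ := by
        apply Fin.ext
        rw [Fin.val_add_one_of_lt']
        simpa using hj
      rwa [h2] at h1
  exact key i.1 i.2

theorem Fin.val_add_one_cases {m : ℕ} [NeZero m] (i : Fin m) :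
    ((i.val + 1 < m) ∧ (i + 1).val = i.val + 1) ∨ (i.val + 1 = m ∧ (i + 1).val = 0) := by
  rcases Nat.lt_or_ge (i.val + 1) m with h | h
  · exact Or.inl ⟨h, Fin.val_add_one_of_lt' h⟩
  · have h1 : i.val + 1 = m := le_antisymm i.2 h
    refine Or.inr ⟨h1, ?_⟩
    rw [Fin.val_add]
    rcases Nat.lt_or_ge 1 m with h2 | h2
    · have : (1 : Fin m).val = 1 := by
        rw [Fin.val_one']; exact Nat.mod_eq_of_lt h2
      rw [this, h1, Nat.mod_self]
    · have : m = 1 := le_antisymm h2 (NeZero.pos m)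
      subst this
      simp

/-- The normal form of a cyclic family of matrices with scalar commutators. -/
theorem exists_cyclic_normalForm {m : ℕ} [NeZero m] {c : Fin m → ℝ}
    {M : Fin m → Matrix (Fin N) (Fin N) ℂ}
    (hM : ∀ i, M (i + 1) * (M (i + 1))ᴴ + Matrix.scalar (Fin N) (c (i + 1) : ℂ)
      = (M i)ᴴ * M i + Matrix.scalar (Fin N) (c i : ℂ)) :
    ∃ (U : Fin m → Matrix (Fin N) (Fin N) ℂ) (x : Fin N → ℝ) (t : Fin m → Fin N → ℂ),
      (∀ i, U i ∈ Matrix.unitaryGroup (Fin N) ℂ) ∧ (∀ i p, c i ≤ x p) ∧ (∀ i p, ‖t i p‖ = 1) ∧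
      ∀ i, M i = U i * Matrix.diagonal (fun p => (Real.sqrt (x p - c i) : ℂ) * t i p)
        * (U (i + 1))ᴴ := by
  set K : Fin m → Matrix (Fin N) (Fin N) ℂ :=
    fun i => M i * (M i)ᴴ + Matrix.scalar (Fin N) (c i : ℂ) with hK
  have hscal : ∀ r : ℝ, (Matrix.scalar (Fin N) (r : ℂ))ᴴ = Matrix.scalar (Fin N) (r : ℂ) := by
    intro r
    rw [Matrix.scalar_apply, Matrix.diagonal_conjTranspose]
    congr 1; funext p; simp
  have hKh : ∀ i, (K i).IsHermitian := by
    intro i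
    rw [Matrix.IsHermitian, hK]
    simp only [Matrix.conjTranspose_add, Matrix.conjTranspose_mul,
      Matrix.conjTranspose_conjTranspose, hscal]
  have hK1 : ∀ i, K (i + 1) = (M i)ᴴ * M i + Matrix.scalar (Fin N) (c i : ℂ) := hM
  -- The hypothesis identifies K (i+1) with the matrix obtained from K i by exchanging the factors M
  -- i and its adjoint, and AB and BA have the same characteristic polynomial.
  have hch : ∀ i, (K i).charpoly = (K 0).charpoly := by
    refine Fin.forall_of_add_one rfl fun i hi => ?_
    rw [hK1, charpoly_mul_add_scalar, ← hi]
  set x : Fin N → ℝ := (hKh 0).eigenvalues with hx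
  have hev : ∀ i, (hKh i).eigenvalues = x := fun i =>
    ((hKh i).eigenvalues_eq_eigenvalues_iff (hKh 0)).2 (hch i)
  set V : Fin m → Matrix (Fin N) (Fin N) ℂ :=
    fun i => ((hKh i).eigenvectorUnitary : Matrix (Fin N) (Fin N) ℂ) with hV
  have hVu : ∀ i, V i ∈ Matrix.unitaryGroup (Fin N) ℂ := fun i => (hKh i).eigenvectorUnitary.2
  have hV1 : ∀ i, (V i)ᴴ * V i = 1 := fun i => conjTranspose_mul_of_mem_unitaryGroup (hVu i)
  have hV2 : ∀ i, V i * (V i)ᴴ = 1 := fun i => mul_conjTranspose_of_mem_unitaryGroup (hVu i)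
  have hdiag : ∀ i, (V i)ᴴ * K i * V i = Matrix.diagonal fun p => (x p : ℂ) := by
    intro i
    have h := (hKh i).spectral_theorem
    rw [Unitary.conjStarAlgAut_apply, hev i] at h
    have h' : K i = V i * (Matrix.diagonal fun p => (x p : ℂ)) * (V i)ᴴ := h
    rw [h']
    calc (V i)ᴴ * (V i * (Matrix.diagonal fun p => (x p : ℂ)) * (V i)ᴴ) * V i
        = ((V i)ᴴ * V i) * (Matrix.diagonal fun p => (x p : ℂ)) * ((V i)ᴴ * V i) := by
          simp only [Matrix.mul_assoc]
      _ = _ := by rw [hV1, Matrix.one_mul, Matrix.mul_one]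
  have hsub : ∀ i, (Matrix.diagonal fun p => ((x p - c i : ℝ) : ℂ))
      = (Matrix.diagonal fun p => (x p : ℂ)) - Matrix.scalar (Fin N) (c i : ℂ) := by
    intro i
    rw [Matrix.scalar_apply, Matrix.diagonal_sub]
    congr 1; funext p; simp
  -- In eigenbases of consecutive K's the block is normal with diagonal modulus squared x - c i,
  -- hence a unitary commuting with x times a diagonal matrix.
  set B : Fin m → Matrix (Fin N) (Fin N) ℂ := fun i => (V i)ᴴ * M i * V (i + 1) with hB
  have hB2 : ∀ i, B i * (B i)ᴴ = Matrix.diagonal fun p => ((x p - c i : ℝ) : ℂ) := by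
    intro i
    rw [hsub, ← hdiag i, hB, hK]
    simp only [Matrix.conjTranspose_mul, Matrix.conjTranspose_conjTranspose]
    calc (V i)ᴴ * M i * V (i + 1) * ((V (i + 1))ᴴ * ((M i)ᴴ * V i))
        = (V i)ᴴ * (M i * ((V (i + 1) * (V (i + 1))ᴴ) * ((M i)ᴴ * V i))) := by
          simp only [Matrix.mul_assoc]
      _ = (V i)ᴴ * (M i * (M i)ᴴ) * V i := by
        rw [hV2, Matrix.one_mul]; simp only [Matrix.mul_assoc]
      _ = _ := by
        rw [Matrix.mul_add, Matrix.add_mul, ← (Matrix.scalar_commute (c i : ℂ) (Commute.all _) _).eq,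
          Matrix.mul_assoc (Matrix.scalar (Fin N) _), hV1, Matrix.mul_one, add_sub_cancel_right]
  have hB1 : ∀ i, (B i)ᴴ * B i = Matrix.diagonal fun p => ((x p - c i : ℝ) : ℂ) := by
    intro i
    rw [hsub, ← hdiag (i + 1), hK1, hB]
    simp only [Matrix.conjTranspose_mul, Matrix.conjTranspose_conjTranspose]
    calc (V (i + 1))ᴴ * ((M i)ᴴ * V i) * ((V i)ᴴ * M i * V (i + 1))
        = (V (i + 1))ᴴ * ((M i)ᴴ * ((V i * (V i)ᴴ) * (M i * V (i + 1)))) := by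
          simp only [Matrix.mul_assoc]
      _ = (V (i + 1))ᴴ * ((M i)ᴴ * M i) * V (i + 1) := by
        rw [hV2, Matrix.one_mul]; simp only [Matrix.mul_assoc]
      _ = _ := by
        rw [Matrix.mul_add, Matrix.add_mul, ← (Matrix.scalar_commute (c i : ℂ) (Commute.all _) _).eq,
          Matrix.mul_assoc (Matrix.scalar (Fin N) _), hV1, Matrix.mul_one, add_sub_cancel_right]
  choose hpos Q hQu hBQ hQx using fun i => exists_unitary_mul_diagonal_sqrt (hB1 i) (hB2 i)
  have hQx' : ∀ i p q, Q i p q ≠ 0 → x p = x q := fun i p q h => by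
    have := hQx i p q h; linarith
  -- partial products of the unitary factors
  let G : ℕ → Matrix (Fin N) (Fin N) ℂ := fun j =>
    Nat.rec 1 (fun j g => g * Q (Fin.ofNat m j)) j
  have hG0 : G 0 = 1 := rfl
  have hGs : ∀ j, G (j + 1) = G j * Q (Fin.ofNat m j) := fun j => rfl
  have hGu : ∀ j, G j ∈ Matrix.unitaryGroup (Fin N) ℂ := by
    intro j
    induction j with
    | zero => exact one_mem _
    | succ j ih => exact mul_mem ih (hQu _)
  have hGx : ∀ j p q, G j p q ≠ 0 → x p = x q := by
    intro j
    induction j with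
    | zero =>
      intro p q h
      rw [hG0] at h
      by_cases hpq : p = q
      · rw [hpq]
      · exact absurd (Matrix.one_apply_ne hpq) h
    | succ j ih =>
      intro p q h
      rw [hGs, Matrix.mul_apply] at h
      obtain ⟨r, -, hr⟩ := Finset.exists_ne_zero_of_sum_ne_zero h
      exact (ih p r (left_ne_zero_of_mul hr)).trans (hQx' _ r q (right_ne_zero_of_mul hr))
  have hcomm : ∀ (A : Matrix (Fin N) (Fin N) ℂ), (∀ p q, A p q ≠ 0 → x p = x q) → ∀ f : ℝ → ℂ,
      (Matrix.diagonal fun p => f (x p)) * A = A * Matrix.diagonal fun p => f (x p) := by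
    intro A hA f
    ext p q
    rw [Matrix.diagonal_mul, Matrix.mul_diagonal, mul_comm]
    by_cases h : A p q = 0
    · rw [h, zero_mul, zero_mul]
    · rw [hA p q h]
  -- G m is the holonomy of the unitary factors once around the cycle, the only part that a change
  -- of frames cannot remove. It commutes with x, so both are diagonalized together.
  obtain ⟨P, hPu, τ, w, hw, hGP, hPτ⟩ := exists_joint_diagonalization (x := x) (hGu m)
    (hcomm _ (hGx m) fun r => (r : ℂ))
  have hP1 := conjTranspose_mul_of_mem_unitaryGroup hPu
  have hP2 := mul_conjTranspose_of_mem_unitaryGroup hPu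
  have hG1 : ∀ j, (G j)ᴴ * G j = 1 := fun j => conjTranspose_mul_of_mem_unitaryGroup (hGu j)
  have hG2 : ∀ j, G j * (G j)ᴴ = 1 := fun j => mul_conjTranspose_of_mem_unitaryGroup (hGu j)
  have hPD : ∀ f : ℝ → ℂ, (Matrix.diagonal fun p => f (x p)) * P
      = P * Matrix.diagonal fun j => f (x (τ j)) := by
    intro f
    ext p j
    rw [Matrix.diagonal_mul, Matrix.mul_diagonal, mul_comm]
    by_cases h : P p j = 0
    · rw [h, zero_mul, zero_mul]
    · rw [hPτ p j h]
  have hstar : ∀ A ∈ Matrix.unitaryGroup (Fin N) ℂ, Aᴴ ∈ Matrix.unitaryGroup (Fin N) ℂ :=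
    fun A hA => by
      rw [← Matrix.star_eq_conjTranspose]
      exact Unitary.star_mem hA
  -- Transporting the frames by G makes every block diagonal without phases except the last one,
  -- which closes the cycle and carries the eigenvalues w of the holonomy.
  refine ⟨fun i => V i * ((G i.val)ᴴ * P), fun j => x (τ j),
    fun i p => if i.val + 1 = m then w p else 1,
    fun i => mul_mem (hVu i) (mul_mem (hstar _ (hGu _)) hPu), fun i p => by linarith [hpos i (τ p)],
    fun i p => ?_, fun i => ?_⟩
  · dsimp only
    split_ifs
    · exact hw p
    · exact norm_one
  · have hMB : M i = V i * B i * (V (i + 1))ᴴ := by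
      rw [hB]
      calc M i = (V i * (V i)ᴴ) * M i * (V (i + 1) * (V (i + 1))ᴴ) := by
            rw [hV2, hV2, Matrix.one_mul, Matrix.mul_one]
        _ = _ := by simp only [Matrix.mul_assoc]
    have hofNat : Fin.ofNat m i.val = i := by
      apply Fin.ext; simp [Fin.ofNat, Nat.mod_eq_of_lt i.2]
    set S : Matrix (Fin N) (Fin N) ℂ :=
      Matrix.diagonal fun p => (Real.sqrt (x p - c i) : ℂ) with hS
    have hBG : B i = (G i.val)ᴴ * S * G (i.val + 1) := by
      have e1 : S * G (i.val + 1) = G (i.val + 1) * S :=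
        hcomm (G (i.val + 1)) (hGx (i.val + 1)) fun r => (Real.sqrt (r - c i) : ℂ)
      rw [Matrix.mul_assoc, e1, hGs, hofNat, hBQ i, ← hS]
      simp only [← Matrix.mul_assoc]
      rw [hG1, Matrix.one_mul]
    have hlast : G (i.val + 1) = P * Matrix.diagonal (fun p => if i.val + 1 = m then w p else 1)
        * Pᴴ * G (i + 1).val := by
      rcases Fin.val_add_one_cases i with ⟨h1, h2⟩ | ⟨h1, h2⟩
      · have h3 : ¬ i.val + 1 = m := h1.ne
        simp only [h3, if_false, Matrix.diagonal_one, Matrix.mul_one, hP2, h2, Matrix.one_mul]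
      · simp only [h1, if_true, h2, hG0, Matrix.mul_one]
        rw [← hGP, Matrix.mul_assoc, hP2, Matrix.mul_one]
    have hSP : S * P = P * Matrix.diagonal fun j => (Real.sqrt (x (τ j) - c i) : ℂ) :=
      hPD fun r => (Real.sqrt (r - c i) : ℂ)
    rw [hMB, hBG, hlast]
    simp only [Matrix.conjTranspose_mul, Matrix.conjTranspose_conjTranspose]
    rw [← Matrix.diagonal_mul_diagonal]
    simp only [Matrix.mul_assoc]
    rw [← Matrix.mul_assoc S P, hSP]
    simp only [Matrix.mul_assoc]

end NormalForm

/-! ### Exponential coordinates on unitary matrices modulo diagonal phases -/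

section SkewExp

open scoped Matrix.Norms.Operator

/-- The pairs `p < q` of indices. -/
abbrev IndexPairs (N : ℕ) : Type := {x : Fin N × Fin N // x.1 < x.2}

variable {N : ℕ}

/-- The antihermitian matrix with zero diagonal and the given entries above the diagonal. -/
noncomputable def skewMatrix (a : IndexPairs N → ℂ) : Matrix (Fin N) (Fin N) ℂ :=
  Matrix.of fun p q => if h : p < q then a ⟨(p, q), h⟩
    else if h : q < p then -(starRingEnd ℂ) (a ⟨(q, p), h⟩) else 0

/-- `skewMatrix` as a linear map. -/
noncomputable def skewMatrixL (N : ℕ) : (IndexPairs N → ℂ) →L[ℝ] Matrix (Fin N) (Fin N) ℂ :=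
  LinearMap.toContinuousLinearMap
    { toFun := skewMatrix
      map_add' := fun a b => by
        ext p q
        simp only [skewMatrix, Matrix.of_apply, Matrix.add_apply, Pi.add_apply, map_add]
        split_ifs <;> ring
      map_smul' := fun r a => by
        ext p q
        simp only [skewMatrix, Matrix.of_apply, Matrix.smul_apply, Pi.smul_apply, RingHom.id_apply]
        split_ifs <;> simp }

@[simp]
theorem skewMatrixL_apply (a : IndexPairs N → ℂ) : skewMatrixL N a = skewMatrix a := rfl

theorem skewMatrix_conjTranspose (a : IndexPairs N → ℂ) : (skewMatrix a)ᴴ = -skewMatrix a := by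
  ext p q
  simp only [skewMatrix, Matrix.conjTranspose_apply, Matrix.of_apply, Matrix.neg_apply]
  rcases lt_trichotomy p q with h | h | h
  · simp [h, h.not_gt]
  · simp [h]
  · simp [h, h.not_gt]

/-- The exponential of an antihermitian matrix with zero diagonal. -/
noncomputable def skewExp (a : IndexPairs N → ℂ) : Matrix (Fin N) (Fin N) ℂ :=
  NormedSpace.exp (skewMatrix a)

theorem skewMatrix_zero : skewMatrix (0 : IndexPairs N → ℂ) = 0 := (skewMatrixL N).map_zero

theorem skewExp_zero : skewExp (0 : IndexPairs N → ℂ) = 1 := by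
  rw [skewExp, skewMatrix_zero, NormedSpace.exp_zero]

theorem skewExp_mem (a : IndexPairs N → ℂ) : skewExp a ∈ Matrix.unitaryGroup (Fin N) ℂ := by
  rw [Matrix.mem_unitaryGroup_iff, Matrix.star_eq_conjTranspose, skewExp, ← Matrix.exp_conjTranspose,
    skewMatrix_conjTranspose, Matrix.exp_neg]
  exact Matrix.mul_nonsing_inv _ ((Matrix.isUnit_iff_isUnit_det _).1 (Matrix.isUnit_exp _))

theorem contDiff_exp_matrix : ContDiff ℝ 1 (NormedSpace.exp : Matrix (Fin N) (Fin N) ℂ → _) :=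
  contDiff_iff_contDiffAt.2 fun x => (NormedSpace.exp_analytic (𝕂 := ℝ) x).contDiffAt

theorem contDiff_skewExp : ContDiff ℝ 1 (skewExp : (IndexPairs N → ℂ) → _) :=
  contDiff_exp_matrix.comp (skewMatrixL N).contDiff

theorem hasStrictFDerivAt_skewExp_zero :
    HasStrictFDerivAt (skewExp : (IndexPairs N → ℂ) → _) (skewMatrixL N) 0 := by
  have h1 : HasStrictFDerivAt (NormedSpace.exp : Matrix (Fin N) (Fin N) ℂ → _)
      (1 : Matrix (Fin N) (Fin N) ℂ →L[ℝ] Matrix (Fin N) (Fin N) ℂ) (skewMatrixL N 0) := by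
    rw [map_zero]
    exact hasStrictFDerivAt_exp_zero
  exact h1.comp 0 (skewMatrixL N).hasStrictFDerivAt

/-- The left logarithmic derivative `U† dU` of `skewExp`. -/
noncomputable def skewExpForm (a b : IndexPairs N → ℂ) : Matrix (Fin N) (Fin N) ℂ :=
  (skewExp a)ᴴ * fderiv ℝ skewExp a b

theorem skewExpForm_zero (b : IndexPairs N → ℂ) : skewExpForm 0 b = skewMatrix b := by
  rw [skewExpForm, hasStrictFDerivAt_skewExp_zero.hasFDerivAt.fderiv, skewExp_zero,
    Matrix.conjTranspose_one, Matrix.one_mul]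
  rfl

theorem skewExpForm_add (a b b' : IndexPairs N → ℂ) :
    skewExpForm a (b + b') = skewExpForm a b + skewExpForm a b' := by
  rw [skewExpForm, map_add, Matrix.mul_add]; rfl

theorem skewExpForm_smul (a b : IndexPairs N → ℂ) (r : ℝ) :
    skewExpForm a (r • b) = r • skewExpForm a b := by
  rw [skewExpForm, map_smul, Matrix.mul_smul]; rfl

theorem continuous_skewExpForm (b : IndexPairs N → ℂ) : Continuous fun a => skewExpForm a b := by
  have h1 : Continuous fun a : IndexPairs N → ℂ => fderiv ℝ skewExp a b :=
    (contDiff_skewExp.continuous_fderiv one_ne_zero).clm_apply continuous_const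
  have h2 : Continuous (skewExp : (IndexPairs N → ℂ) → _) := contDiff_skewExp.continuous
  exact h2.matrix_conjTranspose.matrix_mul h1

theorem hasDerivAt_skewExp_line (a b : IndexPairs N → ℂ) :
    HasDerivAt (fun t : ℝ => skewExp (a + t • b)) (fderiv ℝ skewExp a b) 0 := by
  have h1 : HasDerivAt (fun t : ℝ => a + t • b) b 0 := by
    simpa using ((hasDerivAt_id (0 : ℝ)).smul_const b).const_add a
  have h2 : HasFDerivAt skewExp (fderiv ℝ skewExp a) (a + (0 : ℝ) • b) := by
    rw [zero_smul, add_zero]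
    exact (contDiff_skewExp.differentiable one_ne_zero a).hasFDerivAt
  exact h2.comp_hasDerivAt 0 h1

theorem fderiv_skewExp (a b : IndexPairs N → ℂ) :
    fderiv ℝ skewExp a b = skewExp a * skewExpForm a b := by
  rw [skewExpForm, ← Matrix.mul_assoc, mul_conjTranspose_of_mem_unitaryGroup (skewExp_mem a),
    Matrix.one_mul]

/-- The conjugate transpose as a real linear map. -/
noncomputable def conjTransposeL (N : ℕ) :
    Matrix (Fin N) (Fin N) ℂ →L[ℝ] Matrix (Fin N) (Fin N) ℂ :=
  LinearMap.toContinuousLinearMap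
    { toFun := Matrix.conjTranspose
      map_add' := Matrix.conjTranspose_add
      map_smul' := fun r A => by simp }

@[simp]
theorem conjTransposeL_apply (A : Matrix (Fin N) (Fin N) ℂ) : conjTransposeL N A = Aᴴ := rfl

theorem HasDerivAt.matrix_conjTranspose {f : ℝ → Matrix (Fin N) (Fin N) ℂ}
    {f' : Matrix (Fin N) (Fin N) ℂ} {t : ℝ} (h : HasDerivAt f f' t) :
    HasDerivAt (fun t => (f t)ᴴ) f'ᴴ t :=
  (conjTransposeL N).hasFDerivAt.comp_hasDerivAt t h

/-- Obtained by differentiating U†U = 1 along a line. -/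
theorem skewExpForm_conjTranspose (a b : IndexPairs N → ℂ) :
    (skewExpForm a b)ᴴ = -skewExpForm a b := by
  have h1 := hasDerivAt_skewExp_line a b
  have h2 := h1.matrix_conjTranspose.mul h1
  have h3 : (fun t : ℝ => (skewExp (a + t • b))ᴴ * skewExp (a + t • b)) = fun _ => 1 := by
    funext t
    exact conjTranspose_mul_of_mem_unitaryGroup (skewExp_mem _)
  have h4 : (fderiv ℝ skewExp a b)ᴴ * skewExp (a + (0 : ℝ) • b)
      + (skewExp (a + (0 : ℝ) • b))ᴴ * fderiv ℝ skewExp a b = 0 := by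
    have h5 : HasDerivAt (fun _ : ℝ => (1 : Matrix (Fin N) (Fin N) ℂ))
        ((fderiv ℝ skewExp a b)ᴴ * skewExp (a + (0 : ℝ) • b)
          + (skewExp (a + (0 : ℝ) • b))ᴴ * fderiv ℝ skewExp a b) 0 := by
      rw [← h3]; exact h2
    exact h5.unique (hasDerivAt_const _ _)
  rw [zero_smul, add_zero] at h4
  rw [skewExpForm, Matrix.conjTranspose_mul, Matrix.conjTranspose_conjTranspose]
  exact eq_neg_of_add_eq_zero_left h4

end SkewExp

/-! ### Local charts and finite covers of the unitary group -/

section UnitaryCharts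

open scoped Matrix.Norms.Operator

variable {N : ℕ}

/-- Diagonal unitary matrices. -/
noncomputable def phaseMatrix (θ : Fin N → ℝ) : Matrix (Fin N) (Fin N) ℂ :=
  Matrix.diagonal fun p => Complex.exp (θ p * Complex.I)

theorem phaseMatrix_mem (θ : Fin N → ℝ) : phaseMatrix θ ∈ Matrix.unitaryGroup (Fin N) ℂ := by
  refine mem_unitaryGroup_of_conjTranspose_mul ?_
  rw [phaseMatrix, Matrix.diagonal_conjTranspose, Matrix.diagonal_mul_diagonal, ← Matrix.diagonal_one]
  congr 1
  funext p
  have := Complex.normSq_eq_conj_mul_self (z := Complex.exp (θ p * Complex.I))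
  rw [Complex.normSq_eq_norm_sq, Complex.norm_exp_ofReal_mul_I] at this
  simpa using this.symm

/-- The product of three factors that fill a neighbourhood of the identity. -/
noncomputable def polarChart (v : (IndexPairs N → ℂ) × (Fin N → ℝ) ×
    selfAdjoint.submodule ℝ (Matrix (Fin N) (Fin N) ℂ)) : Matrix (Fin N) (Fin N) ℂ :=
  skewExp v.1 * phaseMatrix v.2.1 * (1 + (v.2.2 : Matrix (Fin N) (Fin N) ℂ))

/-- The diagonal matrix `i θ`. -/
noncomputable def phaseMatrixL (N : ℕ) : (Fin N → ℝ) →L[ℝ] Matrix (Fin N) (Fin N) ℂ :=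
  LinearMap.toContinuousLinearMap
    { toFun := fun θ => Matrix.diagonal fun p => (θ p : ℂ) * Complex.I
      map_add' := fun a b => by
        rw [Matrix.diagonal_add]; congr 1; funext p; simp [add_mul]
      map_smul' := fun r a => by
        rw [RingHom.id_apply, ← Matrix.diagonal_smul]; congr 1; funext p; simp [mul_assoc] }

theorem phaseMatrix_eq_exp (θ : Fin N → ℝ) :
    phaseMatrix θ = NormedSpace.exp (phaseMatrixL N θ) := by
  change _ = NormedSpace.exp (Matrix.diagonal fun p => (θ p : ℂ) * Complex.I)
  rw [Matrix.exp_diagonal, phaseMatrix]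
  congr 1
  funext p
  rw [Pi.coe_exp, Complex.exp_eq_exp_ℂ]

theorem hasStrictFDerivAt_phaseMatrix_zero :
    HasStrictFDerivAt (phaseMatrix : (Fin N → ℝ) → _) (phaseMatrixL N) 0 := by
  have h1 : HasStrictFDerivAt (NormedSpace.exp : Matrix (Fin N) (Fin N) ℂ → _)
      (1 : Matrix (Fin N) (Fin N) ℂ →L[ℝ] Matrix (Fin N) (Fin N) ℂ) (phaseMatrixL N 0) := by
    rw [map_zero]
    exact hasStrictFDerivAt_exp_zero
  have h2 := h1.comp 0 (phaseMatrixL N).hasStrictFDerivAt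
  refine h2.congr_of_eventuallyEq (Eventually.of_forall fun θ => ?_)
  exact (phaseMatrix_eq_exp θ).symm

theorem phaseMatrix_zero : phaseMatrix (0 : Fin N → ℝ) = 1 := by
  simp [phaseMatrix]

/-- The derivative of `polarChart` at the origin. -/
noncomputable def polarChartL (N : ℕ) : ((IndexPairs N → ℂ) × (Fin N → ℝ) ×
    selfAdjoint.submodule ℝ (Matrix (Fin N) (Fin N) ℂ)) →L[ℝ] Matrix (Fin N) (Fin N) ℂ :=
  (skewMatrixL N).comp (ContinuousLinearMap.fst ℝ _ _)
    + ((phaseMatrixL N).comp (ContinuousLinearMap.fst ℝ _ _)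
      + (Submodule.subtypeL _).comp (ContinuousLinearMap.snd ℝ _ _)).comp
        (ContinuousLinearMap.snd ℝ _ _)

theorem hasStrictFDerivAt_polarChart_zero :
    HasStrictFDerivAt (polarChart (N := N)) (polarChartL N) 0 := by
  have h1 : HasStrictFDerivAt (fun v : (IndexPairs N → ℂ) × (Fin N → ℝ) ×
      selfAdjoint.submodule ℝ (Matrix (Fin N) (Fin N) ℂ) => skewExp v.1)
      ((skewMatrixL N).comp (ContinuousLinearMap.fst ℝ _ _)) 0 :=
    HasStrictFDerivAt.comp (g := skewExp) (0 : (IndexPairs N → ℂ) × (Fin N → ℝ) ×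
      selfAdjoint.submodule ℝ (Matrix (Fin N) (Fin N) ℂ))
      hasStrictFDerivAt_skewExp_zero hasStrictFDerivAt_fst
  have h2 : HasStrictFDerivAt (fun v : (IndexPairs N → ℂ) × (Fin N → ℝ) ×
      selfAdjoint.submodule ℝ (Matrix (Fin N) (Fin N) ℂ) => phaseMatrix v.2.1)
      ((phaseMatrixL N).comp ((ContinuousLinearMap.fst ℝ _ _).comp (ContinuousLinearMap.snd ℝ _ _)))
      0 :=
    HasStrictFDerivAt.comp (g := phaseMatrix) (0 : (IndexPairs N → ℂ) × (Fin N → ℝ) ×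
      selfAdjoint.submodule ℝ (Matrix (Fin N) (Fin N) ℂ))
      hasStrictFDerivAt_phaseMatrix_zero
      (((ContinuousLinearMap.fst ℝ (Fin N → ℝ) (selfAdjoint.submodule ℝ
        (Matrix (Fin N) (Fin N) ℂ))).comp (ContinuousLinearMap.snd ℝ (IndexPairs N → ℂ)
        _)).hasStrictFDerivAt)
  have h3 : HasStrictFDerivAt (fun v : (IndexPairs N → ℂ) × (Fin N → ℝ) ×
      selfAdjoint.submodule ℝ (Matrix (Fin N) (Fin N) ℂ) =>
        1 + (v.2.2 : Matrix (Fin N) (Fin N) ℂ))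
      ((Submodule.subtypeL _).comp
        ((ContinuousLinearMap.snd ℝ _ _).comp (ContinuousLinearMap.snd ℝ _ _))) 0 :=
    HasStrictFDerivAt.const_add (1 : Matrix (Fin N) (Fin N) ℂ) (((Submodule.subtypeL
      (selfAdjoint.submodule ℝ (Matrix (Fin N) (Fin N) ℂ))).comp
        ((ContinuousLinearMap.snd ℝ (Fin N → ℝ) _).comp
          (ContinuousLinearMap.snd ℝ (IndexPairs N → ℂ) _))).hasStrictFDerivAt)
  have h := (h1.mul' h2).mul' h3
  refine HasStrictFDerivAt.congr_fderiv h (ContinuousLinearMap.ext fun v => ?_)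
  change skewExp 0 * phaseMatrix 0 * (v.2.2 : Matrix (Fin N) (Fin N) ℂ)
    + (skewExp 0 * phaseMatrixL N v.2.1 + skewMatrix v.1 * phaseMatrix 0)
      * (1 + ((0 : selfAdjoint.submodule ℝ (Matrix (Fin N) (Fin N) ℂ)) : Matrix (Fin N) (Fin N) ℂ))
    = skewMatrix v.1 + (phaseMatrixL N v.2.1 + (v.2.2 : Matrix (Fin N) (Fin N) ℂ))
  rw [skewExp_zero, phaseMatrix_zero, Submodule.coe_zero, add_zero, Matrix.mul_one, Matrix.mul_one,
    Matrix.one_mul, Matrix.one_mul, Matrix.mul_one]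
  abel

/-- Every matrix is uniquely Hermitian plus antihermitian, and the latter splits into an
off-diagonal part and an imaginary diagonal. The Hermitian factor makes the target a full matrix
space, so that the inverse function theorem applies directly. -/
theorem polarChartL_bijective (N : ℕ) : Function.Bijective (polarChartL N) := by
  have happ : ∀ v, polarChartL N v = skewMatrix v.1
      + ((Matrix.diagonal fun p => (v.2.1 p : ℂ) * Complex.I)
        + (v.2.2 : Matrix (Fin N) (Fin N) ℂ)) := fun v => rfl
  constructor
  · rw [injective_iff_map_eq_zero]
    rintro ⟨a, θ, P, hP⟩ h
    rw [happ] at h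
    have hP' : Pᴴ = P := hP
    have h1 := congrArg Matrix.conjTranspose h
    rw [Matrix.conjTranspose_add, Matrix.conjTranspose_add, skewMatrix_conjTranspose,
      Matrix.diagonal_conjTranspose, hP', Matrix.conjTranspose_zero] at h1
    have h2 : ∀ p q, P p q = 0 := by
      intro p q
      have e1 := congrFun (congrFun h p) q
      have e2 := congrFun (congrFun h1 p) q
      simp only [Matrix.add_apply, Matrix.neg_apply, Matrix.zero_apply, Matrix.diagonal_apply,
        Pi.star_apply] at e1 e2
      by_cases hpq : p = q
      · subst hpq
        simp at e1 e2
        linear_combination (e1 + e2) / 2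
      · simp [hpq] at e1 e2
        linear_combination (e1 + e2) / 2
    have hP0 : P = 0 := by ext p q; exact h2 p q
    subst hP0
    have h3 : ∀ p q, skewMatrix a p q
        + (Matrix.diagonal fun p => (θ p : ℂ) * Complex.I : Matrix _ _ ℂ) p q = 0 := by
      intro p q
      have := congrFun (congrFun h p) q
      simpa using this
    refine Prod.ext (funext fun x => ?_) (Prod.ext (funext fun p => ?_) rfl)
    · have := h3 x.1.1 x.1.2
      rw [Matrix.diagonal_apply_ne _ x.2.ne, add_zero, skewMatrix, Matrix.of_apply,
        dif_pos x.2] at this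
      exact this
    · have := h3 p p
      simpa [skewMatrix] using this
  · intro X
    have hskew : ∀ p q, (skewMatrix fun x : IndexPairs N => (X x.1.1 x.1.2 - star (X x.1.2 x.1.1)) / 2)
        p q = if p = q then 0 else (X p q - star (X q p)) / 2 := by
      intro p q
      rw [skewMatrix, Matrix.of_apply]
      rcases lt_trichotomy p q with h | h | h
      · simp [h, h.ne]
      · simp [h]
      · simp only [h.not_gt, h, h.ne', dif_pos, dif_neg, not_false_eq_true, if_false]
        simp only [RCLike.star_def, map_div₀, map_sub, RingHomCompTriple.comp_apply, RingHom.id_apply,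
          map_ofNat]
        ring
    refine ⟨⟨fun x => (X x.1.1 x.1.2 - star (X x.1.2 x.1.1)) / 2, fun p => (X p p).im,
      ⟨(2 : ℂ)⁻¹ • (X + Xᴴ), ?_⟩⟩, ?_⟩
    · change ((2 : ℂ)⁻¹ • (X + Xᴴ))ᴴ = _
      rw [Matrix.conjTranspose_smul, Matrix.conjTranspose_add, Matrix.conjTranspose_conjTranspose,
        add_comm]
      simp
    · rw [happ]
      ext p q
      simp only [Matrix.add_apply, hskew, Matrix.diagonal_apply, Matrix.smul_apply,
        Matrix.conjTranspose_apply, smul_eq_mul]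
      by_cases hpq : p = q
      · subst hpq
        simp only [if_true]
        apply Complex.ext
        · simp; ring
        · simp
      · simp only [hpq, if_false]
        ring

theorem isCompact_setOf_unitary (N : ℕ) :
    IsCompact {U : Matrix (Fin N) (Fin N) ℂ | U ∈ Matrix.unitaryGroup (Fin N) ℂ} := by
  have h1 : IsCompact (Set.univ.pi fun _ : Fin N => Set.univ.pi fun _ : Fin N =>
      Metric.closedBall (0 : ℂ) 1) :=
    isCompact_univ_pi fun _ => isCompact_univ_pi fun _ => isCompact_closedBall 0 1
  refine IsCompact.of_isClosed_subset (s := (Set.univ.pi fun _ : Fin N => Set.univ.pi fun _ : Fin N =>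
      Metric.closedBall (0 : ℂ) 1)) h1 ?_ ?_
  · have : {U : Matrix (Fin N) (Fin N) ℂ | U ∈ Matrix.unitaryGroup (Fin N) ℂ}
        = {U | Uᴴ * U = 1} := by
      ext U
      exact Matrix.mem_unitaryGroup_iff'
    rw [this]
    exact isClosed_eq (continuous_id.matrix_conjTranspose.matrix_mul continuous_id)
      continuous_const
  · intro U hU i _ j _
    simpa using entry_norm_bound_of_unitary hU i j

/-- For small parameters the transition matrix is close to 1, so its diagonal does not vanish and a
pattern with one allowed entry per column must be diagonal. It is then a phase matrix with small
arguments, and local injectivity of `polarChart` gives a = a'. -/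
theorem skewExp_chart (N : ℕ) : ∃ O : Set (IndexPairs N → ℂ), IsOpen O ∧ 0 ∈ O ∧
    (∀ a ∈ O, ∀ a' ∈ O, ∀ σ : Fin N → Fin N,
      (∀ p q, p ≠ σ q → ((skewExp a')ᴴ * skewExp a) p q = 0) → a = a') := by
  let F : ((IndexPairs N → ℂ) × (Fin N → ℝ) ×
    selfAdjoint.submodule ℝ (Matrix (Fin N) (Fin N) ℂ)) ≃L[ℝ] Matrix (Fin N) (Fin N) ℂ :=
    ContinuousLinearEquiv.ofBijective (polarChartL N)
      (LinearMap.ker_eq_bot.2 (polarChartL_bijective N).1)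
      (LinearMap.range_eq_top.2 (polarChartL_bijective N).2)
  have hF : HasStrictFDerivAt (polarChart (N := N)) (F : _ →L[ℝ] Matrix (Fin N) (Fin N) ℂ) 0 :=
    hasStrictFDerivAt_polarChart_zero
  have h0 := hF.mem_toOpenPartialHomeomorph_source
  have hinj : Set.InjOn (polarChart (N := N)) (hF.toOpenPartialHomeomorph _).source :=
    (hF.toOpenPartialHomeomorph _).injOn
  have h1 : (hF.toOpenPartialHomeomorph _).source ∈ 𝓝 (0 : (IndexPairs N → ℂ) × (Fin N → ℝ) ×
      selfAdjoint.submodule ℝ (Matrix (Fin N) (Fin N) ℂ)) :=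
    (hF.toOpenPartialHomeomorph _).open_source.mem_nhds h0
  have h2 : Tendsto (fun v : (IndexPairs N → ℂ) × (Fin N → ℝ) => (v.1, v.2,
      (0 : selfAdjoint.submodule ℝ (Matrix (Fin N) (Fin N) ℂ)))) (𝓝 (0, 0)) (𝓝 0) :=
    Continuous.tendsto (by fun_prop) (0, 0)
  have h3 := h2 h1
  rw [Filter.mem_map, nhds_prod_eq] at h3
  obtain ⟨A, hA, B, hB, hAB⟩ := Filter.mem_prod_iff.1 h3
  have hB' : ∀ᶠ z : Fin N → ℂ in 𝓝 1, (fun p => (z p).arg) ∈ B := by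
    have hc : ContinuousAt (fun z : Fin N → ℂ => fun p => (z p).arg) 1 := by
      refine continuousAt_pi.2 fun p => ?_
      exact (Complex.continuousAt_arg (by simp)).comp (continuous_apply p).continuousAt
    refine hc.eventually ?_
    have : (fun z : Fin N → ℂ => fun p => (z p).arg) 1 = (0 : Fin N → ℝ) := by funext p; simp
    rw [this]
    exact hB
  have hne : ∀ᶠ z : Fin N → ℂ in 𝓝 1, ∀ p, z p ≠ 0 := by
    rw [eventually_all]
    intro p
    exact (continuous_apply p).continuousAt.eventually_ne (by simp)
  have hG : Tendsto (fun v : (IndexPairs N → ℂ) × (IndexPairs N → ℂ) =>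
      fun p => ((skewExp v.2)ᴴ * skewExp v.1) p p) (𝓝 (0, 0)) (𝓝 1) := by
    have hc : Continuous (skewExp : (IndexPairs N → ℂ) → _) := contDiff_skewExp.continuous
    have : Continuous (fun v : (IndexPairs N → ℂ) × (IndexPairs N → ℂ) =>
        fun p => ((skewExp v.2)ᴴ * skewExp v.1) p p) := by
      refine continuous_pi fun p => ?_
      exact ((hc.comp continuous_snd).matrix_conjTranspose.matrix_mul
        (hc.comp continuous_fst)).matrix_elem p p
    have h4 := this.tendsto (0, 0)
    have h5 : (fun p => ((skewExp (0 : IndexPairs N → ℂ))ᴴ * skewExp (0 : IndexPairs N → ℂ)) p p)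
        = (1 : Fin N → ℂ) := by
      funext p; simp [skewExp_zero]
    simpa only [h5] using h4
  have h6 := hG.eventually (hB'.and hne)
  rw [nhds_prod_eq] at h6
  obtain ⟨C, hC, hCC⟩ := Filter.eventually_prod_self_iff (r := fun a a' =>
    (fun p => (((skewExp a')ᴴ * skewExp a) p p).arg) ∈ B ∧
      ∀ p, ((skewExp a')ᴴ * skewExp a) p p ≠ 0) |>.1 h6
  refine ⟨interior (A ∩ C), isOpen_interior,
    mem_interior_iff_mem_nhds.2 (Filter.inter_mem hA hC), fun a ha a' ha' σ hσ => ?_⟩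
  have haA := interior_subset ha
  have haA' := interior_subset ha'
  obtain ⟨hθ, hnz⟩ := hCC a haA.2 a' haA'.2
  set G := (skewExp a')ᴴ * skewExp a with hGdef
  have hGu : G ∈ Matrix.unitaryGroup (Fin N) ℂ := by
    refine mul_mem ?_ (skewExp_mem a)
    rw [← Matrix.star_eq_conjTranspose]
    exact Unitary.star_mem (skewExp_mem a')
  have hσ1 : ∀ q, σ q = q := fun q => by
    by_contra h
    exact hnz q (hσ q q (Ne.symm h))
  have hdiag : G = Matrix.diagonal fun p => G p p := by
    ext p q
    by_cases hpq : p = q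
    · subst hpq; rw [Matrix.diagonal_apply_eq]
    · rw [Matrix.diagonal_apply_ne _ hpq, hσ p q (by rw [hσ1]; exact hpq)]
  have hphase : G = phaseMatrix fun p => (G p p).arg := by
    rw [phaseMatrix]
    conv_lhs => rw [hdiag]
    congr 1
    funext p
    have h7 := conjTranspose_mul_of_mem_unitaryGroup hGu
    rw [hdiag, Matrix.diagonal_conjTranspose, Matrix.diagonal_mul_diagonal] at h7
    have h8 := congrFun (congrFun h7 p) p
    rw [Matrix.diagonal_apply_eq, Matrix.one_apply_eq] at h8
    have h9 : ‖G p p‖ = 1 := by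
      have : ((Complex.normSq (G p p) : ℝ) : ℂ) = 1 := by
        rw [Complex.normSq_eq_conj_mul_self]; exact h8
      have h10 : Complex.normSq (G p p) = 1 := by exact_mod_cast this
      rw [Complex.norm_def, h10, Real.sqrt_one]
    have := Complex.norm_mul_exp_arg_mul_I (G p p)
    rw [h9, Complex.ofReal_one, one_mul] at this
    exact this.symm
  have hmul : skewExp a = skewExp a' * phaseMatrix fun p => (G p p).arg := by
    rw [← hphase, hGdef, ← Matrix.mul_assoc,
      mul_conjTranspose_of_mem_unitaryGroup (skewExp_mem a'), Matrix.one_mul]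
  have hmem1 : (a, (0 : Fin N → ℝ)) ∈ A ×ˢ B := ⟨haA.1, mem_of_mem_nhds hB⟩
  have hmem2 : (a', fun p => (G p p).arg) ∈ A ×ˢ B := ⟨haA'.1, hθ⟩
  have := hinj (hAB hmem1) (hAB hmem2) (by
    simp only [polarChart, Submodule.coe_zero, add_zero, mul_one, phaseMatrix_zero]
    exact hmul)
  exact congrArg Prod.fst this

/-- The image of `polarChart` is a neighbourhood of 1, and for a unitary matrix in it with ‖P‖ < 1
the Hermitian factor 1 + P is trivial. Compactness of the unitary group leaves finitely many
translates. -/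
theorem exists_finset_cover_unitary {O : Set (IndexPairs N → ℂ)} (hO : O ∈ 𝓝 0) :
    ∃ S : Finset (Matrix (Fin N) (Fin N) ℂ), (∀ k ∈ S, k ∈ Matrix.unitaryGroup (Fin N) ℂ) ∧
      ∀ U ∈ Matrix.unitaryGroup (Fin N) ℂ, ∃ k ∈ S, ∃ a ∈ O, ∃ θ : Fin N → ℝ,
        U = k * (skewExp a * phaseMatrix θ) := by
  let F : ((IndexPairs N → ℂ) × (Fin N → ℝ) ×
    selfAdjoint.submodule ℝ (Matrix (Fin N) (Fin N) ℂ)) ≃L[ℝ] Matrix (Fin N) (Fin N) ℂ :=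
    ContinuousLinearEquiv.ofBijective (polarChartL N)
      (LinearMap.ker_eq_bot.2 (polarChartL_bijective N).1)
      (LinearMap.range_eq_top.2 (polarChartL_bijective N).2)
  have hF : HasStrictFDerivAt (polarChart (N := N)) (F : _ →L[ℝ] Matrix (Fin N) (Fin N) ℂ) 0 :=
    hasStrictFDerivAt_polarChart_zero
  have hmap := hF.map_nhds_eq_of_equiv
  have h00 : polarChart (N := N) 0 = 1 := by
    simp [polarChart, skewExp_zero, phaseMatrix_zero]
  rw [h00] at hmap
  have hnb : polarChart (N := N) '' (O ×ˢ Set.univ ×ˢ {P : selfAdjoint.submodule ℝ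
      (Matrix (Fin N) (Fin N) ℂ) | ‖(P : Matrix (Fin N) (Fin N) ℂ)‖ < 1})
      ∈ 𝓝 (1 : Matrix (Fin N) (Fin N) ℂ) := by
    have h1 := Filter.image_mem_map (m := polarChart (N := N)) (prod_mem_nhds hO
      (prod_mem_nhds (Filter.univ_mem (f := 𝓝 (0 : Fin N → ℝ)))
        ((isOpen_lt (f := fun P : selfAdjoint.submodule ℝ (Matrix (Fin N) (Fin N) ℂ) =>
          ‖(P : Matrix (Fin N) (Fin N) ℂ)‖) (g := fun _ => (1 : ℝ)) (by fun_prop)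
            continuous_const).mem_nhds (x := 0) (by simp))))
    exact hmap.ge h1
  have hloc : ∀ U ∈ Matrix.unitaryGroup (Fin N) ℂ,
      U ∈ polarChart (N := N) '' (O ×ˢ Set.univ ×ˢ {P : selfAdjoint.submodule ℝ
      (Matrix (Fin N) (Fin N) ℂ) | ‖(P : Matrix (Fin N) (Fin N) ℂ)‖ < 1}) →
      ∃ a ∈ O, ∃ θ : Fin N → ℝ, U = skewExp a * phaseMatrix θ := by
    rintro U hU ⟨⟨a, θ, P⟩, ⟨ha, -, hP⟩, rfl⟩
    refine ⟨a, ha, θ, ?_⟩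
    have hPh : (P : Matrix (Fin N) (Fin N) ℂ)ᴴ = P := P.2
    have hP1 : ‖(P : Matrix (Fin N) (Fin N) ℂ)‖ < 1 := hP
    set V := skewExp a * phaseMatrix θ with hV
    have hVu : V ∈ Matrix.unitaryGroup (Fin N) ℂ := mul_mem (skewExp_mem a) (phaseMatrix_mem θ)
    have h1 := conjTranspose_mul_of_mem_unitaryGroup hU
    have h2 : polarChart (a, θ, P) = V * (1 + (P : Matrix (Fin N) (Fin N) ℂ)) := rfl
    rw [h2] at h1 ⊢
    rw [Matrix.conjTranspose_mul, Matrix.mul_assoc, ← Matrix.mul_assoc Vᴴ,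
      conjTranspose_mul_of_mem_unitaryGroup hVu, Matrix.one_mul, Matrix.conjTranspose_add, hPh,
      Matrix.conjTranspose_one] at h1
    set Q : Matrix (Fin N) (Fin N) ℂ := P.1 with hQ
    -- Unitarity reduces to (1 + Q)² = 1. Taking norms, 2‖Q‖ ≤ ‖Q‖² with ‖Q‖ < 1 forces Q = 0.
    have h3 : (2 : ℝ) • Q = -(Q * Q) := by
      have h4 : (1 + Q) * (1 + Q) = 1 + ((2 : ℝ) • Q + Q * Q) := by
        rw [two_smul]; noncomm_ring
      rw [h4] at h1
      exact eq_neg_of_add_eq_zero_left (by simpa using h1)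
    have h5 := congrArg norm h3
    rw [norm_smul, norm_neg, Real.norm_ofNat] at h5
    have h6 := norm_mul_le Q Q
    have h7 : ‖Q‖ = 0 := by nlinarith [norm_nonneg Q]
    rw [norm_eq_zero.1 h7, add_zero, Matrix.mul_one]
  obtain ⟨S, hS, hcov⟩ := (isCompact_setOf_unitary N).elim_nhds_subcover
    (fun k => {U | kᴴ * U ∈ polarChart (N := N) ''
      (O ×ˢ Set.univ ×ˢ {P : selfAdjoint.submodule ℝ
      (Matrix (Fin N) (Fin N) ℂ) | ‖(P : Matrix (Fin N) (Fin N) ℂ)‖ < 1})}) (fun k hk => by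
      have hc : Continuous fun U : Matrix (Fin N) (Fin N) ℂ => kᴴ * U :=
        continuous_const.matrix_mul continuous_id
      have h1 := hc.tendsto k
      rw [conjTranspose_mul_of_mem_unitaryGroup hk] at h1
      exact h1 hnb)
  refine ⟨S, hS, fun U hU => ?_⟩
  obtain ⟨k, hk, hUk⟩ := Set.mem_iUnion₂.1 (hcov hU)
  have hku : k ∈ Matrix.unitaryGroup (Fin N) ℂ := hS k hk
  have hkU : kᴴ * U ∈ Matrix.unitaryGroup (Fin N) ℂ := by
    refine mul_mem ?_ hU
    rw [← Matrix.star_eq_conjTranspose]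
    exact Unitary.star_mem hku
  obtain ⟨a, ha, θ, h⟩ := hloc _ hkU hUk
  refine ⟨k, hk, a, ha, θ, ?_⟩
  rw [← h, ← Matrix.mul_assoc, mul_conjTranspose_of_mem_unitaryGroup hku, Matrix.one_mul]

end UnitaryCharts

/-! ### The radial functions √(s² + γ) -/

section Radial

/-- `√(s² + γ)` for `γ > 0`, and `s` for `γ = 0`. -/
noncomputable def radialMap (γ s : ℝ) : ℝ := if γ = 0 then s else √(s ^ 2 + γ)

/-- The derivative of `radialMap γ`. -/
noncomputable def radialDeriv (γ s : ℝ) : ℝ := if γ = 0 then 1 else s / √(s ^ 2 + γ)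

variable {γ s : ℝ}

theorem hasDerivAt_radialMap (hγ : 0 ≤ γ) (s : ℝ) :
    HasDerivAt (radialMap γ) (radialDeriv γ s) s := by
  unfold radialMap radialDeriv
  by_cases h : γ = 0
  · simp only [h, if_true]; exact hasDerivAt_id s
  · simp only [h, if_false]
    have hpos : 0 < s ^ 2 + γ := by have := lt_of_le_of_ne hγ (Ne.symm h); positivity
    have h1 := ((hasDerivAt_pow 2 s).add_const γ).sqrt hpos.ne'
    refine h1.congr_deriv ?_
    rw [Nat.cast_ofNat, show 2 - 1 = 1 from rfl, pow_one, mul_div_mul_left _ _ two_ne_zero]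

/-- At γ = 0 the formula √(s²) = |s| is not differentiable at 0, hence the separate case in the
definition. Smoothness on the whole line is needed to discard the configurations with s = 0 as
images of null sets. -/
theorem contDiff_radialMap (hγ : 0 ≤ γ) : ContDiff ℝ 1 (radialMap γ) := by
  unfold radialMap
  by_cases h : γ = 0
  · simp only [h, if_true]; exact contDiff_id
  · simp only [h, if_false]
    have hpos := lt_of_le_of_ne hγ (Ne.symm h)
    exact ((contDiff_id.pow 2).add contDiff_const).sqrt fun s => by
      have : 0 < (id s) ^ 2 + γ := by positivity
      exact this.ne'

theorem continuous_radialDeriv (hγ : 0 ≤ γ) : Continuous (radialDeriv γ) := by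
  unfold radialDeriv
  by_cases h : γ = 0
  · simpa [h] using continuous_const
  · simp only [h, if_false]
    have hpos := lt_of_le_of_ne hγ (Ne.symm h)
    exact continuous_id.div (by fun_prop) fun s => by positivity

theorem radialMap_sq (hγ : 0 ≤ γ) (s : ℝ) : radialMap γ s ^ 2 = s ^ 2 + γ := by
  unfold radialMap
  by_cases h : γ = 0
  · simp [h]
  · simp only [h, if_false]
    exact Real.sq_sqrt (by positivity)

theorem radialMap_pos (hγ : 0 ≤ γ) (hs : 0 < s) : 0 < radialMap γ s := by
  unfold radialMap
  split_ifs
  · exact hs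
  · positivity

theorem radialDeriv_pos (hγ : 0 ≤ γ) (hs : 0 < s) : 0 < radialDeriv γ s := by
  unfold radialDeriv
  split_ifs
  · exact one_pos
  · positivity

theorem radialMap_eq_sqrt (hs : 0 ≤ s) : radialMap γ s = √(s ^ 2 + γ) := by
  unfold radialMap
  split_ifs with h
  · rw [h, add_zero, Real.sqrt_sq hs]
  · rfl

end Radial

/-! ### Parametrization of block-cyclic matrices and its derivative -/

section NormalChart

open scoped Matrix.Norms.Operator

variable {m N : ℕ} [NeZero m]

/-- The block-cyclic matrix with blocks `B i` in the positions `(i, i + 1)`. -/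
noncomputable def cyclicMatrix (B : Fin m → Matrix (Fin N) (Fin N) ℂ) :
    MatrixSpace (Fin m × Fin N) :=
  WithLp.toLp 2 fun x => if x.2.1 = x.1.1 + 1 then B x.1.1 x.1.2 x.2.2 else 0

theorem cyclicMatrix_apply (B : Fin m → Matrix (Fin N) (Fin N) ℂ)
    (x : (Fin m × Fin N) × (Fin m × Fin N)) :
    cyclicMatrix B x = if x.2.1 = x.1.1 + 1 then B x.1.1 x.1.2 x.2.2 else 0 := rfl

theorem norm_cyclicMatrix_sq (B : Fin m → Matrix (Fin N) (Fin N) ℂ) :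
    ‖cyclicMatrix B‖ ^ 2 = ∑ i, ∑ p, ∑ q, ‖B i p q‖ ^ 2 := by
  rw [EuclideanSpace.norm_sq_eq, Fintype.sum_prod_type, Fintype.sum_prod_type]
  refine Finset.sum_congr rfl fun i _ => Finset.sum_congr rfl fun p _ => ?_
  rw [Fintype.sum_prod_type, Finset.sum_comm]
  refine Finset.sum_congr rfl fun q _ => ?_
  rw [Finset.sum_eq_single (i + 1)]
  · simp [cyclicMatrix_apply]
  · intro j _ hj
    simp [cyclicMatrix_apply, hj]
  · simp

/-- The `i`-th diagonal entry with radial coordinate `y.1` and phases `y.2`. -/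
noncomputable def diagEntry (γ : Fin m → ℝ) (y : ℝ × (Fin m → ℝ)) (i : Fin m) : ℂ :=
  radialMap (γ i) y.1 * Complex.exp (y.2 i * Complex.I)

/-- The block-cyclic matrix with blocks `U_i D_i U_{i+1}†`, the diagonal of `D_i` being given
by `diagEntry`. -/
noncomputable def cyclicPoint (γ : Fin m → ℝ) (U : Fin m → Matrix (Fin N) (Fin N) ℂ)
    (y : Fin N → ℝ × (Fin m → ℝ)) : MatrixSpace (Fin m × Fin N) :=
  cyclicMatrix fun i =>
    U i * Matrix.diagonal (fun p => diagEntry γ (y p) i) * (U (i + 1))ᴴ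

/-- The parameters: off-diagonal, and radial and angular. -/
abbrev ChartSpace (m N : ℕ) : Type := (IndexPairs N → Fin m → ℂ) × (Fin N → ℝ × (Fin m → ℝ))

/-- The unitary matrices with off-diagonal parameters `a`. -/
noncomputable def unitaryTuple (a : IndexPairs N → Fin m → ℂ) (i : Fin m) :
    Matrix (Fin N) (Fin N) ℂ :=
  skewExp fun x => a x i

theorem unitaryTuple_mem (a : IndexPairs N → Fin m → ℂ) (i : Fin m) :
    unitaryTuple a i ∈ Matrix.unitaryGroup (Fin N) ℂ := skewExp_mem _

/-- The parametrization of block-cyclic matrices, centred at the tuple `k`. -/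
noncomputable def cyclicChart (γ : Fin m → ℝ) (k : Fin m → Matrix (Fin N) (Fin N) ℂ)
    (v : ChartSpace m N) : MatrixSpace (Fin m × Fin N) :=
  cyclicPoint γ (fun i => k i * unitaryTuple v.1 i) v.2

theorem contDiff_cyclicChart {γ : Fin m → ℝ} (hγ : ∀ i, 0 ≤ γ i)
    (k : Fin m → Matrix (Fin N) (Fin N) ℂ) : ContDiff ℝ 1 (cyclicChart γ k) := by
  have hU : ∀ i, ContDiff ℝ 1 fun v : ChartSpace m N => k i * unitaryTuple v.1 i := fun i =>
    contDiff_const.mul (contDiff_skewExp.comp (contDiff_pi.2 fun x => by fun_prop))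
  have hUh : ∀ i, ContDiff ℝ 1 fun v : ChartSpace m N => (k i * unitaryTuple v.1 i)ᴴ := fun i =>
    (conjTransposeL N).contDiff.comp (hU i)
  have hentry : ∀ i p, ContDiff ℝ 1 fun v : ChartSpace m N => diagEntry γ (v.2 p) i := by
    intro i p
    have h1 : ContDiff ℝ 1 fun v : ChartSpace m N => (radialMap (γ i) (v.2 p).1 : ℂ) :=
      Complex.ofRealCLM.contDiff.comp ((contDiff_radialMap (hγ i)).comp (by fun_prop))
    have h2 : ContDiff ℝ 1 fun v : ChartSpace m N => (((v.2 p).2 i : ℝ) : ℂ) :=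
      Complex.ofRealCLM.contDiff.comp (by fun_prop)
    exact h1.mul (h2.mul contDiff_const).cexp
  have hE : ∀ p q, ContDiff ℝ 1 fun A : Matrix (Fin N) (Fin N) ℂ => A p q := fun p q =>
    (LinearMap.toContinuousLinearMap ({ toFun := fun A => A p q
                                        map_add' := fun _ _ => rfl
                                        map_smul' := fun _ _ => rfl } :
      Matrix (Fin N) (Fin N) ℂ →ₗ[ℝ] ℂ)).contDiff
  rw [contDiff_piLp]
  rintro ⟨⟨i, p⟩, ⟨j, q⟩⟩
  simp only [cyclicChart, cyclicPoint, cyclicMatrix_apply]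
  split_ifs with h
  · have h1 : ∀ v : ChartSpace m N, (k i * unitaryTuple v.1 i * Matrix.diagonal (fun p =>
        diagEntry γ (v.2 p) i) * (k (i + 1) * unitaryTuple v.1 (i + 1))ᴴ) p q
        = ∑ r, (k i * unitaryTuple v.1 i) p r * diagEntry γ (v.2 r) i
          * (k (i + 1) * unitaryTuple v.1 (i + 1))ᴴ r q :=
      fun v => by
        rw [Matrix.mul_apply]
        exact Finset.sum_congr rfl fun r _ => by rw [Matrix.mul_diagonal]
    simp only [h1]
    exact ContDiff.sum fun r _ =>
      ((((hE p r).comp (hU i)).mul (hentry i r)).mul ((hE r q).comp (hUh (i + 1))))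
  · exact contDiff_const

theorem hasDerivAt_diagEntry_line {γ : Fin m → ℝ} (hγ : ∀ i, 0 ≤ γ i) (y δ : ℝ × (Fin m → ℝ))
    (i : Fin m) :
    HasDerivAt (fun t : ℝ => diagEntry γ (y + t • δ) i)
      ((radialDeriv (γ i) y.1 * δ.1 + Complex.I * (radialMap (γ i) y.1 * δ.2 i))
        * Complex.exp (y.2 i * Complex.I)) 0 := by
  have h1 : HasDerivAt (fun t : ℝ => y.1 + t * δ.1) δ.1 0 := by
    simpa using ((hasDerivAt_id (0 : ℝ)).mul_const δ.1).const_add y.1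
  have h2 : HasDerivAt (fun t : ℝ => y.2 i + t * δ.2 i) (δ.2 i) 0 := by
    simpa using ((hasDerivAt_id (0 : ℝ)).mul_const (δ.2 i)).const_add (y.2 i)
  have h3 : HasDerivAt (fun t : ℝ => radialMap (γ i) (y.1 + t * δ.1))
      (radialDeriv (γ i) y.1 * δ.1) 0 := by
    have h4 := hasDerivAt_radialMap (hγ i) (y.1 + 0 * δ.1)
    have h6 := h4.comp (0 : ℝ) h1
    rw [zero_mul, add_zero] at h6
    exact h6
  have h5 := h3.ofReal_comp.mul ((h2.ofReal_comp.mul_const Complex.I).cexp)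
  refine h5.congr_deriv ?_
  push_cast
  simp only [zero_mul, add_zero]
  ring

/-- Blocks of the derivative of `cyclicChart`, in the moving frame. -/
noncomputable def frameBlock (γ : Fin m → ℝ) (v δ : ChartSpace m N) (i : Fin m) :
    Matrix (Fin N) (Fin N) ℂ :=
  skewExpForm (fun x => v.1 x i) (fun x => δ.1 x i)
      * Matrix.diagonal (fun p => diagEntry γ (v.2 p) i)
    + Matrix.diagonal (fun p => (radialDeriv (γ i) (v.2 p).1 * (δ.2 p).1
        + Complex.I * (radialMap (γ i) (v.2 p).1 * (δ.2 p).2 i))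
          * Complex.exp ((v.2 p).2 i * Complex.I))
    - Matrix.diagonal (fun p => diagEntry γ (v.2 p) i)
      * skewExpForm (fun x => v.1 x (i + 1)) (fun x => δ.1 x (i + 1))

theorem hasDerivAt_matrix_diagonal {f : ℝ → Fin N → ℂ} {f' : Fin N → ℂ} {t : ℝ}
    (h : ∀ p, HasDerivAt (fun s => f s p) (f' p) t) :
    HasDerivAt (fun s => Matrix.diagonal (f s)) (Matrix.diagonal f') t := by
  have h1 : HasDerivAt f f' t := hasDerivAt_pi.2 h
  let L : (Fin N → ℂ) →L[ℝ] Matrix (Fin N) (Fin N) ℂ :=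
    LinearMap.toContinuousLinearMap (Matrix.diagonalLinearMap (Fin N) ℝ ℂ)
  exact L.hasFDerivAt.comp_hasDerivAt t h1

/-- The product rule for U_i D_i U_{i+1}†, with the outer unitary factors pulled out. The sign of
the last term in `frameBlock` comes from the antihermitian form of dU_{i+1}†. -/
theorem fderiv_cyclicChart {γ : Fin m → ℝ} (hγ : ∀ i, 0 ≤ γ i)
    (k : Fin m → Matrix (Fin N) (Fin N) ℂ) (v δ : ChartSpace m N) :
    fderiv ℝ (cyclicChart γ k) v δ = cyclicMatrix fun i =>
      k i * unitaryTuple v.1 i * frameBlock γ v δ i * (k (i + 1) * unitaryTuple v.1 (i + 1))ᴴ := by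
  have hline : HasDerivAt (fun t : ℝ => v + t • δ) δ 0 := by
    simpa using ((hasDerivAt_id (0 : ℝ)).smul_const δ).const_add v
  have h1 : HasFDerivAt (cyclicChart γ k) (fderiv ℝ (cyclicChart γ k) v) (v + (0 : ℝ) • δ) := by
    rw [zero_smul, add_zero]
    exact ((contDiff_cyclicChart hγ k).differentiable one_ne_zero v).hasFDerivAt
  have h2 := h1.comp_hasDerivAt 0 hline
  have hU : ∀ i, HasDerivAt (fun t : ℝ => k i * unitaryTuple (v + t • δ).1 i)
      (k i * unitaryTuple v.1 i * skewExpForm (fun x => v.1 x i) (fun x => δ.1 x i)) 0 := fun i => by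
    have := (hasDerivAt_skewExp_line (fun x => v.1 x i) (fun x => δ.1 x i)).const_mul (k i)
    rw [fderiv_skewExp, ← mul_assoc] at this
    exact this
  have hB : ∀ i, HasDerivAt (fun t : ℝ => k i * unitaryTuple (v + t • δ).1 i
      * Matrix.diagonal (fun p => diagEntry γ ((v + t • δ).2 p) i)
      * (k (i + 1) * unitaryTuple (v + t • δ).1 (i + 1))ᴴ)
      (k i * unitaryTuple v.1 i * frameBlock γ v δ i * (k (i + 1) * unitaryTuple v.1 (i + 1))ᴴ) 0 := fun i => by
    have hD : HasDerivAt (fun t : ℝ => Matrix.diagonal (fun p => diagEntry γ ((v + t • δ).2 p) i))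
        (Matrix.diagonal (fun p => (radialDeriv (γ i) (v.2 p).1 * (δ.2 p).1
        + Complex.I * (radialMap (γ i) (v.2 p).1 * (δ.2 p).2 i))
          * Complex.exp ((v.2 p).2 i * Complex.I))) 0 :=
      hasDerivAt_matrix_diagonal fun p => hasDerivAt_diagEntry_line hγ (v.2 p) (δ.2 p) i
    have h3 := ((hU i).mul hD).mul (hU (i + 1)).matrix_conjTranspose
    refine h3.congr_deriv ?_
    simp only [zero_smul, add_zero, Pi.mul_apply]
    rw [Matrix.conjTranspose_mul (k (i + 1) * _), skewExpForm_conjTranspose, frameBlock]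
    noncomm_ring
  have h4 : HasDerivAt (fun t : ℝ => cyclicChart γ k (v + t • δ)) (cyclicMatrix fun i =>
      k i * unitaryTuple v.1 i * frameBlock γ v δ i * (k (i + 1) * unitaryTuple v.1 (i + 1))ᴴ) 0 := by
    let L : (Fin m → Matrix (Fin N) (Fin N) ℂ) →L[ℝ] MatrixSpace (Fin m × Fin N) :=
      LinearMap.toContinuousLinearMap
        { toFun := cyclicMatrix
          map_add' := fun A B => by
            ext x
            simp only [cyclicMatrix_apply, PiLp.add_apply, Pi.add_apply, Matrix.add_apply]
            split_ifs <;> simp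
          map_smul' := fun r A => by
            ext x
            simp only [cyclicMatrix_apply, PiLp.smul_apply, Pi.smul_apply, Matrix.smul_apply]
            split_ifs <;> simp }
    exact L.hasFDerivAt.comp_hasDerivAt 0 (hasDerivAt_pi.2 hB)
  exact h2.unique h4

end NormalChart

/-! ### The Euclidean metric in the moving frame -/

section FrameNorm

variable {m N : ℕ} [NeZero m]

theorem sum_sum_eq_diag_add_pairs (F : Fin N → Fin N → ℝ) :
    ∑ p, ∑ q, F p q = ∑ p, F p p + ∑ x : IndexPairs N, (F x.1.1 x.1.2 + F x.1.2 x.1.1) := by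
  have h1 : ∀ p q : Fin N, F p q = (if p = q then F p q else 0)
      + ((if p < q then F p q else 0) + (if q < p then F p q else 0)) := by
    intro p q
    rcases lt_trichotomy p q with h | h | h
    · simp [h, h.ne, h.not_gt]
    · simp [h]
    · simp [h, h.ne', h.not_gt]
  have h2 : ∀ G : Fin N → Fin N → ℝ,
      ∑ p, ∑ q, (if p < q then G p q else 0) = ∑ x : IndexPairs N, G x.1.1 x.1.2 := by
    intro G
    rw [← Fintype.sum_prod_type', ← Finset.sum_filter]
    exact Finset.sum_subtype _ (fun x => by simp) (fun x : Fin N × Fin N => G x.1 x.2)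
  calc ∑ p, ∑ q, F p q = ∑ p, ∑ q, ((if p = q then F p q else 0)
      + ((if p < q then F p q else 0) + (if q < p then F p q else 0))) :=
        Finset.sum_congr rfl fun p _ => Finset.sum_congr rfl fun q _ => h1 p q
    _ = _ := by
        simp only [Finset.sum_add_distrib]
        congr 1
        · simp
        · congr 1
          · exact h2 F
          · rw [Finset.sum_comm]
            exact h2 fun p q => F q p

theorem sum_sum_sum_eq_pairs_add_diag (F : Fin m → Fin N → Fin N → ℝ) :
    ∑ i, ∑ p, ∑ q, F i p q
      = ∑ x : IndexPairs N, ∑ i, (F i x.1.1 x.1.2 + F i x.1.2 x.1.1) + ∑ p, ∑ i, F i p p := by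
  rw [Finset.sum_congr rfl fun i _ => sum_sum_eq_diag_add_pairs (F i), Finset.sum_add_distrib,
    add_comm]
  congr 1
  · exact Finset.sum_comm
  · exact Finset.sum_comm

theorem card_indexPairs (N : ℕ) : 2 * Fintype.card (IndexPairs N) + N = N ^ 2 := by
  have h := sum_sum_eq_diag_add_pairs (N := N) fun _ _ => 1
  simp only [Finset.sum_const, Finset.card_univ, Fintype.card_fin, nsmul_eq_mul, mul_one] at h
  have h2 : ((2 * Fintype.card (IndexPairs N) + N : ℕ) : ℝ) = ((N ^ 2 : ℕ) : ℝ) := by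
    push_cast
    nlinarith [h]
  exact_mod_cast h2

theorem sum_norm_sq_eq_trace (X : Matrix (Fin N) (Fin N) ℂ) :
    ((∑ p, ∑ q, ‖X p q‖ ^ 2 : ℝ) : ℂ) = (X * Xᴴ).trace := by
  rw [Matrix.trace]
  push_cast
  refine Finset.sum_congr rfl fun p _ => ?_
  rw [Matrix.diag_apply, Matrix.mul_apply]
  refine Finset.sum_congr rfl fun q _ => ?_
  rw [Matrix.conjTranspose_apply, RCLike.star_def, Complex.mul_conj, Complex.normSq_eq_norm_sq]
  push_cast
  rfl

theorem sum_norm_sq_unitary_mul {U V : Matrix (Fin N) (Fin N) ℂ}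
    (hU : U ∈ Matrix.unitaryGroup (Fin N) ℂ) (hV : V ∈ Matrix.unitaryGroup (Fin N) ℂ)
    (X : Matrix (Fin N) (Fin N) ℂ) :
    ∑ p, ∑ q, ‖(U * X * Vᴴ) p q‖ ^ 2 = ∑ p, ∑ q, ‖X p q‖ ^ 2 := by
  have h : ((∑ p, ∑ q, ‖(U * X * Vᴴ) p q‖ ^ 2 : ℝ) : ℂ) = ((∑ p, ∑ q, ‖X p q‖ ^ 2 : ℝ) : ℂ) := by
    rw [sum_norm_sq_eq_trace, sum_norm_sq_eq_trace]
    have h1 : U * X * Vᴴ * (U * X * Vᴴ)ᴴ = U * (X * Xᴴ * Uᴴ) := by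
      rw [Matrix.conjTranspose_mul, Matrix.conjTranspose_mul, Matrix.conjTranspose_conjTranspose,
        Matrix.mul_assoc (U * X), ← Matrix.mul_assoc Vᴴ, conjTranspose_mul_of_mem_unitaryGroup hV,
        Matrix.one_mul]
      simp only [Matrix.mul_assoc]
    rw [h1, Matrix.trace_mul_comm, Matrix.mul_assoc, conjTranspose_mul_of_mem_unitaryGroup hU,
      Matrix.mul_one]
  exact_mod_cast h

/-- The difference of the two off-diagonal contributions telescopes around the cycle. -/
theorem sum_norm_sq_cyclic (a d d' : Fin m → ℂ) {s s' : ℝ} {γ : Fin m → ℝ}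
    (hd : ∀ i, ‖d i‖ ^ 2 = s + γ i) (hd' : ∀ i, ‖d' i‖ ^ 2 = s' + γ i) :
    ∑ i, (‖a i * d' i - d i * a (i + 1)‖ ^ 2
        + ‖-(starRingEnd ℂ) (a i) * d i - d' i * -(starRingEnd ℂ) (a (i + 1))‖ ^ 2)
      = ∑ i, 2 * ‖a i * d' i - d i * a (i + 1)‖ ^ 2 := by
  -- The mixed terms of the two squares coincide. As |d i|² - |d' i|² = s - s' does not depend on i,
  -- the discrepancy is a constant times a difference of consecutive terms.
  have h1 : ∀ i, ‖a i * d' i - d i * a (i + 1)‖ ^ 2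
        + ‖-(starRingEnd ℂ) (a i) * d i - d' i * -(starRingEnd ℂ) (a (i + 1))‖ ^ 2
      = 2 * ‖a i * d' i - d i * a (i + 1)‖ ^ 2
        + (s - s') * (‖a i‖ ^ 2 - ‖a (i + 1)‖ ^ 2) := by
    intro i
    have e1 := hd i
    have e2 := hd' i
    have e3 : s - s' = ‖d i‖ ^ 2 - ‖d' i‖ ^ 2 := by rw [e1, e2]; ring
    rw [e3]
    simp only [← Complex.normSq_eq_norm_sq, Complex.normSq_apply]
    simp
    ring
  rw [Finset.sum_congr rfl fun i _ => h1 i, Finset.sum_add_distrib, ← Finset.mul_sum (s := Finset.univ)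
    (a := s - s'), Finset.sum_sub_distrib]
  have h2 : ∑ i, ‖a (i + 1)‖ ^ 2 = ∑ i, ‖a i‖ ^ 2 :=
    Equiv.sum_comp (Equiv.addRight (1 : Fin m)) fun i => ‖a i‖ ^ 2
  rw [h2, sub_self, mul_zero, add_zero]

theorem norm_diagEntry_sq {γ : Fin m → ℝ} (hγ : ∀ i, 0 ≤ γ i) (y : ℝ × (Fin m → ℝ)) (i : Fin m) :
    ‖diagEntry γ y i‖ ^ 2 = y.1 ^ 2 + γ i := by
  rw [diagEntry, norm_mul, Complex.norm_exp_ofReal_mul_I, mul_one, Complex.norm_real,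
    Real.norm_eq_abs, sq_abs, radialMap_sq (hγ i)]

/-- The infinitesimal coordinates in the moving frame. -/
noncomputable def frameMap (a : IndexPairs N → Fin m → ℂ) : ChartSpace m N →ₗ[ℝ] ChartSpace m N where
  toFun δ := (fun x i => skewExpForm (fun x => a x i) (fun x => δ.1 x i) x.1.1 x.1.2,
    fun p => ((δ.2 p).1, fun i => (δ.2 p).2 i
      + (skewExpForm (fun x => a x i) (fun x => δ.1 x i) p p).im
      - (skewExpForm (fun x => a x (i + 1)) (fun x => δ.1 x (i + 1)) p p).im))
  map_add' δ δ' := by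
    have h : ∀ i, skewExpForm (fun x => a x i) (fun x => (δ + δ').1 x i)
        = skewExpForm (fun x => a x i) (fun x => δ.1 x i)
          + skewExpForm (fun x => a x i) (fun x => δ'.1 x i) := fun i => skewExpForm_add _ _ _
    simp only [h]
    refine Prod.ext (funext fun x => funext fun i => rfl) (funext fun p => Prod.ext rfl ?_)
    funext i
    simp
    ring
  map_smul' r δ := by
    have h : ∀ i, skewExpForm (fun x => a x i) (fun x => (r • δ).1 x i)
        = r • skewExpForm (fun x => a x i) (fun x => δ.1 x i) := fun i => skewExpForm_smul _ _ _
    simp only [h]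
    refine Prod.ext (funext fun x => funext fun i => rfl) (funext fun p => Prod.ext rfl ?_)
    funext i
    simp
    ring

/-- The map `v ↦ (v_i d'_i - d_i v_{i+1})`. -/
noncomputable def cyclicDifference (d d' : Fin m → ℂ) : (Fin m → ℂ) →ₗ[ℂ] (Fin m → ℂ) where
  toFun v i := v i * d' i - d i * v (i + 1)
  map_add' v w := by funext i; simp; ring
  map_smul' r v := by funext i; simp; ring

/-- The stretching of the radial and angular coordinates. -/
noncomputable def radialScale (γ : Fin m → ℝ) (s : ℝ) :
    (ℝ × (Fin m → ℝ)) →ₗ[ℝ] (ℝ × (Fin m → ℝ)) :=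
  LinearMap.prodMap (√(∑ i, radialDeriv (γ i) s ^ 2) • LinearMap.id)
    (LinearMap.pi fun i => radialMap (γ i) s • LinearMap.proj i)

/-- The stretching of all coordinates. -/
noncomputable def scaleMap (γ : Fin m → ℝ) (y : Fin N → ℝ × (Fin m → ℝ)) :
    ChartSpace m N →ₗ[ℝ] ChartSpace m N :=
  LinearMap.prodMap
    (LinearMap.pi fun x => ((cyclicDifference (diagEntry γ (y x.1.1))
      (diagEntry γ (y x.1.2))).restrictScalars ℝ).comp (LinearMap.proj x))
    (LinearMap.pi fun p => (radialScale γ (y p).1).comp (LinearMap.proj p))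

/-- The isometric model for the metric in the moving frame. -/
noncomputable def chartEmbedding (m N : ℕ) : ChartSpace m N →ₗ[ℝ]
    EuclideanSpace ℂ ((IndexPairs N × Fin m) ⊕ (Fin N × Option (Fin m))) where
  toFun δ := WithLp.toLp 2 (Sum.elim (fun x => (√2 : ℂ) * δ.1 x.1 x.2)
    fun x => x.2.elim ((δ.2 x.1).1 : ℂ) fun i => ((δ.2 x.1).2 i : ℂ))
  map_add' δ δ' := by
    ext x
    rcases x with x | ⟨p, _ | i⟩ <;> simp [mul_add]
  map_smul' r δ := by
    ext x
    rcases x with x | ⟨p, _ | i⟩ <;> simp [mul_left_comm]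

theorem norm_chartEmbedding_sq (δ : ChartSpace m N) :
    ‖chartEmbedding m N δ‖ ^ 2 = ∑ x, ∑ i, 2 * ‖δ.1 x i‖ ^ 2
      + ∑ p, ((δ.2 p).1 ^ 2 + ∑ i, (δ.2 p).2 i ^ 2) := by
  rw [EuclideanSpace.norm_sq_eq, Fintype.sum_sum_type, Fintype.sum_prod_type, Fintype.sum_prod_type]
  congr 1
  · refine Finset.sum_congr rfl fun x _ => Finset.sum_congr rfl fun i _ => ?_
    change ‖(√2 : ℂ) * δ.1 x i‖ ^ 2 = _
    rw [norm_mul, mul_pow, Complex.norm_real, Real.norm_eq_abs, sq_abs, Real.sq_sqrt zero_le_two]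
  · refine Finset.sum_congr rfl fun p _ => ?_
    rw [Fintype.sum_option]
    congr 1
    · change ‖((δ.2 p).1 : ℂ)‖ ^ 2 = _
      rw [Complex.norm_real, Real.norm_eq_abs, sq_abs]
    · refine Finset.sum_congr rfl fun i _ => ?_
      change ‖((δ.2 p).2 i : ℂ)‖ ^ 2 = _
      rw [Complex.norm_real, Real.norm_eq_abs, sq_abs]

theorem chartEmbedding_injective (m N : ℕ) : Function.Injective (chartEmbedding m N) := by
  rw [injective_iff_map_eq_zero]
  intro δ h
  have h1 : ∀ x, chartEmbedding m N δ x = 0 := fun x => by rw [h]; rfl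
  refine Prod.ext (funext fun x => funext fun i => ?_) (funext fun p => Prod.ext ?_ ?_)
  · have := h1 (Sum.inl (x, i))
    change (√2 : ℂ) * δ.1 x i = 0 at this
    simpa using this
  · have := h1 (Sum.inr (p, none))
    change ((δ.2 p).1 : ℂ) = 0 at this
    simpa using this
  · funext i
    have := h1 (Sum.inr (p, some i))
    change ((δ.2 p).2 i : ℂ) = 0 at this
    simpa using this

/-- Unitary invariance of the Frobenius norm removes the frames. The entries (p,q) and (q,p)
together give twice one square by `sum_norm_sq_cyclic`, whence the √2 in `chartEmbedding`. On the
diagonal the radial and angular variations are orthogonal. -/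
theorem norm_fderiv_cyclicChart {γ : Fin m → ℝ} (hγ : ∀ i, 0 ≤ γ i)
    {k : Fin m → Matrix (Fin N) (Fin N) ℂ} (hk : ∀ i, k i ∈ Matrix.unitaryGroup (Fin N) ℂ)
    (v δ : ChartSpace m N) :
    ‖fderiv ℝ (cyclicChart γ k) v δ‖ = ‖chartEmbedding m N (scaleMap γ v.2 (frameMap v.1 δ))‖ := by
  rw [← sq_eq_sq₀ (norm_nonneg _) (norm_nonneg _), fderiv_cyclicChart hγ, norm_cyclicMatrix_sq,
    norm_chartEmbedding_sq]
  rw [Finset.sum_congr rfl fun i _ => sum_norm_sq_unitary_mul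
    (mul_mem (hk i) (unitaryTuple_mem v.1 i)) (mul_mem (hk (i + 1)) (unitaryTuple_mem v.1 (i + 1))) (frameBlock γ v δ i),
    sum_sum_sum_eq_pairs_add_diag fun i p q => ‖frameBlock γ v δ i p q‖ ^ 2]
  set ω : Fin m → Matrix (Fin N) (Fin N) ℂ :=
    fun i => skewExpForm (fun x => v.1 x i) (fun x => δ.1 x i) with hω
  have hskew : ∀ i p q, ω i q p = -(starRingEnd ℂ) (ω i p q) := fun i p q => by
    have h1 := congrFun (congrFun (skewExpForm_conjTranspose (fun x => v.1 x i)
      (fun x => δ.1 x i)) q) p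
    rw [Matrix.conjTranspose_apply, Matrix.neg_apply] at h1
    rw [← RCLike.star_def]
    exact (neg_eq_iff_eq_neg.2 h1).symm ▸ by simp [hω]
  have hoff : ∀ i p q, p ≠ q → frameBlock γ v δ i p q
      = ω i p q * diagEntry γ (v.2 q) i - diagEntry γ (v.2 p) i * ω (i + 1) p q := by
    intro i p q hpq
    rw [frameBlock, Matrix.sub_apply, Matrix.add_apply, Matrix.mul_diagonal, Matrix.diagonal_mul,
      Matrix.diagonal_apply_ne _ hpq, add_zero]
  congr 1
  · refine Finset.sum_congr rfl fun x _ => ?_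
    have h2 := sum_norm_sq_cyclic (fun i => ω i x.1.1 x.1.2) (diagEntry γ (v.2 x.1.1))
      (diagEntry γ (v.2 x.1.2)) (norm_diagEntry_sq hγ (v.2 x.1.1)) (norm_diagEntry_sq hγ (v.2 x.1.2))
    rw [show (∑ i, 2 * ‖(scaleMap γ v.2 (frameMap v.1 δ)).1 x i‖ ^ 2)
      = ∑ i, 2 * ‖ω i x.1.1 x.1.2 * diagEntry γ (v.2 x.1.2) i
        - diagEntry γ (v.2 x.1.1) i * ω (i + 1) x.1.1 x.1.2‖ ^ 2 from rfl, ← h2]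
    refine Finset.sum_congr rfl fun i _ => ?_
    rw [hoff i _ _ x.2.ne, hoff i _ _ x.2.ne', hskew i x.1.1 x.1.2, hskew (i + 1) x.1.1 x.1.2]
  · refine Finset.sum_congr rfl fun p _ => ?_
    have hre : ∀ i, ω i p p = Complex.I * (ω i p p).im := fun i => by
      have h1 := congrArg Complex.re (hskew i p p)
      rw [Complex.neg_re, Complex.conj_re] at h1
      apply Complex.ext
      · simp; linarith
      · simp
    have h3 : ∀ i, ‖frameBlock γ v δ i p p‖ ^ 2
        = (radialDeriv (γ i) (v.2 p).1 ^ 2) * (δ.2 p).1 ^ 2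
          + (radialMap (γ i) (v.2 p).1 * ((δ.2 p).2 i + (ω i p p).im - (ω (i + 1) p p).im)) ^ 2 := by
      intro i
      have h4 : frameBlock γ v δ i p p = ((radialDeriv (γ i) (v.2 p).1 * (δ.2 p).1 : ℝ)
          + (radialMap (γ i) (v.2 p).1 * ((δ.2 p).2 i + (ω i p p).im - (ω (i + 1) p p).im) : ℝ)
            * Complex.I) * Complex.exp ((v.2 p).2 i * Complex.I) := by
        rw [frameBlock, Matrix.sub_apply, Matrix.add_apply, Matrix.mul_diagonal,
          Matrix.diagonal_mul, Matrix.diagonal_apply_eq]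
        change ω i p p * _ + _ - _ * ω (i + 1) p p = _
        rw [hre i, hre (i + 1), diagEntry]
        push_cast
        simp only [Complex.mul_im, Complex.I_re, Complex.I_im, Complex.ofReal_re, Complex.ofReal_im,
          zero_mul, one_mul, zero_add]
        ring
      rw [h4, norm_mul, Complex.norm_exp_ofReal_mul_I, mul_one, Complex.sq_norm,
        Complex.normSq_add_mul_I]
      ring
    rw [Finset.sum_congr rfl fun i _ => h3 i, Finset.sum_add_distrib, ← Finset.sum_mul]
    congr 1
    change _ = (√(∑ i, radialDeriv (γ i) (v.2 p).1 ^ 2) * (δ.2 p).1) ^ 2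
    rw [mul_pow, Real.sq_sqrt (Finset.sum_nonneg fun i _ => sq_nonneg _)]

/-- The off-diagonal coordinates count m(N² - N), the diagonal ones N(m + 1). -/
theorem finrank_chartSpace (m N : ℕ) : Module.finrank ℝ (ChartSpace m N) = m * N ^ 2 + N := by
  rw [Module.finrank_prod, Module.finrank_pi_fintype, Module.finrank_pi_fintype]
  simp only [Module.finrank_pi_fintype, Module.finrank_prod, Complex.finrank_real_complex,
    Module.finrank_self, Finset.sum_const, Finset.card_univ, Fintype.card_fin, smul_eq_mul, mul_one]
  rw [← card_indexPairs N]
  ring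

end FrameNorm

/-! ### The Jacobian and the Vandermonde factor -/

section ChartDeterminant

theorem Fin.forall_of_exists_add_one {m : ℕ} [NeZero m] {P : Fin m → Prop} (h0 : ∃ i, P i)
    (h : ∀ i, P i → P (i + 1)) (i : Fin m) : P i := by
  obtain ⟨i₀, h0⟩ := h0
  have := Fin.forall_of_add_one (P := fun j => P (i₀ + j)) (by simpa using h0)
    (fun j hj => by rw [← add_assoc]; exact h _ hj) (i - i₀)
  simpa using this

/-- In the Leibniz formula a permutation must send each i to i or i + 1. Injectivity propagates one
shift around the cycle, so only the identity and the full rotation survive. -/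
theorem Matrix.det_cyclic_bidiagonal {m : ℕ} [NeZero m] (a b : Fin m → ℂ) :
    (Matrix.of fun i j : Fin m => (if j = i then a i else 0) - (if j = i + 1 then b i else 0)).det
      = ∏ i, a i - ∏ i, b i := by
  obtain _ | _ | n := m
  · exact absurd rfl (NeZero.ne 0)
  · simp
  · set M : Matrix (Fin (n + 2)) (Fin (n + 2)) ℂ := Matrix.of fun i j =>
      (if j = i then a i else 0) - (if j = i + 1 then b i else 0) with hM
    have hne : ∀ i : Fin (n + 2), i + 1 ≠ i := fun i h => by simp at h
    have hrot : ∀ i : Fin (n + 2), finRotate (n + 2) i = i + 1 := fun i => finRotate_apply i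
    have h1r : (1 : Equiv.Perm (Fin (n + 2))) ≠ finRotate (n + 2) := fun h => by
      have := congrArg (fun σ => σ 0) h
      rw [hrot] at this
      exact hne 0 this.symm
    rw [← Matrix.det_transpose, Matrix.det_apply', ← Finset.sum_subset
      (Finset.subset_univ {1, finRotate (n + 2)})]
    · rw [Finset.sum_pair h1r, sign_finRotate]
      have e1 : ∏ i, Mᵀ ((1 : Equiv.Perm (Fin (n + 2))) i) i = ∏ i, a i := by
        refine Finset.prod_congr rfl fun i _ => ?_
        simp [hM, (hne i).symm]
      have e2 : ∏ i, Mᵀ (finRotate (n + 2) i) i = (-1) ^ (n + 2) * ∏ i, b i := by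
        have : ∀ i, Mᵀ (finRotate (n + 2) i) i = -1 * b i := fun i => by
          rw [hrot]
          simp [hM]
        rw [Finset.prod_congr rfl fun i _ => this i, Finset.prod_mul_distrib]
        simp
      rw [e1, e2, Equiv.Perm.sign_one]
      push_cast
      -- The sign of the rotation and the signs of the entries -b i combine to -1 for every size.
      have e3 : ((-1 : ℂ)) ^ (n + 1) * ((-1) ^ (n + 2) * ∏ i, b i) = - ∏ i, b i := by
        rw [← mul_assoc, ← pow_add, Odd.neg_one_pow ⟨n + 1, by omega⟩]
        ring
      rw [e3]
      ring
    · intro σ _ hσ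
      have : ∃ i, σ i ≠ i ∧ σ i ≠ i + 1 := by
        by_contra! hcon
        refine hσ ?_
        by_cases h : ∃ i, σ i = i + 1
        · have := Fin.forall_of_exists_add_one h fun i hi => by
            by_contra h2
            have h3 : σ (i + 1) = i + 1 := by
              by_contra h4
              exact h2 (hcon _ h4)
            exact hne i (σ.injective (h3.trans hi.symm))
          have h5 : σ = finRotate (n + 2) := Equiv.ext fun i => by rw [this i, hrot]
          simp [h5]
        · push Not at h
          have h5 : σ = 1 := Equiv.ext fun i => by
            by_contra h4
            exact h i (hcon i h4)
          simp [h5]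
      obtain ⟨i, h1, h2⟩ := this
      rw [Finset.prod_eq_zero (Finset.mem_univ i), mul_zero]
      simp [hM, h1, h2]

variable {m N : ℕ} [NeZero m]

/-- The origin of the Vandermonde factor: going around the cycle multiplies the diagonal entries,
and only the eigenvalues of the product M₁⋯M_m remain. -/
theorem det_cyclicDifference (d d' : Fin m → ℂ) :
    LinearMap.det (cyclicDifference d d') = ∏ i, d' i - ∏ i, d i := by
  rw [← LinearMap.det_toMatrix', ← Matrix.det_cyclic_bidiagonal d' d]
  congr 1
  ext i j
  rw [LinearMap.toMatrix'_apply, Matrix.of_apply]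
  change (Pi.single j (1 : ℂ) : Fin m → ℂ) i * d' i
    - d i * (Pi.single j (1 : ℂ) : Fin m → ℂ) (i + 1) = _
  simp only [Pi.single_apply, eq_comm (b := j)]
  congr 1 <;> split_ifs <;> simp

/-- The eigenvalue belonging to given radial and angular coordinates. -/
noncomputable def polarEigenvalue (γ : Fin m → ℝ) (y : ℝ × (Fin m → ℝ)) : ℂ :=
  ∏ i, diagEntry γ y i

/-- The density of the radial and angular coordinates of one eigenvalue. -/
noncomputable def polarDensity (γ : Fin m → ℝ) (y : ℝ × (Fin m → ℝ)) : ℝ :=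
  √(∑ i, radialDeriv (γ i) y.1 ^ 2) * ∏ i, radialMap (γ i) y.1

theorem det_radialScale (γ : Fin m → ℝ) (y : ℝ × (Fin m → ℝ)) :
    LinearMap.det (radialScale γ y.1) = polarDensity γ y := by
  rw [radialScale, LinearMap.det_prodMap, LinearMap.det_smul, LinearMap.det_id,
    Module.finrank_self, pow_one, mul_one, polarDensity]
  congr 1
  have := LinearMap.det_pi (R := ℝ) (M := ℝ) fun i => radialMap (γ i) y.1 • LinearMap.id
  simp only [LinearMap.det_smul, LinearMap.det_id, Module.finrank_self, pow_one, mul_one] at this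
  exact this

/-- The determinant of a complex map viewed over ℝ is the squared modulus, which gives |z_q - z_p|²
for each pair. -/
theorem det_scaleMap (γ : Fin m → ℝ) (y : Fin N → ℝ × (Fin m → ℝ)) :
    LinearMap.det (scaleMap γ y)
      = (∏ x : IndexPairs N, ‖polarEigenvalue γ (y x.1.2) - polarEigenvalue γ (y x.1.1)‖ ^ 2)
        * ∏ p, polarDensity γ (y p) := by
  rw [scaleMap, LinearMap.det_prodMap]
  congr 1
  · rw [LinearMap.det_pi]
    refine Finset.prod_congr rfl fun x _ => ?_
    rw [LinearMap.det_restrictScalars, det_cyclicDifference, Algebra.norm_complex_apply,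
      Complex.normSq_eq_norm_sq]
    rfl
  · rw [LinearMap.det_pi]
    exact Finset.prod_congr rfl fun p _ => det_radialScale γ (y p)

theorem continuous_det_frameMap :
    Continuous fun a : IndexPairs N → Fin m → ℂ => LinearMap.det (frameMap a) := by
  let b := Module.finBasis ℝ (ChartSpace m N)
  have h : ∀ a : IndexPairs N → Fin m → ℂ,
      LinearMap.det (frameMap a) = (LinearMap.toMatrix b b (frameMap a)).det := fun a =>
    (LinearMap.det_toMatrix b _).symm
  simp only [h]
  refine Continuous.matrix_det (continuous_matrix fun i j => ?_)
  simp only [LinearMap.toMatrix_apply]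
  have h1 : ∀ δ : ChartSpace m N,
      Continuous fun a : IndexPairs N → Fin m → ℂ => frameMap a δ := fun δ => by
    have h2 : ∀ i p q, Continuous fun a : IndexPairs N → Fin m → ℂ =>
        skewExpForm (fun x => a x i) (fun x => δ.1 x i) p q := fun i p q =>
      ((continuous_skewExpForm fun x => δ.1 x i).comp
        (continuous_pi fun x => by fun_prop)).matrix_elem p q
    refine Continuous.prodMk (continuous_pi fun x => continuous_pi fun i => h2 i _ _)
      (continuous_pi fun p => Continuous.prodMk continuous_const (continuous_pi fun i => ?_))
    exact (continuous_const.add (Complex.continuous_im.comp (h2 i p p))).sub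
      (Complex.continuous_im.comp (h2 (i + 1) p p))
  exact (LinearMap.continuous_of_finiteDimensional (b.coord i)).comp (h1 (b j))

theorem frameMap_zero : frameMap (0 : IndexPairs N → Fin m → ℂ) = LinearMap.id := by
  refine LinearMap.ext fun δ => ?_
  have h : ∀ i, skewExpForm (fun x => (0 : IndexPairs N → Fin m → ℂ) x i) (fun x => δ.1 x i)
      = skewMatrix fun x => δ.1 x i := fun i => skewExpForm_zero _
  refine Prod.ext (funext fun x => funext fun i => ?_) (funext fun p => Prod.ext rfl ?_)
  · change skewExpForm _ _ _ _ = _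
    rw [h]
    simp [skewMatrix, x.2]
  · funext i
    change _ + (skewExpForm _ _ _ _).im - (skewExpForm _ _ _ _).im = _
    rw [h, h]
    simp [skewMatrix]

theorem prod_indexPairs_sq (z : Fin N → ℂ) :
    ∏ x : IndexPairs N, ‖z x.1.2 - z x.1.1‖ ^ 2
      = ∏ x ∈ (Finset.univ : Finset (Fin N)).offDiag, ‖z x.1 - z x.2‖ := by
  have h1 : (Finset.univ : Finset (Fin N)).offDiag
      = (Finset.univ.filter fun x : Fin N × Fin N => x.1 < x.2)
        ∪ (Finset.univ.filter fun x : Fin N × Fin N => x.2 < x.1) := by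
    ext x
    simp [lt_or_lt_iff_ne]
  have hd : Disjoint (Finset.univ.filter fun x : Fin N × Fin N => x.1 < x.2)
      (Finset.univ.filter fun x : Fin N × Fin N => x.2 < x.1) := by
    rw [Finset.disjoint_filter]
    intro x _ h
    exact h.not_gt
  have h2 : ∀ G : Fin N × Fin N → ℝ, ∏ x ∈ Finset.univ.filter (fun x : Fin N × Fin N => x.1 < x.2), G x
      = ∏ x : IndexPairs N, G x.1 := fun G => Finset.prod_subtype _ (fun x => by simp) G
  have h3 : ∏ x ∈ Finset.univ.filter (fun x : Fin N × Fin N => x.2 < x.1), ‖z x.1 - z x.2‖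
      = ∏ x ∈ Finset.univ.filter (fun x : Fin N × Fin N => x.1 < x.2), ‖z x.2 - z x.1‖ :=
    Finset.prod_nbij' Prod.swap Prod.swap (by simp) (by simp) (by simp) (by simp) (by simp)
  rw [h1, Finset.prod_union hd, h3, h2, h2, ← Finset.prod_mul_distrib]
  refine Finset.prod_congr rfl fun x _ => ?_
  rw [norm_sub_rev, sq]

end ChartDeterminant

/-! ### Ambiguity of the normal form: permutations and phases -/

section Overlaps

variable {m N : ℕ} [NeZero m]

theorem norm_diagEntry {γ : Fin m → ℝ} {y : ℝ × (Fin m → ℝ)} (i : Fin m) :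
    ‖diagEntry γ y i‖ = |radialMap (γ i) y.1| := by
  rw [diagEntry, norm_mul, Complex.norm_exp_ofReal_mul_I, mul_one, Complex.norm_real,
    Real.norm_eq_abs]

theorem diagEntry_ne_zero {γ : Fin m → ℝ} (hγ : ∀ i, 0 ≤ γ i) {y : ℝ × (Fin m → ℝ)}
    (hy : 0 < y.1) (i : Fin m) : diagEntry γ y i ≠ 0 := by
  rw [← norm_ne_zero_iff, norm_diagEntry]
  exact (abs_pos.2 (radialMap_pos (hγ i) hy).ne').ne'

theorem diagEntry_injective {γ : Fin m → ℝ} (hγ : ∀ i, 0 ≤ γ i) {y y' : ℝ × (Fin m → ℝ)}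
    (hy : 0 < y.1) (hy' : 0 < y'.1) (hφ : ∀ i, y.2 i ∈ Set.Ico 0 (2 * Real.pi))
    (hφ' : ∀ i, y'.2 i ∈ Set.Ico 0 (2 * Real.pi)) (h : diagEntry γ y = diagEntry γ y') : y = y' := by
  have h1 : y.1 = y'.1 := by
    have h2 := norm_diagEntry_sq hγ y 0
    rw [h, norm_diagEntry_sq hγ y' 0] at h2
    have h3 : y.1 ^ 2 = y'.1 ^ 2 := by linarith
    exact (sq_eq_sq₀ hy.le hy'.le).1 h3
  refine Prod.ext h1 (funext fun i => ?_)
  have h4 := congrFun h i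
  rw [diagEntry, diagEntry, h1] at h4
  have h5 : (radialMap (γ i) y'.1 : ℂ) ≠ 0 := by
    exact_mod_cast (radialMap_pos (hγ i) hy').ne'
  have h6 := mul_left_cancel₀ h5 h4
  obtain ⟨n, hn⟩ := Complex.exp_eq_exp_iff_exists_int.1 h6
  have h7 : (y.2 i : ℂ) = y'.2 i + n * (2 * Real.pi) := by
    have : (y.2 i : ℂ) * Complex.I = (y'.2 i + n * (2 * Real.pi)) * Complex.I := by
      rw [hn]; ring
    exact mul_right_cancel₀ Complex.I_ne_zero this
  have h8 : y.2 i = y'.2 i + n * (2 * Real.pi) := by exact_mod_cast h7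
  have h9 := hφ i
  have h10 := hφ' i
  have hpi := Real.two_pi_pos
  have hn0 : n = 0 := by
    have e1 : (n : ℝ) < 1 := by
      by_contra hc
      push Not at hc
      nlinarith [h9.2, h10.1]
    have e2 : (-1 : ℝ) < n := by
      by_contra hc
      push Not at hc
      nlinarith [h9.1, h10.2]
    have e3 : n < 1 := by exact_mod_cast e1
    have e4 : -1 < n := by exact_mod_cast e2
    omega
  rw [h8, hn0]
  simp

theorem exists_phase_mem_Ico {t : ℂ} (ht : ‖t‖ = 1) :
    ∃ φ ∈ Set.Ico 0 (2 * Real.pi), Complex.exp ((φ : ℝ) * Complex.I) = t := by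
  refine ⟨toIcoMod Real.two_pi_pos 0 t.arg, by simpa using toIcoMod_mem_Ico Real.two_pi_pos 0 t.arg,
    ?_⟩
  have h1 : toIcoMod Real.two_pi_pos 0 t.arg
      = t.arg - toIcoDiv Real.two_pi_pos 0 t.arg • (2 * Real.pi) := rfl
  rw [h1]
  have h2 : ((t.arg - toIcoDiv Real.two_pi_pos 0 t.arg • (2 * Real.pi) : ℝ) : ℂ) * Complex.I
      = t.arg * Complex.I - (toIcoDiv Real.two_pi_pos 0 t.arg : ℤ) * (2 * Real.pi * Complex.I) := by
    push_cast
    simp only [zsmul_eq_mul]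
    ring
  rw [h2, Complex.exp_sub, Complex.exp_int_mul_two_pi_mul_I, div_one]
  have h3 := Complex.norm_mul_exp_arg_mul_I t
  rwa [ht, Complex.ofReal_one, one_mul] at h3

theorem cyclicMatrix_injective :
    Function.Injective (cyclicMatrix : (Fin m → Matrix (Fin N) (Fin N) ℂ) → _) := by
  intro B B' h
  funext i
  ext p q
  have := congrArg (fun a : MatrixSpace (Fin m × Fin N) => a ((i, p), (i + 1, q))) h
  simpa [cyclicMatrix_apply] using this

theorem star_mul_mem_unitaryGroup {U V : Matrix (Fin N) (Fin N) ℂ}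
    (hU : U ∈ Matrix.unitaryGroup (Fin N) ℂ) (hV : V ∈ Matrix.unitaryGroup (Fin N) ℂ) :
    Uᴴ * V ∈ Matrix.unitaryGroup (Fin N) ℂ := by
  refine mul_mem ?_ hV
  rw [← Matrix.star_eq_conjTranspose]
  exact Unitary.star_mem hU

variable {γ : Fin m → ℝ} {U U' : Fin m → Matrix (Fin N) (Fin N) ℂ}
  {y y' : Fin N → ℝ × (Fin m → ℝ)}

/-- Moving the unitary factors across, two representations agree exactly when the transitions G_i =
U'_i† U_i intertwine the diagonals: G_i D_i = D'_i G_{i+1}. -/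
theorem cyclicPoint_eq_iff (hU : ∀ i, U i ∈ Matrix.unitaryGroup (Fin N) ℂ)
    (hU' : ∀ i, U' i ∈ Matrix.unitaryGroup (Fin N) ℂ) :
    cyclicPoint γ U y = cyclicPoint γ U' y' ↔ ∀ i p q,
      ((U' i)ᴴ * U i) p q * diagEntry γ (y q) i
        = diagEntry γ (y' p) i * ((U' (i + 1))ᴴ * U (i + 1)) p q := by
  rw [cyclicPoint, cyclicPoint, cyclicMatrix_injective.eq_iff, funext_iff]
  refine forall_congr' fun i => ?_
  have h1 : (∀ p q, ((U' i)ᴴ * U i) p q * diagEntry γ (y q) i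
        = diagEntry γ (y' p) i * ((U' (i + 1))ᴴ * U (i + 1)) p q) ↔
      (U' i)ᴴ * U i * Matrix.diagonal (fun p => diagEntry γ (y p) i)
        = Matrix.diagonal (fun p => diagEntry γ (y' p) i) * ((U' (i + 1))ᴴ * U (i + 1)) := by
    rw [← Matrix.ext_iff]
    refine forall₂_congr fun p q => ?_
    rw [Matrix.mul_diagonal, Matrix.diagonal_mul]
  rw [h1]
  set D := Matrix.diagonal (fun p => diagEntry γ (y p) i)
  set D' := Matrix.diagonal (fun p => diagEntry γ (y' p) i)
  have e1 := conjTranspose_mul_of_mem_unitaryGroup (hU (i + 1))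
  have e2 := mul_conjTranspose_of_mem_unitaryGroup (hU (i + 1))
  have e3 := conjTranspose_mul_of_mem_unitaryGroup (hU' i)
  have e4 := mul_conjTranspose_of_mem_unitaryGroup (hU' i)
  constructor
  · intro h
    calc (U' i)ᴴ * U i * D = (U' i)ᴴ * (U i * D * (U (i + 1))ᴴ) * U (i + 1) := by
          simp only [Matrix.mul_assoc, e1, Matrix.mul_one]
      _ = (U' i)ᴴ * (U' i * D' * (U' (i + 1))ᴴ) * U (i + 1) := by rw [h]
      _ = ((U' i)ᴴ * U' i) * D' * ((U' (i + 1))ᴴ * U (i + 1)) := by simp only [Matrix.mul_assoc]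
      _ = _ := by rw [e3, Matrix.one_mul]
  · intro h
    calc U i * D * (U (i + 1))ᴴ = (U' i * (U' i)ᴴ) * U i * D * (U (i + 1))ᴴ := by
          rw [e4, Matrix.one_mul]
      _ = U' i * ((U' i)ᴴ * U i * D) * (U (i + 1))ᴴ := by simp only [Matrix.mul_assoc]
      _ = U' i * (D' * ((U' (i + 1))ᴴ * U (i + 1))) * (U (i + 1))ᴴ := by rw [h]
      _ = U' i * D' * (U' (i + 1))ᴴ * (U (i + 1) * (U (i + 1))ᴴ) := by
          simp only [Matrix.mul_assoc]
      _ = _ := by rw [e2, Matrix.mul_one]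

theorem sum_norm_sq_col_unitary {G : Matrix (Fin N) (Fin N) ℂ}
    (hG : G ∈ Matrix.unitaryGroup (Fin N) ℂ) (q : Fin N) : ∑ p, ‖G p q‖ ^ 2 = 1 := by
  have h1 := congrFun (congrFun (conjTranspose_mul_of_mem_unitaryGroup hG) q) q
  rw [Matrix.mul_apply, Matrix.one_apply_eq] at h1
  have h2 : ((∑ p, ‖G p q‖ ^ 2 : ℝ) : ℂ) = 1 := by
    rw [← h1]
    push_cast
    refine Finset.sum_congr rfl fun p _ => ?_
    rw [Matrix.conjTranspose_apply, RCLike.star_def, ← Complex.normSq_eq_conj_mul_self,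
      Complex.normSq_eq_norm_sq]
    push_cast
    rfl
  exact_mod_cast h2

/-- Two representations of the same matrix differ by monomial matrices with a common pattern. -/
theorem exists_perm_of_cyclicPoint_eq (hγ : ∀ i, 0 ≤ γ i)
    (hU : ∀ i, U i ∈ Matrix.unitaryGroup (Fin N) ℂ)
    (hU' : ∀ i, U' i ∈ Matrix.unitaryGroup (Fin N) ℂ)
    (hy' : ∀ p, 0 < (y' p).1)
    (hz : Function.Injective fun p => polarEigenvalue γ (y p))
    (hz' : Function.Injective fun p => polarEigenvalue γ (y' p))
    (h : cyclicPoint γ U y = cyclicPoint γ U' y') :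
    ∃ σ : Equiv.Perm (Fin N), ∀ i p q, p ≠ σ q → ((U' i)ᴴ * U i) p q = 0 := by
  rw [cyclicPoint_eq_iff hU hU'] at h
  set G : Fin m → Matrix (Fin N) (Fin N) ℂ := fun i => (U' i)ᴴ * U i with hG
  have hGu : ∀ i, G i ∈ Matrix.unitaryGroup (Fin N) ℂ := fun i =>
    star_mul_mem_unitaryGroup (hU' i) (hU i)
  -- As the diagonal entries are nonzero, a zero entry propagates around the cycle. At a given
  -- position either all transitions vanish or none does.
  have hstep : ∀ p q i, G i p q = 0 → G (i + 1) p q = 0 := by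
    intro p q i h0
    have h1 := h i p q
    change G i p q * _ = _ * G (i + 1) p q at h1
    rw [h0, zero_mul] at h1
    exact (mul_eq_zero.1 h1.symm).resolve_left (diagEntry_ne_zero hγ (hy' p) i)
  have hev : ∀ p q, (∃ i, G i p q ≠ 0) →
      polarEigenvalue γ (y q) = polarEigenvalue γ (y' p) := by
    intro p q hne
    have hall : ∀ i, G i p q ≠ 0 := by
      by_contra! hc
      obtain ⟨i, hi⟩ := hne
      exact hi (Fin.forall_of_exists_add_one hc (hstep p q) i)
    -- Multiplying the intertwining relations around the cycle cancels the product of the G's and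
    -- equates the eigenvalues.
    have h1 : (∏ i, G i p q) * polarEigenvalue γ (y q)
        = polarEigenvalue γ (y' p) * ∏ i, G (i + 1) p q := by
      rw [polarEigenvalue, polarEigenvalue, ← Finset.prod_mul_distrib, ← Finset.prod_mul_distrib]
      exact Finset.prod_congr rfl fun i _ => h i p q
    have h2 : ∏ i, G (i + 1) p q = ∏ i, G i p q :=
      Equiv.prod_comp (Equiv.addRight (1 : Fin m)) fun i => G i p q
    rw [h2, mul_comm] at h1
    exact mul_right_cancel₀ (Finset.prod_ne_zero_iff.2 fun i _ => hall i) h1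
  have hex : ∀ q, ∃ p, G 0 p q ≠ 0 := by
    intro q
    by_contra! hc
    have := sum_norm_sq_col_unitary (hGu 0) q
    simp [hc] at this
  choose σ hσ using hex
  have hσz : ∀ q, polarEigenvalue γ (y q) = polarEigenvalue γ (y' (σ q)) := fun q =>
    hev _ _ ⟨0, hσ q⟩
  have hinj : Function.Injective σ := fun q q' hqq => hz (by
    change polarEigenvalue γ (y q) = polarEigenvalue γ (y q')
    rw [hσz q, hσz q', hqq])
  refine ⟨Equiv.ofBijective σ (Finite.injective_iff_bijective.1 hinj), fun i p q hpq => ?_⟩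
  by_contra hne
  refine hpq (hz' ?_)
  change polarEigenvalue γ (y' p) = polarEigenvalue γ (y' (σ q))
  rw [← hσz q, hev p q ⟨i, hne⟩]

/-- A monomial unitary transition permutes the diagonal entries and multiplies them by phases, which
new angles absorb. Radii and eigenvalues are only permuted, since the phases cancel around the
cycle. -/
theorem exists_cyclicPoint_eq (hU : ∀ i, U i ∈ Matrix.unitaryGroup (Fin N) ℂ)
    (hU' : ∀ i, U' i ∈ Matrix.unitaryGroup (Fin N) ℂ) (σ : Equiv.Perm (Fin N))
    (hσ : ∀ i p q, p ≠ σ q → ((U' i)ᴴ * U i) p q = 0) (y : Fin N → ℝ × (Fin m → ℝ)) :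
    ∃ y' : Fin N → ℝ × (Fin m → ℝ), (∀ p, (y' (σ p)).1 = (y p).1) ∧
      (∀ p i, (y' p).2 i ∈ Set.Ico 0 (2 * Real.pi)) ∧
      (∀ p, polarEigenvalue γ (y' (σ p)) = polarEigenvalue γ (y p)) ∧
      cyclicPoint γ U y = cyclicPoint γ U' y' := by
  set G : Fin m → Matrix (Fin N) (Fin N) ℂ := fun i => (U' i)ᴴ * U i with hG
  have hGu : ∀ i, G i ∈ Matrix.unitaryGroup (Fin N) ℂ := fun i =>
    star_mul_mem_unitaryGroup (hU' i) (hU i)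
  have hn : ∀ i q, ‖G i (σ q) q‖ = 1 := by
    intro i q
    have h1 := sum_norm_sq_col_unitary (hGu i) q
    rw [Finset.sum_eq_single (σ q) (fun p _ hp => by
      have h0 : G i p q = 0 := hσ i p q hp
      rw [h0]; simp) (by simp)] at h1
    exact (pow_eq_one_iff_of_nonneg (norm_nonneg _) two_ne_zero).1 h1
  have hnc : ∀ i q, (starRingEnd ℂ) (G i (σ q) q) * G i (σ q) q = 1 := fun i q => by
    rw [← Complex.normSq_eq_conj_mul_self, Complex.normSq_eq_norm_sq, hn]
    simp
  have ht : ∀ i q, ‖G i (σ q) q * Complex.exp ((y q).2 i * Complex.I)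
      * (starRingEnd ℂ) (G (i + 1) (σ q) q)‖ = 1 := fun i q => by
    rw [norm_mul, norm_mul, Complex.norm_exp_ofReal_mul_I, RCLike.norm_conj, hn, hn]
    norm_num
  choose φ hφ hφe using fun i q => exists_phase_mem_Ico (ht i q)
  have hd : ∀ p i, diagEntry γ ((y p).1, fun i => φ i p) i
      = G i (σ p) p * diagEntry γ (y p) i * (starRingEnd ℂ) (G (i + 1) (σ p) p) := by
    intro p i
    rw [diagEntry, diagEntry, hφe]
    ring
  refine ⟨fun p => ((y (σ.symm p)).1, fun i => φ i (σ.symm p)), fun p => by simp,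
    fun p i => hφ i _, fun p => ?_, ?_⟩
  · simp only [Equiv.symm_apply_apply, polarEigenvalue]
    have hshift : ∏ i, (starRingEnd ℂ) (G (i + 1) (σ p) p) = ∏ i, (starRingEnd ℂ) (G i (σ p) p) :=
      Equiv.prod_comp (Equiv.addRight (1 : Fin m)) fun i => (starRingEnd ℂ) (G i (σ p) p)
    rw [Finset.prod_congr rfl fun i _ => hd p i, Finset.prod_mul_distrib, Finset.prod_mul_distrib,
      hshift]
    rw [mul_right_comm, ← Finset.prod_mul_distrib, Finset.prod_eq_one, one_mul]
    intro i _
    rw [mul_comm, hnc]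
  · rw [cyclicPoint_eq_iff hU hU']
    intro i p q
    by_cases hpq : p = σ q
    · subst hpq
      simp only [Equiv.symm_apply_apply]
      rw [hd]
      change G i (σ q) q * _ = _ * _ * _ * G (i + 1) (σ q) q
      rw [mul_assoc, hnc, mul_one]
    · rw [hσ i p q hpq, hσ (i + 1) p q hpq, zero_mul, mul_zero]

end Overlaps

/-! ### Integration in one chart -/

section ChartIntegral

variable {m N : ℕ} [NeZero m]

instance isAddHaarMeasure_polar :
    (volume : Measure (ℝ × (Fin m → ℝ))).IsAddHaarMeasure := by
  rw [Measure.volume_eq_prod]; infer_instance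

instance isAddHaarMeasure_chartSpace : (volume : Measure (ChartSpace m N)).IsAddHaarMeasure := by
  haveI : (volume : Measure (IndexPairs N → Fin m → ℂ)).IsAddHaarMeasure :=
    Measure.pi.isAddHaarMeasure _
  haveI : (volume : Measure (Fin N → ℝ × (Fin m → ℝ))).IsAddHaarMeasure :=
    Measure.pi.isAddHaarMeasure _
  rw [Measure.volume_eq_prod]
  exact Measure.prod.instIsAddHaarMeasure _ _

/-- Radial and angular coordinates of an eigenvalue in `D`. -/
def polarDomain (γ : Fin m → ℝ) (D : Set ℂ) : Set (ℝ × (Fin m → ℝ)) :=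
  {y | 0 < y.1 ∧ (∀ i, y.2 i ∈ Set.Ico 0 (2 * Real.pi)) ∧ polarEigenvalue γ y ∈ D}

/-- Coordinates of `N` distinct eigenvalues in `D`. -/
def regularDomain (γ : Fin m → ℝ) (D : Set ℂ) (N : ℕ) : Set (Fin N → ℝ × (Fin m → ℝ)) :=
  {y | (∀ p, y p ∈ polarDomain γ D) ∧ Function.Injective fun p => polarEigenvalue γ (y p)}

theorem continuous_diagEntry {γ : Fin m → ℝ} (hγ : ∀ i, 0 ≤ γ i) (i : Fin m) :
    Continuous fun y => diagEntry γ y i := by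
  have h1 := (contDiff_radialMap (hγ i)).continuous
  unfold diagEntry
  fun_prop

theorem continuous_polarEigenvalue {γ : Fin m → ℝ} (hγ : ∀ i, 0 ≤ γ i) :
    Continuous (polarEigenvalue γ) :=
  continuous_finsetProd _ fun i _ => continuous_diagEntry hγ i

theorem continuous_polarDensity {γ : Fin m → ℝ} (hγ : ∀ i, 0 ≤ γ i) :
    Continuous (polarDensity γ) := by
  unfold polarDensity
  refine Continuous.mul ?_ (continuous_finsetProd _ fun i _ =>
    (contDiff_radialMap (hγ i)).continuous.comp continuous_fst)
  exact (continuous_finsetSum _ fun i _ =>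
    ((continuous_radialDeriv (hγ i)).comp continuous_fst).pow 2).sqrt

theorem polarDensity_pos {γ : Fin m → ℝ} (hγ : ∀ i, 0 ≤ γ i) {y : ℝ × (Fin m → ℝ)}
    (hy : 0 < y.1) : 0 < polarDensity γ y := by
  refine mul_pos (Real.sqrt_pos.2 ?_) (Finset.prod_pos fun i _ => radialMap_pos (hγ i) hy)
  exact Finset.sum_pos (fun i _ => pow_pos (radialDeriv_pos (hγ i) hy) 2)
    ⟨0, Finset.mem_univ _⟩

theorem measurableSet_polarDomain {γ : Fin m → ℝ} (hγ : ∀ i, 0 ≤ γ i) {D : Set ℂ}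
    (hD : MeasurableSet D) : MeasurableSet (polarDomain γ D) := by
  refine (measurableSet_lt measurable_const measurable_fst).inter (MeasurableSet.inter ?_ ?_)
  · change MeasurableSet {y : ℝ × (Fin m → ℝ) | ∀ i, y.2 i ∈ Set.Ico 0 (2 * Real.pi)}
    rw [Set.ofPred_forall]
    exact MeasurableSet.iInter fun i =>
      (measurable_pi_apply i).comp measurable_snd measurableSet_Ico
  · exact (continuous_polarEigenvalue hγ).measurable hD

theorem measurableSet_regularDomain {γ : Fin m → ℝ} (hγ : ∀ i, 0 ≤ γ i) {D : Set ℂ}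
    (hD : MeasurableSet D) : MeasurableSet (regularDomain γ D N) := by
  have hz : ∀ p : Fin N, Continuous fun y : Fin N → ℝ × (Fin m → ℝ) => polarEigenvalue γ (y p) :=
    fun p => (continuous_polarEigenvalue hγ).comp (continuous_apply p)
  refine MeasurableSet.inter ?_ ?_
  · change MeasurableSet {y : Fin N → ℝ × (Fin m → ℝ) | ∀ p, y p ∈ polarDomain γ D}
    rw [Set.ofPred_forall]
    exact MeasurableSet.iInter fun p => measurable_pi_apply p (measurableSet_polarDomain hγ hD)
  · have : {y : Fin N → ℝ × (Fin m → ℝ) | Function.Injective fun p => polarEigenvalue γ (y p)}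
        = ⋂ p, ⋂ q, {y | polarEigenvalue γ (y p) = polarEigenvalue γ (y q) → p = q} := by
      ext y
      simp [Function.Injective]
    change MeasurableSet {y : Fin N → ℝ × (Fin m → ℝ) |
      Function.Injective fun p => polarEigenvalue γ (y p)}
    rw [this]
    refine MeasurableSet.iInter fun p => MeasurableSet.iInter fun q => ?_
    by_cases hpq : p = q
    · simp [hpq]
    · simp only [hpq, imp_false]
      exact (isOpen_ne_fun (hz p) (hz q)).measurableSet

/-- The determinant of `frameMap` is continuous and equals 1 at the origin, so a small ball keeps it
positive. Boundedness of the domain later makes its integral finite. -/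
theorem exists_chart_neighbourhood (m N : ℕ) [NeZero m] :
    ∃ O : Set (IndexPairs N → ℂ), IsOpen O ∧ 0 ∈ O ∧
      (∀ a ∈ O, ∀ a' ∈ O, ∀ σ : Fin N → Fin N,
        (∀ p q, p ≠ σ q → ((skewExp a')ᴴ * skewExp a) p q = 0) → a = a') ∧
      ∃ ε, ∀ a : IndexPairs N → Fin m → ℂ, (∀ i, (fun x => a x i) ∈ O) →
        ‖a‖ < ε ∧ 0 < LinearMap.det (frameMap a) := by
  obtain ⟨O, hO, h0, hinj⟩ := skewExp_chart N
  have h1 : {a : IndexPairs N → Fin m → ℂ | 0 < LinearMap.det (frameMap a)} ∈ 𝓝 0 := by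
    refine (isOpen_lt continuous_const continuous_det_frameMap).mem_nhds ?_
    change 0 < LinearMap.det (frameMap (0 : IndexPairs N → Fin m → ℂ))
    rw [frameMap_zero, LinearMap.det_id]
    exact one_pos
  obtain ⟨ε, hε, hball⟩ := Metric.mem_nhds_iff.1 h1
  refine ⟨O ∩ Metric.ball 0 ε, hO.inter Metric.isOpen_ball, ⟨h0, by simpa using hε⟩,
    fun a ha a' ha' => hinj a ha.1 a' ha'.1, ε, fun a ha => ?_⟩
  have h2 : ‖a‖ < ε := by
    rw [pi_norm_lt_iff hε]
    intro x
    rw [pi_norm_lt_iff hε]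
    intro i
    have h3 := (ha i).2
    rw [mem_ball_zero_iff, pi_norm_lt_iff hε] at h3
    exact h3 x
  exact ⟨h2, hball (mem_ball_zero_iff.2 h2)⟩

/-- Tuples of parameters in `O`. -/
def tupleDomain (m : ℕ) (O : Set (IndexPairs N → ℂ)) : Set (IndexPairs N → Fin m → ℂ) :=
  {a | ∀ i, (fun x => a x i) ∈ O}

theorem isOpen_tupleDomain {O : Set (IndexPairs N → ℂ)} (hO : IsOpen O) :
    IsOpen (tupleDomain m O) := by
  rw [tupleDomain, Set.ofPred_forall]
  exact isOpen_iInter_of_finite fun i => hO.preimage (continuous_pi fun x => by fun_prop)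

variable {γ : Fin m → ℝ} {D : Set ℂ} {O : Set (IndexPairs N → ℂ)}
  {k : Fin m → Matrix (Fin N) (Fin N) ℂ}

/-- Equal points have monomial transitions; the choice of O forces equal unitary parameters, and
then the diagonal entries agree one by one. -/
theorem cyclicChart_injOn (hγ : ∀ i, 0 ≤ γ i) (hk : ∀ i, k i ∈ Matrix.unitaryGroup (Fin N) ℂ)
    (hinj : ∀ a ∈ O, ∀ a' ∈ O, ∀ σ : Fin N → Fin N,
      (∀ p q, p ≠ σ q → ((skewExp a')ᴴ * skewExp a) p q = 0) → a = a') :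
    Set.InjOn (cyclicChart γ k) (tupleDomain m O ×ˢ regularDomain γ D N) := by
  rintro ⟨a, y⟩ ⟨ha, hy⟩ ⟨a', y'⟩ ⟨ha', hy'⟩ h
  have hU : ∀ (b : IndexPairs N → Fin m → ℂ) i, k i * unitaryTuple b i
      ∈ Matrix.unitaryGroup (Fin N) ℂ := fun b i => mul_mem (hk i) (unitaryTuple_mem b i)
  have hkk : ∀ (b b' : IndexPairs N → Fin m → ℂ) i, (k i * unitaryTuple b' i)ᴴ
      * (k i * unitaryTuple b i) = (unitaryTuple b' i)ᴴ * unitaryTuple b i := fun b b' i => by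
    rw [Matrix.conjTranspose_mul, Matrix.mul_assoc, ← Matrix.mul_assoc (k i)ᴴ,
      conjTranspose_mul_of_mem_unitaryGroup (hk i), Matrix.one_mul]
  obtain ⟨σ, hσ⟩ := exists_perm_of_cyclicPoint_eq hγ (hU a) (hU a')
    (fun p => (hy'.1 p).1) hy.2 hy'.2 h
  have haa : a = a' := by
    have h1 : ∀ i, (fun x => a x i) = fun x => a' x i := fun i =>
      hinj _ (ha i) _ (ha' i) σ fun p q hpq => by
        have := hσ i p q hpq
        rw [hkk] at this
        exact this
    funext x i
    exact congrFun (h1 i) x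
  subst haa
  have h2 := (cyclicPoint_eq_iff (hU a) (hU a)).1 h
  refine Prod.ext rfl (funext fun p => diagEntry_injective hγ (hy.1 p).1 (hy'.1 p).1 (hy.1 p).2.1
    (hy'.1 p).2.1 (funext fun i => ?_))
  have h3 := h2 i p p
  simpa only [conjTranspose_mul_of_mem_unitaryGroup (hU a _), Matrix.one_apply_eq, one_mul,
    mul_one] using h3

/-- The joint density of the eigenvalues, integrated against a function of the eigenvalues. -/
noncomputable def polarIntegral (γ : Fin m → ℝ) (D : Set ℂ) (G : (Fin N → ℂ) → ℝ≥0∞) : ℝ≥0∞ :=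
  ∫⁻ y in regularDomain γ D N, ENNReal.ofReal (LinearMap.det (scaleMap γ y))
    * G fun p => polarEigenvalue γ (y p)

theorem det_scaleMap_pos (hγ : ∀ i, 0 ≤ γ i) {y : Fin N → ℝ × (Fin m → ℝ)}
    (hy : y ∈ regularDomain γ D N) : 0 < LinearMap.det (scaleMap γ y) := by
  rw [det_scaleMap]
  refine mul_pos (Finset.prod_pos fun x _ => pow_pos (norm_pos_iff.2 (sub_ne_zero.2 fun h => ?_)) 2)
    (Finset.prod_pos fun p _ => polarDensity_pos hγ (hy.1 p).1)
  exact x.2.ne' (hy.2 h)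

theorem continuous_det_scaleMap (hγ : ∀ i, 0 ≤ γ i) :
    Continuous fun y : Fin N → ℝ × (Fin m → ℝ) => LinearMap.det (scaleMap γ y) := by
  simp only [det_scaleMap]
  have hz : ∀ p : Fin N, Continuous fun y : Fin N → ℝ × (Fin m → ℝ) => polarEigenvalue γ (y p) :=
    fun p => (continuous_polarEigenvalue hγ).comp (continuous_apply p)
  exact (continuous_finsetProd _ fun x _ => ((hz _).sub (hz _)).norm.pow 2).mul
    (continuous_finsetProd _ fun p _ => (continuous_polarDensity hγ).comp (continuous_apply p))

/-- The Jacobian is a function of the unitary coordinates times a function of the eigenvalue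
coordinates. The integral of an eigenvalue function therefore splits off a constant. -/
theorem lintegral_cyclicChart_image (hγ : ∀ i, 0 ≤ γ i) (hD : MeasurableSet D)
    (hk : ∀ i, k i ∈ Matrix.unitaryGroup (Fin N) ℂ)
    (hinj : ∀ a ∈ O, ∀ a' ∈ O, ∀ σ : Fin N → Fin N,
      (∀ p q, p ≠ σ q → ((skewExp a')ᴴ * skewExp a) p q = 0) → a = a')
    (hdet : ∀ a ∈ tupleDomain m O, 0 < LinearMap.det (frameMap a))
    {c : ℝ≥0∞} (hc : ∀ s : Set (ChartSpace m N),
      Measure.hausdorffMeasure (Module.finrank ℝ (ChartSpace m N) : ℝ) (chartEmbedding m N '' s)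
        = c * volume s)
    {A : Set (IndexPairs N → Fin m → ℂ)} (hA : MeasurableSet A) (hAO : A ⊆ tupleDomain m O)
    {F : MatrixSpace (Fin m × Fin N) → ℝ≥0∞} (hF : Measurable F)
    {G : (Fin N → ℂ) → ℝ≥0∞} (hG : Measurable G)
    (hFG : ∀ a, ∀ y ∈ regularDomain γ D N,
      F (cyclicChart γ k (a, y)) = G fun p => polarEigenvalue γ (y p)) :
    ∫⁻ a in cyclicChart γ k '' (A ×ˢ regularDomain γ D N), F a
        ∂(Measure.hausdorffMeasure (Module.finrank ℝ (ChartSpace m N) : ℝ))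
      = (∫⁻ a in A, c * ENNReal.ofReal (LinearMap.det (frameMap a))) * polarIntegral γ D G := by
  have hdetT : ∀ v : ChartSpace m N, LinearMap.det ((scaleMap γ v.2).comp (frameMap v.1))
      = LinearMap.det (scaleMap γ v.2) * LinearMap.det (frameMap v.1) := fun v =>
    LinearMap.det_comp _ _
  have hcont1 : Continuous fun v : ChartSpace m N => LinearMap.det (scaleMap γ v.2) :=
    (continuous_det_scaleMap hγ).comp continuous_snd
  have hcont2 : Continuous fun v : ChartSpace m N => LinearMap.det (frameMap v.1) :=
    continuous_det_frameMap.comp continuous_fst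
  have hms : MeasurableSet (A ×ˢ regularDomain γ D N) := hA.prod (measurableSet_regularDomain hγ hD)
  have hCD := contDiff_cyclicChart hγ k
  have hpos : ∀ v ∈ A ×ˢ regularDomain γ D N,
      0 < LinearMap.det (scaleMap γ v.2) ∧ 0 < LinearMap.det (frameMap v.1) := fun v hv =>
    ⟨det_scaleMap_pos hγ hv.2, hdet _ (hAO hv.1)⟩
  rw [lintegral_hausdorffMeasure_image (e := chartEmbedding m N) (volume : Measure (ChartSpace m N))
    (f := cyclicChart γ k) (f' := fderiv ℝ (cyclicChart γ k))
    (T := fun v => (scaleMap γ v.2).comp (frameMap v.1)) (chartEmbedding_injective m N) hc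
    hCD.continuous.measurable
    (fun v _ => hCD.contDiffAt.hasStrictFDerivAt one_ne_zero)
    (fun v _ δ => norm_fderiv_cyclicChart hγ hk v δ)
    (by simp only [hdetT]; exact (hcont1.mul hcont2).continuousOn)
    (fun v hv => by rw [hdetT]; exact (mul_pos (hpos v hv).1 (hpos v hv).2).ne') hms
    ((cyclicChart_injOn hγ hk hinj).mono (Set.prod_mono hAO subset_rfl)) hF]
  have hzm : Measurable fun y : Fin N → ℝ × (Fin m → ℝ) => fun p => polarEigenvalue γ (y p) :=
    measurable_pi_lambda _ fun p =>
      ((continuous_polarEigenvalue hγ).comp (continuous_apply p)).measurable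
  have h1 : ∫⁻ v in A ×ˢ regularDomain γ D N, c * ENNReal.ofReal
        |LinearMap.det ((scaleMap γ v.2).comp (frameMap v.1))| * F (cyclicChart γ k v)
      = ∫⁻ v in A ×ˢ regularDomain γ D N, (c * ENNReal.ofReal (LinearMap.det (frameMap v.1)))
        * (ENNReal.ofReal (LinearMap.det (scaleMap γ v.2))
          * G fun p => polarEigenvalue γ (v.2 p)) := by
    refine setLIntegral_congr_fun hms fun v hv => ?_
    obtain ⟨e1, e2⟩ := hpos v hv
    rw [hdetT, abs_of_pos (mul_pos e1 e2), ENNReal.ofReal_mul e1.le]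
    have := hFG v.1 v.2 hv.2
    rw [← this]
    ring
  rw [h1, polarIntegral, Measure.volume_eq_prod, ← Measure.prod_restrict]
  refine lintegral_prod_mul (μ := volume.restrict A) (ν := volume.restrict (regularDomain γ D N))
    (f := fun a => c * ENNReal.ofReal (LinearMap.det (frameMap a)))
    (g := fun y => ENNReal.ofReal (LinearMap.det (scaleMap γ y))
      * G fun p => polarEigenvalue γ (y p)) ?_ ?_
  · exact (continuous_det_frameMap.measurable.ennreal_ofReal.const_mul c).aemeasurable
  · exact ((continuous_det_scaleMap hγ).measurable.ennreal_ofReal.mul (hG.comp hzm)).aemeasurable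

end ChartIntegral

/-! ### Patching the charts -/

section Globalize

variable {m N : ℕ} [NeZero m] {γ : Fin m → ℝ} {D : Set ℂ} {O : Set (IndexPairs N → ℂ)}

/-- Whether a point of one chart lies in another chart does not depend on the eigenvalues. -/
theorem cyclicChart_mem_image_iff (hγ : ∀ i, 0 ≤ γ i) {k k' : Fin m → Matrix (Fin N) (Fin N) ℂ}
    (hk : ∀ i, k i ∈ Matrix.unitaryGroup (Fin N) ℂ)
    (hk' : ∀ i, k' i ∈ Matrix.unitaryGroup (Fin N) ℂ) {a : IndexPairs N → Fin m → ℂ}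
    {y y₂ : Fin N → ℝ × (Fin m → ℝ)} (hy : y ∈ regularDomain γ D N)
    (hy₂ : y₂ ∈ regularDomain γ D N)
    (h : cyclicChart γ k (a, y) ∈ cyclicChart γ k' '' (tupleDomain m O ×ˢ regularDomain γ D N)) :
    cyclicChart γ k (a, y₂) ∈ cyclicChart γ k' '' (tupleDomain m O ×ˢ regularDomain γ D N) := by
  obtain ⟨⟨a', y'⟩, ⟨ha', hy'⟩, h⟩ := h
  have hU : ∀ i, k i * unitaryTuple a i ∈ Matrix.unitaryGroup (Fin N) ℂ := fun i =>
    mul_mem (hk i) (unitaryTuple_mem a i)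
  have hU' : ∀ i, k' i * unitaryTuple a' i ∈ Matrix.unitaryGroup (Fin N) ℂ := fun i =>
    mul_mem (hk' i) (unitaryTuple_mem a' i)
  obtain ⟨σ, hσ⟩ := exists_perm_of_cyclicPoint_eq hγ hU hU' (fun p => (hy'.1 p).1) hy.2 hy'.2 h.symm
  obtain ⟨y₃, h1, h2, h3, h4⟩ := exists_cyclicPoint_eq (γ := γ) hU hU' σ hσ y₂
  refine ⟨(a', y₃), ⟨ha', fun p => ⟨?_, h2 p, ?_⟩, ?_⟩, h4.symm⟩
  · rw [← σ.apply_symm_apply p, h1]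
    exact (hy₂.1 _).1
  · rw [← σ.apply_symm_apply p, h3]
    exact (hy₂.1 _).2.2
  · have h5 : (fun p => polarEigenvalue γ (y₃ p))
        = (fun p => polarEigenvalue γ (y₂ p)) ∘ σ.symm := by
      funext p
      rw [Function.comp_apply, ← h3, σ.apply_symm_apply]
    rw [h5]
    exact hy₂.2.comp σ.symm.injective

/-- Induction on the charts. The part of a new chart outside the earlier ones is again a product
with the full eigenvalue domain, so each new piece contributes a constant multiple of the same
integral. -/
theorem exists_lintegral_iUnion_cyclicChart (hγ : ∀ i, 0 ≤ γ i) (hD : MeasurableSet D)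
    (hO : IsOpen O) (h0 : 0 ∈ O)
    (hinj : ∀ a ∈ O, ∀ a' ∈ O, ∀ σ : Fin N → Fin N,
      (∀ p q, p ≠ σ q → ((skewExp a')ᴴ * skewExp a) p q = 0) → a = a')
    {ε : ℝ} (hdet : ∀ a ∈ tupleDomain m O, ‖a‖ < ε ∧ 0 < LinearMap.det (frameMap a))
    (hne : (regularDomain γ D N).Nonempty) (L : Finset (Fin m → Matrix (Fin N) (Fin N) ℂ))
    (hL : ∀ k ∈ L, ∀ i, k i ∈ Matrix.unitaryGroup (Fin N) ℂ) :
    ∃ C : ℝ≥0∞, C ≠ ⊤ ∧ (L.Nonempty → C ≠ 0) ∧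
      ∀ (F : MatrixSpace (Fin m × Fin N) → ℝ≥0∞) (G : (Fin N → ℂ) → ℝ≥0∞), Measurable F →
        Measurable G → (∀ U y, (∀ i, U i ∈ Matrix.unitaryGroup (Fin N) ℂ) →
          F (cyclicPoint γ U y) = G fun p => polarEigenvalue γ (y p)) →
        ∫⁻ a in ⋃ k ∈ L, cyclicChart γ k '' (tupleDomain m O ×ˢ regularDomain γ D N), F a
            ∂(Measure.hausdorffMeasure (Module.finrank ℝ (ChartSpace m N) : ℝ))
          = C * polarIntegral γ D G := by
  classical
  obtain ⟨c, hc0, hct, hc⟩ := exists_hausdorffMeasure_image_linearMap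
    (volume : Measure (ChartSpace m N)) (chartEmbedding m N) (chartEmbedding_injective m N)
  haveI : ProperSpace (ChartSpace m N) := FiniteDimensional.proper_real _
  haveI : SecondCountableTopology (ChartSpace m N) := secondCountable_of_proper
  haveI : PolishSpace (ChartSpace m N) := by constructor
  haveI : (volume : Measure (IndexPairs N → Fin m → ℂ)).IsAddHaarMeasure :=
    Measure.pi.isAddHaarMeasure _
  have hTm : MeasurableSet (tupleDomain m O) := (isOpen_tupleDomain hO).measurableSet
  have hRm := measurableSet_regularDomain (N := N) hγ hD
  have hXm : ∀ k : Fin m → Matrix (Fin N) (Fin N) ℂ,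
      (∀ i, k i ∈ Matrix.unitaryGroup (Fin N) ℂ) →
      MeasurableSet (cyclicChart γ k '' (tupleDomain m O ×ˢ regularDomain γ D N)) := fun k hk =>
    (hTm.prod hRm).image_of_continuousOn_injOn (contDiff_cyclicChart hγ k).continuous.continuousOn
      (cyclicChart_injOn hγ hk hinj)
  have hdm : Measurable fun a : IndexPairs N → Fin m → ℂ =>
      c * ENNReal.ofReal (LinearMap.det (frameMap a)) :=
    continuous_det_frameMap.measurable.ennreal_ofReal.const_mul c
  have hfin : ∫⁻ a in tupleDomain m O, c * ENNReal.ofReal (LinearMap.det (frameMap a)) ≠ ⊤ := by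
    have hb := (isCompact_closedBall (0 : IndexPairs N → Fin m → ℂ) ε)
    obtain ⟨B, hB⟩ := hb.bddAbove_image continuous_det_frameMap.continuousOn
    have hsub : tupleDomain m O ⊆ Metric.closedBall 0 ε := fun a ha => by
      rw [mem_closedBall_zero_iff]
      exact (hdet a ha).1.le
    refine ne_top_of_le_ne_top (b := c * ENNReal.ofReal B * volume (tupleDomain m O)) ?_ ?_
    · exact ENNReal.mul_ne_top (ENNReal.mul_ne_top hct ENNReal.ofReal_ne_top)
        ((measure_mono hsub).trans_lt hb.measure_lt_top).ne
    · rw [← setLIntegral_const]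
      refine setLIntegral_mono measurable_const fun a ha => ?_
      gcongr
      exact hB ⟨a, hsub ha, rfl⟩
  have hpos : ∫⁻ a in tupleDomain m O, c * ENNReal.ofReal (LinearMap.det (frameMap a)) ≠ 0 := by
    rw [← bot_eq_zero, ← bot_lt_iff_ne_bot, bot_eq_zero, setLIntegral_pos_iff hdm]
    have h1 : tupleDomain m O ⊆ Function.support fun a : IndexPairs N → Fin m → ℂ =>
        c * ENNReal.ofReal (LinearMap.det (frameMap a)) := fun a ha =>
      mul_ne_zero hc0 (by simpa using (hdet a ha).2)
    rw [Set.inter_eq_self_of_subset_right h1]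
    exact (isOpen_tupleDomain hO).measure_pos _ ⟨0, fun i => h0⟩
  obtain ⟨y₀, hy₀⟩ := hne
  induction L using Finset.induction_on with
  | empty => exact ⟨0, ENNReal.zero_ne_top, fun h => absurd h Finset.not_nonempty_empty,
      fun F G _ _ _ => by simp⟩
  | insert k L hkL ih =>
    obtain ⟨C', hC't, hC'0, hC'⟩ := ih fun k hk => hL k (Finset.mem_insert_of_mem hk)
    have hk := hL k (Finset.mem_insert_self k L)
    set Y := ⋃ k ∈ L, cyclicChart γ k '' (tupleDomain m O ×ˢ regularDomain γ D N) with hY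
    have hYm : MeasurableSet Y := Finset.measurableSet_biUnion L fun k hk =>
      hXm k (hL k (Finset.mem_insert_of_mem hk))
    -- Membership in earlier charts does not depend on y, so one test configuration y₀ decides.
    set A := {a ∈ tupleDomain m O | cyclicChart γ k (a, y₀) ∉ Y} with hA
    have hcont : Continuous fun a => cyclicChart γ k (a, y₀) :=
      (contDiff_cyclicChart hγ k).continuous.comp (by fun_prop)
    have hAm : MeasurableSet A := hTm.inter (hcont.measurable hYm.compl)
    have hpiece : cyclicChart γ k '' (tupleDomain m O ×ˢ regularDomain γ D N) \ Y
        = cyclicChart γ k '' (A ×ˢ regularDomain γ D N) := by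
      have hiff : ∀ a, ∀ y ∈ regularDomain γ D N, ∀ y₂ ∈ regularDomain γ D N,
          cyclicChart γ k (a, y) ∈ Y → cyclicChart γ k (a, y₂) ∈ Y := by
        intro a y hy y₂ hy₂ h
        obtain ⟨k', hk', h⟩ := Set.mem_iUnion₂.1 h
        exact Set.mem_iUnion₂.2 ⟨k', hk', cyclicChart_mem_image_iff hγ hk
          (hL k' (Finset.mem_insert_of_mem hk')) hy hy₂ h⟩
      ext x
      constructor
      · rintro ⟨⟨⟨a, y⟩, ⟨ha, hy⟩, rfl⟩, hx⟩
        exact ⟨(a, y), ⟨⟨ha, fun h => hx (hiff a y₀ hy₀ y hy h)⟩, hy⟩, rfl⟩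
      · rintro ⟨⟨a, y⟩, ⟨ha, hy⟩, rfl⟩
        exact ⟨⟨(a, y), ⟨ha.1, hy⟩, rfl⟩, fun h => ha.2 (hiff a y hy y₀ hy₀ h)⟩
    refine ⟨(∫⁻ a in A, c * ENNReal.ofReal (LinearMap.det (frameMap a))) + C',
      ENNReal.add_ne_top.2 ⟨ne_top_of_le_ne_top hfin (lintegral_mono_set fun a ha => ha.1), hC't⟩,
      fun _ => ?_, fun F G hF hG hFG => ?_⟩
    · rcases L.eq_empty_or_nonempty with hLe | hLe
      · have hAe : A = tupleDomain m O := by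
          ext a
          simp [hA, hY, hLe]
        rw [hAe]
        exact fun h => hpos (add_eq_zero.1 h).1
      · exact fun h => hC'0 hLe (add_eq_zero.1 h).2
    · rw [Finset.set_biUnion_insert, ← Set.sdiff_union_self, hpiece,
        lintegral_union hYm (hpiece ▸ Set.disjoint_sdiff_left), hC' F G hF hG hFG,
        lintegral_cyclicChart_image hγ hD hk hinj (fun a ha => (hdet a ha).2) hc hAm (fun a ha => ha.1)
          hF hG (fun a y _ => hFG _ y fun i => mul_mem (hk i) (unitaryTuple_mem a i)), add_mul]

/-- The matrices `U_i D_i U_{i+1}†` with eigenvalues in `D`. -/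
def cyclicPoints (γ : Fin m → ℝ) (D : Set ℂ) (N : ℕ) : Set (MatrixSpace (Fin m × Fin N)) :=
  {a | ∃ U y, (∀ i, U i ∈ Matrix.unitaryGroup (Fin N) ℂ) ∧
    (∀ p, 0 ≤ (y p).1 ∧ polarEigenvalue γ (y p) ∈ D) ∧ a = cyclicPoint γ U y}

theorem norm_polarEigenvalue {y : ℝ × (Fin m → ℝ)} (hy : 0 ≤ y.1) :
    ‖polarEigenvalue γ y‖ = ∏ i, √(y.1 ^ 2 + γ i) := by
  rw [polarEigenvalue, norm_prod]
  refine Finset.prod_congr rfl fun i _ => ?_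
  rw [norm_diagEntry, radialMap_eq_sqrt hy, abs_of_nonneg (Real.sqrt_nonneg _)]

/-- The modulus ∏ √(s² + γ_i) increases strictly with s ≥ 0. Coinciding eigenvalues thus force
coinciding radii, a condition linear in the coordinates. -/
theorem radial_eq_of_polarEigenvalue_eq (hγ : ∀ i, 0 ≤ γ i) {y y' : ℝ × (Fin m → ℝ)}
    (hy : 0 ≤ y.1) (hy' : 0 ≤ y'.1) (h : polarEigenvalue γ y = polarEigenvalue γ y') :
    y.1 = y'.1 := by
  have key : ∀ s t : ℝ, 0 ≤ s → s < t → ∏ i, √(s ^ 2 + γ i) < ∏ i, √(t ^ 2 + γ i) := by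
    intro s t hs hst
    have h1 : ∀ i, √(s ^ 2 + γ i) < √(t ^ 2 + γ i) := fun i =>
      Real.sqrt_lt_sqrt (add_nonneg (sq_nonneg _) (hγ i)) (by nlinarith)
    by_cases h0 : ∀ i, 0 < √(s ^ 2 + γ i)
    · exact Finset.prod_lt_prod_of_nonempty (fun i _ => h0 i) (fun i _ => h1 i)
        ⟨0, Finset.mem_univ _⟩
    · push Not at h0
      obtain ⟨i, hi⟩ := h0
      rw [Finset.prod_eq_zero (Finset.mem_univ i) (le_antisymm hi (Real.sqrt_nonneg _))]
      exact Finset.prod_pos fun i _ => (Real.sqrt_nonneg _).trans_lt (h1 i)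
  have h2 := congrArg norm h
  rw [norm_polarEigenvalue hy, norm_polarEigenvalue hy'] at h2
  rcases lt_trichotomy y.1 y'.1 with h3 | h3 | h3
  · exact absurd h2 (key _ _ hy h3).ne
  · exact h3
  · exact absurd h2 (key _ _ hy' h3).ne'

theorem volume_radial_eq_zero :
    volume {v : ChartSpace m N | (∃ p, (v.2 p).1 = 0) ∨ ∃ p q, p ≠ q ∧ (v.2 p).1 = (v.2 q).1} = 0 := by
  have hker : ∀ ℓ : ChartSpace m N →ₗ[ℝ] ℝ, (∃ v, ℓ v ≠ 0) → volume {v | ℓ v = 0} = 0 := by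
    rintro ℓ ⟨v, hv⟩
    refine Measure.addHaar_submodule volume (LinearMap.ker ℓ) fun h => hv ?_
    exact LinearMap.mem_ker.1 (h ▸ Submodule.mem_top)
  let r : Fin N → ChartSpace m N →ₗ[ℝ] ℝ := fun p =>
    (LinearMap.fst ℝ ℝ (Fin m → ℝ)).comp ((LinearMap.proj p).comp (LinearMap.snd ℝ _ _))
  have h1 : {v : ChartSpace m N | (∃ p, (v.2 p).1 = 0) ∨ ∃ p q, p ≠ q ∧ (v.2 p).1 = (v.2 q).1}
      ⊆ (⋃ p, {v | r p v = 0}) ∪ ⋃ p, ⋃ q, ⋃ (_ : p ≠ q), {v | (r p - r q) v = 0} := by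
    rintro v (⟨p, hp⟩ | ⟨p, q, hpq, h⟩)
    · exact Or.inl (Set.mem_iUnion.2 ⟨p, hp⟩)
    · exact Or.inr (Set.mem_iUnion.2 ⟨p, Set.mem_iUnion.2 ⟨q, Set.mem_iUnion.2 ⟨hpq,
        sub_eq_zero.2 h⟩⟩⟩)
  have h2 : ∀ p, r p (0, fun q => (if q = p then 1 else 0, 0)) = 1 := fun p => by simp [r]
  have h3 : ∀ p q, p ≠ q → r q (0, fun q => (if q = p then 1 else 0, 0)) = 0 := fun p q h => by
    simp [r, h.symm]
  refine measure_mono_null h1 (measure_union_null (measure_iUnion_null fun p => hker _ ?_)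
    (measure_iUnion_null fun p => measure_iUnion_null fun q => measure_iUnion_null fun hpq =>
      hker _ ?_))
  · exact ⟨_, by rw [h2 p]; exact one_ne_zero⟩
  · exact ⟨(0, fun q => (if q = p then 1 else 0, 0)), by
      rw [LinearMap.sub_apply, h2, h3 p q hpq, sub_zero]; exact one_ne_zero⟩

/-- Finitely many charts cover everything except points with a zero radius or two equal radii. Those
lie in C¹ images of hyperplanes, which are null for the Hausdorff measure of the chart dimension. -/
theorem exists_lintegral_cyclicPoints (hγ : ∀ i, 0 ≤ γ i) (hD : MeasurableSet D) :
    ∃ C : ℝ≥0∞, C ≠ ⊤ ∧ C ≠ 0 ∧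
      ∀ (F : MatrixSpace (Fin m × Fin N) → ℝ≥0∞) (G : (Fin N → ℂ) → ℝ≥0∞), Measurable F →
        Measurable G → (∀ U y, (∀ i, U i ∈ Matrix.unitaryGroup (Fin N) ℂ) →
          F (cyclicPoint γ U y) = G fun p => polarEigenvalue γ (y p)) →
        ∫⁻ a in cyclicPoints γ D N, F a ∂(Measure.hausdorffMeasure ((m * N ^ 2 + N : ℕ) : ℝ))
          = C * polarIntegral γ D G := by
  classical
  obtain ⟨O, hO, h0, hinj, ε, hdet⟩ := exists_chart_neighbourhood m N
  obtain ⟨S, hS, hcov⟩ := exists_finset_cover_unitary (hO.mem_nhds h0)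
  set L : Finset (Fin m → Matrix (Fin N) (Fin N) ℂ) := Fintype.piFinset fun _ => S with hL
  have hLu : ∀ k ∈ L, ∀ i, k i ∈ Matrix.unitaryGroup (Fin N) ℂ := fun k hk i =>
    hS _ (Fintype.mem_piFinset.1 hk i)
  have hLne : L.Nonempty := by
    obtain ⟨k, hk, -⟩ := hcov 1 (one_mem _)
    exact ⟨fun _ => k, Fintype.mem_piFinset.2 fun _ => hk⟩
  rw [← finrank_chartSpace m N]
  set Y := ⋃ k ∈ L, cyclicChart γ k '' (tupleDomain m O ×ˢ regularDomain γ D N) with hY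
  have hYsub : Y ⊆ cyclicPoints γ D N := by
    intro x hx
    obtain ⟨k, hk, ⟨⟨a, y⟩, ⟨ha, hy⟩, rfl⟩⟩ := Set.mem_iUnion₂.1 hx
    exact ⟨_, y, fun i => mul_mem (hLu k hk i) (unitaryTuple_mem a i),
      fun p => ⟨(hy.1 p).1.le, (hy.1 p).2.2⟩, rfl⟩
  set B := {v : ChartSpace m N | (∃ p, (v.2 p).1 = 0) ∨ ∃ p q, p ≠ q ∧ (v.2 p).1 = (v.2 q).1}
    with hB
  -- The diagonal phases left over by the cover of the unitary group are moved into the angular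
  -- coordinates; the transition is diagonal, so no relabelling is needed.
  have hbad : cyclicPoints γ D N \ Y ⊆ ⋃ k ∈ L, cyclicChart γ k '' B := by
    rintro x ⟨⟨U, y, hU, hy, rfl⟩, hx⟩
    choose k hk a ha θ hθ using fun i => hcov (U i) (hU i)
    have hkL : k ∈ L := Fintype.mem_piFinset.2 hk
    set b : IndexPairs N → Fin m → ℂ := fun x i => a i x with hb
    have hbO : b ∈ tupleDomain m O := fun i => ha i
    have hU' : ∀ i, k i * unitaryTuple b i ∈ Matrix.unitaryGroup (Fin N) ℂ := fun i =>
      mul_mem (hLu k hkL i) (unitaryTuple_mem b i)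
    have hG : ∀ i, (k i * unitaryTuple b i)ᴴ * U i = phaseMatrix (θ i) := fun i => by
      rw [hθ i, ← Matrix.mul_assoc (k i)]
      change (k i * unitaryTuple b i)ᴴ * (k i * unitaryTuple b i * phaseMatrix (θ i)) = _
      rw [← Matrix.mul_assoc, conjTranspose_mul_of_mem_unitaryGroup (hU' i), Matrix.one_mul]
    obtain ⟨y', h1, h2, h3, h4⟩ := exists_cyclicPoint_eq (γ := γ) hU hU' 1 (fun i p q hpq => by
      rw [hG, phaseMatrix]
      exact Matrix.diagonal_apply_ne _ hpq) y
    refine Set.mem_iUnion₂.2 ⟨k, hkL, (b, y'), ?_, h4.symm⟩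
    by_contra hc
    simp only [hB, Set.mem_ofPred_eq, not_or, not_exists, not_and] at hc
    have hs : ∀ p, 0 < (y' p).1 := fun p => lt_of_le_of_ne (by
      have := h1 p
      rw [Equiv.Perm.one_apply] at this
      rw [this]; exact (hy p).1) (Ne.symm (hc.1 p))
    refine hx (Set.mem_iUnion₂.2 ⟨k, hkL, (b, y'), ⟨hbO, fun p => ⟨hs p, h2 p, ?_⟩, ?_⟩, h4.symm⟩)
    · have := h3 p
      rw [Equiv.Perm.one_apply] at this
      rw [this]
      exact (hy p).2
    · intro p q hpq
      by_contra hne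
      exact hc.2 p q hne (radial_eq_of_polarEigenvalue_eq hγ (hs p).le (hs q).le hpq)
  have hnull : Measure.hausdorffMeasure (Module.finrank ℝ (ChartSpace m N) : ℝ)
      (cyclicPoints γ D N \ Y) = 0 := by
    refine measure_mono_null hbad ((measure_biUnion_null_iff L.countable_toSet).2 fun k _ => ?_)
    exact hausdorffMeasure_image_eq_zero (volume : Measure (ChartSpace m N))
      (contDiff_cyclicChart hγ k) volume_radial_eq_zero
  have hae : cyclicPoints γ D N
      =ᵐ[Measure.hausdorffMeasure (Module.finrank ℝ (ChartSpace m N) : ℝ)] Y :=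
    ae_eq_set.2 ⟨hnull, by rw [Set.sdiff_eq_empty.2 hYsub, measure_empty]⟩
  rcases (regularDomain γ D N).eq_empty_or_nonempty with hRe | hRne
  -- Without regular configurations both sides vanish, and any nonzero finite constant will do.
  · refine ⟨1, ENNReal.one_ne_top, one_ne_zero, fun F G _ _ _ => ?_⟩
    have : Y = ∅ := by simp [hY, hRe]
    rw [setLIntegral_congr hae, this, polarIntegral, hRe]
    simp
  · obtain ⟨C, hCt, hC0, hC⟩ := exists_lintegral_iUnion_cyclicChart hγ hD hO h0 hinj hdet hRne L hLu
    refine ⟨C, hCt, hC0 hLne, fun F G hF hG hFG => ?_⟩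
    rw [setLIntegral_congr hae]
    exact hC F G hF hG hFG

end Globalize

/-! ### The one-particle reference measure -/

section PolarMeasure

variable {m N : ℕ} [NeZero m] {γ : Fin m → ℝ} {D : Set ℂ}

/-- The reference measure of one eigenvalue. -/
noncomputable def polarMeasure (γ : Fin m → ℝ) (D : Set ℂ) : Measure ℂ :=
  ((volume.restrict (polarDomain γ D)).withDensity
    fun y => ENNReal.ofReal (polarDensity γ y)).map (polarEigenvalue γ)

/-- For s > 1 each of the m ≥ 1 factors of |z| is at least s, so |z| ≥ s and a bound on D bounds s.
-/
theorem exists_polarDomain_subset_compact (hγ : ∀ i, 0 ≤ γ i) (hD : Bornology.IsBounded D) :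
    ∃ K : Set (ℝ × (Fin m → ℝ)), IsCompact K ∧ polarDomain γ D ⊆ K := by
  obtain ⟨C, hC⟩ := hD.exists_norm_le
  refine ⟨Set.Icc 0 (max 1 C) ×ˢ Set.univ.pi fun _ => Set.Icc 0 (2 * Real.pi),
    isCompact_Icc.prod (isCompact_univ_pi fun _ => isCompact_Icc), fun y hy => ⟨⟨hy.1.le, ?_⟩,
      fun i _ => ⟨(hy.2.1 i).1, (hy.2.1 i).2.le⟩⟩⟩
  by_contra! hlt
  have h1 : 1 < y.1 := (le_max_left _ _).trans_lt hlt
  have h2 := hC _ hy.2.2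
  rw [norm_polarEigenvalue hy.1.le] at h2
  have h3 : y.1 ≤ ∏ i, √(y.1 ^ 2 + γ i) := by
    have h4 : ∀ i, y.1 ≤ √(y.1 ^ 2 + γ i) := fun i =>
      Real.le_sqrt_of_sq_le (le_add_of_nonneg_right (hγ i))
    calc y.1 = y.1 ^ 1 := (pow_one _).symm
      _ ≤ y.1 ^ m := pow_le_pow_right₀ h1.le (Nat.one_le_iff_ne_zero.2 (NeZero.ne m))
      _ = ∏ _i : Fin m, y.1 := by simp
      _ ≤ _ := Finset.prod_le_prod (fun i _ => hy.1.le) fun i _ => h4 i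
  exact absurd (h3.trans (h2.trans (le_max_right 1 C))) (not_le.2 hlt)

theorem isFiniteMeasure_polarWeight (hγ : ∀ i, 0 ≤ γ i) (hD : Bornology.IsBounded D) :
    IsFiniteMeasure ((volume.restrict (polarDomain γ D)).withDensity
      fun y => ENNReal.ofReal (polarDensity γ y)) := by
  obtain ⟨K, hK, hsub⟩ := exists_polarDomain_subset_compact hγ hD
  obtain ⟨B, hB⟩ := hK.bddAbove_image (continuous_polarDensity hγ).continuousOn
  refine isFiniteMeasure_withDensity (ne_top_of_le_ne_top
    (b := ENNReal.ofReal B * volume K) (ENNReal.mul_ne_top ENNReal.ofReal_ne_top hK.measure_lt_top.ne)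
    ((lintegral_mono_set hsub).trans ?_))
  rw [← setLIntegral_const]
  refine setLIntegral_mono measurable_const fun y hy => ?_
  gcongr
  exact hB ⟨y, hy, rfl⟩

theorem isFiniteMeasure_polarMeasure (hγ : ∀ i, 0 ≤ γ i) (hD : Bornology.IsBounded D) :
    IsFiniteMeasure (polarMeasure γ D) := by
  haveI := isFiniteMeasure_polarWeight hγ hD
  rw [polarMeasure]
  infer_instance

theorem polarMeasure_apply (hγ : ∀ i, 0 ≤ γ i) {A : Set ℂ}
    (hA : MeasurableSet A) : polarMeasure γ D A
      = ∫⁻ y in polarDomain γ D ∩ polarEigenvalue γ ⁻¹' A, ENNReal.ofReal (polarDensity γ y) := by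
  have hz := (continuous_polarEigenvalue hγ).measurable
  rw [polarMeasure, Measure.map_apply hz hA, withDensity_apply _ (hz hA),
    Measure.restrict_restrict (hz hA), Set.inter_comm]

theorem polarMeasure_compl (hγ : ∀ i, 0 ≤ γ i) (hD : MeasurableSet D) :
    polarMeasure γ D Dᶜ = 0 := by
  rw [polarMeasure_apply hγ hD.compl]
  have : polarDomain γ D ∩ polarEigenvalue γ ⁻¹' Dᶜ = ∅ := by
    ext y
    simp only [Set.mem_inter_iff, Set.mem_preimage, Set.mem_compl_iff, Set.mem_empty_iff_false,
      iff_false, not_and, not_not]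
    exact fun hy => hy.2.2
  rw [this, Measure.restrict_empty, lintegral_zero_measure]

/-- The eigenvalue as a function of the radial coordinate and of the sum of the phases. -/
noncomputable def planePolar (γ : Fin m → ℝ) (w : ℂ) : ℂ :=
  (∏ i, (radialMap (γ i) w.re : ℂ)) * Complex.exp (w.im * Complex.I)

/-- The radial coordinate and the sum of the phases. -/
noncomputable def phaseSum (m : ℕ) : (ℝ × (Fin m → ℝ)) →ₗ[ℝ] ℂ where
  toFun y := y.1 + (∑ i, y.2 i : ℝ) * Complex.I
  map_add' y y' := by
    simp only [Prod.fst_add, Prod.snd_add, Pi.add_apply, Finset.sum_add_distrib]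
    push_cast
    ring
  map_smul' r y := by
    simp only [Prod.smul_fst, Prod.smul_snd, Pi.smul_apply, smul_eq_mul, ← Finset.mul_sum,
      RingHom.id_apply, Complex.real_smul]
    push_cast
    ring

theorem planePolar_phaseSum (y : ℝ × (Fin m → ℝ)) :
    planePolar γ (phaseSum m y) = polarEigenvalue γ y := by
  have h1 : (phaseSum m y).re = y.1 := by simp [phaseSum]
  have h2 : (phaseSum m y).im = ∑ i, y.2 i := by
    simp [phaseSum]
  rw [planePolar, h1, h2, polarEigenvalue]
  simp only [diagEntry]
  rw [Finset.prod_mul_distrib, ← Complex.exp_sum]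
  push_cast
  rw [Finset.sum_mul]

theorem differentiable_planePolar (hγ : ∀ i, 0 ≤ γ i) : Differentiable ℝ (planePolar γ) := by
  have h1 : ∀ i, ContDiff ℝ 1 fun w : ℂ => (radialMap (γ i) w.re : ℂ) := fun i =>
    Complex.ofRealCLM.contDiff.comp ((contDiff_radialMap (hγ i)).comp Complex.reCLM.contDiff)
  have h2 : Differentiable ℝ fun w : ℂ => Complex.exp (w.im * Complex.I) :=
    ((Complex.ofRealCLM.differentiable.comp Complex.imCLM.differentiable).mul_const _).cexp
  have h3 : Differentiable ℝ fun w : ℂ => ∏ i, (radialMap (γ i) w.re : ℂ) :=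
    (contDiff_prod fun i _ => h1 i).differentiable one_ne_zero
  exact h3.mul h2

/-- Some γ_i vanishes, so the modulus starts at 0 when s = 0. It is unbounded, and the intermediate
value theorem reaches every positive value. -/
theorem exists_planePolar_eq (hγ : ∀ i, 0 ≤ γ i) (h0 : ∃ i, γ i = 0) {z : ℂ} (hz : z ≠ 0) :
    ∃ w : ℂ, 0 < w.re ∧ planePolar γ w = z := by
  have hc : Continuous fun s : ℝ => ∏ i, radialMap (γ i) s :=
    continuous_finsetProd _ fun i _ => (contDiff_radialMap (hγ i)).continuous
  have hzero : ∏ i, radialMap (γ i) 0 = 0 := by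
    obtain ⟨i, hi⟩ := h0
    exact Finset.prod_eq_zero (Finset.mem_univ i) (by simp [radialMap, hi])
  have hbig : ‖z‖ ≤ ∏ i, radialMap (γ i) (max 1 ‖z‖) := by
    have h1 : (1 : ℝ) ≤ max 1 ‖z‖ := le_max_left _ _
    have h2 : ∀ i, max 1 ‖z‖ ≤ radialMap (γ i) (max 1 ‖z‖) := fun i => by
      rw [radialMap_eq_sqrt (by positivity)]
      exact Real.le_sqrt_of_sq_le (le_add_of_nonneg_right (hγ i))
    calc ‖z‖ ≤ max 1 ‖z‖ := le_max_right _ _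
      _ = max 1 ‖z‖ ^ 1 := (pow_one _).symm
      _ ≤ max 1 ‖z‖ ^ m := pow_le_pow_right₀ h1 (Nat.one_le_iff_ne_zero.2 (NeZero.ne m))
      _ = ∏ _i : Fin m, max 1 ‖z‖ := by simp
      _ ≤ _ := Finset.prod_le_prod (fun i _ => by positivity) fun i _ => h2 i
  obtain ⟨s, hs, hsz⟩ := intermediate_value_Icc (show (0 : ℝ) ≤ max 1 ‖z‖ by positivity)
    hc.continuousOn ⟨by rw [hzero]; exact norm_nonneg z, hbig⟩
  have hs0 : 0 < s := lt_of_le_of_ne hs.1 fun h => by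
    subst h
    simp only at hsz
    rw [hzero] at hsz
    exact hz (norm_eq_zero.1 hsz.symm)
  refine ⟨⟨s, z.arg⟩, hs0, ?_⟩
  rw [planePolar]
  simp only at hsz ⊢
  rw [← Complex.ofReal_prod, hsz, Complex.norm_mul_exp_arg_mul_I]

/-- The eigenvalue map is the linear surjection (s, φ) ↦ (s, ∑ φ_i) followed by the differentiable
map `planePolar`. A null preimage upstairs gives a null set in the plane, whose image is null and
covers A ∩ D up to the origin. -/
theorem absolutelyContinuous_polarMeasure (hγ : ∀ i, 0 ≤ γ i) (h0 : ∃ i, γ i = 0)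
    (hD : MeasurableSet D) : volume.restrict D ≪ polarMeasure γ D := by
  have hz := (continuous_polarEigenvalue hγ).measurable
  refine Measure.AbsolutelyContinuous.mk fun A hA hA0 => ?_
  rw [polarMeasure_apply hγ hA] at hA0
  rw [Measure.restrict_apply hA]
  set P := polarDomain γ D ∩ polarEigenvalue γ ⁻¹' A with hP
  have hPm : MeasurableSet P := (measurableSet_polarDomain hγ hD).inter (hz hA)
  have hP0 : volume P = 0 := by
    by_contra hne
    have h1 := (setLIntegral_pos_iff (μ := volume) (s := P)
      (continuous_polarDensity hγ).measurable.ennreal_ofReal).2 (by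
        have h2 : P ⊆ Function.support fun y => ENNReal.ofReal (polarDensity γ y) := fun y hy => by
          simpa using polarDensity_pos hγ hy.1.1
        rw [Set.inter_eq_self_of_subset_right h2]
        exact pos_iff_ne_zero.2 hne)
    exact h1.ne' hA0
  set T : Set ℂ := {w | 0 < w.re ∧ planePolar γ w ∈ A ∩ D} with hT
  have hTm : MeasurableSet T := (measurableSet_lt measurable_const Complex.measurable_re).inter
    ((differentiable_planePolar hγ).continuous.measurable (hA.inter hD))
  have hpre : volume (phaseSum m ⁻¹' T) = 0 := by
    -- The density only sees angles in [0, 2π). Countably many integer shifts of the phases, which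
    -- do not change the eigenvalue, cover the remaining ones.
    have hsub : phaseSum m ⁻¹' T ⊆ ⋃ n : Fin m → ℤ,
        (fun y : ℝ × (Fin m → ℝ) => y + (0, fun i => -(n i * (2 * Real.pi)))) ⁻¹' P := by
      rintro y ⟨hy1, hy2⟩
      have h1 : (phaseSum m y).re = y.1 := by simp [phaseSum]
      rw [h1] at hy1
      rw [planePolar_phaseSum] at hy2
      refine Set.mem_iUnion.2 ⟨fun i => toIcoDiv Real.two_pi_pos 0 (y.2 i), ?_⟩
      have h2 : polarEigenvalue γ (y + ((0, fun i => -((toIcoDiv Real.two_pi_pos 0 (y.2 i) : ℤ)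
          * (2 * Real.pi))) : ℝ × (Fin m → ℝ))) = polarEigenvalue γ y := by
        refine Finset.prod_congr rfl fun i _ => ?_
        rw [diagEntry, diagEntry]
        simp only [Prod.fst_add, add_zero, Prod.snd_add, Pi.add_apply]
        congr 1
        rw [Complex.exp_eq_exp_iff_exists_int]
        refine ⟨-toIcoDiv Real.two_pi_pos 0 (y.2 i), ?_⟩
        push_cast
        ring
      refine ⟨⟨by simpa using hy1, fun i => ?_, ?_⟩, ?_⟩
      · have h3 := toIcoMod_mem_Ico Real.two_pi_pos 0 (y.2 i)
        have h4 : toIcoMod Real.two_pi_pos 0 (y.2 i)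
          = y.2 i + -((toIcoDiv Real.two_pi_pos 0 (y.2 i) : ℤ) * (2 * Real.pi)) := by
          rw [toIcoMod, zsmul_eq_mul, sub_eq_add_neg]
        rw [zero_add, h4] at h3
        exact h3
      · rw [h2]; exact hy2.2
      · change polarEigenvalue γ _ ∈ A
        rw [h2]; exact hy2.1
    refine measure_mono_null hsub (measure_iUnion_null fun n => ?_)
    rw [measure_preimage_add_right]
    exact hP0
  have hsurj : Function.Surjective (phaseSum m) := fun w => by
    refine ⟨(w.re, Pi.single 0 w.im), ?_⟩
    have : ∑ i, (Pi.single 0 w.im : Fin m → ℝ) i = w.im := by simp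
    change ((w.re : ℝ) : ℂ) + (∑ i, (Pi.single 0 w.im : Fin m → ℝ) i : ℝ) * Complex.I = w
    rw [this, Complex.re_add_im]
  have hT0 : volume T = 0 := by
    obtain ⟨c, hc, hmap⟩ := LinearMap.exists_map_addHaar_eq_smul_addHaar (phaseSum m)
      (volume : Measure (ℝ × (Fin m → ℝ))) (volume : Measure ℂ) hsurj
    have h1 := congrArg (fun μ => μ T) hmap
    simp only [Measure.smul_apply, smul_eq_mul] at h1
    rw [Measure.map_apply (LinearMap.continuous_of_finiteDimensional _).measurable hTm, hpre] at h1
    exact (mul_eq_zero.1 h1.symm).resolve_left hc.ne'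
  have himg : volume (planePolar γ '' T) = 0 :=
    addHaar_image_eq_zero_of_differentiableOn_of_addHaar_eq_zero volume
      (differentiable_planePolar hγ).differentiableOn hT0
  refine measure_mono_null (t := planePolar γ '' T ∪ {0}) (fun z hzA => ?_)
    (measure_union_null himg (measure_singleton 0))
  by_cases hz0 : z = 0
  · exact Or.inr hz0
  · obtain ⟨w, hw, hwz⟩ := exists_planePolar_eq hγ h0 hz0
    exact Or.inl ⟨w, ⟨hw, by rw [hwz]; exact hzA⟩, hwz⟩

theorem pi_polarMeasure (hγ : ∀ i, 0 ≤ γ i) (hDb : Bornology.IsBounded D) :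
    (Measure.pi fun _ : Fin N => polarMeasure γ D)
      = (((volume : Measure (Fin N → ℝ × (Fin m → ℝ))).restrict
          (Set.univ.pi fun _ => polarDomain γ D)).withDensity
          fun y => ∏ p, ENNReal.ofReal (polarDensity γ (y p))).map
            fun y p => polarEigenvalue γ (y p) := by
  haveI := isFiniteMeasure_polarWeight hγ hDb
  haveI := isFiniteMeasure_polarMeasure hγ hDb
  haveI : (volume : Measure (ℝ × (Fin m → ℝ))).IsAddHaarMeasure := isAddHaarMeasure_polar
  unfold polarMeasure
  rw [← Measure.pi_map_pi (fun _ => (continuous_polarEigenvalue hγ).aemeasurable), pi_withDensity _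
    (continuous_polarDensity hγ).measurable.ennreal_ofReal, volume_pi, Measure.restrict_pi_pi]

/-- Configurations with coinciding eigenvalues may be put back, because the Vandermonde factor
vanishes there. The domain becomes a product. -/
theorem indicator_regularDomain (hγ : ∀ i, 0 ≤ γ i) (g : ℝ≥0∞) (y : Fin N → ℝ × (Fin m → ℝ)) :
    (regularDomain γ D N).indicator (fun y => ENNReal.ofReal (LinearMap.det (scaleMap γ y)) * g) y
      = (Set.univ.pi fun _ => polarDomain γ D).indicator
        (fun y => (∏ p, ENNReal.ofReal (polarDensity γ (y p))) * (ENNReal.ofReal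
          (∏ x ∈ (Finset.univ : Finset (Fin N)).offDiag,
            ‖polarEigenvalue γ (y x.1) - polarEigenvalue γ (y x.2)‖) * g)) y := by
  have hsub : regularDomain γ D N ⊆ Set.univ.pi fun _ => polarDomain γ D := fun y hy p _ => hy.1 p
  by_cases hy : y ∈ Set.univ.pi fun _ : Fin N => polarDomain γ D
  · rw [Set.indicator_of_mem hy]
    have hpos : ∀ p, 0 ≤ polarDensity γ (y p) := fun p =>
      (polarDensity_pos hγ (hy p (Set.mem_univ p)).1).le
    by_cases hinj : Function.Injective fun p => polarEigenvalue γ (y p)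
    · have hmem : y ∈ regularDomain γ D N := ⟨fun p => hy p (Set.mem_univ p), hinj⟩
      rw [Set.indicator_of_mem hmem, det_scaleMap,
        prod_indexPairs_sq fun p => polarEigenvalue γ (y p),
        ENNReal.ofReal_mul (Finset.prod_nonneg fun _ _ => norm_nonneg _),
        ENNReal.ofReal_prod_of_nonneg fun p _ => hpos p, mul_comm (ENNReal.ofReal _), mul_assoc]
    · rw [Set.indicator_of_notMem fun h => hinj h.2]
      simp only [Function.Injective, not_forall] at hinj
      obtain ⟨p, q, hpq, hne⟩ := hinj
      have h0 : ∏ x ∈ (Finset.univ : Finset (Fin N)).offDiag,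
          ‖polarEigenvalue γ (y x.1) - polarEigenvalue γ (y x.2)‖ = 0 :=
        Finset.prod_eq_zero (i := (p, q)) (by simpa using hne) (by simp [hpq])
      rw [h0, ENNReal.ofReal_zero, zero_mul, mul_zero]
  · rw [Set.indicator_of_notMem hy, Set.indicator_of_notMem fun h => hy (hsub h)]

theorem polarIntegral_eq (hγ : ∀ i, 0 ≤ γ i) (hD : MeasurableSet D) (hDb : Bornology.IsBounded D)
    {G : (Fin N → ℂ) → ℝ≥0∞} (hG : Measurable G) :
    polarIntegral γ D G = ∫⁻ z, ENNReal.ofReal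
        (∏ x ∈ (Finset.univ : Finset (Fin N)).offDiag, ‖z x.1 - z x.2‖) * G z
      ∂(Measure.pi fun _ : Fin N => polarMeasure γ D) := by
  have hz := (continuous_polarEigenvalue hγ).measurable
  have hw' : Measurable fun y : Fin N → ℝ × (Fin m → ℝ) =>
      ∏ p, ENNReal.ofReal (polarDensity γ (y p)) :=
    Finset.measurable_prod _ fun p _ =>
      (continuous_polarDensity hγ).measurable.ennreal_ofReal.comp (measurable_pi_apply p)
  have hzz : Measurable fun y : Fin N → ℝ × (Fin m → ℝ) => fun p => polarEigenvalue γ (y p) :=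
    measurable_pi_lambda _ fun p => hz.comp (measurable_pi_apply p)
  have hV : Measurable fun z : Fin N → ℂ => ENNReal.ofReal
      (∏ x ∈ (Finset.univ : Finset (Fin N)).offDiag, ‖z x.1 - z x.2‖) := by
    refine Measurable.ennreal_ofReal (Continuous.measurable ?_)
    fun_prop
  have hVG : Measurable fun z : Fin N → ℂ => ENNReal.ofReal
      (∏ x ∈ (Finset.univ : Finset (Fin N)).offDiag, ‖z x.1 - z x.2‖) * G z := hV.mul hG
  have hPm : MeasurableSet (Set.univ.pi fun _ : Fin N => polarDomain γ D) :=
    MeasurableSet.univ_pi fun _ => measurableSet_polarDomain hγ hD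
  rw [pi_polarMeasure (N := N) hγ hDb, lintegral_map hVG hzz]
  refine Eq.trans ?_ (lintegral_withDensity_eq_lintegral_mul _ hw' (hVG.comp hzz)).symm
  rw [polarIntegral, ← lintegral_indicator (measurableSet_regularDomain hγ hD),
    ← lintegral_indicator hPm]
  refine lintegral_congr fun y => ?_
  exact indicator_regularDomain hγ (G fun p => polarEigenvalue γ (y p)) y

end PolarMeasure

/-! ### Symmetric functions of unordered eigenvalues -/

section SymmetricFunctions

variable {N : ℕ}

/-- Functions of `N` variables that do not depend on their order. -/
def IsSymmetricFunction {Y : Type*} (Φ : (Fin N → ℂ) → Y) : Prop :=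
  ∀ (π : Equiv.Perm (Fin N)) z, Φ (z ∘ π) = Φ z

theorem exists_perm_of_prod_X_sub_C_eq {z w : Fin N → ℂ}
    (h : ∏ i, (Polynomial.X - Polynomial.C (z i)) = ∏ i, (Polynomial.X - Polynomial.C (w i))) :
    ∃ π : Equiv.Perm (Fin N), z = w ∘ π := by
  have hroots : ∀ u : Fin N → ℂ, (∏ i, (Polynomial.X - Polynomial.C (u i))).roots
      = (Finset.univ : Finset (Fin N)).val.map u := fun u => by
    have : ∏ i, (Polynomial.X - Polynomial.C (u i))
        = (((Finset.univ : Finset (Fin N)).val.map u).map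
          fun a => Polynomial.X - Polynomial.C a).prod := by
      rw [Multiset.map_map]; rfl
    rw [this, Polynomial.roots_multiset_prod_X_sub_C]
  have hm : (Finset.univ : Finset (Fin N)).val.map z = (Finset.univ : Finset (Fin N)).val.map w := by
    rw [← hroots, h, hroots]
  have hcard : ∀ c, Fintype.card {i // z i = c} = Fintype.card {i // w i = c} := fun c => by
    have h1 := congrArg (Multiset.count c) hm
    rw [Multiset.count_map, Multiset.count_map] at h1
    rw [Fintype.card_subtype, Fintype.card_subtype, Finset.card, Finset.card]
    simpa only [eq_comm, Finset.filter_val] using h1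
  let e : Equiv.Perm (Fin N) := (Equiv.sigmaFiberEquiv z).symm.trans
    ((Equiv.sigmaCongrRight fun c => Fintype.equivOfCardEq (hcard c)).trans (Equiv.sigmaFiberEquiv w))
  refine ⟨e, funext fun i => ?_⟩
  exact ((Fintype.equivOfCardEq (hcard (z i))) ⟨i, rfl⟩).2.symm

theorem charpoly_eq_prod_eigenvalueTuple (M : Matrix (Fin N) (Fin N) ℂ) :
    M.charpoly = ∏ i, (Polynomial.X - Polynomial.C (eigenvalueTuple M i)) :=
  Classical.choose_spec (exists_eigenvalueTuple M)

theorem IsSymmetricFunction.eigenvalueTuple_eq {Y : Type*} {Φ : (Fin N → ℂ) → Y}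
    (hΦ : IsSymmetricFunction Φ) {M : Matrix (Fin N) (Fin N) ℂ} {z : Fin N → ℂ}
    (h : M.charpoly = ∏ i, (Polynomial.X - Polynomial.C (z i))) :
    Φ (eigenvalueTuple M) = Φ z := by
  rw [charpoly_eq_prod_eigenvalueTuple] at h
  obtain ⟨π, hπ⟩ := exists_perm_of_prod_X_sub_C_eq h
  rw [hπ, hΦ]

theorem spectrum_eq_range_eigenvalueTuple (M : Matrix (Fin N) (Fin N) ℂ) :
    spectrum ℂ M = Set.range (eigenvalueTuple M) := by
  ext c
  rw [Matrix.mem_spectrum_iff_isRoot_charpoly, charpoly_eq_prod_eigenvalueTuple,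
    Polynomial.IsRoot.def, Polynomial.eval_prod, Finset.prod_eq_zero_iff]
  simp [sub_eq_zero, eq_comm]

/-- Symmetric measurable functions of the eigenvalues are measurable. -/
theorem IsSymmetricFunction.measurable_eigenvalueTuple {Y : Type*} [MeasurableSpace Y]
    {Φ : (Fin N → ℂ) → Y} (hΦ : IsSymmetricFunction Φ) (hm : Measurable Φ) {α : Type*}
    [TopologicalSpace α] [MeasurableSpace α] [OpensMeasurableSpace α]
    {T : α → Matrix (Fin N) (Fin N) ℂ} (hT : Continuous T) :
    Measurable fun a => Φ (eigenvalueTuple (T a)) := by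
  -- The eigenvalue tuple is an arbitrary choice and need not be measurable. Values of the
  -- characteristic polynomial at the natural numbers depend continuously on the matrix and
  -- determine the tuple up to order.
  set κ : (Fin N → ℂ) → ℕ → ℂ := fun z n => ∏ i, ((n : ℂ) - z i) with hκ
  have hκm : Measurable κ := by
    refine Continuous.measurable (continuous_pi fun n => ?_)
    fun_prop
  have hκe : ∀ z n, κ z n = (∏ i, (Polynomial.X - Polynomial.C (z i))).eval (n : ℂ) := fun z n => by
    rw [Polynomial.eval_prod]
    simp [hκ]
  have hκi : ∀ z w, κ z = κ w → Φ z = Φ w := fun z w h => by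
    have h1 : ∏ i, (Polynomial.X - Polynomial.C (z i))
        = ∏ i, (Polynomial.X - Polynomial.C (w i)) := by
      refine Polynomial.eq_of_infinite_eval_eq _ _ (Set.Infinite.mono ?_
        (Set.infinite_range_of_injective (Nat.cast_injective (R := ℂ))))
      rintro _ ⟨n, rfl⟩
      change Polynomial.eval _ _ = Polynomial.eval _ _
      rw [← hκe, ← hκe, h]
    obtain ⟨π, hπ⟩ := exists_perm_of_prod_X_sub_C_eq h1
    rw [hπ, hΦ]
  have hinv : ∀ z, κ (Function.invFun κ (κ z)) = κ z := fun z =>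
    Function.invFun_eq (f := κ) ⟨z, rfl⟩
  have h1 : Measurable ((fun v => Φ (Function.invFun κ v)) ∘ κ) := by
    have : (fun v => Φ (Function.invFun κ v)) ∘ κ = Φ := funext fun z => hκi _ _ (hinv z)
    rw [this]
    exact hm
  -- A function whose composition with a Borel map between standard Borel spaces is measurable is
  -- measurable on the range; no measurable section of κ is needed.
  have h2 := hκm.measurable_comp_iff_restrict.1 h1
  have hval : ∀ M : Matrix (Fin N) (Fin N) ℂ,
      (fun n : ℕ => M.charpoly.eval (n : ℂ)) = κ (eigenvalueTuple M) := fun M => by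
    funext n
    rw [hκe, ← charpoly_eq_prod_eigenvalueTuple]
  have h3 : Measurable fun a => (⟨fun n : ℕ => (T a).charpoly.eval (n : ℂ),
      ⟨_, (hval _).symm⟩⟩ : Set.range κ) := by
    refine Measurable.subtype_mk (Continuous.measurable (continuous_pi fun n => ?_))
    simp only [Matrix.eval_charpoly]
    exact (continuous_const.sub hT).matrix_det
  have h4 : (fun a => Φ (eigenvalueTuple (T a)))
      = (Set.range κ).domRestrict (fun v => Φ (Function.invFun κ v)) ∘ fun a =>
        (⟨fun n : ℕ => (T a).charpoly.eval (n : ℂ), ⟨_, (hval _).symm⟩⟩ : Set.range κ) := by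
    funext a
    change _ = Φ (Function.invFun κ (fun n : ℕ => (T a).charpoly.eval (n : ℂ)))
    rw [hval]
    exact (hκi _ _ (hinv _)).symm
  rw [h4]
  exact h2.comp h3

end SymmetricFunctions

/-! ### Matrix models with Coulomb gas eigenvalues -/

section CoulombModels

variable {ι : Type} [Fintype ι] {N : ℕ}

/-- Matrix models whose eigenvalues are distributed like a Coulomb gas with reference
measure `η`. -/
def IsCoulombModel (S : Set (MatrixSpace ι)) (d : ℕ)
    (T : MatrixSpace ι → Matrix (Fin N) (Fin N) ℂ) (D : Set ℂ) (η : Measure ℂ) : Prop :=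
  Continuous T ∧ MeasurableSet S ∧ (∀ a ∈ S, ∀ i, eigenvalueTuple (T a) i ∈ D) ∧
    ∃ C : ℝ≥0∞, C ≠ ⊤ ∧ C ≠ 0 ∧ ∀ G : (Fin N → ℂ) → ℝ≥0∞, Measurable G → IsSymmetricFunction G →
      ∫⁻ a in S, G (eigenvalueTuple (T a)) ∂(Measure.hausdorffMeasure (d : ℝ))
        = C * ∫⁻ z, ENNReal.ofReal
          (∏ x ∈ (Finset.univ : Finset (Fin N)).offDiag, ‖z x.1 - z x.2‖) * G z
            ∂(Measure.pi fun _ : Fin N => η)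

variable {S : Set (MatrixSpace ι)} {d : ℕ} {T : MatrixSpace ι → Matrix (Fin N) (Fin N) ℂ}
  {D : Set ℂ} {η : Measure ℂ} {W W' : ℂ → ℝ}

theorem modelWeight_congr (h : IsCoulombModel S d T D η) (hW : Set.EqOn W W' D) :
    modelWeight S d T W = modelWeight S d T W' := by
  obtain ⟨-, hS, hSD, -⟩ := h
  refine withDensity_congr_ae (ae_restrict_of_forall_mem hS fun a ha => ?_)
  simp only [tracePotential]
  rw [Finset.sum_congr rfl fun i _ => hW (hSD a ha i)]

theorem isSymmetricFunction_boltzmann (W : ℂ → ℝ) (N : ℕ) : IsSymmetricFunction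
    fun z : Fin N → ℂ => ENNReal.ofReal (Real.exp (-(N : ℝ) * ∑ i, W (z i))) := fun π z => by
  simp only [Function.comp_apply]
  rw [Equiv.sum_comp π fun i => W (z i)]

theorem lintegral_modelWeight (h : IsCoulombModel S d T D η) (hW : Measurable W) :
    ∃ C : ℝ≥0∞, C ≠ ⊤ ∧ C ≠ 0 ∧ ∀ G : (Fin N → ℂ) → ℝ≥0∞, Measurable G → IsSymmetricFunction G →
      ∫⁻ a, G (eigenvalueTuple (T a)) ∂(modelWeight S d T W)
        = C * ∫⁻ z, G z ∂(coulombWeight η W N) := by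
  obtain ⟨hT, hS, hSD, C, hCt, hC0, hC⟩ := h
  refine ⟨C, hCt, hC0, fun G hG hGs => ?_⟩
  have hB : Measurable fun z : Fin N → ℂ =>
      ENNReal.ofReal (Real.exp (-(N : ℝ) * ∑ i, W (z i))) := by
    have : ∀ i : Fin N, Measurable fun z : Fin N → ℂ => W (z i) := fun i =>
      hW.comp (measurable_pi_apply i)
    fun_prop
  have hBs := isSymmetricFunction_boltzmann W N
  have hV : Measurable fun z : Fin N → ℂ =>
      (∏ x ∈ (Finset.univ : Finset (Fin N)).offDiag, ‖z x.1 - z x.2‖) := by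
    refine Continuous.measurable ?_
    fun_prop
  have hVB : Measurable fun z : Fin N → ℂ => ENNReal.ofReal
      ((∏ x ∈ (Finset.univ : Finset (Fin N)).offDiag, ‖z x.1 - z x.2‖)
        * Real.exp (-(N : ℝ) * ∑ i, W (z i))) := by
    have : ∀ i : Fin N, Measurable fun z : Fin N → ℂ => W (z i) := fun i =>
      hW.comp (measurable_pi_apply i)
    refine (hV.mul ?_).ennreal_ofReal
    fun_prop
  have h1 := lintegral_withDensity_eq_lintegral_mul
    ((Measure.hausdorffMeasure (d : ℝ)).restrict S) (hBs.measurable_eigenvalueTuple hB hT)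
    (hGs.measurable_eigenvalueTuple hG hT)
  have h2 := hC (fun z => ENNReal.ofReal (Real.exp (-(N : ℝ) * ∑ i, W (z i))) * G z) (hB.mul hG)
    fun π z => by
      have e1 := hBs π z
      have e2 := hGs π z
      simp only at e1 ⊢
      rw [e1, e2]
  have h3 := lintegral_withDensity_eq_lintegral_mul (Measure.pi fun _ : Fin N => η) hVB hG
  refine (h1.trans h2).trans ?_
  rw [coulombWeight]
  congr 1
  refine Eq.trans ?_ h3.symm
  refine lintegral_congr fun z => ?_
  simp only [Pi.mul_apply]
  rw [ENNReal.ofReal_mul (Finset.prod_nonneg fun _ _ => norm_nonneg _), mul_assoc]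

theorem lintegral_modelLaw (h : IsCoulombModel S d T D η) (hW : Measurable W)
    {G : (Fin N → ℂ) → ℝ≥0∞} (hG : Measurable G) (hGs : IsSymmetricFunction G) :
    ∫⁻ a, G (eigenvalueTuple (T a)) ∂(modelLaw S d T W)
      = ∫⁻ z, G z ∂((coulombWeight η W N Set.univ)⁻¹ • coulombWeight η W N) := by
  obtain ⟨C, hCt, hC0, hC⟩ := lintegral_modelWeight h hW
  have h1 : modelWeight S d T W Set.univ = C * coulombWeight η W N Set.univ := by
    have := hC (fun _ => 1) measurable_const fun _ _ => rfl
    simpa only [lintegral_const, one_mul] using this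
  rw [modelLaw, lintegral_smul_measure, lintegral_smul_measure, hC G hG hGs, h1, smul_eq_mul,
    smul_eq_mul, ENNReal.mul_inv (Or.inl hC0) (Or.inl hCt), mul_comm C⁻¹, mul_assoc,
    ← mul_assoc C⁻¹, ENNReal.inv_mul_cancel hC0 hCt, one_mul]

theorem isProbabilityMeasure_modelLaw (h : IsCoulombModel S d T D η) (hW : Measurable W)
    (hη0 : coulombWeight η W N Set.univ ≠ 0) (hηt : coulombWeight η W N Set.univ ≠ ⊤) :
    IsProbabilityMeasure (modelLaw S d T W) := by
  have h1 := lintegral_modelLaw h hW (G := fun _ => 1) measurable_const fun _ _ => rfl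
  simp only [lintegral_const, one_mul, Measure.smul_apply, smul_eq_mul] at h1
  exact ⟨by rw [h1, ENNReal.inv_mul_cancel hη0 hηt]⟩

/-- The law of `k` of the points of `z`. -/
theorem eigenvalueTupleMeasure_apply (k : ℕ) (M : Matrix (Fin N) (Fin N) ℂ)
    {B : Set (Fin k → ℂ)} (hB : MeasurableSet B) :
    eigenvalueTupleMeasure k M B = ((N.descFactorial k : ℕ) : ℝ≥0∞)⁻¹
      * ∑ e : Fin k ↪ Fin N, B.indicator 1 (fun j => eigenvalueTuple M (e j)) := by
  rw [eigenvalueTupleMeasure, Measure.smul_apply, smul_eq_mul, Measure.finsetSum_apply]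
  congr 1
  exact Finset.sum_congr rfl fun e _ => Measure.dirac_apply' _ hB

/-- Averaging over all injections of k indices is symmetric in the eigenvalues, so the Coulomb gas
formula, stated only for symmetric functions, applies to it. -/
theorem modelCorrelation_eq (h : IsCoulombModel S d T D η) (hW : Measurable W) (k : ℕ) :
    modelCorrelation S d T W k = ((N.descFactorial k : ℕ) : ℝ≥0∞)⁻¹ • ∑ e : Fin k ↪ Fin N,
      ((coulombWeight η W N Set.univ)⁻¹ • coulombWeight η W N).map fun z j => z (e j) := by
  have hpm : ∀ e : Fin k ↪ Fin N, Measurable fun (z : Fin N → ℂ) (j : Fin k) => z (e j) := fun e =>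
    measurable_pi_lambda _ fun j => measurable_pi_apply _
  have hIm : ∀ B : Set (Fin k → ℂ), MeasurableSet B → ∀ e : Fin k ↪ Fin N, Measurable
      fun z : Fin N → ℂ => B.indicator (1 : (Fin k → ℂ) → ℝ≥0∞) (fun j => z (e j)) :=
    fun B hB e => (measurable_one.indicator hB).comp (hpm e)
  have hGm : ∀ B : Set (Fin k → ℂ), MeasurableSet B → Measurable fun z : Fin N → ℂ =>
      ((N.descFactorial k : ℕ) : ℝ≥0∞)⁻¹
        * ∑ e : Fin k ↪ Fin N, B.indicator (1 : (Fin k → ℂ) → ℝ≥0∞) (fun j => z (e j)) :=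
    fun B hB => (Finset.measurable_sum _ fun e _ => hIm B hB e).const_mul _
  have hGs : ∀ B : Set (Fin k → ℂ), IsSymmetricFunction fun z : Fin N → ℂ =>
      ((N.descFactorial k : ℕ) : ℝ≥0∞)⁻¹
        * ∑ e : Fin k ↪ Fin N, B.indicator (1 : (Fin k → ℂ) → ℝ≥0∞) (fun j => z (e j)) := by
    intro B π z
    simp only [Function.comp_apply]
    congr 1
    exact Equiv.sum_comp (Equiv.embeddingCongr (Equiv.refl (Fin k)) π)
      fun e => B.indicator (1 : (Fin k → ℂ) → ℝ≥0∞) fun j => z (e j)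
  ext B hB
  have hκ : Measurable fun a => eigenvalueTupleMeasure k (T a) := by
    refine Measure.measurable_of_measurable_coe _ fun B hB => ?_
    simp only [eigenvalueTupleMeasure_apply k _ hB]
    exact (hGs B).measurable_eigenvalueTuple (hGm B hB) h.1
  rw [modelCorrelation, Measure.bind_apply hB hκ.aemeasurable]
  simp only [eigenvalueTupleMeasure_apply k _ hB]
  rw [lintegral_modelLaw h hW (hGm B hB) (hGs B), lintegral_const_mul _
    (Finset.measurable_sum _ fun e _ => hIm B hB e), lintegral_finsetSum _ fun e _ => hIm B hB e,
    Measure.smul_apply, smul_eq_mul, Measure.finsetSum_apply]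
  congr 1
  refine Finset.sum_congr rfl fun e _ => ?_
  rw [Measure.map_apply (hpm e) hB, ← lintegral_indicator_one (hpm e hB)]
  rfl

theorem integral_modelCorrelation (h : IsCoulombModel S d T D η) (hW : Measurable W)
    (hη0 : coulombWeight η W N Set.univ ≠ 0) (hηt : coulombWeight η W N Set.univ ≠ ⊤) {k : ℕ}
    (f : BoundedContinuousFunction (Fin k → ℂ) ℝ) :
    ∫ y, f y ∂(modelCorrelation S d T W k)
      = ∫ z, tupleAverage f z ∂((coulombWeight η W N Set.univ)⁻¹ • coulombWeight η W N) := by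
  have hpm : ∀ e : Fin k ↪ Fin N, Measurable fun (z : Fin N → ℂ) (j : Fin k) => z (e j) := fun e =>
    measurable_pi_lambda _ fun j => measurable_pi_apply _
  rw [modelCorrelation_eq h hW k]
  set ν := (coulombWeight η W N Set.univ)⁻¹ • coulombWeight η W N with hν
  haveI : IsProbabilityMeasure ν := ⟨by
    rw [hν, Measure.smul_apply, smul_eq_mul, ENNReal.inv_mul_cancel hη0 hηt]⟩
  have hfi : ∀ e : Fin k ↪ Fin N, Integrable f (ν.map fun z j => z (e j)) := fun e => by
    haveI : IsProbabilityMeasure (ν.map fun (z : Fin N → ℂ) (j : Fin k) => z (e j)) :=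
      Measure.isProbabilityMeasure_map (hpm e).aemeasurable
    exact f.integrable _
  have hfi' : ∀ e : Fin k ↪ Fin N, Integrable (fun z : Fin N → ℂ => f fun j => z (e j)) ν :=
    fun e => (hfi e).comp_measurable (hpm e)
  rw [integral_smul_measure, integral_finsetSum_measure fun e _ => hfi e]
  simp only [tupleAverage]
  rw [integral_const_mul, integral_finsetSum _ fun e _ => hfi' e, ENNReal.toReal_inv, ENNReal.toReal_natCast, smul_eq_mul]
  congr 1
  refine Finset.sum_congr rfl fun e _ => ?_
  exact integral_map (hpm e).aemeasurable f.continuous.aestronglyMeasurable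

end CoulombModels

/-! ### The commutator equation in terms of blocks -/

section CyclicCommutator

variable {m N : ℕ} [NeZero m]

theorem toMatrix_apply {ι : Type} [Fintype ι] (a : MatrixSpace ι) (x y : ι) :
    a.toMatrix x y = a (x, y) := rfl

theorem continuous_toMatrix {ι : Type} [Fintype ι] :
    Continuous (MatrixSpace.toMatrix : MatrixSpace ι → Matrix ι ι ℂ) := by
  refine continuous_matrix fun i j => ?_
  simp only [toMatrix_apply]
  fun_prop

theorem exists_cyclicMatrix_eq {a : MatrixSpace (Fin m × Fin N)}
    (ha : ∀ i j : Fin m, j ≠ i + 1 → blockOf a.toMatrix i j = 0) :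
    a = cyclicMatrix fun i => blockOf a.toMatrix i (i + 1) := by
  ext x
  rw [cyclicMatrix_apply]
  split_ifs with h
  · rw [← h]; rfl
  · exact congrFun (congrFun (ha _ _ h) x.1.2) x.2.2

theorem blockOf_cyclicMatrix_self (B : Fin m → Matrix (Fin N) (Fin N) ℂ) (i : Fin m) :
    blockOf (cyclicMatrix B).toMatrix i (i + 1) = B i := by
  ext p q
  change cyclicMatrix B ((i, p), (i + 1, q)) = _
  rw [cyclicMatrix_apply, if_pos rfl]

theorem blockOf_cyclicMatrix_of_ne (B : Fin m → Matrix (Fin N) (Fin N) ℂ) {i j : Fin m}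
    (h : j ≠ i + 1) : blockOf (cyclicMatrix B).toMatrix i j = 0 := by
  ext p q
  change cyclicMatrix B ((i, p), (j, q)) = _
  rw [cyclicMatrix_apply, if_neg h]
  rfl

theorem cyclicMatrix_mul_conjTranspose_apply (B : Fin m → Matrix (Fin N) (Fin N) ℂ)
    (i j : Fin m) (p q : Fin N) :
    ((cyclicMatrix B).toMatrix * (cyclicMatrix B).toMatrixᴴ) (i, p) (j, q)
      = if i = j then (B i * (B i)ᴴ) p q else 0 := by
  rw [Matrix.mul_apply, Fintype.sum_prod_type]
  simp only [Matrix.conjTranspose_apply, toMatrix_apply, cyclicMatrix_apply]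
  rw [Finset.sum_eq_single (i + 1)]
  · by_cases h : i = j
    · subst h
      simp [Matrix.mul_apply]
    · have : i + 1 ≠ j + 1 := fun h' => h (add_right_cancel h')
      simp [this, h]
  · intro l _ hl
    simp [hl]
  · simp

theorem conjTranspose_mul_cyclicMatrix_apply (B : Fin m → Matrix (Fin N) (Fin N) ℂ)
    (i j : Fin m) (p q : Fin N) :
    ((cyclicMatrix B).toMatrixᴴ * (cyclicMatrix B).toMatrix) (i + 1, p) (j + 1, q)
      = if i = j then ((B i)ᴴ * B i) p q else 0 := by
  rw [Matrix.mul_apply, Fintype.sum_prod_type]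
  simp only [Matrix.conjTranspose_apply, toMatrix_apply, cyclicMatrix_apply]
  rw [Finset.sum_eq_single i]
  · by_cases h : i = j
    · subst h
      simp [Matrix.mul_apply]
    · have : j + 1 ≠ i + 1 := fun h' => h (add_right_cancel h').symm
      simp [this, h]
  · intro l _ hl
    have : i + 1 ≠ l + 1 := fun h' => hl (add_right_cancel h').symm
    simp [this]
  · simp

theorem commutator_cyclicMatrix_eq_iff (B : Fin m → Matrix (Fin N) (Fin N) ℂ) (lam : Fin m → ℝ) :
    (cyclicMatrix B).toMatrix * (cyclicMatrix B).toMatrixᴴ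
        - (cyclicMatrix B).toMatrixᴴ * (cyclicMatrix B).toMatrix
        = Matrix.diagonal (fun ip : Fin m × Fin N => (lam ip.1 : ℂ)) ↔
      ∀ i, B (i + 1) * (B (i + 1))ᴴ - (B i)ᴴ * B i
        = Matrix.scalar (Fin N) (lam (i + 1) : ℂ) := by
  have key : ∀ i j p q, ((cyclicMatrix B).toMatrix * (cyclicMatrix B).toMatrixᴴ
        - (cyclicMatrix B).toMatrixᴴ * (cyclicMatrix B).toMatrix) (i + 1, p) (j + 1, q)
      = if i = j then (B (i + 1) * (B (i + 1))ᴴ - (B i)ᴴ * B i) p q else 0 := by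
    intro i j p q
    rw [Matrix.sub_apply, cyclicMatrix_mul_conjTranspose_apply,
      conjTranspose_mul_cyclicMatrix_apply]
    by_cases h : i = j
    · simp [h]
    · have : i + 1 ≠ j + 1 := fun h' => h (add_right_cancel h')
      simp [h, this]
  constructor
  · intro h i
    ext p q
    have h1 := key i i p q
    rw [h, if_pos rfl] at h1
    rw [← h1, Matrix.scalar_apply, Matrix.diagonal_apply, Matrix.diagonal_apply]
    simp
  · intro h
    ext ⟨i, p⟩ ⟨j, q⟩
    have h1 := key (i - 1) (j - 1) p q
    rw [h, sub_add_cancel, sub_add_cancel] at h1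
    rw [h1, Matrix.scalar_apply, Matrix.diagonal_apply, Matrix.diagonal_apply]
    by_cases hij : i = j
    · subst hij; simp
    · simp [hij]

/-- Partial sums with a minus sign; the relation at the last index closes up because the total
vanishes. -/
theorem exists_cyclic_potential (lam : Fin m → ℝ) (h : ∑ i, lam i = 0) :
    ∃ c : Fin m → ℝ, ∀ i, c i - c (i + 1) = lam (i + 1) := by
  refine ⟨fun i => -∑ j ∈ Finset.Iic i, lam j, fun i => ?_⟩
  rcases Fin.val_add_one_cases i with ⟨h1, h2⟩ | ⟨h1, h2⟩
  · have h3 : Finset.Iic (i + 1) = insert (i + 1) (Finset.Iic i) := by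
      ext j
      simp only [Finset.mem_Iic, Finset.mem_insert, Fin.le_def, Fin.ext_iff, h2]
      omega
    have h4 : i + 1 ∉ Finset.Iic i := by
      simp only [Finset.mem_Iic, Fin.le_def, h2]
      omega
    simp only [h3, Finset.sum_insert h4]
    ring
  · have h3 : Finset.Iic i = Finset.univ := by
      ext j
      simp only [Finset.mem_Iic, Fin.le_def, Finset.mem_univ, iff_true]
      omega
    have h4 : Finset.Iic (i + 1) = {i + 1} := by
      ext j
      simp only [Finset.mem_Iic, Finset.mem_singleton, Fin.le_def, Fin.ext_iff, h2]
      omega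
    simp only [h3, h4, h, Finset.sum_singleton]
    ring

end CyclicCommutator

/-! ### The product of the blocks and its eigenvalues -/

section CyclicProduct

variable {m N : ℕ} [NeZero m]

theorem prod_ofFn_conj_diagonal (V : ℕ → Matrix (Fin N) (Fin N) ℂ)
    (hV : ∀ i, V i ∈ Matrix.unitaryGroup (Fin N) ℂ) (d : ℕ → Fin N → ℂ) (n : ℕ) :
    (List.ofFn fun i : Fin n => V i * Matrix.diagonal (d i) * (V (i + 1))ᴴ).prod
      = V 0 * Matrix.diagonal (∏ i : Fin n, d i) * (V n)ᴴ := by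
  induction n with
  | zero =>
    simp only [List.ofFn_zero, List.prod_nil, Finset.univ_eq_empty, Finset.prod_empty]
    rw [show Matrix.diagonal (1 : Fin N → ℂ) = 1 from Matrix.diagonal_one, Matrix.mul_one,
      mul_conjTranspose_of_mem_unitaryGroup (hV 0)]
  | succ n ih =>
    rw [List.ofFn_succ', List.concat_eq_append, List.prod_append, List.prod_singleton]
    simp only [Fin.val_castSucc, Fin.val_last]
    rw [ih, Fin.prod_univ_castSucc]
    simp only [Fin.val_castSucc, Fin.val_last]
    calc _ = V 0 * Matrix.diagonal (∏ i : Fin n, d i) * ((V n)ᴴ * V n)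
          * Matrix.diagonal (d n) * (V (n + 1))ᴴ := by simp only [Matrix.mul_assoc]
      _ = _ := by
        rw [conjTranspose_mul_of_mem_unitaryGroup (hV n), Matrix.mul_one,
          Matrix.mul_assoc (V 0), Matrix.diagonal_mul_diagonal]
        rfl

theorem blockProduct_cyclicPoint (γ : Fin m → ℝ) {U : Fin m → Matrix (Fin N) (Fin N) ℂ}
    (hU : ∀ i, U i ∈ Matrix.unitaryGroup (Fin N) ℂ) (y : Fin N → ℝ × (Fin m → ℝ)) :
    blockProduct m N (cyclicPoint γ U y)
      = U 0 * Matrix.diagonal (fun p => polarEigenvalue γ (y p)) * (U 0)ᴴ := by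
  have h1 := prod_ofFn_conj_diagonal (fun n => U (Fin.ofNat m n)) (fun n => hU _)
    (fun n p => diagEntry γ (y p) (Fin.ofNat m n)) m
  have h2 : ∀ i : Fin m, Fin.ofNat m i.val = i := fun i => by
    ext; exact Nat.mod_eq_of_lt i.2
  have h3 : ∀ i : Fin m, Fin.ofNat m (i.val + 1) = i + 1 := fun i => by
    ext
    rw [Fin.val_add, Fin.val_ofNat, Fin.coe_ofNat_eq_mod, Nat.add_mod_mod]
  have h4 : Fin.ofNat m m = 0 := by
    ext; simp
  simp only [h2, h3, h4] at h1
  rw [blockProduct]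
  simp only [cyclicPoint, blockOf_cyclicMatrix_self]
  rw [h1]
  congr 3
  funext p
  rw [Finset.prod_apply]
  rfl

theorem charpoly_blockProduct_cyclicPoint (γ : Fin m → ℝ)
    {U : Fin m → Matrix (Fin N) (Fin N) ℂ}
    (hU : ∀ i, U i ∈ Matrix.unitaryGroup (Fin N) ℂ) (y : Fin N → ℝ × (Fin m → ℝ)) :
    (blockProduct m N (cyclicPoint γ U y)).charpoly
      = ∏ p, (Polynomial.X - Polynomial.C (polarEigenvalue γ (y p))) := by
  rw [blockProduct_cyclicPoint γ hU, Matrix.mul_assoc, Matrix.charpoly_mul_comm, Matrix.mul_assoc,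
    conjTranspose_mul_of_mem_unitaryGroup (hU 0), Matrix.mul_one, Matrix.charpoly_diagonal]

theorem spectrum_blockProduct_cyclicPoint (γ : Fin m → ℝ)
    {U : Fin m → Matrix (Fin N) (Fin N) ℂ}
    (hU : ∀ i, U i ∈ Matrix.unitaryGroup (Fin N) ℂ) (y : Fin N → ℝ × (Fin m → ℝ)) :
    spectrum ℂ (blockProduct m N (cyclicPoint γ U y))
      = Set.range fun p => polarEigenvalue γ (y p) := by
  ext c
  rw [Matrix.mem_spectrum_iff_isRoot_charpoly, charpoly_blockProduct_cyclicPoint γ hU,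
    Polynomial.IsRoot.def, Polynomial.eval_prod, Finset.prod_eq_zero_iff]
  simp [sub_eq_zero, eq_comm]

theorem continuous_blockProduct : Continuous (blockProduct m N) := by
  have h : ∀ (n : ℕ) (f : Fin n → MatrixSpace (Fin m × Fin N) → Matrix (Fin N) (Fin N) ℂ),
      (∀ i, Continuous (f i)) → Continuous fun a => (List.ofFn fun i => f i a).prod := by
    intro n
    induction n with
    | zero => intro f _; simpa using continuous_const
    | succ n ih =>
      intro f hf
      simp only [List.ofFn_succ, List.prod_cons]
      exact (hf 0).mul (ih _ fun i => hf _)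
  refine h m _ fun i => continuous_matrix fun p q => ?_
  change Continuous fun a : MatrixSpace (Fin m × Fin N) => a ((i, p), (i + 1, q))
  fun_prop

/-- The generalized normal matrices in normal form. -/
theorem generalizedNormalMatrices_eq_cyclicPoints {lam c γ : Fin m → ℝ} {b : ℝ}
    (hc : ∀ i, c i - c (i + 1) = lam (i + 1)) (hγ : ∀ i, γ i = b - c i) (hb : ∀ i, c i ≤ b)
    (hb' : ∃ i, c i = b) (D : Set ℂ) :
    generalizedNormalMatrices m N lam D = cyclicPoints γ D N := by
  have hγ0 : ∀ i, 0 ≤ γ i := fun i => by rw [hγ]; linarith [hb i]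
  ext a
  constructor
  · rintro ⟨h1, h2, h3⟩
    have ha := exists_cyclicMatrix_eq h1
    set M : Fin m → Matrix (Fin N) (Fin N) ℂ := fun i => blockOf a.toMatrix i (i + 1) with hM
    rw [ha, commutator_cyclicMatrix_eq_iff] at h3
    obtain ⟨U, x, t, hU, hx, ht, hMU⟩ := exists_cyclic_normalForm (c := c) (M := M) fun i => by
      have h4 := h3 i
      rw [← hc, Complex.ofReal_sub, map_sub, sub_eq_iff_eq_add] at h4
      rw [h4]
      abel
    obtain ⟨i₀, hi₀⟩ := hb'
    -- The block where c is largest gives the strongest bound x ≥ b, so √(x - b) is available as the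
    -- common radial coordinate.
    have hxb : ∀ p, 0 ≤ x p - b := fun p => by rw [← hi₀]; linarith [hx i₀ p]
    choose φ hφ hφe using fun i p => exists_phase_mem_Ico (ht i p)
    have haU : a = cyclicPoint γ U fun p => (√(x p - b), fun i => φ i p) := by
      rw [ha, cyclicPoint]
      congr 1
      funext i
      rw [hMU]
      congr 3
      funext p
      rw [diagEntry, hφe, radialMap_eq_sqrt (Real.sqrt_nonneg _), Real.sq_sqrt (hxb p), hγ]
      congr 3
      ring
    refine ⟨U, _, hU, fun p => ⟨Real.sqrt_nonneg _, ?_⟩, haU⟩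
    refine h2 ?_
    rw [haU, spectrum_blockProduct_cyclicPoint γ hU]
    exact ⟨p, rfl⟩
  · rintro ⟨U, y, hU, hy, rfl⟩
    refine ⟨fun i j hij => blockOf_cyclicMatrix_of_ne _ hij, ?_, ?_⟩
    · rw [spectrum_blockProduct_cyclicPoint γ hU]
      rintro _ ⟨p, rfl⟩
      exact (hy p).2
    · rw [cyclicPoint, commutator_cyclicMatrix_eq_iff]
      intro i
      have h1 : ∀ V V' : Matrix (Fin N) (Fin N) ℂ, V' ∈ Matrix.unitaryGroup (Fin N) ℂ →
          ∀ d : Fin N → ℂ, V * Matrix.diagonal d * V'ᴴ * (V * Matrix.diagonal d * V'ᴴ)ᴴ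
            = V * Matrix.diagonal (fun p => ((‖d p‖ ^ 2 : ℝ) : ℂ)) * Vᴴ := by
        intro V V' hV' d
        simp only [Matrix.conjTranspose_mul, Matrix.conjTranspose_conjTranspose,
          Matrix.diagonal_conjTranspose]
        calc _ = V * Matrix.diagonal d * ((V'ᴴ * V') * (Matrix.diagonal (star d) * Vᴴ)) := by
              simp only [Matrix.mul_assoc]
          _ = V * (Matrix.diagonal d * Matrix.diagonal (star d)) * Vᴴ := by
              rw [conjTranspose_mul_of_mem_unitaryGroup hV', Matrix.one_mul]
              simp only [Matrix.mul_assoc]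
          _ = _ := by
              rw [Matrix.diagonal_mul_diagonal]
              congr 3
              funext p
              rw [Pi.star_apply, ← starRingEnd_apply, Complex.mul_conj, Complex.normSq_eq_norm_sq]
      have h2 : ∀ V V' : Matrix (Fin N) (Fin N) ℂ, V ∈ Matrix.unitaryGroup (Fin N) ℂ →
          ∀ d : Fin N → ℂ, (V * Matrix.diagonal d * V'ᴴ)ᴴ * (V * Matrix.diagonal d * V'ᴴ)
            = V' * Matrix.diagonal (fun p => ((‖d p‖ ^ 2 : ℝ) : ℂ)) * V'ᴴ := by
        intro V V' hV d
        have h3 := h1 V' V hV (star d)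
        simp only [Matrix.conjTranspose_mul, Matrix.conjTranspose_conjTranspose,
          Matrix.diagonal_conjTranspose, star_star, Pi.star_apply, norm_star] at h3 ⊢
        simp only [Matrix.mul_assoc] at h3 ⊢
        exact h3
      rw [h1 _ _ (hU _), h2 _ _ (hU _), ← Matrix.sub_mul, ← Matrix.mul_sub, Matrix.diagonal_sub]
      have h4 : (fun p => ((‖diagEntry γ (y p) (i + 1)‖ ^ 2 : ℝ) : ℂ)
          - ((‖diagEntry γ (y p) i‖ ^ 2 : ℝ) : ℂ)) = fun _ => (lam (i + 1) : ℂ) := by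
        funext p
        rw [norm_diagEntry_sq hγ0, norm_diagEntry_sq hγ0, ← Complex.ofReal_sub, hγ, hγ, ← hc]
        congr 1
        ring
      rw [h4, ← Matrix.scalar_apply, ← (Matrix.scalar_commute _ (Commute.all _) _).eq,
        Matrix.mul_assoc, mul_conjTranspose_of_mem_unitaryGroup (hU _), Matrix.mul_one]

end CyclicProduct

/-! ### The two matrix models as Coulomb gases -/

section CoulombInstances

variable {m N : ℕ} [NeZero m]

theorem measurableSet_spectrum_subset {α : Type*} [TopologicalSpace α] [MeasurableSpace α]
    [OpensMeasurableSpace α] {T : α → Matrix (Fin N) (Fin N) ℂ} (hT : Continuous T) {D : Set ℂ}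
    (hD : MeasurableSet D) : MeasurableSet {a | spectrum ℂ (T a) ⊆ D} := by
  have h1 : IsSymmetricFunction fun z : Fin N → ℂ => ∀ i, z i ∈ D := fun π z =>
    propext ⟨fun h i => by simpa using h (π.symm i), fun h i => h _⟩
  have h2 : Measurable fun z : Fin N → ℂ => ∀ i, z i ∈ D :=
    Measurable.forall fun i => (measurableSet_setOfPred (p := fun c => c ∈ D)).1 hD |>.comp
      (measurable_pi_apply i)
  have h3 := h1.measurable_eigenvalueTuple h2 hT
  have h4 : {a | spectrum ℂ (T a) ⊆ D} = {a | ∀ i, eigenvalueTuple (T a) i ∈ D} := by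
    ext a
    change _ ⊆ D ↔ ∀ i, eigenvalueTuple (T a) i ∈ D
    rw [spectrum_eq_range_eigenvalueTuple, Set.range_subset_iff]
  rw [h4]
  exact measurableSet_setOfPred.2 h3

theorem measurableSet_generalizedNormalMatrices (lam : Fin m → ℝ) {D : Set ℂ}
    (hD : MeasurableSet D) : MeasurableSet (generalizedNormalMatrices m N lam D) := by
  have hT : Continuous fun a : MatrixSpace (Fin m × Fin N) => a.toMatrix := continuous_toMatrix
  have hb : ∀ i j : Fin m,
      Continuous fun a : MatrixSpace (Fin m × Fin N) => blockOf a.toMatrix i j := fun i j => by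
    refine continuous_matrix fun p q => ?_
    change Continuous fun a : MatrixSpace (Fin m × Fin N) => a ((i, p), (j, q))
    fun_prop
  refine MeasurableSet.inter (s₁ := {a | ∀ i j : Fin m, j ≠ i + 1 → blockOf a.toMatrix i j = 0}) ?_
    (MeasurableSet.inter (measurableSet_spectrum_subset continuous_blockProduct hD) ?_)
  · have : {a : MatrixSpace (Fin m × Fin N) | ∀ i j : Fin m, j ≠ i + 1 → blockOf a.toMatrix i j = 0}
        = ⋂ i, ⋂ j, ⋂ _ : j ≠ i + 1, {a | blockOf a.toMatrix i j = 0} := by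
      ext a; simp
    rw [this]
    exact (isClosed_iInter fun i => isClosed_iInter fun j => isClosed_iInter fun _ =>
      isClosed_eq (hb i j) continuous_const).measurableSet
  · exact (isClosed_eq ((hT.matrix_mul hT.matrix_conjTranspose).sub
      (hT.matrix_conjTranspose.matrix_mul hT)) continuous_const).measurableSet

/-- Here γ_i is max c - c_i, which depends on λ alone. It is chosen before D and N, so the reference
measure is the same for all N. -/
theorem isCoulombModel_generalizedNormalMatrices {lam : Fin m → ℝ} (h : ∑ i, lam i = 0) :
    ∃ γ : Fin m → ℝ, (∀ i, 0 ≤ γ i) ∧ (∃ i, γ i = 0) ∧ ∀ (D : Set ℂ) (N : ℕ), MeasurableSet D →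
      Bornology.IsBounded D →
      IsCoulombModel (generalizedNormalMatrices m N lam D) (m * N ^ 2 + N) (blockProduct m N) D
        (polarMeasure γ D) := by
  obtain ⟨c, hc⟩ := exists_cyclic_potential lam h
  obtain ⟨i₀, hi₀⟩ := Finite.exists_max c
  have hγ : ∀ i, 0 ≤ c i₀ - c i := fun i => sub_nonneg.2 (hi₀ i)
  refine ⟨fun i => c i₀ - c i, hγ, ⟨i₀, sub_self _⟩, fun D N hD hDb => ⟨continuous_blockProduct,
    measurableSet_generalizedNormalMatrices lam hD, fun a ha i => ha.2.1 ?_, ?_⟩⟩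
  · rw [spectrum_eq_range_eigenvalueTuple]
    exact ⟨i, rfl⟩
  · obtain ⟨C, hCt, hC0, hC⟩ := exists_lintegral_cyclicPoints (N := N) hγ hD
    refine ⟨C, hCt, hC0, fun G hG hGs => ?_⟩
    rw [generalizedNormalMatrices_eq_cyclicPoints hc (fun _ => rfl) hi₀ ⟨i₀, rfl⟩ D,
      ← polarIntegral_eq hγ hD hDb hG]
    exact hC _ G (hGs.measurable_eigenvalueTuple hG continuous_blockProduct) hG fun U y hU =>
      hGs.eigenvalueTuple_eq (charpoly_blockProduct_cyclicPoint _ hU y)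

/-- Hausdorff measure is invariant under isometries; this carries the case m = 1, indexed by `Fin 1
× Fin N`, over to ordinary matrices. -/
theorem IsCoulombModel.comp_isometryEquiv {ι κ : Type} [Fintype ι] [Fintype κ]
    {S : Set (MatrixSpace ι)} {d : ℕ} {T : MatrixSpace ι → Matrix (Fin N) (Fin N) ℂ}
    {D : Set ℂ} {η : Measure ℂ} (h : IsCoulombModel S d T D η)
    (e : MatrixSpace κ ≃ᵢ MatrixSpace ι) :
    IsCoulombModel (e ⁻¹' S) d (fun a => T (e a)) D η := by
  obtain ⟨hT, hS, hSD, C, hCt, hC0, hC⟩ := h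
  refine ⟨hT.comp e.continuous, hS.preimage e.continuous.measurable, fun a ha => hSD _ ha,
    C, hCt, hC0, fun G hG hGs => ?_⟩
  rw [← hC G hG hGs]
  exact (e.measurePreserving_hausdorffMeasure (d : ℝ)).setLIntegral_comp_preimage_emb
    e.toHomeomorph.measurableEmbedding (fun b => G (eigenvalueTuple (T b))) S

/-- A square matrix as a block matrix with one block. -/
noncomputable def oneBlockEquiv (N : ℕ) : MatrixSpace (Fin N) ≃ᵢ MatrixSpace (Fin 1 × Fin N) :=
  (LinearIsometryEquiv.piLpCongrLeft 2 ℂ ℂ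
    ((Equiv.uniqueProd (Fin N) (Fin 1)).symm.prodCongr
      (Equiv.uniqueProd (Fin N) (Fin 1)).symm)).toIsometryEquiv

theorem oneBlockEquiv_eq (a : MatrixSpace (Fin N)) :
    oneBlockEquiv N a = cyclicMatrix fun _ : Fin 1 => a.toMatrix := by
  ext x
  rw [cyclicMatrix_apply, if_pos (Subsingleton.elim _ _)]
  rfl

theorem blockProduct_oneBlockEquiv (a : MatrixSpace (Fin N)) :
    blockProduct 1 N (oneBlockEquiv N a) = a.toMatrix := by
  rw [blockProduct, oneBlockEquiv_eq]
  simp only [blockOf_cyclicMatrix_self]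
  simp

theorem oneBlockEquiv_preimage (D : Set ℂ) :
    oneBlockEquiv N ⁻¹' generalizedNormalMatrices 1 N 0 D = normalMatrices N D := by
  ext a
  have h0 : ∀ i j : Fin 1, j ≠ i + 1 → blockOf (oneBlockEquiv N a).toMatrix i j = 0 :=
    fun i j hij => absurd (Subsingleton.elim _ _) hij
  have h1 := commutator_cyclicMatrix_eq_iff (fun _ : Fin 1 => a.toMatrix) 0
  rw [← oneBlockEquiv_eq] at h1
  change (_ ∧ _ ∧ _) ↔ (_ ∧ _)
  rw [h1, blockProduct_oneBlockEquiv]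
  simp only [Pi.zero_apply, Complex.ofReal_zero, map_zero, forall_const]
  exact ⟨fun h => ⟨h.2.2, h.2.1⟩, fun h => ⟨h0, h.2, h.1⟩⟩

theorem isCoulombModel_normalMatrices :
    ∃ γ : Fin 1 → ℝ, (∀ i, 0 ≤ γ i) ∧ (∃ i, γ i = 0) ∧ ∀ (D : Set ℂ) (N : ℕ), MeasurableSet D →
      Bornology.IsBounded D →
      IsCoulombModel (normalMatrices N D) (N ^ 2 + N) MatrixSpace.toMatrix D
        (polarMeasure γ D) := by
  obtain ⟨γ, hγ, hγ0, h⟩ := isCoulombModel_generalizedNormalMatrices (m := 1) (lam := 0) (by simp)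
  refine ⟨γ, hγ, hγ0, fun D N hD hDb => ?_⟩
  have h1 := (h D N hD hDb).comp_isometryEquiv (oneBlockEquiv N)
  rw [oneBlockEquiv_preimage, one_mul] at h1
  simpa only [blockProduct_oneBlockEquiv] using h1

end CoulombInstances

/-! ### Independence of the potential outside D -/

section PotentialExtension

variable {D : Set ℂ} {W W' : ℂ → ℝ}

theorem energy_congr (h : Set.EqOn W W' D) {σ : Measure ℂ} (hσ : σ Dᶜ = 0) :
    energy W σ = energy W' σ := by
  rw [energy, energy, integral_congr_ae]
  filter_upwards [mem_ae_iff.2 hσ] with z hz using h hz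

theorem isEquilibriumMeasure_congr (h : Set.EqOn W W' D) (σ : Measure ℂ) :
    IsEquilibriumMeasure D W σ ↔ IsEquilibriumMeasure D W' σ := by
  have h1 : ⨅ μ ∈ admissibleMeasures D, energy W μ = ⨅ μ ∈ admissibleMeasures D, energy W' μ :=
    iInf_congr fun μ => iInf_congr fun hμ => energy_congr h hμ.2.1
  refine and_congr_right fun hσ => ?_
  rw [h1, energy_congr h hσ.2.1]

/-- Tietze extension. The Coulomb gas argument uses a potential continuous on ℂ, while energies and
laws only see its values on D. -/
theorem exists_continuous_eqOn (hD : IsClosed D) (hW : ContinuousOn W D) :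
    ∃ W' : ℂ → ℝ, Continuous W' ∧ Set.EqOn W W' D := by
  obtain ⟨g, hg⟩ := ContinuousMap.exists_restrict_eq hD ⟨D.domRestrict W, hW.domRestrict⟩
  exact ⟨g, g.continuous, fun z hz => (DFunLike.congr_fun hg ⟨z, hz⟩).symm⟩

end PotentialExtension

/-! ### The common limit of all Coulomb models -/

section Limit

variable {D : Set ℂ} {W W' : ℂ → ℝ}

/-- Existence and uniqueness of the equilibrium measure, and convergence of all matrix models
whose eigenvalues form a Coulomb gas. -/
theorem exists_equilibriumMeasure_limit (hD : IsCompact D) (hDconn : IsConnected (interior D))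
    (hDcl : closure (interior D) = D) (hW : ContinuousOn W D) :
    ∃ σ : Measure ℂ, IsEquilibriumMeasure D W σ ∧
      (∀ τ : Measure ℂ, IsEquilibriumMeasure D W τ → τ = σ) ∧
      ∀ (ι : ℕ → Type) [∀ N, Fintype (ι N)] (S : ∀ N, Set (MatrixSpace (ι N))) (d : ℕ → ℕ)
        (T : ∀ N, MatrixSpace (ι N) → Matrix (Fin N) (Fin N) ℂ) (η : Measure ℂ),
        IsFiniteMeasure η → η Dᶜ = 0 → volume.restrict D ≪ η →
        (∀ N, IsCoulombModel (S N) (d N) (T N) D η) →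
        (∀ N, IsProbabilityMeasure (modelLaw (S N) (d N) (T N) W)) ∧
        ∀ k, ConvergesWeakly (fun N => modelCorrelation (S N) (d N) (T N) W k)
          (Measure.pi fun _ : Fin k => σ) := by
  obtain ⟨W', hW', hWW'⟩ := exists_continuous_eqOn hD.isClosed hW
  obtain ⟨σ, hσ, hσu, hσl⟩ := exists_equilibriumMeasure hD hDconn hDcl hW'
  refine ⟨σ, (isEquilibriumMeasure_congr hWW' σ).2 hσ,
    fun τ hτ => hσu τ ((isEquilibriumMeasure_congr hWW' τ).1 hτ),
    fun ι _ S d T η hη hη0 hac hS => ?_⟩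
  obtain ⟨hZ, hlim⟩ := hσl η hη0 hac
  have hlaw : ∀ N, modelLaw (S N) (d N) (T N) W = modelLaw (S N) (d N) (T N) W' := fun N => by
    rw [modelLaw, modelLaw, modelWeight_congr (hS N) hWW']
  refine ⟨fun N => ?_, fun k f => ?_⟩
  · rw [hlaw]
    exact isProbabilityMeasure_modelLaw (hS N) hW'.measurable (hZ N).1 (hZ N).2
  · refine (hlim k f).congr fun N => ?_
    have h1 : modelCorrelation (S N) (d N) (T N) W k = modelCorrelation (S N) (d N) (T N) W' k := by
      unfold modelCorrelation
      rw [hlaw]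
    beta_reduce
    rw [h1, integral_modelCorrelation (hS N) hW'.measurable (hZ N).1 (hZ N).2 f]

end Limit


theorem mainTheorem2 (D : Set ℂ) (hD : IsCompact D) (hDconn : IsConnected (interior D))
    (hDcl : closure (interior D) = D) (W : ℂ → ℝ) (hW : ContinuousOn W D) :
    ∃ σ : Measure ℂ,
      IsEquilibriumMeasure D W σ ∧
      (∀ τ : Measure ℂ, IsEquilibriumMeasure D W τ → τ = σ) ∧
      -- the generalized normal matrix model
      (∀ (m : ℕ) [NeZero m] (lam : Fin m → ℝ), ∑ i, lam i = 0 →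
        (∀ N : ℕ, 0 < N → IsProbabilityMeasure (generalizedLaw m N lam D W)) ∧
        ∀ k : ℕ, ConvergesWeakly (fun N => generalizedCorrelation m N lam D W k)
          (Measure.pi fun _ : Fin k => σ)) ∧
      -- the usual normal matrix model, with the same limits
      (∀ N : ℕ, 0 < N → IsProbabilityMeasure (normalLaw N D W)) ∧
      ∀ k : ℕ, ConvergesWeakly (fun N => normalCorrelation N D W k)
        (Measure.pi fun _ : Fin k => σ) := by
  -- σ is fixed before any model is chosen. The models enter only through their parameters γ in
  -- `polarMeasure`, which is why the limits coincide.
  obtain ⟨σ, hσ, hσu, hlim⟩ := exists_equilibriumMeasure_limit hD hDconn hDcl hW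
  have hDm := hD.isClosed.measurableSet
  refine ⟨σ, hσ, hσu, fun m _ lam hlam => ?_, ?_⟩
  · obtain ⟨γ, hγ, hγ0, hγm⟩ := isCoulombModel_generalizedNormalMatrices hlam
    have h := hlim (fun N => Fin m × Fin N) (fun N => generalizedNormalMatrices m N lam D)
      (fun N => m * N ^ 2 + N) (fun N => blockProduct m N) (polarMeasure γ D)
      (isFiniteMeasure_polarMeasure hγ hD.isBounded) (polarMeasure_compl hγ hDm)
      (absolutelyContinuous_polarMeasure hγ hγ0 hDm) fun N => hγm D N hDm hD.isBounded
    exact ⟨fun N _ => h.1 N, h.2⟩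
  · obtain ⟨γ, hγ, hγ0, hγm⟩ := isCoulombModel_normalMatrices
    have h := hlim (fun N => Fin N) (fun N => normalMatrices N D) (fun N => N ^ 2 + N)
      (fun N => MatrixSpace.toMatrix) (polarMeasure γ D)
      (isFiniteMeasure_polarMeasure hγ hD.isBounded) (polarMeasure_compl hγ hDm)
      (absolutelyContinuous_polarMeasure hγ hγ0 hDm) fun N => hγm D N hDm hD.isBounded
    exact ⟨fun N _ => h.1 N, h.2⟩
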